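/- **Setting.** A *data graph* $G(V,E,l)$ is a finite undirected graph whose nodes carry label sets; a *pattern* $P(V_P,E_P,l_P,f_P)$ is a finite connected undirected graph whose nodes carry one label $l_P(u)$ and a capacity interval $f_P(u)=[x,y]$ of non-negative integers, $x\le y$. $|\cdot|$ is the number of nodes plus edges, and the density of a graph is $|E|/|V|$. For $v\in V$, the ball $\hat G[v,t]$ is the subgraph of $G$ induced on the nodes at most $t$ hops from $v$. A relation $M\subseteq V_P\times V(B)$ is a *match relation* for $P$ in a graph $B$ if $(u,w)\in M$ implies $l_P(u)\in l(w)$; every $u\in V_P$ occurs in $M$; and for $(u,w)\in M$ and every neighbour $u'$ of $u$ there is a neighbour $w'$ of $w$ in $B$ with $(u',w')\in M$. $B$ *matches* $P$ if one exists; $M(P,B)$ denotes the largest one ($\emptyset$ if there is none). For fixed $r\ge 1$, a *perfect subgraph* of $G$ for $P$ is the subgraph induced on the nodes of $G$ occurring in $M(P,\hat G[v,t])$ for some ball with $v\in V$, $1\le t\le r$, that matches $P$ and in which the number of nodes matched with $u$ lies in $f_P(u)$ for all $u\in V_P$. $L_k(P,G)$ denotes a list of $k\ge1$ distinct perfect subgraphs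 of largest density in non-ascending order (all perfect subgraphs if there are fewer than $k$; ties are broken arbitrarily). *Fragmentation.* An $h$-fragmentation partitions $V_P$ into $V_{f1},\dots,V_{fh}$; $P_{fi}$ is the subpattern induced on $V_{fi}$, and the cut $C$ is the set of the remaining edges. *Updates.* $\Delta P$ is a finite sequence of insertions of an edge, deletions of an edge, insertions of a node $u$ with an edge to an existing node $u'$ ($u$ joins the fragment of $u'$), deletions of a node, and capacity changes; $P\oplus\Delta P$ must be connected. $\Delta G$ is a finite sequence of edge insertions, edge deletions, insertions of a new node (isolated, or attached to an existing node; identifiers are not reused) and node deletions. Either sequence may be empty. $|\Delta P|$ is the number of unit updates; in $|\Delta G|$ an inserted node also counts its labels. *Auxiliary structures.* All unit pattern updates get consecutive ids $1,2,\dots$. For each ball $\hat G=\hat G[v,r]$, $v\in V$, the number $\mathit{cflag}$ is the id of the last unit pattern update processed for it (initially $0$), and $\tilde M$ stores $M(P_{fi},\hat G)$, $1\le i\le h$, for the version of $P$ after update number $\mathit{cflag}$. The type code $tc\in\{0,1\}^h$ of $\hat G$ has $i$-th bit 1 iff $\hat G$ matches $P_{fi}$ (in that version). The index FBM links each of the $2^h$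 type codes to the list of the balls that have it, and each ball to its $\mathit{cflag}$, an upper bound for the density of its subgraphs, and its stored relations. The ball filter BF holds for each type code a filtering code $fc\in\{0,1\}^h$, initially $(1,\dots,1)$; the update planner UP holds, for each fragment and for the cut, the stack of all updates to it so far, with their ids. *One round on $(\Delta P,\Delta G)$.* For each edge or node deletion in $\Delta P$ inside fragment $i$, the $i$-th bit of all filtering codes is set to 0. A ball of radius $r$ of $G$ or of $G\oplus\Delta G$ is *affected* (belongs to AffBs) if it is a ball of $G$ whose type code satisfies $tc\,\&\,fc=fc$ (bitwise and) for the corresponding updated filtering code, or if its center lies, for some unit update of $\Delta G$, in the balls of radius $r$ around both ends of the inserted or deleted edge, or in the ball of radius $r$ around the inserted or deleted node, taken in the intermediate graph in which this edge or node is present. After the round, the structures are to be as described above for $G\oplus\Delta G$, with $\mathit{cflag}$ of exactly the affected balls set to the id of the last unit pattern update, $\Delta P$ appended to UP, and each filtering code with $tc\,\&\,fc=fc$ reset to $(1,\dots,1)$. *Machine.* A unit-cost random access machine: structured programs (assignment, sequence, conditional, while loop) over arrays of natural numbers with computed indices, addition and truncated subtraction; every assignment and every test is one step. $h,r,k$,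 $P$ with its fragmentation, $G$ (node test, label test, adjacency lists, adjacency test), the auxiliary structures, $\Delta P$ and $\Delta G$ are stored in fixed arrays; the contents of all other memory cells are arbitrary. **Theorem.** There are a single program *dynamic* and a function $F:\mathbb N^8\to\mathbb N$ such that the following holds for all $h$, $r\ge1$, $k\ge1$, all patterns $P$ with an $h$-fragmentation, all data graphs $G$, and all contents of the auxiliary structures that arise from freshly built ones ($\tilde M(P,G)$ and FBM exact, all filtering codes $(1,\dots,1)$, UP empty) by any finite number (possibly zero) of rounds. Given these structures and updates $\Delta P$, $\Delta G$, the program halts, outputs a list $L_k(P\oplus\Delta P,G\oplus\Delta G)$, and leaves in memory the updated pattern, data graph and auxiliary structures, ready for the next round. It takes at most $$F\bigl(h,\;r,\;|P|,\;|\Delta P|,\;|\Delta G|,\;m,\;\|\mathrm{AffBs}\|,\;|\mathrm{AffBs}|\bigr)$$ steps, where $m$ is the total size of the relations stored in $\tilde M$ for the affected balls, $\|\mathrm{AffBs}\|$ is the number of affected balls, and $|\mathrm{AffBs}|$ is their total size, $m$ and $|\mathrm{AffBs}|$ each being taken before and after the round. Thus the running time is determined by $P$, $\tilde M(P,G)$,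 the affected balls and the updates, and does not depend directly on $G$. -/

import Mathlib

/-!
Dynamic team formation by graph simulation: data graphs, patterns, team simulation, updates,
the incremental auxiliary structures, and a unit-cost random access machine with their layout.
-/

open Classical

noncomputable section

namespace TF

/-! ### Graphs and patterns -/

/-- The part of an undirected graph that lies inside a finite set of nodes. -/
def inside (S : Finset ℕ) (H : SimpleGraph ℕ) : SimpleGraph ℕ where
  Adj a b := H.Adj a b ∧ a ∈ S ∧ b ∈ S
  symm := ⟨fun _ _ h => ⟨h.1.symm, h.2.2, h.2.1⟩⟩
  loopless := ⟨fun _ h => h.1.ne rfl⟩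

/-- A data graph: finite, undirected, every node carries a set of labels.
`fresh` bounds all node identifiers handed out so far; identifiers are not reused. The values of
`label` outside `V` are irrelevant. -/
structure DataGraph where
  V : Finset ℕ
  graph : SimpleGraph ℕ
  mem_of_adj : ∀ a b, graph.Adj a b → a ∈ V
  label : ℕ → Finset ℕ
  fresh : ℕ
  lt_fresh : ∀ v ∈ V, v < fresh

/-- A pattern graph: every node carries one label and a capacity interval `[x, y]`, `x ≤ y`.
It comes with the assignment `part` of its nodes to fragments. -/
structure Pattern where
  V : Finset ℕ
  graph : SimpleGraph ℕ
  mem_of_adj : ∀ a b, graph.Adj a b → a ∈ V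
  label : ℕ → ℕ
  cap : ℕ → NonemptyInterval ℕ
  part : ℕ → ℕ

/-- Number of nodes plus number of edges. -/
def DataGraph.size (G : DataGraph) : ℕ := G.V.card + G.graph.edgeSet.ncard

/-- Number of nodes plus number of edges. -/
def Pattern.size (P : Pattern) : ℕ := P.V.card + P.graph.edgeSet.ncard

/-- Number of edges divided by number of nodes. -/
def DataGraph.density (G : DataGraph) : ℚ := (G.graph.edgeSet.ncard : ℚ) / (G.V.card : ℚ)

/-- The subgraph of `G` induced on the nodes in `S`. -/
def DataGraph.induce (G : DataGraph) (S : Finset ℕ) : DataGraph where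
  V := G.V ∩ S
  graph := inside (G.V ∩ S) G.graph
  mem_of_adj _ _ h := h.2.1
  label := G.label
  fresh := G.fresh
  lt_fresh v hv := G.lt_fresh v (Finset.mem_inter.1 hv).1

/-- The ball with center `v` and radius `t`: the subgraph induced on the nodes of `G` that are
at most `t` hops away from `v`. It has no nodes if `v` is not a node of `G`. -/
def DataGraph.ball (G : DataGraph) (v t : ℕ) : DataGraph :=
  G.induce (G.V.filter fun w => ∃ p : G.graph.Walk v w, p.length ≤ t)

/-- The pattern is connected (in particular it has a node). -/
def Pattern.Connected (P : Pattern) : Prop := (P.graph.induce (P.V : Set ℕ)).Connected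

/-- `part` splits the pattern into `h` fragments: fragment `i` is the subpattern induced on the
nodes `u` with `part u = i`, and the cut consists of the edges between different fragments. -/
def Pattern.Fragmented (P : Pattern) (h : ℕ) : Prop := ∀ u ∈ P.V, P.part u < h

/-- The `i`-th fragment. -/
def Pattern.frag (P : Pattern) (i : ℕ) : Pattern where
  V := P.V.filter fun u => P.part u = i
  graph := inside (P.V.filter fun u => P.part u = i) P.graph
  mem_of_adj _ _ h := h.2.1
  label := P.label
  cap := P.cap
  part := P.part

/-! ### Graph simulation and team simulation -/

/-- `M` is a match relation in the data graph `B` for `P`, via graph simulation. -/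
structure IsMatch (P : Pattern) (B : DataGraph) (M : Finset (ℕ × ℕ)) : Prop where
  subset : M ⊆ P.V ×ˢ B.V
  label : ∀ u w, (u, w) ∈ M → P.label u ∈ B.label w
  total : ∀ u ∈ P.V, ∃ w, (u, w) ∈ M
  adj : ∀ u w, (u, w) ∈ M → ∀ u', P.graph.Adj u u' → ∃ w', B.graph.Adj w w' ∧ (u', w') ∈ M

/-- `B` matches `P` via graph simulation. -/
def Matches (P : Pattern) (B : DataGraph) : Prop := ∃ M, IsMatch P B M

/-- The maximum match relation: the union of all match relations, empty if there is none. -/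
def maxMatch (P : Pattern) (B : DataGraph) : Finset (ℕ × ℕ) :=
  (P.V ×ˢ B.V).filter fun p => ∃ M, IsMatch P B M ∧ p ∈ M

/-- The union of all match relations is a match relation, hence the largest one. -/
theorem maxMatch_isMatch (P : Pattern) (B : DataGraph) (h : Matches P B) :
    IsMatch P B (maxMatch P B) := by
  have key : ∀ M, IsMatch P B M → ∀ p ∈ M, p ∈ maxMatch P B := fun M hM p hp =>
    Finset.mem_filter.2 ⟨hM.subset hp, M, hM, hp⟩
  refine ⟨Finset.filter_subset _ _, ?_, ?_, ?_⟩
  · intro u w hp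
    obtain ⟨M, hM, hm⟩ := (Finset.mem_filter.1 hp).2
    exact hM.label u w hm
  · intro u hu
    obtain ⟨M, hM⟩ := h
    obtain ⟨w, hw⟩ := hM.total u hu
    exact ⟨w, key M hM _ hw⟩
  · intro u w hp u' hu'
    obtain ⟨M, hM, hm⟩ := (Finset.mem_filter.1 hp).2
    obtain ⟨w', hw', hm'⟩ := hM.adj u w hm u' hu'
    exact ⟨w', hw', key M hM _ hm'⟩

/-- The data nodes that are matched with the pattern node `u` in the relation `M`. -/
def matched (M : Finset (ℕ × ℕ)) (u : ℕ) : Finset ℕ :=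
  (M.filter fun p => p.1 = u).image Prod.snd

/-- The node sets of the perfect subgraphs of `G` for `P` with respect to the radius `r`: `X` is
the set of all nodes in the maximum match relation in some ball of radius `t`, `1 ≤ t ≤ r`, that
matches `P` and respects all capacities. The perfect subgraph itself is `G.induce X`. -/
def teams (P : Pattern) (G : DataGraph) (r : ℕ) : Set (Finset ℕ) :=
  {X | ∃ v ∈ G.V, ∃ t, 1 ≤ t ∧ t ≤ r ∧ Matches P (G.ball v t) ∧
    (∀ u ∈ P.V, (matched (maxMatch P (G.ball v t)) u).card ∈ P.cap u) ∧
    X = (maxMatch P (G.ball v t)).image Prod.snd}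

/-- `L` is a list of the top-`k` perfect subgraphs: distinct perfect subgraphs, in non-ascending
order of density, `k` of them or else all that exist, none left out that is denser than one
in the list. -/
structure IsTopK (P : Pattern) (G : DataGraph) (r k : ℕ) (L : List (Finset ℕ)) : Prop where
  mem : ∀ X ∈ L, X ∈ teams P G r
  nodup : L.Nodup
  sorted : L.Pairwise fun X Y => (G.induce Y).density ≤ (G.induce X).density
  length_le : L.length ≤ k
  best : ∀ Y ∈ teams P G r, Y ∉ L →
    L.length = k ∧ ∀ X ∈ L, (G.induce Y).density ≤ (G.induce X).density

/-! ### Updates -/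

/-- Unit pattern updates. `addNode u u' c I` inserts a new node `u` with label `c` and capacity
`I`, together with the edge `(u, u')`. -/
inductive PUpd where
  | addEdge (u u' : ℕ)
  | delEdge (u u' : ℕ)
  | addNode (u u' c : ℕ) (I : NonemptyInterval ℕ)
  | delNode (u : ℕ)
  | setCap (u : ℕ) (I : NonemptyInterval ℕ)

/-- Unit data updates. `addNode w L o` inserts a new node `w` with label set `L`, isolated if `o`
is `none` and together with the edge `(w, w')` if `o` is `some w'`. -/
inductive DUpd where
  | addEdge (a b : ℕ)
  | delEdge (a b : ℕ)
  | addNode (w : ℕ) (L : Finset ℕ) (o : Option ℕ)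
  | delNode (w : ℕ)

/-- The unit update makes sense for the pattern. -/
def PUpd.Valid (P : Pattern) : PUpd → Prop
  | .addEdge u u' => u ∈ P.V ∧ u' ∈ P.V ∧ u ≠ u' ∧ ¬ P.graph.Adj u u'
  | .delEdge u u' => P.graph.Adj u u'
  | .addNode u u' _ _ => u ∉ P.V ∧ u' ∈ P.V
  | .delNode u => u ∈ P.V
  | .setCap u _ => u ∈ P.V

/-- The unit update makes sense for the data graph. -/
def DUpd.Valid (G : DataGraph) : DUpd → Prop
  | .addEdge a b => a ∈ G.V ∧ b ∈ G.V ∧ a ≠ b ∧ ¬ G.graph.Adj a b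
  | .delEdge a b => G.graph.Adj a b
  | .addNode w _ o => G.fresh ≤ w ∧ ∀ w' ∈ o, w' ∈ G.V
  | .delNode w => w ∈ G.V

/-- The pattern with node set `V` and the edges of `H` inside `V`. -/
def Pattern.withGraph (P : Pattern) (V : Finset ℕ) (H : SimpleGraph ℕ) : Pattern where
  V := V
  graph := inside V H
  mem_of_adj _ _ h := h.2.1
  label := P.label
  cap := P.cap
  part := P.part

/-- Apply a unit pattern update. A new node joins the fragment of the node it is attached to. -/
def Pattern.apply (P : Pattern) : PUpd → Pattern
  | .addEdge u u' => P.withGraph P.V (P.graph ⊔ SimpleGraph.edge u u')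
  | .delEdge u u' => P.withGraph P.V (P.graph.deleteEdges {s(u, u')})
  | .addNode u u' c I =>
      { P.withGraph (insert u P.V) (P.graph ⊔ SimpleGraph.edge u u') with
        label := Function.update P.label u c
        cap := Function.update P.cap u I
        part := Function.update P.part u (P.part u') }
  | .delNode u => P.withGraph (P.V.erase u) P.graph
  | .setCap u I => { P with cap := Function.update P.cap u I }

/-- The data graph with nodes and edges reduced to (resp. extended by edges inside) `G.V`. -/
def DataGraph.withEdges (G : DataGraph) (H : SimpleGraph ℕ) : DataGraph where
  V := G.V
  graph := inside G.V H
  mem_of_adj _ _ h := h.2.1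
  label := G.label
  fresh := G.fresh
  lt_fresh := G.lt_fresh

/-- Insert an isolated node `w` with label set `L`. -/
def DataGraph.addIsolated (G : DataGraph) (w : ℕ) (L : Finset ℕ) : DataGraph where
  V := insert w G.V
  graph := G.graph
  mem_of_adj a b h := Finset.mem_insert_of_mem (G.mem_of_adj a b h)
  label := Function.update G.label w L
  fresh := max G.fresh (w + 1)
  lt_fresh v hv := by
    rcases Finset.mem_insert.1 hv with rfl | hv
    · exact lt_max_of_lt_right (Nat.lt_succ_self _)
    · exact lt_max_of_lt_left (G.lt_fresh v hv)

/-- Apply a unit data update. -/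
def DataGraph.apply (G : DataGraph) : DUpd → DataGraph
  | .addEdge a b => G.withEdges (G.graph ⊔ SimpleGraph.edge a b)
  | .delEdge a b => G.withEdges (G.graph.deleteEdges {s(a, b)})
  | .addNode w L none => G.addIsolated w L
  | .addNode w L (some w') =>
      (G.addIsolated w L).withEdges (G.graph ⊔ SimpleGraph.edge w w')
  | .delNode w => G.induce (G.V.erase w)

/-- Apply a list of pattern updates, in order. -/
def Pattern.applyAll (P : Pattern) (D : List PUpd) : Pattern := D.foldl Pattern.apply P

/-- Apply a list of data updates, in order. -/
def DataGraph.applyAll (G : DataGraph) (D : List DUpd) : DataGraph := D.foldl DataGraph.apply G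

/-- Every unit update makes sense at the moment when it is applied. -/
def ValidP : Pattern → List PUpd → Prop
  | _, [] => True
  | P, δ :: D => δ.Valid P ∧ ValidP (P.apply δ) D

/-- Every unit update makes sense at the moment when it is applied. -/
def ValidG : DataGraph → List DUpd → Prop
  | _, [] => True
  | G, δ :: D => δ.Valid G ∧ ValidG (G.apply δ) D

/-- Size of a data update: a unit update counts `1`, plus the number of labels of a new node. -/
def DUpd.size : DUpd → ℕ
  | .addNode _ L _ => 1 + L.card
  | _ => 1

/-- Size of a list of data updates. -/
def dsize (D : List DUpd) : ℕ := (D.map DUpd.size).sum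

/-- Where a unit update on `P` with `h` fragments takes place: in fragment `i < h`, or in the
cut, for which the number `h` stands. -/
def PUpd.place (h : ℕ) (P : Pattern) : PUpd → ℕ
  | .addEdge u u' => if P.part u = P.part u' then P.part u else h
  | .delEdge u u' => if P.part u = P.part u' then P.part u else h
  | .addNode _ u' _ _ => P.part u'
  | .delNode u => P.part u
  | .setCap u _ => P.part u

/-- Edge and node deletions. -/
def PUpd.IsDeletion : PUpd → Prop
  | .delEdge _ _ => True
  | .delNode _ => True
  | _ => False

/-- The fragments in which `D` deletes an edge or a node (and `h` if it deletes a cut edge). -/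
def deletedIn (h : ℕ) : Pattern → List PUpd → Finset ℕ
  | _, [] => ∅
  | P, δ :: D => (if δ.IsDeletion then {δ.place h P} else ∅) ∪ deletedIn h (P.apply δ) D

/-- The centers of the balls of radius `r` that the updates in `D` may change: for an edge
insertion or deletion, the nodes that lie in the balls around both ends of the edge, and for a
node insertion or deletion, those in the ball around the node, in the graph in which that edge or
node is present. -/
def structural (r : ℕ) : DataGraph → List DUpd → Finset ℕ
  | _, [] => ∅
  | G, δ :: D =>
    (match δ with
      | .addEdge a b => ((G.apply δ).ball a r).V ∩ ((G.apply δ).ball b r).V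
      | .delEdge a b => (G.ball a r).V ∩ (G.ball b r).V
      | .addNode w _ _ => ((G.apply δ).ball w r).V
      | .delNode w => (G.ball w r).V) ∪ structural r (G.apply δ) D

/-! ### The auxiliary structures of the incremental algorithm, and how a round changes them -/

/-- What determines the contents of the auxiliary structures: the parameters, the pattern `base`
at the beginning and all unit pattern updates `log` that arrived since then (the `n`-th one has
the id `n`, counting from 1), the current data graph, for each ball the id `cflag` of the latest
unit pattern update processed for it, and the ball filter `bf`. Boolean vectors of length `h`
(type codes and filtering codes) are given by the set of indices `i < h` where they are 1;
`bf c` is the filtering code that corresponds to the type code `c`. -/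
structure State where
  h : ℕ
  r : ℕ
  k : ℕ
  base : Pattern
  log : List PUpd
  G : DataGraph
  cflag : ℕ → ℕ
  bf : Finset ℕ → Finset ℕ

/-- The pattern after the first `n` unit updates. -/
def State.patAt (S : State) (n : ℕ) : Pattern := S.base.applyAll (S.log.take n)

/-- The current pattern. -/
def State.P (S : State) : Pattern := S.base.applyAll S.log

/-- Type code of the ball with center `v`: the fragments that the ball matches. -/
def State.tc (S : State) (v : ℕ) : Finset ℕ :=
  (Finset.range S.h).filter fun i => Matches ((S.patAt (S.cflag v)).frag i) (S.G.ball v S.r)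

/-- The fragment-ball matches stored for the ball with center `v`: the union of the maximum match
relations of all fragments. -/
def State.fbMatch (S : State) (v : ℕ) : Finset (ℕ × ℕ) :=
  (Finset.range S.h).biUnion fun i =>
    maxMatch ((S.patAt (S.cflag v)).frag i) (S.G.ball v S.r)

/-- Structures just built for `P` and `G`: no pending updates, all filtering codes `(1, …, 1)`. -/
def State.init (h r k : ℕ) (P : Pattern) (G : DataGraph) : State where
  h := h
  r := r
  k := k
  base := P
  log := []
  G := G
  cflag := fun _ => 0
  bf := fun _ => Finset.range h

/-- The ball filter after it has taken note of the deletions in `DP`. -/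
def State.bfNew (S : State) (DP : List PUpd) (c : Finset ℕ) : Finset ℕ :=
  S.bf c \ deletedIn S.h S.P DP

/-- The (centers of the) affected balls: the balls of the old graph with a type code `tc` such
that `tc & fc = fc` for the updated filtering code `fc` of `tc`, and the structurally affected
balls of the old and the new graph. The balls with type code `(1, …, 1)` are always among them. -/
def State.affected (S : State) (DP : List PUpd) (DG : List DUpd) : Finset ℕ :=
  (S.G.V.filter fun v => S.bfNew DP (S.tc v) ⊆ S.tc v) ∪
    (structural S.r S.G DG ∩ (S.G.V ∪ (S.G.applyAll DG).V))

/-- The state after a round: the affected balls are brought up to date, all others keep their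
matches with respect to the pattern version `cflag`, and the filtering codes of those type
codes whose balls have been marked as affected are reset. -/
def State.next (S : State) (DP : List PUpd) (DG : List DUpd) : State where
  h := S.h
  r := S.r
  k := S.k
  base := S.base
  log := S.log ++ DP
  G := S.G.applyAll DG
  cflag := fun v => if v ∈ S.affected DP DG then (S.log ++ DP).length else S.cflag v
  bf := fun c => if S.bfNew DP c ⊆ c then Finset.range S.h else S.bfNew DP c

/-- An admissible pair of update sets; the updated pattern must be connected again. -/
structure State.Admissible (S : State) (DP : List PUpd) (DG : List DUpd) : Prop where
  validP : ValidP S.P DP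
  validG : ValidG S.G DG
  connected : (S.P.applyAll DP).Connected

/-- The states that arise from freshly built structures by processing any number of admissible
(separate or simultaneous) sets of pattern and data updates. -/
inductive Reachable : State → Prop
  | init (h r k : ℕ) (P : Pattern) (G : DataGraph) (hr : 1 ≤ r) (hk : 1 ≤ k)
      (hP : P.Connected) (hf : P.Fragmented h) : Reachable (State.init h r k P G)
  | next (S : State) (DP : List PUpd) (DG : List DUpd) (hS : Reachable S)
      (hD : S.Admissible DP DG) : Reachable (S.next DP DG)

/-- Number of affected balls. -/
def State.affCard (S : State) (DP : List PUpd) (DG : List DUpd) : ℕ := (S.affected DP DG).card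

/-- Total size (nodes and edges) of the affected balls, before and after the update. -/
def State.affSize (S : State) (DP : List PUpd) (DG : List DUpd) : ℕ :=
  ∑ v ∈ S.affected DP DG, ((S.G.ball v S.r).size + ((S.next DP DG).G.ball v S.r).size)

/-- Total number of fragment-ball matches in the affected balls, before and after the update. -/
def State.affMatches (S : State) (DP : List PUpd) (DG : List DUpd) : ℕ :=
  ∑ v ∈ S.affected DP DG, ((S.fbMatch v).card + ((S.next DP DG).fbMatch v).card)

/-! ### Random access machine -/

/-- Memory: arrays `a` of natural numbers with three indices. -/
abbrev Store := ℕ → ℕ → ℕ → ℕ → ℕ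

/-- Expressions: constants, memory accesses (addresses may be computed), addition and
truncated subtraction. -/
inductive Expr where
  | lit (n : ℕ)
  | get (a : ℕ) (i j l : Expr)
  | add (e f : Expr)
  | sub (e f : Expr)

/-- Value of an expression. -/
def Expr.eval (σ : Store) : Expr → ℕ
  | .lit n => n
  | .get a i j l => σ a (i.eval σ) (j.eval σ) (l.eval σ)
  | .add e f => e.eval σ + f.eval σ
  | .sub e f => e.eval σ - f.eval σ

/-- Overwrite one memory cell. -/
def Store.write (σ : Store) (a i j l x : ℕ) : Store := fun a' i' j' l' =>
  if a' = a ∧ i' = i ∧ j' = j ∧ l' = l then x else σ a' i' j' l'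

/-- Programs. A test succeeds if its value is not 0. -/
inductive Prog where
  | skip
  | assign (a : ℕ) (i j l e : Expr)
  | seq (p q : Prog)
  | ite (e : Expr) (p q : Prog)
  | loop (e : Expr) (p : Prog)

/-- `Exec p σ σ' T`: started in memory `σ`, the program `p` halts in memory `σ'` after `T` steps.
Every assignment and every test is one step; the expressions in it have a fixed size, so that
this is the unit-cost measure up to a constant factor that depends on the program only. -/
inductive Exec : Prog → Store → Store → ℕ → Prop
  | skip (σ : Store) : Exec .skip σ σ 1
  | assign (σ : Store) (a : ℕ) (i j l e : Expr) :
      Exec (.assign a i j l e) σ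
        (σ.write a (i.eval σ) (j.eval σ) (l.eval σ) (e.eval σ)) 1
  | seq (σ₁ σ₂ σ₃ : Store) (p q : Prog) (T U : ℕ) (hp : Exec p σ₁ σ₂ T) (hq : Exec q σ₂ σ₃ U) :
      Exec (.seq p q) σ₁ σ₃ (T + U)
  | iteTrue (σ₁ σ₂ : Store) (e : Expr) (p q : Prog) (T : ℕ) (he : e.eval σ₁ ≠ 0)
      (hp : Exec p σ₁ σ₂ T) : Exec (.ite e p q) σ₁ σ₂ (T + 1)
  | iteFalse (σ₁ σ₂ : Store) (e : Expr) (p q : Prog) (T : ℕ) (he : e.eval σ₁ = 0)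
      (hq : Exec q σ₁ σ₂ T) : Exec (.ite e p q) σ₁ σ₂ (T + 1)
  | loopDone (σ : Store) (e : Expr) (p : Prog) (he : e.eval σ = 0) : Exec (.loop e p) σ σ 1
  | loopStep (σ₁ σ₂ σ₃ : Store) (e : Expr) (p : Prog) (T U : ℕ) (he : e.eval σ₁ ≠ 0)
      (hp : Exec p σ₁ σ₂ T) (hq : Exec (.loop e p) σ₂ σ₃ U) :
      Exec (.loop e p) σ₁ σ₃ (T + U + 1)

/-! ### Memory layout -/

/-- `1` or `0`. -/
def bit (p : Prop) : ℕ := if p then 1 else 0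

/-- The first `n` values of `f` list the elements of `A`, each of them once. -/
def Lists (f : ℕ → ℕ) (n : ℕ) (A : Finset ℕ) : Prop := Set.BijOn f (Set.Iio n) (A : Set ℕ)

/-- The number that stands for the boolean vector with ones exactly at the indices in `c`. -/
def codeNum (c : Finset ℕ) : ℕ := ∑ i ∈ c, 2 ^ i

/-- A unit pattern update as a record of six numbers. -/
def PUpd.field : PUpd → ℕ → ℕ
  | .addEdge u u', f => [0, u, u'].getD f 0
  | .delEdge u u', f => [1, u, u'].getD f 0
  | .addNode u u' c I, f => [2, u, u', c, I.fst, I.snd].getD f 0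
  | .delNode u, f => [3, u].getD f 0
  | .setCap u I, f => [4, u, I.fst, I.snd].getD f 0

/-- A unit data update as a record of five numbers; the labels of a new node are listed apart. -/
def DUpd.field : DUpd → ℕ → ℕ
  | .addEdge a b, f => [0, a, b].getD f 0
  | .delEdge a b, f => [1, a, b].getD f 0
  | .addNode w L none, f => [2, w, 0, 0, L.card].getD f 0
  | .addNode w L (some w'), f => [2, w, 1, w', L.card].getD f 0
  | .delNode w, f => [3, w].getD f 0

/-- The part of the log with the updates placed in fragment `s < h` (or in the cut, `s = h`), in
order of arrival, each with its id: one stack of the update planner. `n` is the number of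
updates already processed and `P` the pattern they led to. -/
def planner (h s : ℕ) : Pattern → ℕ → List PUpd → List (ℕ × PUpd)
  | _, _, [] => []
  | P, n, δ :: D =>
    if δ.place h P = s then (n + 1, δ) :: planner h s (P.apply δ) (n + 1) D
    else planner h s (P.apply δ) (n + 1) D

/-- The parameters and the data graph in memory, with random access: arrays 0, 1, 2 hold `h`,
`r`, `k`; 3 the node test; 4 the label test; 5, 6 degrees and adjacency lists; 7 the adjacency
test; 8 the bound for the identifiers in use. -/
structure StoresData (σ : Store) (S : State) : Prop where
  h : σ 0 0 0 0 = S.h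
  r : σ 1 0 0 0 = S.r
  k : σ 2 0 0 0 = S.k
  node : ∀ v, σ 3 v 0 0 = bit (v ∈ S.G.V)
  label : ∀ v ∈ S.G.V, ∀ c, σ 4 v c 0 = bit (c ∈ S.G.label v)
  label_fresh : ∀ v, S.G.fresh ≤ v → ∀ c, σ 4 v c 0 = 0
  nbrs : ∀ v ∈ S.G.V,
    Lists (fun j => σ 6 v j 0) (σ 5 v 0 0) (S.G.V.filter fun w => S.G.graph.Adj v w)
  adj : ∀ v w, σ 7 v w 0 = bit (S.G.graph.Adj v w)
  fresh : σ 8 0 0 0 = S.G.fresh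

/-- The current pattern in memory: number of nodes, list of nodes, labels, capacities, fragment
numbers, adjacency test. -/
structure StoresPattern (σ : Store) (S : State) : Prop where
  nodes : Lists (fun j => σ 10 j 0 0) (σ 9 0 0 0) S.P.V
  label : ∀ u ∈ S.P.V, σ 11 u 0 0 = S.P.label u
  lo : ∀ u ∈ S.P.V, σ 12 u 0 0 = (S.P.cap u).fst
  hi : ∀ u ∈ S.P.V, σ 13 u 0 0 = (S.P.cap u).snd
  part : ∀ u ∈ S.P.V, σ 14 u 0 0 = S.P.part u
  adj : ∀ u ∈ S.P.V, ∀ u' ∈ S.P.V, σ 15 u u' 0 = bit (S.P.graph.Adj u u')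

/-- The auxiliary structures in memory. Fragment status: array 16 holds the bits of the type
codes, and arrays 17, 18 link each type code to the balls that have it. Ball status: arrays 19 to
23 hold the type code of a ball, its position in the list of that type code, `cflag`, and
an upper bound (numerator and denominator) for the density of subgraphs of the ball.
Fragment-ball matches: arrays 24, 25 list, for each ball and each node of the pattern version the
ball is up to date with, the matched nodes. Ball filter: array 26. Update planner: arrays 27 (number
of updates so far), 28 (height of each stack), 29 and 30 (ids and updates in each stack). -/
structure StoresAux (σ : Store) (S : State) : Prop where
  fs : ∀ c ⊆ Finset.range S.h, ∀ i < S.h, σ 16 (codeNum c) i 0 = bit (i ∈ c)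
  balls : ∀ c ⊆ Finset.range S.h,
    Lists (fun p => σ 18 (codeNum c) p 0) (σ 17 (codeNum c) 0 0)
      (S.G.V.filter fun v => S.tc v = c)
  tc : ∀ v ∈ S.G.V, σ 19 v 0 0 = codeNum (S.tc v)
  pos : ∀ v ∈ S.G.V, σ 20 v 0 0 < σ 17 (codeNum (S.tc v)) 0 0 ∧
    σ 18 (codeNum (S.tc v)) (σ 20 v 0 0) 0 = v
  cflag : ∀ v ∈ S.G.V, σ 21 v 0 0 = S.cflag v
  den : ∀ v ∈ S.G.V, 0 < σ 23 v 0 0 ∧ ∀ X ⊆ (S.G.ball v S.r).V, X.Nonempty →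
    (S.G.induce X).density ≤ (σ 22 v 0 0 : ℚ) / (σ 23 v 0 0 : ℚ)
  fbMatch : ∀ v ∈ S.G.V, ∀ u ∈ (S.patAt (S.cflag v)).V,
    Lists (fun j => σ 25 v u j) (σ 24 v u 0) (matched (S.fbMatch v) u)
  bf : ∀ c ⊆ Finset.range S.h, ∀ i < S.h, σ 26 (codeNum c) i 0 = bit (i ∈ S.bf c)
  log : σ 27 0 0 0 = S.log.length
  height : ∀ s ≤ S.h, σ 28 s 0 0 = (planner S.h s S.base 0 S.log).length
  stack : ∀ s ≤ S.h, ∀ q n δ, (planner S.h s S.base 0 S.log)[q]? = some (n, δ) →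
    σ 29 s q 0 = n ∧ ∀ f < 6, σ 30 s q f = δ.field f

/-- The memory holds the data graph, the pattern and all auxiliary structures. Nothing is assumed
about the other cells. -/
structure Stores (σ : Store) (S : State) : Prop where
  data : StoresData σ S
  pattern : StoresPattern σ S
  aux : StoresAux σ S

/-- The memory holds the updates to be processed: number and records of the pattern updates in
arrays 31, 32, and number, records and labels of the data updates in arrays 33, 34, 35. -/
structure StoresInput (σ : Store) (DP : List PUpd) (DG : List DUpd) : Prop where
  numP : σ 31 0 0 0 = DP.length
  recP : ∀ q δ, DP[q]? = some δ → ∀ f < 6, σ 32 q f 0 = δ.field f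
  numG : σ 33 0 0 0 = DG.length
  recG : ∀ q δ, DG[q]? = some δ → ∀ f < 5, σ 34 q f 0 = δ.field f
  labels : ∀ q w L o, DG[q]? = some (.addNode w L o) → Lists (fun j => σ 35 q j 0) L.card L

/-- The memory holds the list `L` of node sets: its length in array 36, their sizes in array 37
and their elements in array 38. -/
structure StoresOutput (σ : Store) (L : List (Finset ℕ)) : Prop where
  num : σ 36 0 0 0 = L.length
  sets : ∀ p X, L[p]? = some X → Lists (fun j => σ 38 p j 0) (σ 37 p 0 0) X

/-- One program handles, for all inputs, a round of pattern updates `DP` and data updates `DG`: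
it outputs top-`k` perfect subgraphs for the updated pattern in the updated graph, and leaves all
structures ready for the next round; it runs for at most `T S DP DG` steps. -/
def Processes (dynamic : Prog) (T : State → List PUpd → List DUpd → ℕ) : Prop :=
  ∀ (S : State) (DP : List PUpd) (DG : List DUpd) (σ : Store),
    Reachable S → S.Admissible DP DG → Stores σ S → StoresInput σ DP DG →
    ∃ (σ' : Store) (t : ℕ) (L : List (Finset ℕ)),
      Exec dynamic σ σ' t ∧ t ≤ T S DP DG ∧
      IsTopK (S.P.applyAll DP) (S.G.applyAll DG) S.r S.k L ∧ StoresOutput σ' L ∧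
      Stores σ' (S.next DP DG)

end TF

end

/-!
The bounding function is arbitrary, so the program may treat every affected ball by brute force;
what matters is that no loop depends on the rest of the data graph. Hence the proof has three parts:
a way to write and verify programs whose loops are bounded, the fact that the affected balls
suffice, and a bound for all searches in terms of the affected balls and the updates.

Programs are written in a language of terms `Tm` and commands `Cm`, in which all loops and sums are
bounded in advance. It has a denotational semantics, and if all bounds that occur are at most `N`,
the compiled program needs at most `Cm.cost N` machine steps, a number that does not depend on the
memory (`Cm.comp_spec`). It remains to show that one command, `roundCm`, performs a round within
loop bound `loopBound`, a function of the parameters (`roundCm_does`). Programs are verified by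
`Cm.Does`, with loop invariants and the fact that arrays which are not assigned to are kept. Arrays
up to 38 are those of the prescribed layout. Arrays 40 to 53 and cells 60 to 69 are working memory:
40, 41 list the centers of the balls to be processed, 42, 43 the nodes of the current ball, 44, 45
those of a second ball, 46, 47 the nodes of the current pattern, 48 holds the relation to be refined
and 49 the result of the refinement, and 50 to 53 hold the perfect subgraphs found. Arrays 100 and
101 are the registers and loop variables of compiled programs.

That the affected balls suffice has two reasons. A unit update of the data graph changes the ball
with center `v` only if `v` is within reach of both ends of the edge, or of the node
(`DataGraph.apply_same`); this concerns the structural part of the affected balls. For the filter,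
`State.Inv` states that a filtering code has a zero for each fragment that has lost an edge or a
node since a ball with this type code was brought up to date. If the type code of a ball misses a
bit of its filtering code, then the ball did not match a fragment that has only grown since then,
hence it does not match the new pattern, and neither do the smaller balls around its center
(`State.Inv.not_matches`). So all perfect subgraphs come from affected balls, and the entries of the
other balls are still correct (`State.Inv.unaffected`).

The running time is critical where the program searches the intermediate graphs, since their balls
are neither old nor new ones. But both ends of each inserted edge are centers of touched balls. A
path from a touched node therefore leads, after its last inserted edge, through the old ball around
a touched node, and the ball in the intermediate graph has at most as many nodes as the old balls
around the touched nodes together, plus the inserted nodes (`DataGraph.card_ball_applyAll`).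

The largest match relation is computed by refinement: pairs that violate the condition are removed
until none is left (`sim_does`). The output is sorted by writing each perfect subgraph to the
position given by its rank, with densities compared by cross-multiplication (`outPhase_does`).
-/

namespace TF

/-! ### A structured language of bounded loops over the store -/

/-- Terms with variables, case distinction and bounded sums. `sum d e t` is the sum of the values
of `t` over all values of variable `d` below the value of `e`; with truth values `0` and `1`
it also serves as a bounded quantifier. -/
inductive Tm where
  | lit (n : ℕ)
  | var (n : ℕ)
  | get (a : ℕ) (i j l : Tm)
  | add (e f : Tm)
  | sub (e f : Tm)
  | ite (c e f : Tm)
  | sum (d : ℕ) (e t : Tm)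

/-- Commands: assignments, case distinctions and loops that run through all values of a variable
below a bound, which is evaluated once. -/
inductive Cm where
  | skip
  | put (a : ℕ) (i j l e : Tm)
  | seq (p q : Cm)
  | ite (e : Tm) (p q : Cm)
  | rep (d : ℕ) (e : Tm) (p : Cm)

/-- Value of a term for the values `ρ` of the variables. -/
def Tm.eval (σ : Store) : Tm → (ℕ → ℕ) → ℕ
  | .lit n, _ => n
  | .var n, ρ => ρ n
  | .get a i j l, ρ => σ a (i.eval σ ρ) (j.eval σ ρ) (l.eval σ ρ)
  | .add e f, ρ => e.eval σ ρ + f.eval σ ρ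
  | .sub e f, ρ => e.eval σ ρ - f.eval σ ρ
  | .ite c e f, ρ => if c.eval σ ρ = 0 then f.eval σ ρ else e.eval σ ρ
  | .sum d e t, ρ => ∑ x ∈ Finset.range (e.eval σ ρ), t.eval σ (Function.update ρ d x)

/-- The store after `n` steps of a loop, step number `x` being `f x`. -/
def iter (f : ℕ → Store → Store) : ℕ → Store → Store
  | 0, σ => σ
  | n + 1, σ => f n (iter f n σ)

/-- Effect of a command on the store. -/
def Cm.run : Cm → (ℕ → ℕ) → Store → Store
  | .skip, _, σ => σ
  | .put a i j l e, ρ, σ =>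
      σ.write a (i.eval σ ρ) (j.eval σ ρ) (l.eval σ ρ) (e.eval σ ρ)
  | .seq p q, ρ, σ => q.run ρ (p.run ρ σ)
  | .ite e p q, ρ, σ => if e.eval σ ρ = 0 then q.run ρ σ else p.run ρ σ
  | .rep d e p, ρ, σ => iter (fun x σ => p.run (Function.update ρ d x) σ) (e.eval σ ρ) σ

/-- No bounded sum in the evaluation of a term has more than `N` summands. -/
def Tm.ok (N : ℕ) (σ : Store) : Tm → (ℕ → ℕ) → Prop
  | .lit _, _ => True
  | .var _, _ => True
  | .get _ i j l, ρ => i.ok N σ ρ ∧ j.ok N σ ρ ∧ l.ok N σ ρ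
  | .add e f, ρ => e.ok N σ ρ ∧ f.ok N σ ρ
  | .sub e f, ρ => e.ok N σ ρ ∧ f.ok N σ ρ
  | .ite c e f, ρ =>
      c.ok N σ ρ ∧ (c.eval σ ρ ≠ 0 → e.ok N σ ρ) ∧ (c.eval σ ρ = 0 → f.ok N σ ρ)
  | .sum d e t, ρ => e.ok N σ ρ ∧ e.eval σ ρ ≤ N ∧
      ∀ x < e.eval σ ρ, t.ok N σ (Function.update ρ d x)

/-- No loop in the execution of a command makes more than `N` steps. -/
def Cm.ok (N : ℕ) : Cm → (ℕ → ℕ) → Store → Prop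
  | .skip, _, _ => True
  | .put _ i j l e, ρ, σ => i.ok N σ ρ ∧ j.ok N σ ρ ∧ l.ok N σ ρ ∧ e.ok N σ ρ
  | .seq p q, ρ, σ => p.ok N ρ σ ∧ q.ok N ρ (p.run ρ σ)
  | .ite e p q, ρ, σ =>
      e.ok N σ ρ ∧ (e.eval σ ρ ≠ 0 → p.ok N ρ σ) ∧ (e.eval σ ρ = 0 → q.ok N ρ σ)
  | .rep d e p, ρ, σ => e.ok N σ ρ ∧ e.eval σ ρ ≤ N ∧ ∀ x < e.eval σ ρ,
      p.ok N (Function.update ρ d x)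
        (iter (fun x σ => p.run (Function.update ρ d x) σ) x σ)

/-- All free variables are below `k`, the bound ones are numbered consecutively from `k` on along the
nesting, and the arrays 100 and 101 are not used. -/
def Tm.wf : Tm → ℕ → Bool
  | .lit _, _ => true
  | .var n, k => Nat.blt n k
  | .get a i j l, k => Nat.blt a 100 && (i.wf k && (j.wf k && l.wf k))
  | .add e f, k => e.wf k && f.wf k
  | .sub e f, k => e.wf k && f.wf k
  | .ite c e f, k => c.wf k && (e.wf k && f.wf k)
  | .sum d e t, k => Nat.beq k d && (e.wf k && t.wf (d + 1))

/-- The condition of `Tm.wf` for commands; loop variables count as bound. -/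
def Cm.wf : Cm → ℕ → Bool
  | .skip, _ => true
  | .put a i j l e, k => Nat.blt a 100 && (i.wf k && (j.wf k && (l.wf k && e.wf k)))
  | .seq p q, k => p.wf k && q.wf k
  | .ite e p q, k => e.wf k && (p.wf k && q.wf k)
  | .rep d e p, k => Nat.beq k d && (e.wf k && p.wf (d + 1))

/-! ### Compilation to the random access machine -/

/-- Register number `r`, in array 100. -/
abbrev rg (r : ℕ) : Expr := .get 100 (.lit r) (.lit 0) (.lit 0)

/-- Loop variable number `d`, in array 101. -/
abbrev vr (d : ℕ) : Expr := .get 101 (.lit d) (.lit 0) (.lit 0)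

/-- Assignment to register number `r`. -/
abbrev putR (r : ℕ) (e : Expr) : Prog := .assign 100 (.lit r) (.lit 0) (.lit 0) e

/-- Assignment to loop variable number `d`. -/
abbrev putV (d : ℕ) (e : Expr) : Prog := .assign 101 (.lit d) (.lit 0) (.lit 0) e

/-- A program that stores the value of a term in register `r`, using only registers from `r` on. -/
def Tm.comp : Tm → ℕ → Prog
  | .lit n, r => putR r (.lit n)
  | .var n, r => putR r (vr n)
  | .get a i j l, r => .seq (i.comp r) (.seq (j.comp (r + 1)) (.seq (l.comp (r + 2))
      (putR r (.get a (rg r) (rg (r + 1)) (rg (r + 2))))))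
  | .add e f, r => .seq (e.comp r) (.seq (f.comp (r + 1)) (putR r (.add (rg r) (rg (r + 1)))))
  | .sub e f, r => .seq (e.comp r) (.seq (f.comp (r + 1)) (putR r (.sub (rg r) (rg (r + 1)))))
  | .ite c e f, r => .seq (c.comp r) (.ite (rg r) (e.comp r) (f.comp r))
  | .sum d e t, r => .seq (e.comp r) (.seq (putR (r + 1) (.lit 0)) (.seq (putV d (.lit 0))
      (.seq (.loop (.sub (rg r) (vr d)) (.seq (.seq (t.comp (r + 2))
        (putR (r + 1) (.add (rg (r + 1)) (rg (r + 2))))) (putV d (.add (vr d) (.lit 1)))))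
      (putR r (rg (r + 1))))))

/-- A program that has the effect of a command, using only registers from `r` on. -/
def Cm.comp : Cm → ℕ → Prog
  | .skip, _ => .skip
  | .put a i j l e, r => .seq (i.comp r) (.seq (j.comp (r + 1)) (.seq (l.comp (r + 2))
      (.seq (e.comp (r + 3)) (.assign a (rg r) (rg (r + 1)) (rg (r + 2)) (rg (r + 3))))))
  | .seq p q, r => .seq (p.comp r) (q.comp r)
  | .ite e p q, r => .seq (e.comp r) (.ite (rg r) (p.comp r) (q.comp r))
  | .rep d e p, r => .seq (e.comp r) (.seq (putV d (.lit 0))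
      (.loop (.sub (rg r) (vr d)) (.seq (p.comp (r + 1)) (putV d (.add (vr d) (.lit 1))))))

/-- Bound for the number of machine steps that the evaluation of a term takes, if no bounded sum has
more than `N` summands. It does not depend on the store. -/
def Tm.cost (N : ℕ) : Tm → ℕ
  | .lit _ => 1
  | .var _ => 1
  | .get _ i j l => i.cost N + (j.cost N + (l.cost N + 1))
  | .add e f => e.cost N + (f.cost N + 1)
  | .sub e f => e.cost N + (f.cost N + 1)
  | .ite c e f => c.cost N + (e.cost N + f.cost N + 1)
  | .sum _ e t => e.cost N + (1 + (1 + (N * (t.cost N + 2 + 1) + 1 + 1)))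

/-- Bound for the number of machine steps of a command, if no loop makes more than `N` iterations. -/
def Cm.cost (N : ℕ) : Cm → ℕ
  | .skip => 1
  | .put _ i j l e => i.cost N + (j.cost N + (l.cost N + (e.cost N + 1)))
  | .seq p q => p.cost N + q.cost N
  | .ite e p q => e.cost N + (p.cost N + q.cost N + 1)
  | .rep _ e p => e.cost N + (1 + (N * (p.cost N + 1 + 1) + 1))

/-- The machine memory `τ` represents the store `σ` and the values `ρ` of the variables
below `k`. -/
def Agree (σ : Store) (ρ : ℕ → ℕ) (k : ℕ) (τ : Store) : Prop :=
  (∀ a < 100, τ a = σ a) ∧ ∀ n < k, τ 101 n 0 0 = ρ n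

theorem Agree.putR {σ : Store} {ρ : ℕ → ℕ} {k : ℕ} {τ : Store} (h : Agree σ ρ k τ)
    (i j l x : ℕ) : Agree σ ρ k (τ.write 100 i j l x) := by
  refine ⟨fun a ha => ?_, fun n hn => ?_⟩
  · rw [← h.1 a ha]; funext i' j' l'; simp [Store.write, ha.ne]
  · rw [← h.2 n hn]; simp [Store.write]

theorem Agree.putV {σ : Store} {ρ : ℕ → ℕ} {k : ℕ} {τ : Store} (h : Agree σ ρ k τ)
    (x : ℕ) : Agree σ (Function.update ρ k x) (k + 1) (τ.write 101 k 0 0 x) := by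
  refine ⟨fun a ha => ?_, fun n hn => ?_⟩
  · rw [← h.1 a ha]; funext i' j' l'; simp [Store.write, (show a ≠ 101 by omega)]
  · by_cases hnd : n = k
    · subst hnd; simp [Store.write]
    · simp [Store.write, hnd, h.2 n (by omega)]

theorem Agree.ofUpdate {σ : Store} {ρ : ℕ → ℕ} {k x : ℕ} {τ : Store}
    (h : Agree σ (Function.update ρ k x) (k + 1) τ) : Agree σ ρ k τ := by
  refine ⟨h.1, fun n hn => ?_⟩
  rw [h.2 n (by omega), Function.update_of_ne hn.ne]

/-- What a compiled program does: from the memory `τ` it reaches, in at most `T` steps, a memory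
that represents `σ'` and `ρ` and satisfies `Q`, without changing the registers below `r`. -/
def Reach (p : Prog) (τ : Store) (T : ℕ) (σ' : Store) (ρ : ℕ → ℕ) (k r : ℕ)
    (Q : Store → Prop) : Prop :=
  ∃ τ' t, Exec p τ τ' t ∧ t ≤ T ∧ Agree σ' ρ k τ' ∧ (∀ q < r, τ' 100 q 0 0 = τ 100 q 0 0) ∧ Q τ'

theorem Reach.seq {p q : Prog} {τ : Store} {T U r r' : ℕ} {σ₁ σ₂ : Store} {ρ : ℕ → ℕ} {k : ℕ}
    {Q R : Store → Prop} (hp : Reach p τ T σ₁ ρ k r Q) (hr : r' ≤ r)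
    (hq : ∀ τ', Agree σ₁ ρ k τ' → (∀ q < r, τ' 100 q 0 0 = τ 100 q 0 0) → Q τ' →
      Reach q τ' U σ₂ ρ k r' R) :
    Reach (.seq p q) τ (T + U) σ₂ ρ k r' R := by
  obtain ⟨τ₁, t, h1, h2, h3, h4, h5⟩ := hp
  obtain ⟨τ₂, u, g1, g2, g3, g4, g5⟩ := hq τ₁ h3 h4 h5
  exact ⟨τ₂, t + u, .seq _ _ _ _ _ _ _ h1 g1, by omega, g3,
    fun q hq => (g4 q hq).trans (h4 q (by omega)), g5⟩

theorem Reach.putR {τ σ : Store} {ρ : ℕ → ℕ} {k r r' : ℕ} {e : Expr} (h : Agree σ ρ k τ)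
    (hr : r' ≤ r) : Reach (putR r e) τ 1 σ ρ k r' (fun τ' => τ' = τ.write 100 r 0 0 (e.eval τ)) := by
  refine ⟨_, _, .assign _ _ _ _ _ _, le_rfl, ?_, ?_, rfl⟩
  · exact h.putR _ _ _ _
  · intro q hq
    simp [Store.write, Expr.eval, (show q ≠ r by omega)]

/-- The shape of all compiled loops: variable `k` runs up to the value `n` of register `r`. -/
theorem Reach.loop {p : Prog} {f : ℕ → Store} {τ : Store} {T N n k r : ℕ} {ρ : ℕ → ℕ}
    {I : ℕ → Store → Prop} (hn : n ≤ N)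
    (hp : ∀ x < n, ∀ τ, Agree (f x) (Function.update ρ k x) (k + 1) τ → I x τ →
      τ 100 r 0 0 = n →
      Reach p τ T (f (x + 1)) (Function.update ρ k x) (k + 1) (r + 1) fun τ' =>
        ∀ y, I (x + 1) (τ'.write 101 k 0 0 y))
    (hI : I 0 τ) (hA : Agree (f 0) (Function.update ρ k 0) (k + 1) τ) (hr : τ 100 r 0 0 = n) :
    Reach (.loop (.sub (rg r) (vr k)) (.seq p (putV k (.add (vr k) (.lit 1))))) τ
      (N * (T + 1 + 1) + 1) (f n) ρ k (r + 1) (I n) := by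
  suffices H : ∀ m x τ, x + m = n → I x τ → Agree (f x) (Function.update ρ k x) (k + 1) τ →
      τ 100 r 0 0 = n →
      Reach (.loop (.sub (rg r) (vr k)) (.seq p (putV k (.add (vr k) (.lit 1))))) τ
        (m * (T + 1 + 1) + 1) (f n) ρ k (r + 1) (I n) by
    obtain ⟨τ', t, h1, h2, h3⟩ := H n 0 τ (by omega) hI hA hr
    exact ⟨τ', t, h1, h2.trans (by gcongr), h3⟩
  intro m
  induction m with
  | zero =>
    intro x τ hx hI hA hr
    have hx : x = n := by omega
    subst hx
    refine ⟨τ, 1, .loopDone _ _ _ ?_, by omega, hA.ofUpdate, fun _ _ => rfl, hI⟩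
    have := hA.2 k (by omega)
    simp [Expr.eval, hr, this]
  | succ m ih =>
    intro x τ hx hI hA hr
    obtain ⟨τ₁, t, h1, h2, h3, h4, h5⟩ := hp x (by omega) τ hA hI hr
    have e1 := h3.2 k (by omega)
    obtain ⟨τ₂, u, g1, g2, g3, g4, g5⟩ := ih (x + 1) (τ₁.write 101 k 0 0 (x + 1)) (by omega) (h5 _)
      (h3.ofUpdate.putV _) (by simp [Store.write, h4, hr])
    refine ⟨τ₂, t + 1 + u + 1, .loopStep _ _ _ _ _ _ u ?_
      (.seq _ _ _ _ _ _ _ h1 (.assign _ _ _ _ _ _)) ?_, ?_, g3, ?_, g5⟩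
    · have := hA.2 k (by omega)
      simp only [Function.update_self] at this
      simp only [Expr.eval, hr, this]; omega
    · simp only [Expr.eval]
      rw [e1]; simpa using g1
    · ring_nf; ring_nf at g2; omega
    · intro q hq
      rw [g4 q hq, ← h4 q hq]; simp [Store.write]

/-- A compiled term leaves its value in register `r`, within its cost. -/
theorem Tm.comp_spec (N : ℕ) (e : Tm) : ∀ (k r : ℕ) (σ τ : Store) (ρ : ℕ → ℕ),
    e.wf k = true → e.ok N σ ρ → Agree σ ρ k τ →
    Reach (e.comp r) τ (e.cost N) σ ρ k r fun τ' => τ' 100 r 0 0 = e.eval σ ρ := by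
  have fin : ∀ {k r r' : ℕ} {σ τ : Store} {ρ : ℕ → ℕ} (e : Expr) (y : ℕ), Agree σ ρ k τ →
      r' ≤ r → e.eval τ = y →
      Reach (putR r e) τ 1 σ ρ k r' fun τ' => τ' 100 r 0 0 = y := by
    intro k r r' σ τ ρ e y h hr hy
    obtain ⟨τ', t, h1, h2, h3, h4, h5⟩ := Reach.putR (e := e) h hr
    exact ⟨τ', t, h1, h2, h3, h4, by subst h5; simp [Store.write, hy]⟩
  induction e with
  | lit n => intro k r σ τ ρ hw ho hA; exact fin _ _ hA le_rfl rfl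
  | var n =>
    intro k r σ τ ρ hw ho hA
    refine fin _ _ hA le_rfl ?_
    simp only [Tm.wf, Nat.blt_eq] at hw
    simp [Expr.eval, Tm.eval, hA.2 n hw]
  | get a i j l hi hj hl =>
    intro k r σ τ ρ hw ho hA
    simp only [Tm.wf, Bool.and_eq_true, Nat.blt_eq] at hw
    simp only [Tm.ok] at ho
    refine (hi k r σ τ ρ hw.2.1 ho.1 hA).seq le_rfl fun τ₁ h1 g1 e1 => ?_
    refine (hj k (r + 1) σ τ₁ ρ hw.2.2.1 ho.2.1 h1).seq (by omega) fun τ₂ h2 g2 e2 => ?_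
    refine (hl k (r + 2) σ τ₂ ρ hw.2.2.2 ho.2.2 h2).seq (by omega) fun τ₃ h3 g3 e3 => ?_
    refine fin _ _ h3 le_rfl ?_
    simp only [Expr.eval, Tm.eval]
    rw [e3, g3 (r + 1) (by omega), e2, g3 r (by omega), g2 r (by omega), e1, h3.1 a hw.1]
  | add e f he hf =>
    intro k r σ τ ρ hw ho hA
    simp only [Tm.wf, Bool.and_eq_true] at hw
    simp only [Tm.ok] at ho
    refine (he k r σ τ ρ hw.1 ho.1 hA).seq le_rfl fun τ₁ h1 g1 e1 => ?_
    refine (hf k (r + 1) σ τ₁ ρ hw.2 ho.2 h1).seq (by omega) fun τ₂ h2 g2 e2 => ?_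
    refine fin _ _ h2 le_rfl ?_
    simp only [Expr.eval, Tm.eval]
    rw [e2, g2 r (by omega), e1]
  | sub e f he hf =>
    intro k r σ τ ρ hw ho hA
    simp only [Tm.wf, Bool.and_eq_true] at hw
    simp only [Tm.ok] at ho
    refine (he k r σ τ ρ hw.1 ho.1 hA).seq le_rfl fun τ₁ h1 g1 e1 => ?_
    refine (hf k (r + 1) σ τ₁ ρ hw.2 ho.2 h1).seq (by omega) fun τ₂ h2 g2 e2 => ?_
    refine fin _ _ h2 le_rfl ?_
    simp only [Expr.eval, Tm.eval]
    rw [e2, g2 r (by omega), e1]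
  | ite c e f hc he hf =>
    intro k r σ τ ρ hw ho hA
    simp only [Tm.wf, Bool.and_eq_true] at hw
    simp only [Tm.ok] at ho
    refine (hc k r σ τ ρ hw.1 ho.1 hA).seq le_rfl fun τ₁ h1 g1 e1 => ?_
    by_cases hz : c.eval σ ρ = 0
    · obtain ⟨τ₂, t, a1, a2, a3, a4, a5⟩ := hf k r σ τ₁ ρ hw.2.2 (ho.2.2 hz) h1
      refine ⟨τ₂, _, .iteFalse _ _ _ _ _ _ ?_ a1, by omega, a3, a4, by simp [Tm.eval, hz, a5]⟩
      simp only [Expr.eval]; rw [e1, hz]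
    · obtain ⟨τ₂, t, a1, a2, a3, a4, a5⟩ := he k r σ τ₁ ρ hw.2.1 (ho.2.1 hz) h1
      refine ⟨τ₂, _, .iteTrue _ _ _ _ _ _ ?_ a1, by omega, a3, a4, by simp [Tm.eval, hz, a5]⟩
      simp only [Expr.eval]; rw [e1]; exact hz
  | sum d e t he ht =>
    intro k r σ τ ρ hw ho hA
    simp only [Tm.wf, Bool.and_eq_true, Nat.beq_eq] at hw
    obtain ⟨rfl, hw1, hw2⟩ := hw
    simp only [Tm.ok] at ho
    refine (he k r σ τ ρ hw1 ho.1 hA).seq le_rfl fun τ₁ h1 g1 e1 => ?_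
    refine (Reach.putR (e := .lit 0) h1 (show r + 1 ≤ r + 1 by omega)).seq (by omega)
      fun τ₂ h2 g2 e2 => ?_
    have hS : Reach (putV k (.lit 0)) τ₂ 1 σ ρ k (r + 1)
        (fun τ' => τ' = τ₂.write 101 k 0 0 0) :=
      ⟨_, _, .assign _ _ _ _ _ _, le_rfl, (h2.putV 0).ofUpdate,
        fun q hq => by simp [Store.write], rfl⟩
    refine hS.seq (by omega) fun τ₃ h3 g3 e3 => ?_
    have hL := Reach.loop (p := .seq (t.comp (r + 2)) (putR (r + 1) (.add (rg (r + 1)) (rg (r + 2)))))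
      (f := fun _ => σ) (τ := τ₃) (T := t.cost N + 1) (N := N) (n := e.eval σ ρ) (k := k) (r := r)
      (ρ := ρ)
      (I := fun x τ => τ 100 (r + 1) 0 0 =
        ∑ y ∈ Finset.range x, t.eval σ (Function.update ρ k y)) ho.2.1 ?_ ?_ ?_ ?_
    · refine Reach.seq (T := N * (t.cost N + 2 + 1) + 1) hL (by omega) fun τ₄ h4 g4 e4 => ?_
      exact fin _ _ h4 le_rfl (by simpa [Expr.eval, Tm.eval] using e4)
    · intro x hx τ' hA' hI hr'
      refine (ht (k + 1) (r + 2) σ τ' _ hw2 (ho.2.2 x hx) hA').seq (by omega)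
        fun τ₅ h5 g5 e5 => ?_
      obtain ⟨τ₆, u, b1, b2, b3, b4, b5⟩ :=
        Reach.putR (e := .add (rg (r + 1)) (rg (r + 2))) h5 (show r + 1 ≤ r + 1 by omega)
      refine ⟨τ₆, u, b1, b2, b3, b4, fun y => ?_⟩
      subst b5
      rw [Finset.sum_range_succ, ← hI, ← e5, ← g5 (r + 1) (by omega)]
      simp [Store.write, Expr.eval]
    · subst e3 e2; simp [Store.write, Expr.eval]
    · subst e3; exact h2.putV 0
    · subst e3 e2; simp [Store.write, e1]

/-- A compiled command does what the command does, within its cost. -/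
theorem Cm.comp_spec (N : ℕ) (c : Cm) : ∀ (k r : ℕ) (σ τ : Store) (ρ : ℕ → ℕ),
    c.wf k = true → c.ok N ρ σ → Agree σ ρ k τ →
    Reach (c.comp r) τ (c.cost N) (c.run ρ σ) ρ k r fun _ => True := by
  induction c with
  | skip =>
    intro k r σ τ ρ hw ho hA
    exact ⟨τ, 1, .skip _, le_rfl, hA, fun _ _ => rfl, trivial⟩
  | put a i j l e =>
    intro k r σ τ ρ hw ho hA
    simp only [Cm.wf, Bool.and_eq_true, Nat.blt_eq] at hw
    simp only [Cm.ok] at ho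
    refine (i.comp_spec N k r σ τ ρ hw.2.1 ho.1 hA).seq le_rfl fun τ₁ h1 g1 e1 => ?_
    refine (j.comp_spec N k (r + 1) σ τ₁ ρ hw.2.2.1 ho.2.1 h1).seq (by omega) fun τ₂ h2 g2 e2 => ?_
    refine (l.comp_spec N k (r + 2) σ τ₂ ρ hw.2.2.2.1 ho.2.2.1 h2).seq (by omega)
      fun τ₃ h3 g3 e3 => ?_
    refine (e.comp_spec N k (r + 3) σ τ₃ ρ hw.2.2.2.2 ho.2.2.2 h3).seq (by omega)
      fun τ₄ h4 g4 e4 => ?_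
    refine ⟨_, 1, .assign _ _ _ _ _ _, le_rfl, ⟨fun b hb => ?_, fun n hn => ?_⟩, ?_, trivial⟩
    · simp only [Expr.eval, Cm.run]
      rw [e4, g4 (r + 2) (by omega), e3, g4 (r + 1) (by omega), g3 (r + 1) (by omega), e2,
        g4 r (by omega), g3 r (by omega), g2 r (by omega), e1]
      funext i' j' l'
      simp only [Store.write, h4.1 b hb]
    · simp [Store.write, h4.2 n hn, (show 101 ≠ a by omega)]
    · intro q hq
      simp [Store.write, (show 100 ≠ a by omega)]
  | seq p q hp hq =>
    intro k r σ τ ρ hw ho hA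
    simp only [Cm.wf, Bool.and_eq_true] at hw
    exact (hp k r σ τ ρ hw.1 ho.1 hA).seq le_rfl fun τ₁ h1 _ _ => hq k r _ τ₁ ρ hw.2 ho.2 h1
  | ite e p q hp hq =>
    intro k r σ τ ρ hw ho hA
    simp only [Cm.wf, Bool.and_eq_true] at hw
    simp only [Cm.ok] at ho
    refine (e.comp_spec N k r σ τ ρ hw.1 ho.1 hA).seq le_rfl fun τ₁ h1 g1 e1 => ?_
    by_cases hz : e.eval σ ρ = 0
    · obtain ⟨τ₂, t, a1, a2, a3, a4, a5⟩ := hq k r σ τ₁ ρ hw.2.2 (ho.2.2 hz) h1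
      refine ⟨τ₂, _, .iteFalse _ _ _ _ _ _ ?_ a1, by omega, ?_, a4, trivial⟩
      · simp only [Expr.eval]; rw [e1, hz]
      · simpa [Cm.run, hz] using a3
    · obtain ⟨τ₂, t, a1, a2, a3, a4, a5⟩ := hp k r σ τ₁ ρ hw.2.1 (ho.2.1 hz) h1
      refine ⟨τ₂, _, .iteTrue _ _ _ _ _ _ ?_ a1, by omega, ?_, a4, trivial⟩
      · simp only [Expr.eval]; rw [e1]; exact hz
      · simpa [Cm.run, hz] using a3
  | rep d e p hp =>
    intro k r σ τ ρ hw ho hA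
    simp only [Cm.wf, Bool.and_eq_true, Nat.beq_eq] at hw
    obtain ⟨rfl, hw1, hw2⟩ := hw
    simp only [Cm.ok] at ho
    refine (e.comp_spec N k r σ τ ρ hw1 ho.1 hA).seq le_rfl fun τ₁ h1 g1 e1 => ?_
    have hS : Reach (putV k (.lit 0)) τ₁ 1 σ ρ k (r + 1)
        (fun τ' => τ' = τ₁.write 101 k 0 0 0) :=
      ⟨_, _, .assign _ _ _ _ _ _, le_rfl, (h1.putV 0).ofUpdate,
        fun q hq => by simp [Store.write], rfl⟩
    refine hS.seq (by omega) fun τ₂ h2 g2 e2 => ?_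
    obtain ⟨τ₃, t, a1, a2, a3, a4, a5⟩ := Reach.loop (p := p.comp (r + 1))
      (f := fun x => iter (fun x σ => p.run (Function.update ρ k x) σ) x σ) (τ := τ₂)
      (T := p.cost N) (N := N) (n := e.eval σ ρ) (k := k) (r := r) (ρ := ρ)
      (I := fun _ _ => True) ho.2.1
      (fun x hx τ' hA' _ _ => by
        obtain ⟨τ₃, t, a1, a2, a3, a4, a5⟩ := hp (k + 1) (r + 1) _ τ' _ hw2 (ho.2.2 x hx) hA'
        exact ⟨τ₃, t, a1, a2, a3, a4, fun _ => trivial⟩)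
      trivial (by subst e2; exact h1.putV 0) (by subst e2; simp [Store.write, e1])
    exact ⟨τ₃, t, a1, a2, a3, fun q hq => a4 q (by omega), trivial⟩

/-! ### Reasoning about commands -/

/-- The value of the term is a positive truth value. -/
def Tm.holds (e : Tm) (σ : Store) (ρ : ℕ → ℕ) : Prop := e.eval σ ρ ≠ 0

namespace Tm

/-- Negation. -/
def no (e : Tm) : Tm := .ite e (.lit 0) (.lit 1)

/-- Equality test. -/
def eq (e f : Tm) : Tm := no (.add (.sub e f) (.sub f e))

/-- Comparison. -/
def le (e f : Tm) : Tm := no (.sub e f)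

/-- Strict comparison. -/
def lt (e f : Tm) : Tm := .sub f e

/-- Conjunction; the second term is only evaluated if the first one holds. -/
def and (e f : Tm) : Tm := .ite e f (.lit 0)

/-- Disjunction; the second term is only evaluated if the first one fails. -/
def or (e f : Tm) : Tm := .ite e (.lit 1) f

/-- Bounded existential quantifier. -/
def ex (d : ℕ) (e t : Tm) : Tm := .sum d e t

/-- Bounded universal quantifier. -/
def all (d : ℕ) (e t : Tm) : Tm := no (.sum d e (no t))

/-- The cell of an array with indices `0, 0, 0`. -/
def cell (a : ℕ) : Tm := .get a (.lit 0) (.lit 0) (.lit 0)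

/-- The cell of an array with indices `i, 0, 0`. -/
def at1 (a : ℕ) (i : Tm) : Tm := .get a i (.lit 0) (.lit 0)

/-- The cell of an array with indices `i, j, 0`. -/
def at2 (a : ℕ) (i j : Tm) : Tm := .get a i j (.lit 0)

end Tm

/-- Assignment to the cell with indices `0, 0, 0`. -/
def Cm.put0 (a : ℕ) (e : Tm) : Cm := .put a (.lit 0) (.lit 0) (.lit 0) e

/-- Assignment to the cell with indices `i, 0, 0`. -/
def Cm.put1 (a : ℕ) (i e : Tm) : Cm := .put a i (.lit 0) (.lit 0) e

/-- Assignment to the cell with indices `i, j, 0`. -/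
def Cm.put2 (a : ℕ) (i j e : Tm) : Cm := .put a i j (.lit 0) e

infixr:60 ";;" => Cm.seq

section simps

variable (N : ℕ) (σ : Store) (ρ : ℕ → ℕ) (e f t i j : Tm) (a d n : ℕ)

@[simp] theorem Tm.eval_lit : (Tm.lit n).eval σ ρ = n := rfl
@[simp] theorem Tm.eval_var : (Tm.var n).eval σ ρ = ρ n := rfl
@[simp] theorem Tm.eval_get : (Tm.get a i j t).eval σ ρ =
    σ a (i.eval σ ρ) (j.eval σ ρ) (t.eval σ ρ) := rfl
@[simp] theorem Tm.eval_cell : (Tm.cell a).eval σ ρ = σ a 0 0 0 := rfl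
@[simp] theorem Tm.eval_at1 : (Tm.at1 a i).eval σ ρ = σ a (i.eval σ ρ) 0 0 := rfl
@[simp] theorem Tm.eval_at2 : (Tm.at2 a i j).eval σ ρ = σ a (i.eval σ ρ) (j.eval σ ρ) 0 := rfl
@[simp] theorem Tm.eval_add : (Tm.add e f).eval σ ρ = e.eval σ ρ + f.eval σ ρ := rfl
@[simp] theorem Tm.eval_sub : (Tm.sub e f).eval σ ρ = e.eval σ ρ - f.eval σ ρ := rfl
@[simp] theorem Tm.eval_sum : (Tm.sum d e t).eval σ ρ =
    ∑ x ∈ Finset.range (e.eval σ ρ), t.eval σ (Function.update ρ d x) := rfl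
@[simp] theorem Tm.eval_ite : (Tm.ite e f t).eval σ ρ =
    if e.holds σ ρ then f.eval σ ρ else t.eval σ ρ := by
  simp only [Tm.eval, Tm.holds]; split_ifs <;> simp_all

@[simp] theorem Tm.holds_lit : (Tm.lit n).holds σ ρ ↔ n ≠ 0 := Iff.rfl
@[simp] theorem Tm.holds_get : (Tm.get a i j t).holds σ ρ ↔
    σ a (i.eval σ ρ) (j.eval σ ρ) (t.eval σ ρ) ≠ 0 := Iff.rfl
@[simp] theorem Tm.holds_cell : (Tm.cell a).holds σ ρ ↔ σ a 0 0 0 ≠ 0 := Iff.rfl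
@[simp] theorem Tm.holds_at1 : (Tm.at1 a i).holds σ ρ ↔ σ a (i.eval σ ρ) 0 0 ≠ 0 := Iff.rfl
@[simp] theorem Tm.holds_at2 : (Tm.at2 a i j).holds σ ρ ↔
    σ a (i.eval σ ρ) (j.eval σ ρ) 0 ≠ 0 := Iff.rfl
@[simp] theorem Tm.holds_no : e.no.holds σ ρ ↔ ¬ e.holds σ ρ := by
  simp only [Tm.no, Tm.eval, Tm.holds]; split_ifs <;> simp_all
@[simp] theorem Tm.holds_eq : (e.eq f).holds σ ρ ↔ e.eval σ ρ = f.eval σ ρ := by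
  simp only [Tm.eq, Tm.holds_no]; simp only [Tm.holds, Tm.eval]; omega
@[simp] theorem Tm.holds_le : (e.le f).holds σ ρ ↔ e.eval σ ρ ≤ f.eval σ ρ := by
  simp only [Tm.le, Tm.holds_no]; simp only [Tm.holds, Tm.eval]; omega
@[simp] theorem Tm.holds_lt : (e.lt f).holds σ ρ ↔ e.eval σ ρ < f.eval σ ρ := by
  simp only [Tm.lt, Tm.holds, Tm.eval]; omega
@[simp] theorem Tm.holds_and : (e.and f).holds σ ρ ↔ e.holds σ ρ ∧ f.holds σ ρ := by
  simp only [Tm.and, Tm.holds, Tm.eval]; split_ifs <;> simp_all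
@[simp] theorem Tm.holds_or : (e.or f).holds σ ρ ↔ e.holds σ ρ ∨ f.holds σ ρ := by
  simp only [Tm.or, Tm.holds, Tm.eval]; split_ifs <;> simp_all
@[simp] theorem Tm.holds_ite : (Tm.ite e f t).holds σ ρ ↔
    if e.holds σ ρ then f.holds σ ρ else t.holds σ ρ := by
  simp only [Tm.holds, Tm.eval]; split_ifs <;> simp_all
@[simp] theorem Tm.holds_ex : (Tm.ex d e t).holds σ ρ ↔
    ∃ x < e.eval σ ρ, t.holds σ (Function.update ρ d x) := by
  simp [Tm.ex, Tm.holds]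
@[simp] theorem Tm.holds_all : (Tm.all d e t).holds σ ρ ↔
    ∀ x < e.eval σ ρ, t.holds σ (Function.update ρ d x) := by
  have := Tm.holds_ex σ ρ e t.no d
  simp only [Tm.all, Tm.holds_no, Tm.ex] at this ⊢
  rw [this]; push Not; rfl

theorem Tm.eval_no : e.no.eval σ ρ = if e.holds σ ρ then 0 else 1 := by simp [Tm.no]
theorem Tm.eval_all : (Tm.all d e t).eval σ ρ =
    if ∀ x < e.eval σ ρ, t.holds σ (Function.update ρ d x) then 1 else 0 := by
  have := Tm.holds_all σ ρ e t d
  simp only [Tm.all, Tm.holds_no] at this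
  rw [Tm.all, Tm.eval_no]; split_ifs <;> tauto

@[simp] theorem Tm.ok_lit : (Tm.lit n).ok N σ ρ ↔ True := Iff.rfl
@[simp] theorem Tm.ok_var : (Tm.var n).ok N σ ρ ↔ True := Iff.rfl
@[simp] theorem Tm.ok_get : (Tm.get a i j t).ok N σ ρ ↔
    i.ok N σ ρ ∧ j.ok N σ ρ ∧ t.ok N σ ρ := Iff.rfl
@[simp] theorem Tm.ok_cell : (Tm.cell a).ok N σ ρ ↔ True := by simp [Tm.cell]
@[simp] theorem Tm.ok_at1 : (Tm.at1 a i).ok N σ ρ ↔ i.ok N σ ρ := by simp [Tm.at1]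
@[simp] theorem Tm.ok_at2 : (Tm.at2 a i j).ok N σ ρ ↔ i.ok N σ ρ ∧ j.ok N σ ρ := by
  simp [Tm.at2]
@[simp] theorem Tm.ok_add : (Tm.add e f).ok N σ ρ ↔ e.ok N σ ρ ∧ f.ok N σ ρ := Iff.rfl
@[simp] theorem Tm.ok_sub : (Tm.sub e f).ok N σ ρ ↔ e.ok N σ ρ ∧ f.ok N σ ρ := Iff.rfl
@[simp] theorem Tm.ok_ite : (Tm.ite e f t).ok N σ ρ ↔
    e.ok N σ ρ ∧ (e.holds σ ρ → f.ok N σ ρ) ∧ (¬ e.holds σ ρ → t.ok N σ ρ) := by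
  simp [Tm.ok, Tm.holds]
@[simp] theorem Tm.ok_no : e.no.ok N σ ρ ↔ e.ok N σ ρ := by simp [Tm.no]
@[simp] theorem Tm.ok_eq : (e.eq f).ok N σ ρ ↔ e.ok N σ ρ ∧ f.ok N σ ρ := by
  simp [Tm.eq]; tauto
@[simp] theorem Tm.ok_le : (e.le f).ok N σ ρ ↔ e.ok N σ ρ ∧ f.ok N σ ρ := by simp [Tm.le]
@[simp] theorem Tm.ok_lt : (e.lt f).ok N σ ρ ↔ f.ok N σ ρ ∧ e.ok N σ ρ := by simp [Tm.lt]
@[simp] theorem Tm.ok_and : (e.and f).ok N σ ρ ↔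
    e.ok N σ ρ ∧ (e.holds σ ρ → f.ok N σ ρ) := by simp [Tm.and]
@[simp] theorem Tm.ok_or : (e.or f).ok N σ ρ ↔
    e.ok N σ ρ ∧ (¬ e.holds σ ρ → f.ok N σ ρ) := by simp [Tm.or]
@[simp] theorem Tm.ok_sum : (Tm.sum d e t).ok N σ ρ ↔ e.ok N σ ρ ∧ e.eval σ ρ ≤ N ∧
    ∀ x < e.eval σ ρ, t.ok N σ (Function.update ρ d x) := Iff.rfl
@[simp] theorem Tm.ok_ex : (Tm.ex d e t).ok N σ ρ ↔ e.ok N σ ρ ∧ e.eval σ ρ ≤ N ∧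
    ∀ x < e.eval σ ρ, t.ok N σ (Function.update ρ d x) := Iff.rfl
@[simp] theorem Tm.ok_all : (Tm.all d e t).ok N σ ρ ↔ e.ok N σ ρ ∧ e.eval σ ρ ≤ N ∧
    ∀ x < e.eval σ ρ, t.ok N σ (Function.update ρ d x) := by simp [Tm.all]

end simps

theorem Store.write_apply (σ : Store) (a i j l x a' i' j' l' : ℕ) :
    σ.write a i j l x a' i' j' l' =
      if a' = a ∧ i' = i ∧ j' = j ∧ l' = l then x else σ a' i' j' l' := rfl

theorem Store.write_of_ne (σ : Store) {a a' : ℕ} (i j l x : ℕ) (h : a' ≠ a) :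
    σ.write a i j l x a' = σ a' := by
  funext i' j' l'; simp [Store.write, h]

/-- The command does not assign to array `a`. -/
def Cm.keeps (a : ℕ) : Cm → Bool
  | .skip => true
  | .put b _ _ _ _ => !(a == b)
  | .seq p q => p.keeps a && q.keeps a
  | .ite _ p q => p.keeps a && q.keeps a
  | .rep _ _ p => p.keeps a

theorem iter_keeps {f : ℕ → Store → Store} {a : ℕ} (h : ∀ x σ, f x σ a = σ a) (n : ℕ)
    (σ : Store) : iter f n σ a = σ a := by
  induction n with
  | zero => rfl
  | succ n ih => rw [iter, h, ih]

/-- An array that does not occur on the left of an assignment keeps its contents. Together with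
`Cm.Does.seq` and `Cm.Does.rep` this is how parts of the memory are carried through a program. -/
theorem Cm.run_keeps {a : ℕ} (c : Cm) : ∀ (ρ : ℕ → ℕ) (σ : Store), c.keeps a = true →
    c.run ρ σ a = σ a := by
  induction c with
  | skip => intros; rfl
  | put b i j l e =>
    intro ρ σ h
    exact Store.write_of_ne _ _ _ _ _ (by simpa [Cm.keeps] using h)
  | seq p q hp hq =>
    intro ρ σ h
    simp only [Cm.keeps, Bool.and_eq_true] at h
    rw [Cm.run, hq _ _ h.2, hp _ _ h.1]
  | ite e p q hp hq =>
    intro ρ σ h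
    simp only [Cm.keeps, Bool.and_eq_true] at h
    rw [Cm.run]; split_ifs
    exacts [hq _ _ h.2, hp _ _ h.1]
  | rep d e p hp =>
    intro ρ σ h
    exact iter_keeps (fun x σ => hp _ _ h) _ _

/-- Started in `σ`, the command stays within the loop bound `N` and reaches a store
with property `Q`. -/
def Cm.Does (N : ℕ) (c : Cm) (ρ : ℕ → ℕ) (σ : Store) (Q : Store → Prop) : Prop :=
  c.ok N ρ σ ∧ Q (c.run ρ σ)

namespace Cm.Does

variable {N : ℕ} {ρ : ℕ → ℕ} {σ : Store} {Q R : Store → Prop}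

theorem mono {c : Cm} (h : c.Does N ρ σ R)
    (hQ : ∀ σ', (∀ a, c.keeps a = true → σ' a = σ a) → R σ' → Q σ') : c.Does N ρ σ Q :=
  ⟨h.1, hQ _ (fun _ ha => c.run_keeps _ _ ha) h.2⟩

@[simp] theorem skip_iff : Cm.skip.Does N ρ σ Q ↔ Q σ := by simp [Cm.Does, Cm.ok, Cm.run]

@[simp] theorem put_iff {a : ℕ} {i j l e : Tm} : (Cm.put a i j l e).Does N ρ σ Q ↔
    (i.ok N σ ρ ∧ j.ok N σ ρ ∧ l.ok N σ ρ ∧ e.ok N σ ρ) ∧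
      Q (σ.write a (i.eval σ ρ) (j.eval σ ρ) (l.eval σ ρ) (e.eval σ ρ)) := Iff.rfl

@[simp] theorem put0_iff {a : ℕ} {e : Tm} : (Cm.put0 a e).Does N ρ σ Q ↔
    e.ok N σ ρ ∧ Q (σ.write a 0 0 0 (e.eval σ ρ)) := by simp [Cm.put0]

@[simp] theorem put1_iff {a : ℕ} {i e : Tm} : (Cm.put1 a i e).Does N ρ σ Q ↔
    (i.ok N σ ρ ∧ e.ok N σ ρ) ∧ Q (σ.write a (i.eval σ ρ) 0 0 (e.eval σ ρ)) := by
  simp [Cm.put1]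

@[simp] theorem put2_iff {a : ℕ} {i j e : Tm} : (Cm.put2 a i j e).Does N ρ σ Q ↔
    (i.ok N σ ρ ∧ j.ok N σ ρ ∧ e.ok N σ ρ) ∧
      Q (σ.write a (i.eval σ ρ) (j.eval σ ρ) 0 (e.eval σ ρ)) := by
  simp [Cm.put2]

@[simp] theorem seq_iff {p q : Cm} : (p ;; q).Does N ρ σ Q ↔
    p.Does N ρ σ fun σ' => q.Does N ρ σ' Q := by
  simp [Cm.Does, Cm.ok, Cm.run, and_assoc]

@[simp] theorem ite_iff {e : Tm} {p q : Cm} : (Cm.ite e p q).Does N ρ σ Q ↔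
    e.ok N σ ρ ∧ (e.holds σ ρ → p.Does N ρ σ Q) ∧ (¬ e.holds σ ρ → q.Does N ρ σ Q) := by
  by_cases h : e.eval σ ρ = 0 <;> simp [Cm.Does, Cm.ok, Cm.run, Tm.holds, h, and_assoc]

theorem seq {p q : Cm} (hp : p.Does N ρ σ R)
    (hq : ∀ σ', (∀ a, p.keeps a = true → σ' a = σ a) → R σ' → q.Does N ρ σ' Q) :
    (p ;; q).Does N ρ σ Q :=
  seq_iff.2 (hp.mono hq)

/-- Loops by invariants; the invariant is complemented by the arrays that the body keeps. -/
theorem rep {d : ℕ} {e : Tm} {p : Cm} (n : ℕ) (I : ℕ → Store → Prop) (he : e.ok N σ ρ)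
    (hn : e.eval σ ρ = n) (hN : n ≤ N) (h0 : I 0 σ)
    (hs : ∀ x < n, ∀ σ', (∀ a, p.keeps a = true → σ' a = σ a) → I x σ' →
      p.Does N (Function.update ρ d x) σ' (I (x + 1)))
    (hQ : ∀ σ', (∀ a, p.keeps a = true → σ' a = σ a) → I n σ' → Q σ') :
    (Cm.rep d e p).Does N ρ σ Q := by
  have key : ∀ x ≤ n, I x (iter (fun x σ => p.run (Function.update ρ d x) σ) x σ) := by
    intro x
    induction x with
    | zero => intro _; exact h0
    | succ x ih =>
      intro hx
      exact (hs x (by omega) _ (fun a ha => iter_keeps (fun x σ => p.run_keeps _ _ ha) _ _)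
        (ih (by omega))).2
  refine ⟨⟨he, by omega, fun x hx => ?_⟩, ?_⟩
  · exact (hs x (by omega) _ (fun a ha => iter_keeps (fun x σ => p.run_keeps _ _ ha) _ _)
      (key x (by omega))).1
  · subst hn
    exact hQ _ (fun a ha => iter_keeps (fun x σ => p.run_keeps _ _ ha) _ _) (key _ le_rfl)

end Cm.Does

/-! ### Lists of nodes -/

namespace Lists

variable {f g : ℕ → ℕ} {n : ℕ} {A : Finset ℕ}

theorem mem_iff (h : Lists f n A) {x : ℕ} : x ∈ A ↔ ∃ j < n, f j = x := by
  constructor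
  · intro hx
    obtain ⟨j, hj, rfl⟩ := h.surjOn hx
    exact ⟨j, hj, rfl⟩
  · rintro ⟨j, hj, rfl⟩
    exact h.mapsTo hj

theorem mem (h : Lists f n A) {j : ℕ} (hj : j < n) : f j ∈ A := h.mem_iff.2 ⟨j, hj, rfl⟩

theorem inj (h : Lists f n A) {i j : ℕ} (hi : i < n) (hj : j < n) (e : f i = f j) : i = j :=
  h.injOn hi hj e

theorem image_eq (h : Lists f n A) : (Finset.range n).image f = A := by
  ext x; simp [h.mem_iff]

theorem card_eq (h : Lists f n A) : A.card = n := by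
  rw [← h.image_eq, Finset.card_image_of_injOn, Finset.card_range]
  intro i hi j hj e
  simp only [Finset.coe_range] at hi hj
  exact h.injOn hi hj e

theorem intro (hi : ∀ i < n, ∀ j < n, f i = f j → i = j) (hm : ∀ x, x ∈ A ↔ ∃ j < n, f j = x) :
    Lists f n A :=
  ⟨fun j hj => (hm _).2 ⟨j, hj, rfl⟩, fun i h j h' e => hi i h j h' e,
    fun x hx => (hm x).1 hx⟩

theorem congr (h : Lists f n A) (hg : ∀ j < n, g j = f j) : Lists g n A :=
  intro (fun i hi j hj e => h.inj hi hj (by rw [← hg i hi, ← hg j hj, e]))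
    (fun x => by
      rw [h.mem_iff]
      exact exists_congr fun j => and_congr_right fun hj => by rw [hg j hj])

theorem zero (f : ℕ → ℕ) : Lists f 0 ∅ := intro (by simp) (by simp)

theorem push (h : Lists f n A) {z : ℕ} (hz : z ∉ A) (hg : ∀ j < n, g j = f j) (hn : g n = z) :
    Lists g (n + 1) (insert z A) := by
  refine intro ?_ ?_
  · intro i hi j hj e
    rcases Nat.lt_succ_iff_lt_or_eq.1 hi with hi | rfl <;>
      rcases Nat.lt_succ_iff_lt_or_eq.1 hj with hj | rfl
    · exact h.inj hi hj (by rw [← hg i hi, ← hg j hj, e])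
    · exact absurd (h.mem hi) (by rw [← hg i hi, e, hn]; exact hz)
    · exact absurd (h.mem hj) (by rw [← hg j hj, ← e, hn]; exact hz)
    · rfl
  · intro x
    rw [Finset.mem_insert, h.mem_iff]
    constructor
    · rintro (rfl | ⟨j, hj, rfl⟩)
      exacts [⟨n, by omega, hn⟩, ⟨j, by omega, hg j hj⟩]
    · rintro ⟨j, hj, rfl⟩
      rcases Nat.lt_succ_iff_lt_or_eq.1 hj with hj | rfl
      exacts [Or.inr ⟨j, hj, (hg j hj).symm⟩, Or.inl hn]

/-- Removing an element by overwriting it with the last one. -/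
theorem swapRemove (h : Lists f n A) {p : ℕ} (hp : p < n) (hgp : g p = f (n - 1))
    (hg : ∀ j < n - 1, j ≠ p → g j = f j) : Lists g (n - 1) (A.erase (f p)) := by
  have hgj : ∀ j < n - 1, ∃ j' < n, g j = f j' ∧ j' ≠ p ∧ (j = p → j' = n - 1) ∧
      (j ≠ p → j' = j) := by
    intro j hj
    by_cases hjp : j = p
    · subst hjp; exact ⟨n - 1, by omega, hgp, by omega, by simp, by simp⟩
    · exact ⟨j, by omega, hg j hj hjp, hjp, by simp [hjp], by simp⟩
  refine intro ?_ ?_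
  · intro i hi j hj e
    obtain ⟨i', hi', ei, hip, hi1, hi2⟩ := hgj i hi
    obtain ⟨j', hj', ej, hjp, hj1, hj2⟩ := hgj j hj
    have := h.inj hi' hj' (by rw [← ei, ← ej, e])
    by_cases h1 : i = p <;> by_cases h2 : j = p <;>
      simp only [h1, h2, ne_eq, not_true_eq_false, not_false_eq_true, forall_const,
        IsEmpty.forall_iff] at * <;> omega
  · intro x
    rw [Finset.mem_erase, h.mem_iff]
    constructor
    · rintro ⟨hx, j, hj, rfl⟩
      have hjp : j ≠ p := fun e => hx (by rw [e])
      by_cases hj1 : j = n - 1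
      · exact ⟨p, by omega, by rw [hgp, hj1]⟩
      · exact ⟨j, by omega, hg j (by omega) hjp⟩
    · rintro ⟨j, hj, rfl⟩
      obtain ⟨j', hj', e, hjp, -⟩ := hgj j hj
      exact ⟨fun e' => hjp (h.inj hj' hp (by rw [← e, e'])), j', hj', e.symm⟩

theorem of_mem_iff {B : Finset ℕ} (h : Lists f n A) (hAB : ∀ x, x ∈ A ↔ x ∈ B) : Lists f n B :=
  Finset.ext hAB ▸ h

theorem insertNew (h : Lists f n A) {z : ℕ} (hz : z ∈ A) : Lists f n (insert z A) := by
  rwa [Finset.insert_eq_of_mem hz]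

end Lists

/-- Append the value of `z` to the list with length `c` and elements `b`, unless it is there. -/
def addNew (c b : ℕ) (z : Tm) (d : ℕ) : Cm :=
  .ite (.ex d (.cell c) (.eq (.at1 b (.var d)) z)) .skip
    (.put1 b (.cell c) z ;; .put0 c (.add (.cell c) (.lit 1)))

theorem addNew_does {N c b d : ℕ} {z : Tm} {ρ : ℕ → ℕ} {σ : Store} {A : Finset ℕ} {y : ℕ}
    (hcb : c ≠ b) (hA : Lists (fun j => σ b j 0 0) (σ c 0 0 0) A) (hN : A.card ≤ N)
    (hok : z.ok N σ ρ) (hz : z.eval σ ρ = y)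
    (hz' : ∀ x, z.ok N σ (Function.update ρ d x) ∧ z.eval σ (Function.update ρ d x) = y) :
    (addNew c b z d).Does N ρ σ fun σ' =>
      Lists (fun j => σ' b j 0 0) (σ' c 0 0 0) (insert y A) ∧
      ∀ j < σ c 0 0 0, σ' b j 0 0 = σ b j 0 0 := by
  have hn := hA.card_eq
  simp [addNew, hn ▸ hN, hok, hz, hz', Store.write_apply, hcb, hcb.symm]
  refine ⟨fun x hx e => ?_, fun hne => ⟨?_, fun j hj h => absurd h hj.ne⟩⟩
  · exact hA.insertNew (hA.mem_iff.2 ⟨x, hx, e⟩)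
  · refine hA.push (fun h => ?_) (fun j hj => ?_) ?_
    · obtain ⟨j, hj, e⟩ := hA.mem_iff.1 h
      exact hne j hj e
    · simp [hj.ne]
    · simp

/-! ### Balls -/

namespace DataGraph

variable {G G' : DataGraph} {v w x t r : ℕ}

theorem mem_of_adj' {a b : ℕ} (h : G.graph.Adj a b) : b ∈ G.V := G.mem_of_adj _ _ h.symm

theorem mem_ball : w ∈ (G.ball v t).V ↔ w ∈ G.V ∧ ∃ p : G.graph.Walk v w, p.length ≤ t := by
  simp [ball, induce]

theorem ball_subset : (G.ball v t).V ⊆ G.V := fun _ h => (mem_ball.1 h).1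

theorem ball_adj {a b : ℕ} : (G.ball v t).graph.Adj a b ↔
    G.graph.Adj a b ∧ a ∈ (G.ball v t).V ∧ b ∈ (G.ball v t).V := Iff.rfl

theorem mem_ball_zero : w ∈ (G.ball v 0).V ↔ w ∈ G.V ∧ w = v := by
  rw [mem_ball]
  refine and_congr_right fun _ => ⟨?_, ?_⟩
  · rintro ⟨p, hp⟩
    exact (SimpleGraph.Walk.eq_of_length_eq_zero (by omega : p.length = 0)).symm
  · rintro rfl
    exact ⟨.nil, le_rfl⟩

theorem mem_ball_succ : w ∈ (G.ball v (t + 1)).V ↔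
    w ∈ (G.ball v t).V ∨ ∃ x ∈ (G.ball v t).V, G.graph.Adj x w := by
  simp only [mem_ball]
  constructor
  · rintro ⟨hw, p, hp⟩
    rcases Nat.lt_or_ge t p.length with h | h
    · have hp' : p.reverse.length = t + 1 := by rw [SimpleGraph.Walk.length_reverse]; omega
      generalize p.reverse = q at hp'
      cases q with
      | nil => simp at hp'
      | cons h q =>
        refine Or.inr ⟨_, ⟨G.mem_of_adj' h, q.reverse, ?_⟩, h.symm⟩
        simp at hp' ⊢; omega
    · exact Or.inl ⟨hw, p, h⟩
  · rintro (⟨hw, p, hp⟩ | ⟨x, ⟨hx, p, hp⟩, h⟩)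
    · exact ⟨hw, p, by omega⟩
    · exact ⟨G.mem_of_adj' h, p.concat h, by simp; omega⟩

theorem ball_mono {s : ℕ} (h : s ≤ t) : (G.ball v s).V ⊆ (G.ball v t).V := fun _ hw =>
  let ⟨h1, p, hp⟩ := mem_ball.1 hw
  mem_ball.2 ⟨h1, p, hp.trans h⟩

theorem self_mem_ball (h : v ∈ G.V) : v ∈ (G.ball v t).V := mem_ball.2 ⟨h, .nil, by simp⟩

theorem center_mem (h : w ∈ (G.ball v t).V) : v ∈ G.V := by
  obtain ⟨h1, p, -⟩ := mem_ball.1 h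
  cases p with
  | nil => exact h1
  | cons h _ => exact G.mem_of_adj _ _ h

theorem mem_ball_symm (h : w ∈ (G.ball v t).V) : v ∈ (G.ball w t).V := by
  obtain ⟨h1, p, hp⟩ := mem_ball.1 h
  exact mem_ball.2 ⟨center_mem h, p.reverse, by simpa using hp⟩

theorem adj_mem_ball (h : G.graph.Adj v w) (hr : 1 ≤ r) : w ∈ (G.ball v r).V :=
  mem_ball.2 ⟨G.mem_of_adj' h, .cons h .nil, by simpa using hr⟩

/-- The same graph, with the same labels on its nodes. -/
structure Same (B B' : DataGraph) : Prop where
  V : B.V = B'.V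
  adj : ∀ a b, B.graph.Adj a b ↔ B'.graph.Adj a b
  label : ∀ a ∈ B.V, B.label a = B'.label a

theorem Same.refl (B : DataGraph) : Same B B := ⟨rfl, fun _ _ => Iff.rfl, fun _ _ => rfl⟩

theorem Same.symm {B B' : DataGraph} (h : Same B B') : Same B' B :=
  ⟨h.V.symm, fun a b => (h.adj a b).symm, fun a ha => (h.label a (h.V ▸ ha)).symm⟩

theorem Same.trans {B B' B'' : DataGraph} (h : Same B B') (h' : Same B' B'') : Same B B'' :=
  ⟨h.V.trans h'.V, fun a b => (h.adj a b).trans (h'.adj a b),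
    fun a ha => (h.label a ha).trans (h'.label a (h.V ▸ ha))⟩

/-- If two graphs differ only at a node `b` out of reach, then the ball is the same in both. -/
theorem ball_same_of_not_mem {b : ℕ} (hV : ∀ x, x ≠ b → (x ∈ G.V ↔ x ∈ G'.V))
    (hle : ∀ x y, G.graph.Adj x y → G'.graph.Adj x y)
    (hadj : ∀ x y, x ≠ b → y ≠ b → G'.graph.Adj x y → G.graph.Adj x y)
    (hlab : ∀ x ∈ G.V, x ≠ b → G.label x = G'.label x) (hbV : b ∈ G'.V)
    (hb : b ∉ (G'.ball v r).V) : Same (G.ball v r) (G'.ball v r) := by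
  have hvb : v ≠ b := by rintro rfl; exact hb (self_mem_ball hbV)
  have key : ∀ s ≤ r, ∀ x, x ∈ (G.ball v s).V ↔ x ∈ (G'.ball v s).V := by
    intro s
    induction s with
    | zero =>
      intro _ x
      rw [mem_ball_zero, mem_ball_zero]
      refine and_congr_left fun e => hV x (e ▸ hvb)
    | succ s ih =>
      intro hs x
      have hne : ∀ y ∈ (G'.ball v s).V, y ≠ b := fun y hy e =>
        hb (e ▸ ball_mono (by omega) hy)
      rw [mem_ball_succ, mem_ball_succ, ih (by omega)]
      refine or_congr_right ⟨?_, ?_⟩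
      · rintro ⟨y, hy, h⟩; exact ⟨y, (ih (by omega) y).1 hy, hle _ _ h⟩
      · rintro ⟨y, hy, h⟩
        refine ⟨y, (ih (by omega) y).2 hy, hadj _ _ (hne y hy) ?_ h⟩
        rintro rfl
        exact hb (ball_mono hs (mem_ball_succ.2 (Or.inr ⟨y, hy, h⟩)))
  have hVr : (G.ball v r).V = (G'.ball v r).V := Finset.ext (key r le_rfl)
  have hne : ∀ y ∈ (G'.ball v r).V, y ≠ b := fun y hy e => hb (e ▸ hy)
  refine ⟨hVr, fun a c => ?_, fun a ha => ?_⟩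
  · rw [ball_adj, ball_adj, hVr]
    exact ⟨fun h => ⟨hle _ _ h.1, h.2⟩, fun h => ⟨hadj _ _ (hne _ h.2.1) (hne _ h.2.2) h.1, h.2⟩⟩
  · exact hlab a (ball_subset ha) (hne a (hVr ▸ ha))

/-! ### Unit updates of data graphs -/

theorem apply_addEdge_adj {a b : ℕ} (h : (DUpd.addEdge a b).Valid G) (x y : ℕ) :
    (G.apply (.addEdge a b)).graph.Adj x y ↔
      G.graph.Adj x y ∨ (x = a ∧ y = b) ∨ (x = b ∧ y = a) := by
  obtain ⟨ha, hb, hab, -⟩ := h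
  simp only [apply, withEdges, inside, SimpleGraph.sup_adj, SimpleGraph.edge_adj]
  constructor
  · rintro ⟨h | ⟨h, -⟩, -⟩
    · exact Or.inl h
    · exact Or.inr h
  · rintro (h | ⟨rfl, rfl⟩ | ⟨rfl, rfl⟩)
    · exact ⟨Or.inl h, G.mem_of_adj _ _ h, G.mem_of_adj' h⟩
    · exact ⟨Or.inr ⟨Or.inl ⟨rfl, rfl⟩, hab⟩, ha, hb⟩
    · exact ⟨Or.inr ⟨Or.inr ⟨rfl, rfl⟩, hab.symm⟩, hb, ha⟩

theorem apply_delEdge_adj {a b : ℕ} (x y : ℕ) :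
    (G.apply (.delEdge a b)).graph.Adj x y ↔
      G.graph.Adj x y ∧ ¬ (x = a ∧ y = b) ∧ ¬ (x = b ∧ y = a) := by
  simp only [apply, withEdges, inside, SimpleGraph.deleteEdges_adj, Set.mem_singleton_iff,
    Sym2.eq_iff, not_or]
  exact ⟨fun h => h.1, fun h => ⟨h, G.mem_of_adj _ _ h.1, G.mem_of_adj' h.1⟩⟩

theorem apply_addNode_adj {a : ℕ} {L : Finset ℕ} {o : Option ℕ}
    (h : (DUpd.addNode a L o).Valid G) (x y : ℕ) :
    (G.apply (.addNode a L o)).graph.Adj x y ↔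
      G.graph.Adj x y ∨ (x = a ∧ o = some y) ∨ (y = a ∧ o = some x) := by
  obtain ⟨hf, ho⟩ := h
  cases o with
  | none => simp [apply, addIsolated]
  | some b =>
    have hb : b ∈ G.V := ho b rfl
    have hab : a ≠ b := by rintro rfl; exact absurd (G.lt_fresh _ hb) (by omega)
    simp only [apply, withEdges, inside, addIsolated, SimpleGraph.sup_adj, SimpleGraph.edge_adj,
      Option.some.injEq]
    constructor
    · rintro ⟨h | ⟨h, -⟩, -⟩
      · exact Or.inl h
      · exact Or.inr (h.imp (fun h => ⟨h.1, h.2.symm⟩) (fun h => ⟨h.2, h.1.symm⟩))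
    · rintro (h | ⟨rfl, rfl⟩ | ⟨rfl, rfl⟩)
      · exact ⟨Or.inl h, Finset.mem_insert_of_mem (G.mem_of_adj _ _ h),
          Finset.mem_insert_of_mem (G.mem_of_adj' h)⟩
      · exact ⟨Or.inr ⟨Or.inl ⟨rfl, rfl⟩, hab⟩, Finset.mem_insert_self _ _,
          Finset.mem_insert_of_mem hb⟩
      · exact ⟨Or.inr ⟨Or.inr ⟨rfl, rfl⟩, hab.symm⟩, Finset.mem_insert_of_mem hb,
          Finset.mem_insert_self _ _⟩

theorem apply_delNode_adj {a : ℕ} (x y : ℕ) :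
    (G.apply (.delNode a)).graph.Adj x y ↔ G.graph.Adj x y ∧ x ≠ a ∧ y ≠ a := by
  simp only [apply, induce, inside, Finset.mem_inter, Finset.mem_erase]
  constructor
  · rintro ⟨h, h1, h2⟩; exact ⟨h, h1.2.1, h2.2.1⟩
  · rintro ⟨h, h1, h2⟩
    exact ⟨h, ⟨G.mem_of_adj _ _ h, h1, G.mem_of_adj _ _ h⟩, ⟨G.mem_of_adj' h, h2, G.mem_of_adj' h⟩⟩

/-- The node set after a unit update. -/
theorem mem_apply (δ : DUpd) (x : ℕ) : x ∈ (G.apply δ).V ↔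
    match δ with
    | .addEdge _ _ => x ∈ G.V
    | .delEdge _ _ => x ∈ G.V
    | .addNode w _ _ => x = w ∨ x ∈ G.V
    | .delNode w => x ∈ G.V ∧ x ≠ w := by
  rcases δ with _ | _ | ⟨w, L, _ | w'⟩ | w
  · rfl
  · rfl
  · simp [apply, addIsolated]
  · simp [apply, addIsolated, withEdges]
  · simp [apply, induce]; tauto

theorem apply_label (δ : DUpd) : (G.apply δ).label =
    match δ with
    | .addNode w L _ => Function.update G.label w L
    | _ => G.label := by
  rcases δ with _ | _ | ⟨w, L, _ | w'⟩ | w <;> rfl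

theorem apply_fresh (δ : DUpd) : (G.apply δ).fresh =
    match δ with
    | .addNode w _ _ => max G.fresh (w + 1)
    | _ => G.fresh := by
  rcases δ with _ | _ | ⟨w, L, _ | w'⟩ | w <;> rfl

/-- The centers of the balls that a unit update may change. -/
noncomputable def touched (r : ℕ) (G : DataGraph) : DUpd → Finset ℕ
  | .addEdge a b => ((G.apply (.addEdge a b)).ball a r).V ∩ ((G.apply (.addEdge a b)).ball b r).V
  | .delEdge a b => (G.ball a r).V ∩ (G.ball b r).V
  | .addNode w L o => ((G.apply (.addNode w L o)).ball w r).V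
  | .delNode w => (G.ball w r).V

theorem structural_cons (r : ℕ) (G : DataGraph) (δ : DUpd) (D : List DUpd) :
    structural r G (δ :: D) = touched r G δ ∪ structural r (G.apply δ) D := by
  cases δ <;> rfl

theorem applyAll_cons (G : DataGraph) (δ : DUpd) (D : List DUpd) :
    G.applyAll (δ :: D) = (G.apply δ).applyAll D := rfl

theorem applyAll_append (G : DataGraph) (D D' : List DUpd) :
    G.applyAll (D ++ D') = (G.applyAll D).applyAll D' := by simp [applyAll]

theorem structural_append (r : ℕ) (G : DataGraph) (D D' : List DUpd) :
    structural r G (D ++ D') = structural r G D ∪ structural r (G.applyAll D) D' := by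
  induction D generalizing G with
  | nil => simp [structural, applyAll]
  | cons δ D ih => rw [List.cons_append, structural_cons, structural_cons, ih, applyAll_cons,
      Finset.union_assoc]

theorem validG_append (G : DataGraph) (D D' : List DUpd) :
    ValidG G (D ++ D') ↔ ValidG G D ∧ ValidG (G.applyAll D) D' := by
  induction D generalizing G with
  | nil => simp [ValidG, applyAll]
  | cons δ D ih => simp [ValidG, ih, applyAll_cons, and_assoc]

/-- A unit update does not change the balls with other centers. -/
theorem apply_same {δ : DUpd} (hδ : δ.Valid G) (hv : v ∉ touched r G δ) :
    (v ∈ G.V ↔ v ∈ (G.apply δ).V) ∧ Same (G.ball v r) ((G.apply δ).ball v r) := by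
  cases δ with
  | addEdge a b =>
    refine ⟨by rw [mem_apply], ?_⟩
    have hadj := apply_addEdge_adj hδ
    simp only [touched, Finset.mem_inter, not_and_or] at hv
    rcases hv with hv | hv
    · refine ball_same_of_not_mem (b := a) (fun x _ => by rw [mem_apply])
        (fun x y h => (hadj x y).2 (Or.inl h)) (fun x y hx hy h => ?_) (fun x _ _ => by rw [apply_label])
        ((mem_apply _ _).2 hδ.1) (fun h => hv (mem_ball_symm h))
      rcases (hadj x y).1 h with h | h | h <;> tauto
    · refine ball_same_of_not_mem (b := b) (fun x _ => by rw [mem_apply])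
        (fun x y h => (hadj x y).2 (Or.inl h)) (fun x y hx hy h => ?_) (fun x _ _ => by rw [apply_label])
        ((mem_apply _ _).2 hδ.2.1) (fun h => hv (mem_ball_symm h))
      rcases (hadj x y).1 h with h | h | h <;> tauto
  | delEdge a b =>
    refine ⟨by rw [mem_apply], Same.symm ?_⟩
    have hadj := apply_delEdge_adj (G := G) (a := a) (b := b)
    simp only [touched, Finset.mem_inter, not_and_or] at hv
    rcases hv with hv | hv
    · refine ball_same_of_not_mem (b := a) (fun x _ => by rw [mem_apply])
        (fun x y h => ((hadj x y).1 h).1) (fun x y hx hy h => (hadj x y).2 ⟨h, by tauto⟩)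
        (fun x _ _ => by rw [apply_label]) (G.mem_of_adj _ _ hδ) (fun h => hv (mem_ball_symm h))
    · refine ball_same_of_not_mem (b := b) (fun x _ => by rw [mem_apply])
        (fun x y h => ((hadj x y).1 h).1) (fun x y hx hy h => (hadj x y).2 ⟨h, by tauto⟩)
        (fun x _ _ => by rw [apply_label]) (G.mem_of_adj' hδ) (fun h => hv (mem_ball_symm h))
  | addNode w L o =>
    have hadj := apply_addNode_adj hδ
    have hw : w ∈ (G.apply (.addNode w L o)).V := (mem_apply _ _).2 (Or.inl rfl)
    have hvw : v ≠ w := by rintro rfl; exact hv (self_mem_ball hw)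
    refine ⟨by rw [mem_apply]; simp [hvw], ?_⟩
    refine ball_same_of_not_mem (b := w) (fun x hx => by rw [mem_apply]; simp [hx])
      (fun x y h => (hadj x y).2 (Or.inl h)) (fun x y hx hy h => ?_)
      (fun x _ hx => by rw [apply_label]; simp [hx]) hw (fun h => hv (mem_ball_symm h))
    rcases (hadj x y).1 h with h | h | h <;> tauto
  | delNode w =>
    have hvw : v ≠ w := by rintro rfl; exact hv (self_mem_ball hδ)
    refine ⟨by rw [mem_apply]; simp [hvw], Same.symm ?_⟩
    have hadj := apply_delNode_adj (G := G) (a := w)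
    exact ball_same_of_not_mem (b := w) (fun x hx => by rw [mem_apply]; simp [hx])
      (fun x y h => ((hadj x y).1 h).1) (fun x y hx hy h => (hadj x y).2 ⟨h, hx, hy⟩)
      (fun x _ hx => by rw [apply_label]) hδ (fun h => hv (mem_ball_symm h))

/-- Outside the structural set, balls survive the whole sequence of updates. -/
theorem applyAll_same {D : List DUpd} (hD : ValidG G D) (hv : v ∉ structural r G D) :
    (v ∈ G.V ↔ v ∈ (G.applyAll D).V) ∧ Same (G.ball v r) ((G.applyAll D).ball v r) := by
  induction D generalizing G with
  | nil => exact ⟨Iff.rfl, Same.refl _⟩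
  | cons δ D ih =>
    rw [structural_cons, Finset.mem_union, not_or] at hv
    obtain ⟨h1, h2⟩ := apply_same hD.1 hv.1
    obtain ⟨h3, h4⟩ := ih hD.2 hv.2
    exact ⟨h1.trans h3, h2.trans h4⟩

/-! ### Balls in the intermediate graphs -/

/-- The ends of all inserted edges are centers of touched balls. -/
theorem adj_of_apply {δ : DUpd} (hδ : δ.Valid G) (hr : 1 ≤ r) {a b : ℕ}
    (h : (G.apply δ).graph.Adj a b) :
    G.graph.Adj a b ∨ a ∈ touched r G δ ∧ b ∈ touched r G δ := by
  cases δ with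
  | addEdge c d =>
    have key : (G.apply (.addEdge c d)).graph.Adj c d :=
      (apply_addEdge_adj hδ _ _).2 (Or.inr (Or.inl ⟨rfl, rfl⟩))
    have hc := self_mem_ball (t := r) (mem_of_adj _ _ _ key)
    have hd := self_mem_ball (t := r) (mem_of_adj' key)
    have hcd := adj_mem_ball key hr
    have hdc := adj_mem_ball key.symm hr
    rcases (apply_addEdge_adj hδ _ _).1 h with h | ⟨rfl, rfl⟩ | ⟨rfl, rfl⟩
    · exact Or.inl h
    · simp only [touched, Finset.mem_inter]; tauto
    · simp only [touched, Finset.mem_inter]; tauto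
  | delEdge c d => exact Or.inl ((apply_delEdge_adj _ _).1 h).1
  | addNode w L o =>
    rcases (apply_addNode_adj hδ _ _).1 h with h' | ⟨rfl, h'⟩ | ⟨rfl, h'⟩
    · exact Or.inl h'
    · exact Or.inr ⟨self_mem_ball (mem_of_adj _ _ _ h), adj_mem_ball h hr⟩
    · exact Or.inr ⟨adj_mem_ball h.symm hr, self_mem_ball (mem_of_adj' h)⟩
  | delNode w => exact Or.inl ((apply_delNode_adj _ _).1 h).1

theorem adj_of_applyAll {D : List DUpd} (hD : ValidG G D) (hr : 1 ≤ r) {a b : ℕ}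
    (h : (G.applyAll D).graph.Adj a b) :
    G.graph.Adj a b ∨ a ∈ structural r G D ∧ b ∈ structural r G D := by
  induction D generalizing G with
  | nil => exact Or.inl h
  | cons δ D ih =>
    rw [structural_cons, Finset.mem_union, Finset.mem_union]
    rcases ih hD.2 h with h | h
    · rcases adj_of_apply hD.1 hr h with h | h <;> tauto
    · tauto

/-- Updates create at most as many nodes as their size says. -/
theorem card_new (D : List DUpd) : ((G.applyAll D).V \ G.V).card ≤ dsize D := by
  induction D generalizing G with
  | nil => simp [applyAll]
  | cons δ D ih =>
    have h1 : ((G.apply δ).V \ G.V).card ≤ δ.size := by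
      cases δ with
      | addNode w L o =>
        refine le_trans (Finset.card_le_card (t := {w}) fun x hx => ?_) (by simp [DUpd.size])
        rw [Finset.mem_sdiff, mem_apply] at hx
        simp only [Finset.mem_singleton]; tauto
      | _ =>
        refine le_trans (Finset.card_le_card (t := ∅) fun x hx => ?_) (by simp)
        rw [Finset.mem_sdiff, mem_apply] at hx
        simp only at hx; tauto
    have h2 := Finset.card_le_card (fun x hx => by
      simp only [Finset.mem_sdiff, Finset.mem_union] at hx ⊢; tauto :
      ((G.applyAll (δ :: D)).V \ G.V) ⊆
        ((G.apply δ).V \ G.V) ∪ (((G.apply δ).applyAll D).V \ (G.apply δ).V))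
    have h3 := Finset.card_union_le ((G.apply δ).V \ G.V)
      (((G.apply δ).applyAll D).V \ (G.apply δ).V)
    have h4 := ih (G := G.apply δ)
    simp only [dsize, List.map_cons, List.sum_cons] at *
    omega

/-- Balls around touched nodes stay small in all intermediate graphs: a path from a touched node
leads, after the last inserted edge, through the original ball of another touched node. -/
theorem card_ball_applyAll {D : List DUpd} {Z : Finset ℕ} (hD : ValidG G D) (hr : 1 ≤ r)
    (hZ : structural r G D ⊆ Z) (hx : x ∈ Z) :
    ((G.applyAll D).ball x r).V.card ≤ ∑ z ∈ Z ∩ G.V, (G.ball z r).V.card + dsize D := by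
  -- Follow the path: an edge of the old graph prolongs the path from the current center, and after
  -- an inserted edge its end is taken as the new center.
  have key : ∀ s, ∀ y ∈ ((G.applyAll D).ball x s).V,
      y ∈ G.V → ∃ z ∈ Z ∩ G.V, y ∈ (G.ball z s).V := by
    intro s
    induction s with
    | zero =>
      intro y hy hyV
      obtain ⟨-, rfl⟩ := mem_ball_zero.1 hy
      exact ⟨y, Finset.mem_inter.2 ⟨hx, hyV⟩, mem_ball_zero.2 ⟨hyV, rfl⟩⟩
    | succ s ih =>
      intro y hy hyV
      rcases mem_ball_succ.1 hy with hy | ⟨w, hw, h⟩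
      · obtain ⟨z, hz, h⟩ := ih y hy hyV
        exact ⟨z, hz, ball_mono (by omega) h⟩
      · rcases adj_of_applyAll hD hr h with h | h
        · obtain ⟨z, hz, h'⟩ := ih w hw (G.mem_of_adj _ _ h)
          exact ⟨z, hz, mem_ball_succ.2 (Or.inr ⟨w, h', h⟩)⟩
        · exact ⟨y, Finset.mem_inter.2 ⟨hZ h.2, hyV⟩, self_mem_ball hyV⟩
  -- The nodes not in the old graph are paid for by the size of the updates.
  have h1 : ((G.applyAll D).ball x r).V ⊆
      (Z ∩ G.V).biUnion (fun z => (G.ball z r).V) ∪ ((G.applyAll D).V \ G.V) := by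
    intro y hy
    rw [Finset.mem_union, Finset.mem_biUnion, Finset.mem_sdiff]
    by_cases hyV : y ∈ G.V
    · exact Or.inl (key r y hy hyV)
    · exact Or.inr ⟨ball_subset hy, hyV⟩
  refine (Finset.card_le_card h1).trans ((Finset.card_union_le _ _).trans ?_)
  exact Nat.add_le_add Finset.card_biUnion_le (card_new D)

theorem dsize_append (D D' : List DUpd) : dsize (D ++ D') = dsize D + dsize D' := by
  simp [dsize]

end DataGraph

/-! ### Matches under changes of pattern and graph -/

theorem IsMatch.congr {P : Pattern} {B B' : DataGraph} (h : B.Same B') {M : Finset (ℕ × ℕ)}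
    (hM : IsMatch P B M) : IsMatch P B' M := by
  refine ⟨h.V ▸ hM.subset, fun u w hp => ?_, hM.total, fun u w hp u' hu => ?_⟩
  · rw [← h.label w (Finset.mem_product.1 (hM.subset hp)).2]; exact hM.label u w hp
  · obtain ⟨w', h1, h2⟩ := hM.adj u w hp u' hu
    exact ⟨w', (h.adj _ _).1 h1, h2⟩

theorem isMatch_congr {P : Pattern} {B B' : DataGraph} (h : B.Same B') (M : Finset (ℕ × ℕ)) :
    IsMatch P B M ↔ IsMatch P B' M := ⟨fun hM => hM.congr h, fun hM => hM.congr h.symm⟩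

theorem matches_congr {P : Pattern} {B B' : DataGraph} (h : B.Same B') :
    Matches P B ↔ Matches P B' := exists_congr fun M => isMatch_congr h M

theorem maxMatch_congr {P : Pattern} {B B' : DataGraph} (h : B.Same B') :
    maxMatch P B = maxMatch P B' := by
  simp only [maxMatch, h.V, isMatch_congr h]

/-- `Q` is a part of `Q'`, with the same labels. -/
structure Pattern.Le (Q Q' : Pattern) : Prop where
  V : Q.V ⊆ Q'.V
  adj : ∀ a b, Q.graph.Adj a b → Q'.graph.Adj a b
  label : ∀ a ∈ Q.V, Q.label a = Q'.label a

theorem Pattern.Le.refl (Q : Pattern) : Q.Le Q := ⟨subset_rfl, fun _ _ h => h, fun _ _ => rfl⟩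

theorem Pattern.Le.trans {Q Q' Q'' : Pattern} (h : Q.Le Q') (h' : Q'.Le Q'') : Q.Le Q'' :=
  ⟨h.V.trans h'.V, fun a b hab => h'.adj a b (h.adj a b hab),
    fun a ha => (h.label a ha).trans (h'.label a (h.V ha))⟩

theorem Matches.of_le {Q Q' : Pattern} {B : DataGraph} (h : Q.Le Q') (hM : Matches Q' B) :
    Matches Q B := by
  obtain ⟨M, hM⟩ := hM
  refine ⟨M.filter fun p => p.1 ∈ Q.V, ⟨fun p hp => ?_, fun u w hp => ?_, fun u hu => ?_,
    fun u w hp u' hu' => ?_⟩⟩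
  · rw [Finset.mem_filter] at hp
    exact Finset.mem_product.2 ⟨hp.2, (Finset.mem_product.1 (hM.subset hp.1)).2⟩
  · rw [Finset.mem_filter] at hp
    rw [h.label u hp.2]; exact hM.label u w hp.1
  · obtain ⟨w, hw⟩ := hM.total u (h.V hu)
    exact ⟨w, Finset.mem_filter.2 ⟨hw, hu⟩⟩
  · rw [Finset.mem_filter] at hp
    obtain ⟨w', h1, h2⟩ := hM.adj u w hp.1 u' (h.adj _ _ hu')
    exact ⟨w', h1, Finset.mem_filter.2 ⟨h2, Q.mem_of_adj _ _ hu'.symm⟩⟩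

theorem Pattern.frag_le (P : Pattern) (i : ℕ) : (P.frag i).Le P :=
  ⟨Finset.filter_subset _ _, fun _ _ h => h.1, fun _ _ => rfl⟩

theorem Matches.ball_mono {Q : Pattern} {G : DataGraph} {v s t : ℕ} (hst : s ≤ t)
    (hM : Matches Q (G.ball v s)) : Matches Q (G.ball v t) := by
  obtain ⟨M, hM⟩ := hM
  have hsub : (G.ball v s).V ⊆ (G.ball v t).V := DataGraph.ball_mono hst
  refine ⟨M, hM.subset.trans (Finset.product_subset_product_right hsub), hM.label,
    hM.total, fun u w hp u' hu' => ?_⟩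
  obtain ⟨w', h1, h2⟩ := hM.adj u w hp u' hu'
  exact ⟨w', ⟨h1.1, hsub h1.2.1, hsub h1.2.2⟩, h2⟩

/-! ### Unit updates of patterns -/

namespace Pattern

variable {P : Pattern}

theorem mem_of_adj' {a b : ℕ} (h : P.graph.Adj a b) : b ∈ P.V := P.mem_of_adj _ _ h.symm

theorem apply_addEdge_adj {a b : ℕ} (h : (PUpd.addEdge a b).Valid P) (x y : ℕ) :
    (P.apply (.addEdge a b)).graph.Adj x y ↔
      P.graph.Adj x y ∨ (x = a ∧ y = b) ∨ (x = b ∧ y = a) := by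
  obtain ⟨ha, hb, hab, -⟩ := h
  simp only [apply, withGraph, inside, SimpleGraph.sup_adj, SimpleGraph.edge_adj]
  constructor
  · rintro ⟨h | ⟨h, -⟩, -⟩
    exacts [Or.inl h, Or.inr h]
  · rintro (h | ⟨rfl, rfl⟩ | ⟨rfl, rfl⟩)
    · exact ⟨Or.inl h, P.mem_of_adj _ _ h, P.mem_of_adj' h⟩
    · exact ⟨Or.inr ⟨Or.inl ⟨rfl, rfl⟩, hab⟩, ha, hb⟩
    · exact ⟨Or.inr ⟨Or.inr ⟨rfl, rfl⟩, hab.symm⟩, hb, ha⟩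

theorem apply_delEdge_adj {a b : ℕ} (x y : ℕ) :
    (P.apply (.delEdge a b)).graph.Adj x y ↔
      P.graph.Adj x y ∧ ¬ (x = a ∧ y = b) ∧ ¬ (x = b ∧ y = a) := by
  simp only [apply, withGraph, inside, SimpleGraph.deleteEdges_adj, Set.mem_singleton_iff,
    Sym2.eq_iff, not_or]
  exact ⟨fun h => h.1, fun h => ⟨h, P.mem_of_adj _ _ h.1, P.mem_of_adj' h.1⟩⟩

theorem apply_addNode_adj {u u' c : ℕ} {I : NonemptyInterval ℕ}
    (h : (PUpd.addNode u u' c I).Valid P) (x y : ℕ) :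
    (P.apply (.addNode u u' c I)).graph.Adj x y ↔
      P.graph.Adj x y ∨ (x = u ∧ y = u') ∨ (x = u' ∧ y = u) := by
  obtain ⟨hu, hu'⟩ := h
  have hne : u ≠ u' := by rintro rfl; exact hu hu'
  simp only [apply, withGraph, inside, SimpleGraph.sup_adj, SimpleGraph.edge_adj]
  constructor
  · rintro ⟨h | ⟨h, -⟩, -⟩
    exacts [Or.inl h, Or.inr h]
  · rintro (h | ⟨rfl, rfl⟩ | ⟨rfl, rfl⟩)
    · exact ⟨Or.inl h, Finset.mem_insert_of_mem (P.mem_of_adj _ _ h),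
        Finset.mem_insert_of_mem (P.mem_of_adj' h)⟩
    · exact ⟨Or.inr ⟨Or.inl ⟨rfl, rfl⟩, hne⟩, Finset.mem_insert_self _ _,
        Finset.mem_insert_of_mem hu'⟩
    · exact ⟨Or.inr ⟨Or.inr ⟨rfl, rfl⟩, hne.symm⟩, Finset.mem_insert_of_mem hu',
        Finset.mem_insert_self _ _⟩

theorem apply_delNode_adj {u : ℕ} (x y : ℕ) :
    (P.apply (.delNode u)).graph.Adj x y ↔ P.graph.Adj x y ∧ x ≠ u ∧ y ≠ u := by
  simp only [apply, withGraph, inside, Finset.mem_erase]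
  exact ⟨fun ⟨h, h1, h2⟩ => ⟨h, h1.1, h2.1⟩,
    fun ⟨h, h1, h2⟩ => ⟨h, ⟨h1, P.mem_of_adj _ _ h⟩, h2, P.mem_of_adj' h⟩⟩

/-- The node set after a unit update. -/
theorem mem_apply (δ : PUpd) (x : ℕ) : x ∈ (P.apply δ).V ↔
    match δ with
    | .addNode u _ _ _ => x = u ∨ x ∈ P.V
    | .delNode u => x ≠ u ∧ x ∈ P.V
    | _ => x ∈ P.V := by
  cases δ <;> simp [apply, withGraph]

theorem apply_label (δ : PUpd) : (P.apply δ).label =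
    match δ with
    | .addNode u _ c _ => Function.update P.label u c
    | _ => P.label := by
  cases δ <;> rfl

theorem apply_cap (δ : PUpd) : (P.apply δ).cap =
    match δ with
    | .addNode u _ _ I => Function.update P.cap u I
    | .setCap u I => Function.update P.cap u I
    | _ => P.cap := by
  cases δ <;> rfl

theorem apply_part (δ : PUpd) : (P.apply δ).part =
    match δ with
    | .addNode u u' _ _ => Function.update P.part u (P.part u')
    | _ => P.part := by
  cases δ <;> rfl

theorem mem_frag {i u : ℕ} : u ∈ (P.frag i).V ↔ u ∈ P.V ∧ P.part u = i := Finset.mem_filter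

theorem frag_adj {i a b : ℕ} : (P.frag i).graph.Adj a b ↔
    P.graph.Adj a b ∧ P.part a = i ∧ P.part b = i := by
  refine ⟨fun h => ⟨h.1, (mem_frag.1 h.2.1).2, (mem_frag.1 h.2.2).2⟩, fun h => ⟨h.1, ?_, ?_⟩⟩
  · exact mem_frag.2 ⟨P.mem_of_adj _ _ h.1, h.2.1⟩
  · exact mem_frag.2 ⟨P.mem_of_adj' h.1, h.2.2⟩

theorem applyAll_cons (P : Pattern) (δ : PUpd) (D : List PUpd) :
    P.applyAll (δ :: D) = (P.apply δ).applyAll D := rfl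

theorem applyAll_append (P : Pattern) (D D' : List PUpd) :
    P.applyAll (D ++ D') = (P.applyAll D).applyAll D' := by simp [applyAll]

theorem _root_.TF.validP_append (P : Pattern) (D D' : List PUpd) :
    ValidP P (D ++ D') ↔ ValidP P D ∧ ValidP (P.applyAll D) D' := by
  induction D generalizing P with
  | nil => simp [ValidP, applyAll]
  | cons δ D ih => simp [ValidP, ih, applyAll_cons, and_assoc]

theorem _root_.TF.deletedIn_append (h : ℕ) (P : Pattern) (D D' : List PUpd) :
    deletedIn h P (D ++ D') = deletedIn h P D ∪ deletedIn h (P.applyAll D) D' := by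
  induction D generalizing P with
  | nil => simp [deletedIn, applyAll]
  | cons δ D ih => simp [deletedIn, ih, applyAll_cons, Finset.union_assoc]

theorem _root_.TF.planner_append (h s : ℕ) (P : Pattern) (n : ℕ) (D D' : List PUpd) :
    planner h s P n (D ++ D') =
      planner h s P n D ++ planner h s (P.applyAll D) (n + D.length) D' := by
  induction D generalizing P n with
  | nil => simp [planner, applyAll]
  | cons δ D ih =>
    simp only [List.cons_append, planner, ih, applyAll_cons, List.length_cons]
    rw [show n + 1 + D.length = n + (D.length + 1) by omega]
    split_ifs <;> simp

/-- Without a deletion in a fragment, the fragment can only grow. -/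
theorem frag_le_apply {h i : ℕ} {δ : PUpd} (hδ : δ.Valid P)
    (hi : ¬ (δ.IsDeletion ∧ δ.place h P = i)) : (P.frag i).Le ((P.apply δ).frag i) := by
  cases δ with
  | addEdge a b =>
    refine ⟨fun u hu => ?_, fun x y hxy => ?_, fun u hu => rfl⟩
    · rw [mem_frag] at hu ⊢; rw [mem_apply, apply_part]; exact hu
    · rw [frag_adj] at hxy ⊢; rw [apply_addEdge_adj hδ, apply_part]; tauto
  | delEdge a b =>
    refine ⟨fun u hu => ?_, fun x y hxy => ?_, fun u hu => rfl⟩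
    · rw [mem_frag] at hu ⊢; rw [mem_apply, apply_part]; exact hu
    · simp only [PUpd.IsDeletion, PUpd.place, true_and] at hi
      rw [frag_adj] at hxy ⊢; rw [apply_delEdge_adj, apply_part]
      refine ⟨⟨hxy.1, ?_, ?_⟩, hxy.2⟩
      · rintro ⟨rfl, rfl⟩; rw [if_pos (hxy.2.1.trans hxy.2.2.symm)] at hi; tauto
      · rintro ⟨rfl, rfl⟩; rw [if_pos (hxy.2.2.trans hxy.2.1.symm)] at hi; tauto
  | addNode w w' c I =>
    have hne : ∀ u ∈ P.V, u ≠ w := fun u hu e => hδ.1 (e ▸ hu)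
    refine ⟨fun u hu => ?_, fun x y hxy => ?_, fun u hu => ?_⟩
    · rw [mem_frag] at hu ⊢; rw [mem_apply, apply_part]
      simp [hne u hu.1, hu.1, hu.2]
    · rw [frag_adj] at hxy ⊢; rw [apply_addNode_adj hδ, apply_part]
      simp [hne x (P.mem_of_adj _ _ hxy.1), hne y (P.mem_of_adj' hxy.1), hxy]
    · rw [mem_frag] at hu
      change P.label u = (P.apply (.addNode w w' c I)).label u
      rw [apply_label]; simp [hne u hu.1]
  | delNode w =>
    simp only [PUpd.IsDeletion, PUpd.place, true_and] at hi
    refine ⟨fun u hu => ?_, fun x y hxy => ?_, fun u hu => rfl⟩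
    · rw [mem_frag] at hu ⊢; rw [mem_apply, apply_part]
      exact ⟨⟨by rintro rfl; exact hi hu.2, hu.1⟩, hu.2⟩
    · rw [frag_adj] at hxy ⊢; rw [apply_delNode_adj, apply_part]
      exact ⟨⟨hxy.1, by rintro rfl; exact hi hxy.2.1, by rintro rfl; exact hi hxy.2.2⟩, hxy.2⟩
  | setCap w I =>
    exact ⟨subset_rfl, fun _ _ h => h, fun u hu => rfl⟩

theorem frag_le_applyAll {h i : ℕ} {D : List PUpd} (hD : ValidP P D)
    (hi : i ∉ deletedIn h P D) : (P.frag i).Le ((P.applyAll D).frag i) := by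
  induction D generalizing P with
  | nil => exact Le.refl _
  | cons δ D ih =>
    simp only [deletedIn, Finset.mem_union, not_or] at hi
    refine (frag_le_apply (h := h) hD.1 ?_).trans (ih hD.2 hi.2)
    rintro ⟨h1, h2⟩
    rw [if_pos h1] at hi
    exact hi.1 (by simp [h2])

theorem Fragmented.apply {h : ℕ} {δ : PUpd} (hP : P.Fragmented h) (hδ : δ.Valid P) :
    (P.apply δ).Fragmented h := by
  intro u hu
  rw [mem_apply] at hu
  rw [apply_part]
  cases δ with
  | addNode w w' c I =>
    simp only at hu ⊢
    by_cases hw : u = w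
    · subst hw; simpa using hP _ hδ.2
    · simpa [hw] using hP _ (hu.resolve_left hw)
  | delNode w => exact hP _ hu.2
  | _ => exact hP _ hu

theorem Fragmented.applyAll {h : ℕ} {D : List PUpd} (hP : P.Fragmented h) (hD : ValidP P D) :
    (P.applyAll D).Fragmented h := by
  induction D generalizing P with
  | nil => exact hP
  | cons δ D ih => exact ih (hP.apply hD.1) hD.2

theorem Fragmented.place_le {h : ℕ} {δ : PUpd} (hP : P.Fragmented h) (hδ : δ.Valid P) :
    δ.place h P ≤ h := by
  cases δ with
  | addEdge a b => simp only [PUpd.place]; split_ifs; exacts [(hP _ hδ.1).le, le_rfl]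
  | delEdge a b =>
    simp only [PUpd.place]; split_ifs; exacts [(hP _ (P.mem_of_adj _ _ hδ)).le, le_rfl]
  | addNode a b => exact (hP _ hδ.2).le
  | delNode a => exact (hP _ hδ).le
  | setCap a => exact (hP _ hδ).le

theorem card_applyAll (D : List PUpd) : (P.applyAll D).V.card ≤ P.V.card + D.length := by
  induction D generalizing P with
  | nil => simp [applyAll]
  | cons δ D ih =>
    have h1 : (P.apply δ).V.card ≤ P.V.card + 1 := by
      cases δ with
      | addNode => exact Finset.card_insert_le _ _
      | delNode => exact (Finset.card_erase_le).trans (Nat.le_succ _)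
      | _ => exact Nat.le_succ _
    have h2 := ih (P := P.apply δ)
    rw [applyAll_cons, List.length_cons]; omega

end Pattern

/-! ### The filter of type codes -/

/-- What all reachable states have in common. The last field is what makes the filter work: a
filtering code has a zero for every fragment that has lost an edge or node
since a ball with the corresponding type code was brought up to date. -/
structure State.Inv (S : State) : Prop where
  r : 1 ≤ S.r
  k : 1 ≤ S.k
  valid : ValidP S.base S.log
  frag : S.P.Fragmented S.h
  cflag : ∀ v, S.cflag v ≤ S.log.length
  bf : ∀ c, S.bf c ⊆ Finset.range S.h
  filter : ∀ v ∈ S.G.V, ∀ i ∈ S.bf (S.tc v),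
    i ∉ deletedIn S.h (S.patAt (S.cflag v)) (S.log.drop (S.cflag v))

namespace State

variable {S : State} {DP : List PUpd} {DG : List DUpd}

theorem next_P (S : State) (DP : List PUpd) (DG : List DUpd) :
    (S.next DP DG).P = S.P.applyAll DP := Pattern.applyAll_append _ _ _

theorem patAt_length (S : State) : S.patAt S.log.length = S.P := by simp [patAt, State.P]

theorem patAt_next {n : ℕ} (hn : n ≤ S.log.length) : (S.next DP DG).patAt n = S.patAt n := by
  simp [patAt, next, List.take_append_of_le_length hn]

theorem patAt_next_length : (S.next DP DG).patAt (S.log ++ DP).length = S.P.applyAll DP := by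
  rw [← next_P S DP DG]; exact (S.next DP DG).patAt_length

theorem mem_affected {v : ℕ} : v ∈ S.affected DP DG ↔
    (v ∈ S.G.V ∧ S.bfNew DP (S.tc v) ⊆ S.tc v) ∨
      (v ∈ structural S.r S.G DG ∧ (v ∈ S.G.V ∨ v ∈ (S.G.applyAll DG).V)) := by
  simp [affected]

theorem tc_subset (S : State) (v : ℕ) : S.tc v ⊆ Finset.range S.h := Finset.filter_subset _ _

/-- What a round leaves unchanged. -/
structure Unaffected (S : State) (DP : List PUpd) (DG : List DUpd) (v : ℕ) : Prop where
  mem : v ∈ S.G.V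
  mem' : v ∈ (S.next DP DG).G.V
  same : (S.G.ball v S.r).Same ((S.next DP DG).G.ball v S.r)
  cflag : (S.next DP DG).cflag v = S.cflag v
  tc : (S.next DP DG).tc v = S.tc v
  fbMatch : (S.next DP DG).fbMatch v = S.fbMatch v
  patAt : (S.next DP DG).patAt (S.cflag v) = S.patAt (S.cflag v)

/-- The ball around an unaffected center is the same before and after, and so is what is stored
for it. -/
theorem Inv.unaffected (hS : S.Inv) (hD : S.Admissible DP DG) {v : ℕ}
    (hv : v ∉ S.affected DP DG) (hvV : v ∈ S.G.V ∨ v ∈ (S.G.applyAll DG).V) :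
    Unaffected S DP DG v := by
  have hs : v ∉ structural S.r S.G DG := fun h => hv (mem_affected.2 (Or.inr ⟨h, hvV⟩))
  obtain ⟨h1, h2⟩ := DataGraph.applyAll_same hD.validG hs
  have hc : (S.next DP DG).cflag v = S.cflag v := if_neg hv
  have hp : (S.next DP DG).patAt (S.cflag v) = S.patAt (S.cflag v) := patAt_next (hS.cflag v)
  refine ⟨hvV.elim id h1.2, hvV.elim h1.1 id, h2, hc, ?_, ?_, hp⟩
  · rw [State.tc, hc, hp]
    exact Finset.filter_congr fun i _ => (matches_congr h2).symm
  · rw [State.fbMatch, hc, hp]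
    exact Finset.biUnion_congr rfl fun i _ => (maxMatch_congr h2).symm

theorem Inv.next (hS : S.Inv) (hD : S.Admissible DP DG) : (S.next DP DG).Inv where
  r := hS.r
  k := hS.k
  valid := (validP_append _ _ _).2 ⟨hS.valid, hD.validP⟩
  frag := by rw [next_P]; exact hS.frag.applyAll hD.validP
  cflag v := by
    simp only [State.next]
    split_ifs
    · exact le_rfl
    · exact (hS.cflag v).trans (by simp)
  bf c := by
    simp only [State.next]
    split_ifs
    · exact subset_rfl
    · exact Finset.sdiff_subset.trans (hS.bf c)
  filter v hv i hi := by
    by_cases hva : v ∈ S.affected DP DG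
    · have : (S.next DP DG).cflag v = (S.log ++ DP).length := if_pos hva
      rw [this]
      simp [State.next, deletedIn]
    · have hu := hS.unaffected hD hva (Or.inr hv)
      rw [hu.tc] at hi
      rw [hu.cflag, hu.patAt]
      have hn : ¬ S.bfNew DP (S.tc v) ⊆ S.tc v := fun h =>
        hva (mem_affected.2 (Or.inl ⟨hu.mem, h⟩))
      simp only [State.next, if_neg hn] at hi ⊢
      rw [bfNew, Finset.mem_sdiff] at hi
      rw [List.drop_append_of_le_length (hS.cflag v), deletedIn_append, Finset.mem_union, not_or]
      refine ⟨hS.filter v hu.mem i hi.1, ?_⟩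
      have : (S.patAt (S.cflag v)).applyAll (S.log.drop (S.cflag v)) = S.P := by
        rw [patAt, ← Pattern.applyAll_append, List.take_append_drop]; rfl
      rw [this]; exact hi.2

theorem _root_.TF.Reachable.inv (hS : Reachable S) : S.Inv := by
  induction hS with
  | init h r k P G hr hk hP hf =>
    exact ⟨hr, hk, trivial, hf, fun v => le_rfl, fun c => subset_rfl,
      fun v hv i hi => by simp [State.init, deletedIn]⟩
  | next S DP DG hS hD ih => exact ih.next hD

/-- A ball that is not affected contains no team: it fails to match a fragment that has not lost
anything since the ball was last brought up to date. -/
theorem Inv.not_matches (hS : S.Inv) (hD : S.Admissible DP DG) {v t : ℕ}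
    (hv : v ∉ S.affected DP DG) (hvV : v ∈ (S.G.applyAll DG).V) (ht : t ≤ S.r) :
    ¬ Matches (S.P.applyAll DP) ((S.G.applyAll DG).ball v t) := by
  intro hM
  have hu := hS.unaffected hD hv (Or.inr hvV)
  have hn : ¬ S.bfNew DP (S.tc v) ⊆ S.tc v := fun h =>
    hv (mem_affected.2 (Or.inl ⟨hu.mem, h⟩))
  obtain ⟨i, hi, hit⟩ := Finset.not_subset.1 hn
  rw [bfNew, Finset.mem_sdiff] at hi
  -- Fragment `i` is required by the filter and not matched. It has only grown since the ball was
  -- brought up to date, so the new pattern contains what the ball failed to match.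
  refine hit (Finset.mem_filter.2 ⟨hS.bf _ hi.1, ?_⟩)
  rw [matches_congr hu.same]
  refine Matches.of_le ?_ (hM.ball_mono ht)
  refine Pattern.Le.trans ?_ (Pattern.frag_le _ i)
  have e' : (S.patAt (S.cflag v)).applyAll (S.log.drop (S.cflag v)) = S.P := by
    rw [patAt, ← Pattern.applyAll_append, List.take_append_drop]; rfl
  have e : (S.patAt (S.cflag v)).applyAll (S.log.drop (S.cflag v) ++ DP) = S.P.applyAll DP := by
    rw [Pattern.applyAll_append, e']
  rw [← e]
  refine Pattern.frag_le_applyAll (h := S.h) ?_ ?_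
  · rw [validP_append, e']
    refine ⟨?_, hD.validP⟩
    have := hS.valid
    rw [← List.take_append_drop (S.cflag v) S.log, validP_append] at this
    exact this.2
  · rw [deletedIn_append, e', Finset.mem_union, not_or]
    exact ⟨hS.filter v hu.mem i hi.1, hi.2⟩

end State

/-! ### The data graph in memory, and breadth-first search -/

/-- The memory holds the data graph `H`. -/
structure DataIn (σ : Store) (H : DataGraph) : Prop where
  node : ∀ v, σ 3 v 0 0 = bit (v ∈ H.V)
  label : ∀ v ∈ H.V, ∀ c, σ 4 v c 0 = bit (c ∈ H.label v)
  label_fresh : ∀ v, H.fresh ≤ v → ∀ c, σ 4 v c 0 = 0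
  nbrs : ∀ v ∈ H.V,
    Lists (fun j => σ 6 v j 0) (σ 5 v 0 0) (H.V.filter fun w => H.graph.Adj v w)
  adj : ∀ v w, σ 7 v w 0 = bit (H.graph.Adj v w)
  fresh : σ 8 0 0 0 = H.fresh

theorem DataIn.congr {σ σ' : Store} {H : DataGraph} (h : DataIn σ H)
    (hσ : ∀ a, 3 ≤ a → a ≤ 8 → σ' a = σ a) : DataIn σ' H := by
  have h3 := hσ 3 (by omega) (by omega)
  have h4 := hσ 4 (by omega) (by omega)
  have h5 := hσ 5 (by omega) (by omega)
  have h6 := hσ 6 (by omega) (by omega)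
  have h7 := hσ 7 (by omega) (by omega)
  have h8 := hσ 8 (by omega) (by omega)
  constructor
  · rw [h3]; exact h.node
  · rw [h4]; exact h.label
  · rw [h4]; exact h.label_fresh
  · rw [h5, h6]; exact h.nbrs
  · rw [h7]; exact h.adj
  · rw [h8]; exact h.fresh

/-- A node that is expanded in the search has at most as many neighbors as the ball has nodes. -/
theorem DataIn.degree_le {σ : Store} {H : DataGraph} (h : DataIn σ H) {v x t : ℕ}
    (hv : v ∈ (H.ball x t).V) : σ 5 v 0 0 ≤ (H.ball x (t + 1)).V.card := by
  rw [← (h.nbrs v (DataGraph.ball_subset hv)).card_eq]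
  refine Finset.card_le_card fun w hw => ?_
  exact DataGraph.mem_ball_succ.2 (Or.inr ⟨v, hv, (Finset.mem_filter.1 hw).2⟩)

/-- Append all neighbors of the node at position `var e` to the list with length `c` and
elements `b`. -/
def expand (c b e d : ℕ) : Cm :=
  .rep d (.at1 5 (.at1 b (.var e))) (addNew c b (.at2 6 (.at1 b (.var e)) (.var d)) (d + 1))

/-- Collect the ball with center `v` and radius `t` in the list with length `c` and
elements `b`. -/
def bfs (c b : ℕ) (v t : Tm) (d : ℕ) : Cm :=
  .put1 b (.lit 0) v ;; .put0 c (.lit 1) ;;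
  .rep d t (.rep (d + 1) (.cell c) (expand c b (d + 1) (d + 2)))

theorem addNew_keeps {c b d a : ℕ} {z : Tm} :
    (addNew c b z d).keeps a = true ↔ a ≠ b ∧ a ≠ c := by
  simp [addNew, Cm.keeps, Cm.put1, Cm.put0]

theorem bfs_keeps {c b d a : ℕ} {v t : Tm} :
    (bfs c b v t d).keeps a = true ↔ a ≠ b ∧ a ≠ c := by
  simp [bfs, expand, addNew, Cm.keeps, Cm.put1, Cm.put0]; tauto

theorem expand_does {N c b e d m : ℕ} {ρ : ℕ → ℕ} {σ : Store} {H : DataGraph} {A : Finset ℕ}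
    (hσ : DataIn σ H) (hcb : c ≠ b) (hc : 8 < c) (hb : 8 < b) (hed : e < d) (he : ρ e = m)
    (hA : Lists (fun j => σ b j 0 0) (σ c 0 0 0) A) (hm : m < σ c 0 0 0)
    (hmV : σ b m 0 0 ∈ H.V)
    (hN : (A ∪ H.V.filter fun w => H.graph.Adj (σ b m 0 0) w).card ≤ N) :
    (expand c b e d).Does N ρ σ fun σ' =>
      Lists (fun j => σ' b j 0 0) (σ' c 0 0 0)
        (A ∪ H.V.filter fun w => H.graph.Adj (σ b m 0 0) w) ∧
      ∀ j < σ c 0 0 0, σ' b j 0 0 = σ b j 0 0 := by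
  set y := σ b m 0 0 with hy
  have hL := hσ.nbrs y hmV
  set C := fun q => A ∪ (Finset.range q).image fun j => σ 6 y j 0 with hC
  have hCn : C (σ 5 y 0 0) = A ∪ H.V.filter fun w => H.graph.Adj y w := by
    rw [← hL.image_eq]
  have hCcard : ∀ q ≤ σ 5 y 0 0, (C q).card ≤ N := fun q hq => by
    refine (Finset.card_le_card ?_).trans hN
    rw [← hCn]
    exact Finset.union_subset_union_right (Finset.image_subset_image
      (Finset.range_subset_range.2 hq))
  refine Cm.Does.rep (σ 5 y 0 0) (fun q σ' =>
    Lists (fun j => σ' b j 0 0) (σ' c 0 0 0) (C q) ∧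
    σ c 0 0 0 ≤ σ' c 0 0 0 ∧ ∀ j < σ c 0 0 0, σ' b j 0 0 = σ b j 0 0) (by simp)
    (by simp [he, hy]) ?_ ?_ ?_ ?_
  · rw [← hL.card_eq]
    exact (Finset.card_le_card Finset.subset_union_right).trans hN
  · exact ⟨by simpa [hC] using hA, le_rfl, fun _ _ => rfl⟩
  · intro q hq σ₁ hk ⟨hL₁, hn₁, hp₁⟩
    have e6 : σ₁ 6 = σ 6 := hk 6 (addNew_keeps.2 ⟨by omega, by omega⟩)
    have hev : ∀ ρ' : ℕ → ℕ, ρ' e = m → ρ' d = q →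
        (Tm.at2 6 (.at1 b (.var e)) (.var d)).eval σ₁ ρ' = σ 6 y q 0 := by
      intro ρ' h1 h2
      simp [h1, h2, hp₁ m hm, e6, hy]
    refine (addNew_does (y := σ 6 y q 0) hcb hL₁ (hCcard q hq.le) (by simp) ?_ ?_).mono ?_
    · exact hev _ (by simp [hed.ne, he]) (by simp)
    · intro z
      exact ⟨by simp, hev _ (by simp [hed.ne, he, (show e ≠ d + 1 by omega)])
        (by simp)⟩
    · rintro σ₂ - ⟨h1, h2⟩
      have : C (q + 1) = insert (σ 6 y q 0) (C q) := by
        simp [hC, Finset.range_add_one, Finset.image_insert]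
      rw [this]
      refine ⟨h1, ?_, fun j hj => (h2 j (by omega)).trans (hp₁ j hj)⟩
      rw [← h1.card_eq]
      exact (hn₁.trans hL₁.card_eq.ge).trans (Finset.card_le_card (Finset.subset_insert _ _))
  · rintro σ₁ - ⟨h, -, h'⟩
    exact ⟨hCn ▸ h, h'⟩

/-- Round `s` of the search scans the list as it is at the beginning of the round, so that the list
holds the ball of radius `s + 1` afterwards. -/
theorem bfs_does {N c b d s x : ℕ} {v t : Tm} {ρ : ℕ → ℕ} {σ : Store} {H : DataGraph}
    (hσ : DataIn σ H) (hcb : c ≠ b) (hc : 8 < c) (hb : 8 < b) (hvok : v.ok N σ ρ)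
    (hv : v.eval σ ρ = x) (hx : x ∈ H.V)
    (ht : ∀ σ', (∀ a, a ≠ b → a ≠ c → σ' a = σ a) → t.ok N σ' ρ ∧ t.eval σ' ρ = s)
    (hs : s ≤ N) (hN : (H.ball x s).V.card ≤ N) :
    (bfs c b v t d).Does N ρ σ fun σ' =>
      Lists (fun j => σ' b j 0 0) (σ' c 0 0 0) (H.ball x s).V := by
  have hball : ∀ s' ≤ s, (H.ball x s').V.card ≤ N := fun s' h =>
    (Finset.card_le_card (DataGraph.ball_mono h)).trans hN
  simp only [bfs, Cm.Does.seq_iff, Cm.Does.put1_iff, Cm.Does.put0_iff, Tm.ok_lit, Tm.eval_lit,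
    hvok, hv, true_and]
  set σ₁ := (σ.write b 0 0 0 x).write c 0 0 0 1 with hσ₁
  have e₁ : ∀ a, a ≠ b → a ≠ c → σ₁ a = σ a := fun a h1 h2 => by
    rw [hσ₁, Store.write_of_ne _ _ _ _ _ h2, Store.write_of_ne _ _ _ _ _ h1]
  have hdata : ∀ σ', (∀ a, a ≠ b → a ≠ c → σ' a = σ₁ a) → DataIn σ' H := fun σ' h =>
    hσ.congr fun a h3 h8 => by rw [h a (by omega) (by omega), e₁ a (by omega) (by omega)]
  have hkeep : ∀ a, a ≠ b → a ≠ c → (expand c b (d + 1) (d + 2)).keeps a = true := by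
    intro a h1 h2
    exact (addNew_keeps (d := d + 3)).2 ⟨h1, h2⟩
  refine Cm.Does.rep s (fun s' σ' => Lists (fun j => σ' b j 0 0) (σ' c 0 0 0) (H.ball x s').V)
    (ht _ e₁).1 (ht _ e₁).2 hs ?_ ?_ (fun σ' _ h => h)
  · have : (H.ball x 0).V = {x} := by
      ext y; rw [DataGraph.mem_ball_zero, Finset.mem_singleton]
      exact ⟨fun h => h.2, fun h => ⟨h ▸ hx, h⟩⟩
    rw [this]
    refine Lists.intro ?_ ?_ <;> simp [hσ₁, Store.write_apply, hcb.symm, eq_comm]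
  · intro s' hs' σ₂ hk₂ hL₂
    have hD₂ := hdata σ₂ fun a h1 h2 => hk₂ a (hkeep a h1 h2)
    set f₀ : ℕ → ℕ := fun j => σ₂ b j 0 0 with hf₀
    set B := fun m => (H.ball x s').V ∪ (Finset.range m).biUnion fun j =>
      H.V.filter fun w => H.graph.Adj (f₀ j) w with hB
    have hBsub : ∀ m ≤ σ₂ c 0 0 0, B m ⊆ (H.ball x (s' + 1)).V := by
      intro m hm y hy
      simp only [hB, Finset.mem_union, Finset.mem_biUnion, Finset.mem_range,
        Finset.mem_filter] at hy
      rw [DataGraph.mem_ball_succ]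
      rcases hy with hy | ⟨j, hj, -, hy⟩
      · exact Or.inl hy
      · exact Or.inr ⟨_, hL₂.mem (hj.trans_le hm), hy⟩
    have hBn : B (σ₂ c 0 0 0) = (H.ball x (s' + 1)).V := by
      refine subset_antisymm (hBsub _ le_rfl) fun y hy => ?_
      simp only [hB, Finset.mem_union, Finset.mem_biUnion, Finset.mem_range, Finset.mem_filter]
      rcases DataGraph.mem_ball_succ.1 hy with h | ⟨w, hw, h⟩
      · exact Or.inl h
      · obtain ⟨j, hj, rfl⟩ := hL₂.mem_iff.1 hw
        exact Or.inr ⟨j, hj, H.mem_of_adj' h, h⟩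
    refine Cm.Does.rep (σ₂ c 0 0 0) (fun m σ' => Lists (fun j => σ' b j 0 0) (σ' c 0 0 0) (B m) ∧
      σ₂ c 0 0 0 ≤ σ' c 0 0 0 ∧ ∀ j < σ₂ c 0 0 0, σ' b j 0 0 = f₀ j) (by simp) (by simp)
      (by rw [← hL₂.card_eq]; exact hball s' (by omega)) ?_ ?_ ?_
    · exact ⟨by simpa [hB] using hL₂, le_rfl, fun _ _ => rfl⟩
    · intro m hm σ₃ hk₃ ⟨hL₃, hn₃, hp₃⟩
      have hy : f₀ m ∈ (H.ball x s').V := hL₂.mem hm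
      have hD₃ : DataIn σ₃ H := hD₂.congr fun a h3 h8 => hk₃ a (hkeep a (by omega) (by omega))
      have hBs : B (m + 1) = B m ∪ H.V.filter fun w => H.graph.Adj (σ₃ b m 0 0) w := by
        rw [hp₃ m hm]
        simp only [hB, Finset.range_add_one, Finset.biUnion_insert]
        rw [Finset.union_assoc, Finset.union_comm (Finset.filter _ _)]
      refine (expand_does hD₃ hcb hc hb (by omega) (by simp) hL₃
        (hm.trans_le hn₃) (by rw [hp₃ m hm]; exact DataGraph.ball_subset hy) ?_).mono ?_
      · rw [← hBs]
        exact (Finset.card_le_card (hBsub (m + 1) hm)).trans (hball _ (by omega))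
      · rintro σ₄ - ⟨h1, h2⟩
        rw [← hBs] at h1
        refine ⟨h1, ?_, fun j hj => (h2 j (by omega)).trans (hp₃ j hj)⟩
        rw [← h1.card_eq]
        refine (hn₃.trans hL₃.card_eq.ge).trans (Finset.card_le_card ?_)
        rw [hBs]; exact Finset.subset_union_left
    · rintro σ₃ - ⟨h, -⟩
      rwa [hBn] at h

theorem bit_ne_zero {p : Prop} : bit p ≠ 0 ↔ p := by simp [bit]

theorem bit_congr {p q : Prop} (h : p ↔ q) : bit p = bit q := by simp [bit, h]

/-! ### Updating the data graph in memory -/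

/-- Adjacency lists and adjacency test hold the relation `R` on `V`. -/
structure ArcsIn (σ : Store) (V : Finset ℕ) (R : ℕ → ℕ → Prop) : Prop where
  nbrs : ∀ v ∈ V, Lists (fun j => σ 6 v j 0) (σ 5 v 0 0) (V.filter (R v))
  adj : ∀ v w, σ 7 v w 0 = bit (R v w)

theorem ArcsIn.congr {σ σ' : Store} {V : Finset ℕ} {R R' : ℕ → ℕ → Prop} (h : ArcsIn σ V R)
    (hR : ∀ x y, R x y ↔ R' x y) (h5 : σ' 5 = σ 5) (h6 : σ' 6 = σ 6) (h7 : σ' 7 = σ 7) :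
    ArcsIn σ' V R' := by
  constructor
  · intro v hv
    rw [h5, h6]
    exact (h.nbrs v hv).of_mem_iff fun x => by simp only [Finset.mem_filter, hR]
  · intro v w
    rw [h7, h.adj v w]; exact bit_congr (hR v w)

/-- Insert the arc from the node in cell `x` to the node in cell `y`. -/
def addArc (x y : ℕ) : Cm :=
  .put2 6 (.cell x) (.at1 5 (.cell x)) (.cell y) ;;
  .put1 5 (.cell x) (.add (.at1 5 (.cell x)) (.lit 1)) ;;
  .put2 7 (.cell x) (.cell y) (.lit 1)

/-- Remove the arc from the node in cell `x` to the node in cell `y`. -/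
def rmArc (x y d : ℕ) : Cm :=
  .put0 62 (.sum d (.at1 5 (.cell x))
    (.ite (.eq (.at2 6 (.cell x) (.var d)) (.cell y)) (.var d) (.lit 0))) ;;
  .put2 6 (.cell x) (.cell 62) (.at2 6 (.cell x) (.sub (.at1 5 (.cell x)) (.lit 1))) ;;
  .put1 5 (.cell x) (.sub (.at1 5 (.cell x)) (.lit 1)) ;;
  .put2 7 (.cell x) (.cell y) (.lit 0)

theorem addArc_does {N x y a b : ℕ} {ρ : ℕ → ℕ} {σ : Store} {V : Finset ℕ}
    {R : ℕ → ℕ → Prop} (h : ArcsIn σ V R) (hx : 8 < x) (hy : 8 < y) (ha : σ x 0 0 0 = a)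
    (hb : σ y 0 0 0 = b) (haV : a ∈ V) (hbV : b ∈ V) (hR : ¬ R a b) :
    (addArc x y).Does N ρ σ fun σ' => ArcsIn σ' V fun u w => R u w ∨ (u = a ∧ w = b) := by
  have n5 : x ≠ 5 := by omega
  have n6 : x ≠ 6 := by omega
  have m5 : y ≠ 5 := by omega
  have m6 : y ≠ 6 := by omega
  simp only [addArc, Cm.Does.seq_iff, Cm.Does.put2_iff, Cm.Does.put1_iff, Tm.ok_cell, Tm.ok_at1,
    Tm.ok_add, Tm.ok_lit, Tm.eval_cell, Tm.eval_at1, Tm.eval_add, Tm.eval_lit, true_and,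
    Store.write_apply, n5, n6, m5, m6, ha, hb, false_and, if_false]
  constructor
  · intro v hv
    by_cases hva : v = a
    · subst hva
      refine Lists.of_mem_iff (A := insert b (V.filter (R v))) ?_ fun w => by
        simp only [Finset.mem_filter, Finset.mem_insert, true_and]
        constructor
        · rintro (rfl | h) <;> tauto
        · rintro ⟨h1, h2 | h2⟩ <;> tauto
      have := (h.nbrs v hv).push (z := b)
        (g := fun j => if j = σ 5 v 0 0 then b else σ 6 v j 0)
        (by simp [hR]) (fun j hj => by simp [hj.ne]) (by simp)
      simpa [Store.write_apply] using this
    · refine Lists.of_mem_iff (A := V.filter (R v)) ?_ fun w => by simp [hva]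
      simpa [Store.write_apply, hva] using h.nbrs v hv
  · intro v w
    have := h.adj v w
    by_cases hvw : v = a ∧ w = b
    · simp [Store.write_apply, hvw, bit]
    · simp [Store.write_apply, hvw, this]

theorem rmArc_does {N x y d a b : ℕ} {ρ : ℕ → ℕ} {σ : Store} {V : Finset ℕ}
    {R : ℕ → ℕ → Prop} (h : ArcsIn σ V R) (hx : 8 < x) (hy : 8 < y) (hx' : x ≠ 62) (hy' : y ≠ 62)
    (ha : σ x 0 0 0 = a)
    (hb : σ y 0 0 0 = b) (haV : a ∈ V) (hbV : b ∈ V) (hR : R a b)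
    (hN : σ 5 a 0 0 ≤ N) :
    (rmArc x y d).Does N ρ σ fun σ' => (ArcsIn σ' V fun u w => R u w ∧ ¬ (u = a ∧ w = b)) ∧
      ∀ v, σ' 5 v 0 0 = if v = a then σ 5 a 0 0 - 1 else σ 5 v 0 0 := by
  have n5 : x ≠ 5 := by omega
  have n6 : x ≠ 6 := by omega
  have m5 : y ≠ 5 := by omega
  have m6 : y ≠ 6 := by omega
  have hL := h.nbrs a haV
  obtain ⟨p, hp, hpb⟩ := hL.mem_iff.1 (Finset.mem_filter.2 ⟨hbV, hR⟩)
  have hsum : (∑ j ∈ Finset.range (σ 5 a 0 0), if σ 6 a j 0 = b then j else 0) = p := by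
    rw [Finset.sum_eq_single_of_mem p (Finset.mem_range.2 hp)]
    · simp [hpb]
    · intro j hj hjp
      rw [if_neg]
      rintro e
      exact hjp (hL.inj (Finset.mem_range.1 hj) hp (by rw [e, hpb]))
  simp only [rmArc, Cm.Does.seq_iff, Cm.Does.put2_iff, Cm.Does.put1_iff, Cm.Does.put0_iff,
    Tm.ok_cell, Tm.ok_at1, Tm.ok_at2, Tm.ok_sum, Tm.ok_ite, Tm.ok_eq, Tm.ok_var,
    Tm.ok_sub, Tm.ok_lit, Tm.eval_cell, Tm.eval_at1, Tm.eval_at2, Tm.eval_sub, Tm.eval_lit,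
    Tm.eval_sum, Tm.eval_ite, Tm.holds_eq, Tm.eval_var, Function.update_self, true_and, and_true,
    Store.write_apply, n5, n6, m5, m6, hx', hy', ha, hb, false_and, if_false, hsum, hN,
    implies_true]
  refine ⟨⟨?_, ?_⟩, ?_⟩
  · intro v hv
    by_cases hva : v = a
    · subst hva
      refine Lists.of_mem_iff (A := (V.filter (R v)).erase (σ 6 v p 0)) ?_ fun w => by
        simp only [Finset.mem_filter, Finset.mem_erase, true_and, hpb]
        tauto
      have := hL.swapRemove hp
        (g := fun j => if j = p then σ 6 v (σ 5 v 0 0 - 1) 0 else σ 6 v j 0)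
        (by simp) (fun j hj hjp => by simp [hjp])
      simpa [Store.write_apply] using this
    · refine Lists.of_mem_iff (A := V.filter (R v)) ?_ fun w => by simp [hva]
      simpa [Store.write_apply, hva] using h.nbrs v hv
  · intro v w
    have := h.adj v w
    by_cases hvw : v = a ∧ w = b
    · simp [Store.write_apply, hvw, bit]
    · simp [Store.write_apply, hvw, this]
  · intro v
    by_cases hva : v = a <;> simp [hva]

theorem DataIn.arcs {σ : Store} {H : DataGraph} (h : DataIn σ H) :
    ArcsIn σ H.V H.graph.Adj := ⟨h.nbrs, h.adj⟩

/-- Insert the edge between the nodes in cells 60 and 61. -/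
def addEdgeCm : Cm := addArc 60 61 ;; addArc 61 60

/-- Remove the edge between the nodes in cells 60 and 61. -/
def delEdgeCm : Cm := rmArc 60 61 1 ;; rmArc 61 60 1

/-- Insert the node in cell 60, as described by the record number `var 0`. -/
def addNodeCm : Cm :=
  .put1 3 (.cell 60) (.lit 1) ;; .put1 5 (.cell 60) (.lit 0) ;;
  .put0 8 (.add (.cell 8) (.sub (.add (.cell 60) (.lit 1)) (.cell 8))) ;;
  .rep 1 (.at2 34 (.var 0) (.lit 4)) (.put2 4 (.cell 60) (.at2 35 (.var 0) (.var 1)) (.lit 1)) ;;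
  .ite (.at2 34 (.var 0) (.lit 2)) (.put0 61 (.at2 34 (.var 0) (.lit 3)) ;; addEdgeCm) .skip

/-- Remove the node in cell 60 and all its edges. -/
def delNodeCm : Cm :=
  .rep 1 (.at1 5 (.cell 60)) (.put0 61 (.at2 6 (.cell 60) (.lit 0)) ;;
    rmArc 60 61 2 ;; rmArc 61 60 2) ;;
  .put1 3 (.cell 60) (.lit 0)

theorem addEdgeCm_does {N a b : ℕ} {ρ : ℕ → ℕ} {σ : Store} {V : Finset ℕ}
    {R : ℕ → ℕ → Prop} (h : ArcsIn σ V R) (ha : σ 60 0 0 0 = a) (hb : σ 61 0 0 0 = b)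
    (haV : a ∈ V) (hbV : b ∈ V) (hab : a ≠ b) (hR : ¬ R a b) (hR' : ¬ R b a) :
    addEdgeCm.Does N ρ σ fun σ' =>
      ArcsIn σ' V fun u w => R u w ∨ (u = a ∧ w = b) ∨ (u = b ∧ w = a) := by
  refine (addArc_does h (by omega) (by omega) ha hb haV hbV hR).seq fun σ₁ k₁ h₁ => ?_
  refine (addArc_does h₁ (by omega) (by omega) (by rw [k₁ 61 rfl, hb])
    (by rw [k₁ 60 rfl, ha]) hbV haV (by tauto)).mono fun σ₂ _ h₂ => ?_
  exact h₂.congr (fun x y => by tauto) rfl rfl rfl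

theorem delEdgeCm_does {N a b : ℕ} {ρ : ℕ → ℕ} {σ : Store} {V : Finset ℕ}
    {R : ℕ → ℕ → Prop} (h : ArcsIn σ V R) (ha : σ 60 0 0 0 = a) (hb : σ 61 0 0 0 = b)
    (haV : a ∈ V) (hbV : b ∈ V) (hab : a ≠ b) (hR : R a b) (hR' : R b a)
    (hNa : σ 5 a 0 0 ≤ N) (hNb : σ 5 b 0 0 ≤ N) :
    delEdgeCm.Does N ρ σ fun σ' =>
      ArcsIn σ' V fun u w => R u w ∧ ¬ (u = a ∧ w = b) ∧ ¬ (u = b ∧ w = a) := by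
  refine (rmArc_does h (by omega) (by omega) (by omega) (by omega) ha hb haV hbV hR hNa).seq
    fun σ₁ k₁ h₁ => ?_
  refine (rmArc_does h₁.1 (by omega) (by omega) (by omega) (by omega)
    (by rw [k₁ 61 rfl, hb])
    (by rw [k₁ 60 rfl, ha]) hbV haV (by tauto) ?_).mono fun σ₂ _ h₂ => ?_
  · rw [h₁.2, if_neg hab.symm]; exact hNb
  · exact h₂.1.congr (fun x y => by tauto) rfl rfl rfl

/-- The first entry in the adjacency list of the node is removed as often as the node has neighbors. -/
theorem delNodeCm_does {N w : ℕ} {ρ : ℕ → ℕ} {σ : Store} {H : DataGraph} (hσ : DataIn σ H)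
    (hw : σ 60 0 0 0 = w) (hwV : w ∈ H.V) (hNw : σ 5 w 0 0 ≤ N)
    (hN : ∀ x, H.graph.Adj w x → σ 5 x 0 0 ≤ N) :
    delNodeCm.Does N ρ σ fun σ' => DataIn σ' (H.apply (.delNode w)) := by
  set n := σ 5 w 0 0 with hn
  refine (Cm.Does.rep n (fun j σ' => ∃ R : ℕ → ℕ → Prop, ArcsIn σ' H.V R ∧
      (∀ x y, R x y → H.graph.Adj x y) ∧ (∀ x y, R x y → R y x) ∧
      (∀ x y, H.graph.Adj x y → x ≠ w → y ≠ w → R x y) ∧ σ' 5 w 0 0 = n - j)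
      (Q := fun σ' => (∀ a, a ≠ 5 → a ≠ 6 → a ≠ 7 → a ≠ 61 → a ≠ 62 → σ' a = σ a) ∧
        ArcsIn σ' (H.apply (.delNode w)).V (H.apply (.delNode w)).graph.Adj)
      (by simp) (by simp [hw, hn]) hNw ?_ ?_ ?_).seq fun σ₁ k₁ h₁ => ?_
  · exact ⟨_, hσ.arcs, fun _ _ h => h, fun _ _ h => h.symm, fun _ _ h _ _ => h, by omega⟩
  · rintro j hj σ₁ k₁ ⟨R, hA, hR1, hR2, hR3, hd⟩
    have e60 : σ₁ 60 0 0 0 = w := by rw [k₁ 60 rfl, hw]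
    have hb := (hA.nbrs w hwV).mem (j := 0) (by omega)
    set b := σ₁ 6 w 0 0 with hbd
    rw [Finset.mem_filter] at hb
    obtain ⟨hbV, hwb⟩ := hb
    have hne : w ≠ b := (hR1 _ _ hwb).ne
    have hdb : σ₁ 5 b 0 0 ≤ N := by
      rw [← (hA.nbrs b hbV).card_eq]
      refine (Finset.card_le_card (t := H.V.filter fun x => H.graph.Adj b x) fun x hx => ?_).trans
        ((hσ.nbrs b hbV).card_eq.le.trans (hN b (hR1 _ _ hwb)))
      rw [Finset.mem_filter] at hx ⊢
      exact ⟨hx.1, hR1 _ _ hx.2⟩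
    simp only [Cm.Does.seq_iff, Cm.Does.put0_iff, Tm.ok_at2, Tm.ok_cell, Tm.ok_lit, true_and,
      Tm.eval_at2, Tm.eval_cell, Tm.eval_lit, e60, ← hbd]
    have hA' : ArcsIn (σ₁.write 61 0 0 0 b) H.V R := hA.congr (fun _ _ => Iff.rfl)
      (Store.write_of_ne _ _ _ _ _ (by omega)) (Store.write_of_ne _ _ _ _ _ (by omega))
      (Store.write_of_ne _ _ _ _ _ (by omega))
    refine (rmArc_does (a := w) (b := b) hA' (by omega) (by omega) (by omega) (by omega)
      (by simp [Store.write_apply, e60])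
      (by simp [Store.write_apply]) hwV hbV hwb ?_).mono fun σ₂ k₂ ⟨h₂, d₂⟩ => ?_
    · simp only [Store.write_apply, hd]; simp; omega
    refine (rmArc_does (a := b) (b := w) h₂ (by omega) (by omega) (by omega) (by omega)
      (by rw [k₂ 61 rfl]; simp [Store.write_apply])
      (by rw [k₂ 60 rfl]; simp [Store.write_apply, e60]) hbV hwV ⟨hR2 _ _ hwb, by tauto⟩ ?_).mono
      fun σ₃ k₃ ⟨h₃, d₃⟩ => ?_
    · rw [d₂, if_neg hne.symm]; simpa [Store.write_apply] using hdb
    refine ⟨_, h₃, fun x y h => hR1 _ _ h.1.1, fun x y h => ⟨⟨hR2 _ _ h.1.1, by tauto⟩, by tauto⟩,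
      fun x y h h1 h2 => ⟨⟨hR3 _ _ h h1 h2, by tauto⟩, by tauto⟩, ?_⟩
    rw [d₃, if_neg hne, d₂, if_pos rfl]
    simp [Store.write_apply, hd]; omega
  · rintro σ₁ k₁ ⟨R, hA, hR1, hR2, hR3, hd⟩
    refine ⟨fun a h5 h6 h7 h61 h62 => k₁ a ?_, ?_⟩
    · simp [Cm.keeps, rmArc, Cm.put0, Cm.put1, Cm.put2, *]
    · have hwR : ∀ y, ¬ R w y := by
        intro y h
        obtain ⟨j, hj, -⟩ := (hA.nbrs w hwV).mem_iff.1
          (Finset.mem_filter.2 ⟨H.mem_of_adj' (hR1 _ _ h), h⟩)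
        omega
      have hRiff : ∀ x y, R x y ↔ H.graph.Adj x y ∧ x ≠ w ∧ y ≠ w := fun x y =>
        ⟨fun h => ⟨hR1 _ _ h, by rintro rfl; exact hwR _ h, by rintro rfl; exact hwR _ (hR2 _ _ h)⟩,
          fun h => hR3 _ _ h.1 h.2.1 h.2.2⟩
      constructor
      · intro v hv
        have hv' := (DataGraph.mem_apply _ _).1 hv
        refine (hA.nbrs v hv'.1).of_mem_iff fun x => ?_
        simp only [Finset.mem_filter, DataGraph.mem_apply, DataGraph.apply_delNode_adj, hRiff]
        tauto
      · intro v x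
        rw [hA.adj]
        exact bit_congr (by rw [hRiff, DataGraph.apply_delNode_adj])
  · obtain ⟨hk, hA⟩ := h₁
    have k3 := hk 3 (by omega) (by omega) (by omega) (by omega) (by omega)
    have k4 := hk 4 (by omega) (by omega) (by omega) (by omega) (by omega)
    have k8 := hk 8 (by omega) (by omega) (by omega) (by omega) (by omega)
    have k60 := hk 60 (by omega) (by omega) (by omega) (by omega) (by omega)
    simp only [Cm.Does.put1_iff, Tm.ok_cell, Tm.ok_lit, Tm.eval_cell, Tm.eval_lit, true_and, k60, hw]
    refine ⟨fun v => ?_, ?_, ?_, hA.nbrs, hA.adj, ?_⟩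
    · have := hσ.node v
      by_cases hv : v = w
      · subst hv; simp [Store.write_apply, DataGraph.mem_apply, bit]
      · simp [Store.write_apply, DataGraph.mem_apply, bit, hv, k3, this]
    · intro v hv c
      rw [Store.write_of_ne _ _ _ _ _ (by omega), k4, DataGraph.apply_label]
      exact hσ.label v ((DataGraph.mem_apply _ _).1 hv).1 c
    · rw [Store.write_of_ne _ _ _ _ _ (by omega), k4, DataGraph.apply_fresh]
      exact hσ.label_fresh
    · rw [Store.write_of_ne _ _ _ _ _ (by omega), k8, DataGraph.apply_fresh]
      exact hσ.fresh

theorem addNodeCm_does {N w q : ℕ} {L : Finset ℕ} {o : Option ℕ} {ρ : ℕ → ℕ} {σ : Store}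
    {H : DataGraph} (hσ : DataIn σ H) (hδ : (DUpd.addNode w L o).Valid H)
    (hw : σ 60 0 0 0 = w) (hq : ρ 0 = q)
    (hrec : ∀ f < 5, σ 34 q f 0 = (DUpd.addNode w L o).field f)
    (hL : Lists (fun j => σ 35 q j 0) L.card L) (hN : L.card ≤ N) :
    addNodeCm.Does N ρ σ fun σ' => DataIn σ' (H.apply (.addNode w L o)) := by
  have h4 : σ 34 q 4 0 = L.card := by rw [hrec 4 (by omega)]; cases o <;> rfl
  have hwV : w ∉ H.V := fun h => absurd (H.lt_fresh _ h) (by have := hδ.1; omega)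
  have hwA : ∀ x, ¬ H.graph.Adj w x := fun x h => hwV (H.mem_of_adj _ _ h)
  simp only [addNodeCm, Cm.Does.seq_iff, Cm.Does.put1_iff, Cm.Does.put0_iff, Tm.ok_cell,
    Tm.ok_lit, Tm.ok_add, Tm.ok_sub, Tm.eval_cell, Tm.eval_lit, Tm.eval_add, Tm.eval_sub,
    true_and, hw]
  set σ₁ := ((σ.write 3 w 0 0 1).write 5 ((σ.write 3 w 0 0 1) 60 0 0 0) 0 0 0).write 8 0 0 0
    (((σ.write 3 w 0 0 1).write 5 ((σ.write 3 w 0 0 1) 60 0 0 0) 0 0 0) 8 0 0 0 +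
      (((σ.write 3 w 0 0 1).write 5 ((σ.write 3 w 0 0 1) 60 0 0 0) 0 0 0) 60 0 0 0 + 1 -
        ((σ.write 3 w 0 0 1).write 5 ((σ.write 3 w 0 0 1) 60 0 0 0) 0 0 0) 8 0 0 0)) with hσ₁
  have e₁ : ∀ a, a ≠ 3 → a ≠ 5 → a ≠ 8 → σ₁ a = σ a := fun a h3 h5 h8 => by
    rw [hσ₁, Store.write_of_ne _ _ _ _ _ h8, Store.write_of_ne _ _ _ _ _ h5,
      Store.write_of_ne _ _ _ _ _ h3]
  have e3 : ∀ v, σ₁ 3 v 0 0 = bit (v ∈ (H.apply (.addNode w L o)).V) := by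
    intro v
    have := hσ.node v
    by_cases hv : v = w <;> simp [hσ₁, Store.write_apply, DataGraph.mem_apply, bit, hv, this]
  have e5 : ∀ v, σ₁ 5 v 0 0 = if v = w then 0 else σ 5 v 0 0 := by
    intro v
    by_cases hv : v = w <;> simp [hσ₁, Store.write_apply, hv, hw]
  have e8 : σ₁ 8 0 0 0 = (H.apply (.addNode w L o)).fresh := by
    rw [DataGraph.apply_fresh]
    have := hσ.fresh
    simp [hσ₁, Store.write_apply, hw, this]; omega
  refine (Cm.Does.rep L.card (fun j σ' => ∀ v c, σ' 4 v c 0 =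
    if v = w ∧ ∃ i < j, σ 35 q i 0 = c then 1 else σ 4 v c 0) (by simp)
    (by simp [hq, e₁ 34, h4]) hN ?_ ?_ (fun σ₂ k₂ h₂ => ?_))
  · intro v c; simp [e₁ 4]
  · intro j hj σ₂ k₂ h₂
    have e35 : σ₂ 35 = σ 35 := by rw [k₂ 35 rfl, e₁ 35 (by omega) (by omega) (by omega)]
    have e60 : σ₂ 60 = σ 60 := by rw [k₂ 60 rfl, e₁ 60 (by omega) (by omega) (by omega)]
    simp only [Cm.Does.put2_iff, Tm.ok_cell, Tm.ok_at2, Tm.ok_var, Tm.ok_lit, Tm.eval_cell,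
      Tm.eval_at2, Tm.eval_var, Tm.eval_lit, Function.update_self, true_and, e60, hw, e35]
    intro v c
    have hq' : Function.update ρ 1 j 0 = q := by simp [hq]
    rw [hq']
    simp only [Store.write_apply, true_and, and_true, h₂]
    by_cases hv : v = w
    · by_cases hc : c = σ 35 q j 0
      · subst hc
        rw [if_pos ⟨hv, rfl⟩, if_pos ⟨hv, j, by omega, rfl⟩]
      · rw [if_neg (by tauto)]
        refine if_congr (and_congr_right fun _ => ⟨?_, ?_⟩) rfl rfl
        · rintro ⟨i, hi, e⟩; exact ⟨i, by omega, e⟩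
        · rintro ⟨i, hi, e⟩
          refine ⟨i, ?_, e⟩
          rcases Nat.lt_succ_iff_lt_or_eq.1 hi with hi | rfl
          · exact hi
          · exact absurd e.symm hc
    · simp [hv]
  · have k : ∀ a, a ≠ 4 → σ₂ a = σ₁ a := fun a ha => k₂ a (by simp [Cm.keeps, Cm.put2, ha])
    have l₂ : ∀ v c, σ₂ 4 v c 0 = if v = w ∧ c ∈ L then 1 else σ 4 v c 0 := by
      intro v c; rw [h₂]
      exact if_congr (and_congr_right fun _ => hL.mem_iff.symm) rfl rfl
    have hA : ArcsIn σ₂ (insert w H.V) H.graph.Adj := by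
      constructor
      · intro v hv
        rw [k 5 (by omega), k 6 (by omega), e₁ 6 (by omega) (by omega) (by omega)]
        simp only [e5]
        by_cases hvw : v = w
        · subst hvw
          rw [if_pos rfl]
          exact (Lists.zero _).of_mem_iff fun x => by simp [hwA]
        · rw [if_neg hvw]
          refine (hσ.nbrs v ((Finset.mem_insert.1 hv).resolve_left hvw)).of_mem_iff fun x => ?_
          simp only [Finset.mem_filter, Finset.mem_insert]
          exact ⟨fun h => ⟨Or.inr h.1, h.2⟩, fun h => ⟨H.mem_of_adj' h.2, h.2⟩⟩
      · rw [k 7 (by omega), e₁ 7 (by omega) (by omega) (by omega)]; exact hσ.adj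
    have hVeq : (H.apply (.addNode w L o)).V = insert w H.V := by
      ext x; rw [DataGraph.mem_apply, Finset.mem_insert]
    have fin : ∀ σ₃ : Store, (∀ a, a ≠ 5 → a ≠ 6 → a ≠ 7 → a ≠ 61 → σ₃ a = σ₂ a) →
        ArcsIn σ₃ (insert w H.V) (H.apply (.addNode w L o)).graph.Adj →
        DataIn σ₃ (H.apply (.addNode w L o)) := by
      intro σ₃ k₃ hA₃
      rw [← hVeq] at hA₃
      refine ⟨fun v => ?_, fun v hv c => ?_, fun v hv c => ?_, hA₃.nbrs, hA₃.adj, ?_⟩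
      · rw [k₃ 3 (by omega) (by omega) (by omega) (by omega), k 3 (by omega), e3]
      · rw [k₃ 4 (by omega) (by omega) (by omega) (by omega), l₂, DataGraph.apply_label]
        rw [hVeq, Finset.mem_insert] at hv
        by_cases hvw : v = w
        · subst hvw
          have := hσ.label_fresh v hδ.1 c
          simp [this, bit]
        · have := hσ.label v (hv.resolve_left hvw) c
          simp [this, hvw]
      · rw [DataGraph.apply_fresh] at hv
        simp only at hv
        rw [k₃ 4 (by omega) (by omega) (by omega) (by omega), l₂, if_neg (by omega)]
        exact hσ.label_fresh v (by omega) c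
      · rw [k₃ 8 (by omega) (by omega) (by omega) (by omega), k 8 (by omega), e8]
    have e34 : ∀ f < 5, σ₂ 34 q f 0 = (DUpd.addNode w L o).field f := by
      rw [k 34 (by omega), e₁ 34 (by omega) (by omega) (by omega)]; exact hrec
    simp only [Cm.Does.ite_iff, Cm.Does.seq_iff, Cm.Does.put0_iff, Cm.Does.skip_iff, Tm.ok_at2,
      Tm.ok_var, Tm.ok_lit, Tm.holds_at2, Tm.eval_var, Tm.eval_lit, Tm.eval_at2, hq, true_and,
      e34 2 (by omega), e34 3 (by omega)]
    cases o with
    | none =>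
      refine ⟨fun h => absurd rfl h, fun _ => fin σ₂ (fun _ _ _ _ _ => rfl) ?_⟩
      exact hA.congr (fun x y => by rw [DataGraph.apply_addNode_adj hδ]; simp) rfl rfl rfl
    | some b =>
      refine ⟨fun _ => ?_, fun h => absurd (show (1 : ℕ) ≠ 0 by omega) h⟩
      have hbV : b ∈ H.V := hδ.2 b rfl
      have hwb : w ≠ b := by rintro rfl; exact hwV hbV
      refine (addEdgeCm_does (a := w) (b := b) (V := insert w H.V) (R := H.graph.Adj)
        (hA.congr (fun _ _ => Iff.rfl)
          (Store.write_of_ne _ _ _ _ _ (by omega)) (Store.write_of_ne _ _ _ _ _ (by omega))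
          (Store.write_of_ne _ _ _ _ _ (by omega))) ?_ rfl (Finset.mem_insert_self _ _)
        (Finset.mem_insert_of_mem hbV) hwb (hwA b) (fun h => hwA b h.symm)).mono
        fun σ₃ k₃ h₃ => fin σ₃ (fun a h5 h6 h7 h61 => ?_) ?_
      · rw [Store.write_of_ne _ _ _ _ _ (by omega), k 60 (by omega),
          e₁ 60 (by omega) (by omega) (by omega), hw]
      · rw [k₃ a (by simp [Cm.keeps, addEdgeCm, addArc, Cm.put2, Cm.put1, *]),
          Store.write_of_ne _ _ _ _ _ h61]
      · refine h₃.congr (fun x y => ?_) rfl rfl rfl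
        rw [DataGraph.apply_addNode_adj hδ]
        simp only [Option.some.injEq]
        constructor
        · rintro (h | ⟨rfl, rfl⟩ | ⟨rfl, rfl⟩) <;> simp_all
        · rintro (h | ⟨rfl, rfl⟩ | ⟨rfl, rfl⟩) <;> simp_all

theorem DataIn.of_arcs {σ σ' : Store} {H : DataGraph} {δ : DUpd} (hσ : DataIn σ H)
    (hδ : (∃ a b, δ = .addEdge a b) ∨ ∃ a b, δ = .delEdge a b) (h3 : σ' 3 = σ 3) (h4 : σ' 4 = σ 4)
    (h8 : σ' 8 = σ 8) (hA : ArcsIn σ' H.V (H.apply δ).graph.Adj) : DataIn σ' (H.apply δ) := by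
  have hV : (H.apply δ).V = H.V := by
    rcases hδ with ⟨a, b, rfl⟩ | ⟨a, b, rfl⟩ <;> rfl
  have hl : (H.apply δ).label = H.label := by
    rcases hδ with ⟨a, b, rfl⟩ | ⟨a, b, rfl⟩ <;> rfl
  have hf : (H.apply δ).fresh = H.fresh := by
    rcases hδ with ⟨a, b, rfl⟩ | ⟨a, b, rfl⟩ <;> rfl
  rw [← hV] at hA
  refine ⟨?_, ?_, ?_, hA.nbrs, hA.adj, ?_⟩
  · rw [h3, hV]; exact hσ.node
  · rw [h4, hV, hl]; exact hσ.label
  · rw [h4, hf]; exact hσ.label_fresh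
  · rw [h8, hf]; exact hσ.fresh

/-- Add to the list in arrays 40, 41 the centers of the balls that contain both the node in
cell 60 and the node in cell 61. -/
def collect : Cm :=
  bfs 42 43 (.cell 60) (.cell 1) 1 ;; bfs 44 45 (.cell 61) (.cell 1) 1 ;;
  .rep 1 (.cell 42) (.ite (.ex 2 (.cell 44) (.eq (.at1 45 (.var 2)) (.at1 43 (.var 1))))
    (addNew 40 41 (.at1 43 (.var 1)) 2) .skip)

theorem collect_does {N a b r : ℕ} {ρ : ℕ → ℕ} {σ : Store} {H : DataGraph} {A : Finset ℕ}
    (hσ : DataIn σ H) (ha : σ 60 0 0 0 = a) (hb : σ 61 0 0 0 = b) (haV : a ∈ H.V) (hbV : b ∈ H.V)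
    (hr : σ 1 0 0 0 = r) (hrN : r ≤ N) (hNa : (H.ball a r).V.card ≤ N)
    (hNb : (H.ball b r).V.card ≤ N) (hA : Lists (fun j => σ 41 j 0 0) (σ 40 0 0 0) A)
    (hN : (A ∪ (H.ball a r).V ∩ (H.ball b r).V).card ≤ N) :
    collect.Does N ρ σ fun σ' => Lists (fun j => σ' 41 j 0 0) (σ' 40 0 0 0)
      (A ∪ (H.ball a r).V ∩ (H.ball b r).V) := by
  refine (bfs_does hσ (by omega) (by omega) (by omega) (by simp) (by simpa using ha) haV
    (fun σ' h => ⟨by simp, by simp [h 1, hr]⟩) hrN hNa).seq fun σ₁ k₁ h₁ => ?_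
  replace k₁ : ∀ a, a ≠ 43 → a ≠ 42 → σ₁ a = σ a := fun a h h' => k₁ a (bfs_keeps.2 ⟨h, h'⟩)
  have hσ₁ : DataIn σ₁ H := hσ.congr fun a _ _ => k₁ a (by omega) (by omega)
  refine (bfs_does hσ₁ (by omega) (by omega) (by omega) (by simp) (by simpa [k₁ 61] using hb) hbV
    (fun σ' h => ⟨by simp, by simp [h 1, k₁ 1, hr]⟩) hrN hNb).seq fun σ₂ k₂ h₂ => ?_
  replace k₂ : ∀ a, a ≠ 45 → a ≠ 44 → σ₂ a = σ₁ a := fun a h h' => k₂ a (bfs_keeps.2 ⟨h, h'⟩)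
  have h₁' : Lists (fun j => σ₂ 43 j 0 0) (σ₂ 42 0 0 0) (H.ball a r).V := by
    rw [k₂ 42 (by omega) (by omega), k₂ 43 (by omega) (by omega)]; exact h₁
  set f := fun j => σ₂ 43 j 0 0 with hf
  set C := fun q => A ∪ ((Finset.range q).image f) ∩ (H.ball b r).V with hC
  have hCn : C (σ₂ 42 0 0 0) = A ∪ (H.ball a r).V ∩ (H.ball b r).V := by
    rw [← h₁'.image_eq]
  have hCN : ∀ q ≤ σ₂ 42 0 0 0, (C q).card ≤ N := fun q hq => by
    refine (Finset.card_le_card ?_).trans hN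
    rw [← hCn]
    exact Finset.union_subset_union_right (Finset.inter_subset_inter_right
      (Finset.image_subset_image (Finset.range_subset_range.2 hq)))
  refine Cm.Does.rep (σ₂ 42 0 0 0) (fun q σ' => Lists (fun j => σ' 41 j 0 0) (σ' 40 0 0 0) (C q))
    (by simp) (by simp) (h₁'.card_eq ▸ hNa) ?_ ?_ ?_
  · rw [k₂ 40 (by omega) (by omega), k₂ 41 (by omega) (by omega), k₁ 40 (by omega) (by omega),
      k₁ 41 (by omega) (by omega)]
    simpa [hC] using hA
  · intro q hq σ₃ k₃ h₃
    have e43 : σ₃ 43 = σ₂ 43 := k₃ 43 rfl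
    have e44 : σ₃ 44 = σ₂ 44 := k₃ 44 rfl
    have e45 : σ₃ 45 = σ₂ 45 := k₃ 45 rfl
    have hmem : (∃ x < σ₂ 44 0 0 0, σ₂ 45 x 0 0 = f q) ↔ f q ∈ (H.ball b r).V := h₂.mem_iff.symm
    simp only [Cm.Does.ite_iff, Tm.ok_ex, Tm.ok_cell, Tm.eval_cell, Tm.ok_eq, Tm.ok_at1, Tm.ok_var,
      Tm.holds_ex, Tm.holds_eq, Tm.eval_at1, Tm.eval_var, Function.update_self, e43, e44, e45,
      Cm.Does.skip_iff, true_and, and_true, implies_true]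
    have hq1 : ∀ x, Function.update (Function.update ρ 1 q) 2 x 1 = q := fun x => by simp
    simp only [hq1]
    refine ⟨h₂.card_eq ▸ hNb, fun h => ?_, fun h => ?_⟩
    · refine (addNew_does (y := f q) (by omega) h₃ (hCN q hq.le) (by simp) (by simp [e43, hf])
        (fun x => by simp [e43, hf])).mono fun σ₄ _ h₄ => ?_
      refine h₄.1.of_mem_iff fun x => ?_
      have := hmem.1 h
      simp only [hC, Finset.range_add_one, Finset.image_insert, Finset.mem_insert,
        Finset.mem_union, Finset.mem_inter]
      constructor
      · rintro (rfl | h) <;> tauto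
      · tauto
    · refine h₃.of_mem_iff fun x => ?_
      have : f q ∉ (H.ball b r).V := fun h' => h (hmem.2 h')
      simp only [hC, Finset.range_add_one, Finset.image_insert, Finset.mem_insert,
        Finset.mem_union, Finset.mem_inter]
      constructor
      · tauto
      · rintro (h | ⟨rfl | h, h'⟩) <;> tauto
  · rintro σ₃ - h₃
    rwa [hCn] at h₃

/-- Process record number `var 0` of the data updates. -/
def dataStep : Cm :=
  .put0 60 (.at2 34 (.var 0) (.lit 1)) ;; .put0 61 (.at2 34 (.var 0) (.lit 2)) ;;
  .ite (.eq (.at2 34 (.var 0) (.lit 0)) (.lit 0)) (addEdgeCm ;; collect)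
    (.ite (.eq (.at2 34 (.var 0) (.lit 0)) (.lit 1)) (collect ;; delEdgeCm)
      (.ite (.eq (.at2 34 (.var 0) (.lit 0)) (.lit 2))
        (addNodeCm ;; .put0 61 (.cell 60) ;; collect)
        (.put0 61 (.cell 60) ;; collect ;; delNodeCm)))

/-- Process all data updates and collect the centers of the balls they may change. -/
def dataPhase : Cm := .rep 0 (.cell 33) dataStep

theorem DataIn.deg_le {σ : Store} {H : DataGraph} (hσ : DataIn σ H) {x r N : ℕ} (hx : x ∈ H.V)
    (hr : 1 ≤ r) (hN : (H.ball x r).V.card ≤ N) : σ 5 x 0 0 ≤ N :=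
  ((hσ.degree_le (DataGraph.self_mem_ball (t := 0) hx)).trans
    (Finset.card_le_card (DataGraph.ball_mono hr))).trans hN

/-- The touched balls are collected in the graph in which the edge or node is present: after an
insertion, and before a deletion. -/
theorem dataStep_does {N q r : ℕ} {ρ : ℕ → ℕ} {σ : Store} {H : DataGraph} {A : Finset ℕ}
    {δ : DUpd} (hσ : DataIn σ H) (hδ : δ.Valid H) (hq : ρ 0 = q)
    (hrec : ∀ f < 5, σ 34 q f 0 = δ.field f)
    (hL : ∀ w L o, δ = .addNode w L o → Lists (fun j => σ 35 q j 0) L.card L ∧ L.card ≤ N)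
    (hr : σ 1 0 0 0 = r) (hr1 : 1 ≤ r) (hrN : r ≤ N)
    (hN : ∀ x ∈ DataGraph.touched r H δ, (H.ball x r).V.card ≤ N ∧
      ((H.apply δ).ball x r).V.card ≤ N)
    (hA : Lists (fun j => σ 41 j 0 0) (σ 40 0 0 0) A)
    (hAN : (A ∪ DataGraph.touched r H δ).card ≤ N) :
    dataStep.Does N ρ σ fun σ' => DataIn σ' (H.apply δ) ∧
      Lists (fun j => σ' 41 j 0 0) (σ' 40 0 0 0) (A ∪ DataGraph.touched r H δ) := by
  simp only [dataStep, Cm.Does.seq_iff, Cm.Does.put0_iff, Tm.ok_at2, Tm.ok_var, Tm.ok_lit,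
    Tm.eval_at2, Tm.eval_var, Tm.eval_lit, hq, true_and]
  rw [Store.write_of_ne _ _ _ _ _ (show 34 ≠ 60 by omega), hrec 1 (by omega), hrec 2 (by omega)]
  set σ₁ := (σ.write 60 0 0 0 (δ.field 1)).write 61 0 0 0 (δ.field 2) with hσ₁
  have e₁ : ∀ a, a ≠ 60 → a ≠ 61 → σ₁ a = σ a := fun a h h' => by
    rw [hσ₁, Store.write_of_ne _ _ _ _ _ h', Store.write_of_ne _ _ _ _ _ h]
  have e60 : σ₁ 60 0 0 0 = δ.field 1 := by simp [hσ₁, Store.write_apply]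
  have e61 : σ₁ 61 0 0 0 = δ.field 2 := by simp [hσ₁, Store.write_apply]
  have hD₁ : DataIn σ₁ H := hσ.congr fun a _ _ => e₁ a (by omega) (by omega)
  have hr₁ : σ₁ 1 0 0 0 = r := by rw [e₁ 1 (by omega) (by omega), hr]
  have hA₁ : Lists (fun j => σ₁ 41 j 0 0) (σ₁ 40 0 0 0) A := by
    rw [e₁ 40 (by omega) (by omega), e₁ 41 (by omega) (by omega)]; exact hA
  have hrec₁ : ∀ f < 5, σ₁ 34 q f 0 = δ.field f := by
    rw [e₁ 34 (by omega) (by omega)]; exact hrec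
  have e0 := hrec₁ 0 (by omega)
  simp only [Cm.Does.ite_iff, Tm.ok_eq, Tm.ok_at2, Tm.ok_var, Tm.ok_lit, Tm.holds_eq, Tm.eval_at2,
    Tm.eval_var, Tm.eval_lit, hq, true_and, e0]
  cases δ with
  | addEdge a b =>
    refine ⟨fun _ => ?_, fun h => absurd rfl h⟩
    have hadj := DataGraph.apply_addEdge_adj hδ
    have hab : (H.apply (.addEdge a b)).graph.Adj a b := (hadj a b).2 (Or.inr (Or.inl ⟨rfl, rfl⟩))
    have ha' := DataGraph.mem_of_adj _ _ _ hab
    have hb' := DataGraph.mem_of_adj' hab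
    have hat : a ∈ DataGraph.touched r H (.addEdge a b) := Finset.mem_inter.2
      ⟨DataGraph.self_mem_ball ha', DataGraph.adj_mem_ball hab.symm hr1⟩
    have hbt : b ∈ DataGraph.touched r H (.addEdge a b) := Finset.mem_inter.2
      ⟨DataGraph.adj_mem_ball hab hr1, DataGraph.self_mem_ball hb'⟩
    refine (addEdgeCm_does hD₁.arcs e60 e61 hδ.1 hδ.2.1 hδ.2.2.1 hδ.2.2.2
      (fun h => hδ.2.2.2 h.symm)).seq fun σ₂ k₂ h₂ => ?_
    have hD₂ : DataIn σ₂ (H.apply (.addEdge a b)) :=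
      hD₁.of_arcs (Or.inl ⟨a, b, rfl⟩) (k₂ 3 rfl) (k₂ 4 rfl) (k₂ 8 rfl)
        (h₂.congr (fun x y => (hadj x y).symm) rfl rfl rfl)
    refine (collect_does hD₂ (by rw [k₂ 60 rfl]; exact e60) (by rw [k₂ 61 rfl]; exact e61) ha' hb'
      (by rw [k₂ 1 rfl, hr₁]) hrN (hN a hat).2 (hN b hbt).2
      (by rw [k₂ 40 rfl, k₂ 41 rfl]; exact hA₁) hAN).mono fun σ₃ k₃ h₃ => ⟨?_, h₃⟩
    exact hD₂.congr fun c h3 h8 => k₃ c (by interval_cases c <;> rfl)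
  | delEdge a b =>
    refine ⟨fun h => absurd h (show (1 : ℕ) ≠ 0 by omega), fun _ => ⟨fun _ => ?_,
      fun h => absurd rfl h⟩⟩
    have hab : H.graph.Adj a b := hδ
    have ha' := DataGraph.mem_of_adj _ _ _ hab
    have hb' := DataGraph.mem_of_adj' hab
    have hat : a ∈ DataGraph.touched r H (.delEdge a b) := Finset.mem_inter.2
      ⟨DataGraph.self_mem_ball ha', DataGraph.adj_mem_ball hab.symm hr1⟩
    have hbt : b ∈ DataGraph.touched r H (.delEdge a b) := Finset.mem_inter.2
      ⟨DataGraph.adj_mem_ball hab hr1, DataGraph.self_mem_ball hb'⟩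
    refine (collect_does hD₁ e60 e61 ha' hb' hr₁ hrN (hN a hat).1 (hN b hbt).1 hA₁ hAN).seq
      fun σ₂ k₂ h₂ => ?_
    have hD₂ : DataIn σ₂ H := hD₁.congr fun c h3 h8 => k₂ c (by interval_cases c <;> rfl)
    refine (delEdgeCm_does hD₂.arcs (by rw [k₂ 60 rfl]; exact e60) (by rw [k₂ 61 rfl]; exact e61)
      ha' hb' hab.ne hab hab.symm (hD₂.deg_le ha' hr1 (hN a hat).1)
      (hD₂.deg_le hb' hr1 (hN b hbt).1)).mono fun σ₃ k₃ h₃ => ⟨?_, ?_⟩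
    · exact hD₂.of_arcs (Or.inr ⟨a, b, rfl⟩) (k₃ 3 rfl) (k₃ 4 rfl) (k₃ 8 rfl)
        (h₃.congr (fun x y => (DataGraph.apply_delEdge_adj x y).symm) rfl rfl rfl)
    · rw [k₃ 40 rfl, k₃ 41 rfl]; exact h₂
  | addNode w L o =>
    have f0 : (DUpd.addNode w L o).field 0 = 2 := by cases o <;> rfl
    have f1 : (DUpd.addNode w L o).field 1 = w := by cases o <;> rfl
    refine ⟨fun h => absurd h (by omega), fun _ => ⟨fun h => absurd h (by omega),
      fun _ => ⟨fun _ => ?_, fun h => absurd f0 h⟩⟩⟩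
    have hw' : w ∈ (H.apply (.addNode w L o)).V := (DataGraph.mem_apply _ _).2 (Or.inl rfl)
    have hwt : w ∈ DataGraph.touched r H (.addNode w L o) := DataGraph.self_mem_ball hw'
    refine (addNodeCm_does hD₁ hδ (by rw [e60, f1]) hq hrec₁
      (by rw [e₁ 35 (by omega) (by omega)]; exact (hL w L o rfl).1) (hL w L o rfl).2).seq
      fun σ₂ k₂ hD₂ => ?_
    simp only [Cm.Does.seq_iff, Cm.Does.put0_iff, Tm.ok_cell, Tm.eval_cell, true_and]
    have e2 : ∀ c, c ≠ 61 → (σ₂.write 61 0 0 0 (σ₂ 60 0 0 0)) c = σ₂ c := fun c hc =>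
      Store.write_of_ne _ _ _ _ _ hc
    have e60' : σ₂ 60 0 0 0 = w := by rw [k₂ 60 rfl, e60, f1]
    have hD₃ : DataIn (σ₂.write 61 0 0 0 (σ₂ 60 0 0 0)) (H.apply (.addNode w L o)) :=
      hD₂.congr fun c _ _ => e2 c (by omega)
    have hu : A ∪ DataGraph.touched r H (.addNode w L o) =
        A ∪ ((H.apply (.addNode w L o)).ball w r).V ∩ ((H.apply (.addNode w L o)).ball w r).V := by
      rw [Finset.inter_self]; rfl
    rw [hu] at hAN ⊢
    refine (collect_does hD₃ (by rw [e2 60 (by omega), e60'])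
      (by simp [Store.write_apply, e60']) hw' hw'
      (by rw [e2 1 (by omega), k₂ 1 rfl, hr₁]) hrN (hN w hwt).2 (hN w hwt).2
      (by rw [e2 40 (by omega), e2 41 (by omega), k₂ 40 rfl, k₂ 41 rfl]; exact hA₁) hAN).mono
      fun σ₃ k₃ h₃ => ⟨?_, h₃⟩
    exact hD₃.congr fun c h3 h8 => k₃ c (by interval_cases c <;> rfl)
  | delNode w =>
    refine ⟨fun h => absurd h (show (3 : ℕ) ≠ 0 by omega), fun _ => ⟨fun h => absurd h
      (show (3 : ℕ) ≠ 1 by omega), fun _ => ⟨fun h => absurd h (show (3 : ℕ) ≠ 2 by omega),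
      fun _ => ?_⟩⟩⟩
    have hw' : w ∈ H.V := hδ
    have hwt : w ∈ DataGraph.touched r H (.delNode w) := DataGraph.self_mem_ball hw'
    simp only [Cm.Does.seq_iff, Cm.Does.put0_iff, Tm.ok_cell, Tm.eval_cell, true_and]
    rw [e60]
    have e2 : ∀ c, c ≠ 61 → (σ₁.write 61 0 0 0 ((DUpd.delNode w).field 1)) c = σ₁ c := fun c hc =>
      Store.write_of_ne _ _ _ _ _ hc
    have hD₂ : DataIn (σ₁.write 61 0 0 0 ((DUpd.delNode w).field 1)) H :=
      hD₁.congr fun c _ _ => e2 c (by omega)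
    have hu : A ∪ DataGraph.touched r H (.delNode w) =
        A ∪ (H.ball w r).V ∩ (H.ball w r).V := by
      rw [Finset.inter_self]; rfl
    rw [hu] at hAN ⊢
    refine (collect_does hD₂ (by rw [e2 60 (by omega)]; exact e60)
      (by simp [Store.write_apply, DUpd.field]) hw' hw'
      (by rw [e2 1 (by omega), hr₁]) hrN (hN w hwt).1 (hN w hwt).1
      (by rw [e2 40 (by omega), e2 41 (by omega)]; exact hA₁) hAN).mono fun σ₃ k₃ h₃ => ?_
    have hD₃ : DataIn σ₃ H := hD₂.congr fun c h3 h8 => k₃ c (by interval_cases c <;> rfl)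
    refine (delNodeCm_does hD₃ (by rw [k₃ 60 rfl, e2 60 (by omega)]; exact e60) hw'
      (hD₃.deg_le hw' hr1 (hN w hwt).1) fun x hx => ?_).mono fun σ₄ k₄ h₄ => ⟨h₄, ?_⟩
    · exact hD₃.deg_le (DataGraph.mem_of_adj' hx) hr1 (hN x (DataGraph.adj_mem_ball hx hr1)).1
    · rw [k₄ 40 rfl, k₄ 41 rfl]; exact h₃

theorem dataPhase_does {N r : ℕ} {ρ : ℕ → ℕ} {σ : Store} {G : DataGraph} {DG : List DUpd}
    {DP : List PUpd} {A : Finset ℕ} (hσ : DataIn σ G) (hD : ValidG G DG)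
    (hI : StoresInput σ DP DG) (hr : σ 1 0 0 0 = r) (hr1 : 1 ≤ r) (hrN : r ≤ N)
    (hdN : dsize DG ≤ N)
    (hN : ∀ x ∈ structural r G DG, ∀ n, ((G.applyAll (DG.take n)).ball x r).V.card ≤ N)
    (hA : Lists (fun j => σ 41 j 0 0) (σ 40 0 0 0) A)
    (hAN : (A ∪ structural r G DG).card ≤ N) :
    dataPhase.Does N ρ σ fun σ' => DataIn σ' (G.applyAll DG) ∧
      Lists (fun j => σ' 41 j 0 0) (σ' 40 0 0 0) (A ∪ structural r G DG) := by
  have hsz : ∀ δ ∈ DG, δ.size ≤ dsize DG := fun δ h =>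
    List.single_le_sum (by simp) _ (List.mem_map_of_mem h)
  have hlen : DG.length ≤ dsize DG := by
    clear hσ hD hI hdN hN hAN hsz
    induction DG with
    | nil => simp
    | cons δ D ih =>
      simp only [dsize, List.map_cons, List.sum_cons, List.length_cons] at ih ⊢
      have : 1 ≤ δ.size := by cases δ <;> simp [DUpd.size]
      omega
  refine Cm.Does.rep DG.length (fun q σ' => DataIn σ' (G.applyAll (DG.take q)) ∧
    Lists (fun j => σ' 41 j 0 0) (σ' 40 0 0 0) (A ∪ structural r G (DG.take q)))
    (by simp) (by simpa using hI.numG) (hlen.trans hdN) ?_ ?_ ?_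
  · exact ⟨by simpa [DataGraph.applyAll] using hσ, by simpa [structural] using hA⟩
  · rintro q hq σ₁ k₁ ⟨hD₁, hA₁⟩
    have ht : DG.take (q + 1) = DG.take q ++ [DG[q]] := by simp
    have hsplit : DG = DG.take q ++ DG[q] :: DG.drop (q + 1) := by simp
    have hval : DG[q].Valid (G.applyAll (DG.take q)) := by
      have := hD
      rw [hsplit, DataGraph.validG_append] at this
      exact this.2.1
    have hsub : structural r G (DG.take (q + 1)) ⊆ structural r G DG := by
      conv_rhs => rw [← List.take_append_drop (q + 1) DG, DataGraph.structural_append]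
      exact Finset.subset_union_left
    have happ : G.applyAll (DG.take (q + 1)) = (G.applyAll (DG.take q)).apply DG[q] := by
      rw [ht, DataGraph.applyAll_append]; rfl
    have hst : structural r G (DG.take (q + 1)) = structural r G (DG.take q) ∪
        DataGraph.touched r (G.applyAll (DG.take q)) DG[q] := by
      rw [ht, DataGraph.structural_append, DataGraph.structural_cons]
      simp [structural]
    have h? : DG[q]? = some DG[q] := by simp
    refine (dataStep_does hD₁ hval (q := q) (r := r) (by simp)
      (by rw [k₁ 34 rfl]; exact hI.recG q _ h?) (fun w L o e => ⟨?_, ?_⟩)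
      (by rw [k₁ 1 rfl, hr]) hr1 hrN (fun x hx => ⟨?_, ?_⟩) hA₁ ?_).mono fun σ₂ _ h₂ => ?_
    · rw [k₁ 35 rfl]; exact hI.labels q w L o (by rw [h?, e])
    · have := hsz _ (List.getElem_mem hq)
      rw [e] at this
      simp only [DUpd.size] at this
      omega
    · exact hN x (hsub (hst ▸ Finset.mem_union_right _ hx)) q
    · rw [← happ]; exact hN x (hsub (hst ▸ Finset.mem_union_right _ hx)) (q + 1)
    · rw [Finset.union_assoc, ← hst]
      exact (Finset.card_le_card (Finset.union_subset_union_right hsub)).trans hAN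
    · rw [happ, hst, ← Finset.union_assoc]; exact h₂
  · rintro σ₁ - h₁
    simpa using h₁

/-! ### Updating the pattern, the planner and the filter in memory -/

/-- The memory holds the pattern `P`. -/
structure PatIn (σ : Store) (P : Pattern) : Prop where
  nodes : Lists (fun j => σ 10 j 0 0) (σ 9 0 0 0) P.V
  label : ∀ u ∈ P.V, σ 11 u 0 0 = P.label u
  lo : ∀ u ∈ P.V, σ 12 u 0 0 = (P.cap u).fst
  hi : ∀ u ∈ P.V, σ 13 u 0 0 = (P.cap u).snd
  part : ∀ u ∈ P.V, σ 14 u 0 0 = P.part u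
  adj : ∀ u ∈ P.V, ∀ u' ∈ P.V, σ 15 u u' 0 = bit (P.graph.Adj u u')

theorem PatIn.congr {σ σ' : Store} {P : Pattern} (h : PatIn σ P)
    (hσ : ∀ a, 9 ≤ a → a ≤ 15 → σ' a = σ a) : PatIn σ' P := by
  have h9 := hσ 9 (by omega) (by omega)
  have h10 := hσ 10 (by omega) (by omega)
  have h11 := hσ 11 (by omega) (by omega)
  have h12 := hσ 12 (by omega) (by omega)
  have h13 := hσ 13 (by omega) (by omega)
  have h14 := hσ 14 (by omega) (by omega)
  have h15 := hσ 15 (by omega) (by omega)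
  constructor
  · rw [h9, h10]; exact h.nodes
  · rw [h11]; exact h.label
  · rw [h12]; exact h.lo
  · rw [h13]; exact h.hi
  · rw [h14]; exact h.part
  · rw [h15]; exact h.adj

/-- The memory holds the stacks `st s`, `s ≤ h`. -/
structure StackIn (σ : Store) (h : ℕ) (st : ℕ → List (ℕ × PUpd)) : Prop where
  height : ∀ s ≤ h, σ 28 s 0 0 = (st s).length
  stack : ∀ s ≤ h, ∀ q n δ, (st s)[q]? = some (n, δ) →
    σ 29 s q 0 = n ∧ ∀ f < 6, σ 30 s q f = δ.field f

theorem StackIn.congr {σ σ' : Store} {h : ℕ} {st : ℕ → List (ℕ × PUpd)} (hs : StackIn σ h st)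
    (h28 : σ' 28 = σ 28) (h29 : σ' 29 = σ 29) (h30 : σ' 30 = σ 30) : StackIn σ' h st := by
  constructor
  · rw [h28]; exact hs.height
  · rw [h29, h30]; exact hs.stack

/-- Store the place of the update in record `var 0` in cell 63, and its first two arguments in
cells 60 and 61. -/
def placeCm : Cm :=
  .put0 60 (.at2 32 (.var 0) (.lit 1)) ;; .put0 61 (.at2 32 (.var 0) (.lit 2)) ;;
  .put0 63 (.ite (.le (.at2 32 (.var 0) (.lit 0)) (.lit 1))
    (.ite (.eq (.at1 14 (.cell 60)) (.at1 14 (.cell 61))) (.at1 14 (.cell 60)) (.cell 0))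
    (.ite (.eq (.at2 32 (.var 0) (.lit 0)) (.lit 2)) (.at1 14 (.cell 61)) (.at1 14 (.cell 60))))

/-- If the update in record `var 0` is a deletion, clear the bit of its place, in cell 63, in all
filtering codes; their number is in cell 64. -/
def clearCm : Cm :=
  .ite (.or (.eq (.at2 32 (.var 0) (.lit 0)) (.lit 1)) (.eq (.at2 32 (.var 0) (.lit 0)) (.lit 3)))
    (.rep 1 (.cell 64) (.put2 26 (.var 1) (.cell 63) (.lit 0))) .skip

/-- Push the update in record `var 0` on the stack of its place, in cell 63. -/
def pushCm : Cm :=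
  .put2 29 (.cell 63) (.at1 28 (.cell 63)) (.add (.cell 27) (.add (.var 0) (.lit 1))) ;;
  .rep 1 (.lit 6) (.put 30 (.cell 63) (.at1 28 (.cell 63)) (.var 1) (.at2 32 (.var 0) (.var 1))) ;;
  .put1 28 (.cell 63) (.add (.at1 28 (.cell 63)) (.lit 1))

/-- Write a value to the adjacency test of the pattern nodes in cells 60 and 61. -/
def setAdj (e : Tm) : Cm := .put2 15 (.cell 60) (.cell 61) e ;; .put2 15 (.cell 61) (.cell 60) e

/-- Insert the pattern node in cell 60, attached to the one in cell 61. -/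
def addPatNode : Cm :=
  .rep 1 (.cell 9) (.put2 15 (.cell 60) (.at1 10 (.var 1)) (.lit 0) ;;
    .put2 15 (.at1 10 (.var 1)) (.cell 60) (.lit 0)) ;;
  .put2 15 (.cell 60) (.cell 60) (.lit 0) ;; setAdj (.lit 1) ;;
  .put1 11 (.cell 60) (.at2 32 (.var 0) (.lit 3)) ;;
  .put1 12 (.cell 60) (.at2 32 (.var 0) (.lit 4)) ;;
  .put1 13 (.cell 60) (.at2 32 (.var 0) (.lit 5)) ;;
  .put1 14 (.cell 60) (.at1 14 (.cell 61)) ;;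
  .put1 10 (.cell 9) (.cell 60) ;; .put0 9 (.add (.cell 9) (.lit 1))

/-- Remove the pattern node in cell 60. -/
def delPatNode : Cm :=
  .put0 62 (.sum 1 (.cell 9) (.ite (.eq (.at1 10 (.var 1)) (.cell 60)) (.var 1) (.lit 0))) ;;
  .put1 10 (.cell 62) (.at1 10 (.sub (.cell 9) (.lit 1))) ;;
  .put0 9 (.sub (.cell 9) (.lit 1))

/-- Apply the update in record `var 0`, with arguments in cells 60 and 61, to the pattern. -/
def applyPat : Cm :=
  .ite (.eq (.at2 32 (.var 0) (.lit 0)) (.lit 0)) (setAdj (.lit 1))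
    (.ite (.eq (.at2 32 (.var 0) (.lit 0)) (.lit 1)) (setAdj (.lit 0))
      (.ite (.eq (.at2 32 (.var 0) (.lit 0)) (.lit 2)) addPatNode
        (.ite (.eq (.at2 32 (.var 0) (.lit 0)) (.lit 3)) delPatNode
          (.put1 12 (.cell 60) (.at2 32 (.var 0) (.lit 2)) ;;
            .put1 13 (.cell 60) (.at2 32 (.var 0) (.lit 3))))))

theorem clearCm_does {N q pl n : ℕ} {δ : PUpd} {ρ : ℕ → ℕ} {σ : Store} (hq : ρ 0 = q)
    (hrec : ∀ f < 6, σ 32 q f 0 = δ.field f) (hpl : σ 63 0 0 0 = pl) (hn : σ 64 0 0 0 = n)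
    (hN : n ≤ N) :
    clearCm.Does N ρ σ fun σ' => ∀ x i, σ' 26 x i 0 =
      if x < n ∧ i = pl ∧ δ.IsDeletion then 0 else σ 26 x i 0 := by
  have e0 := hrec 0 (by omega)
  have hdel : (δ.field 0 = 1 ∨ δ.field 0 = 3) ↔ δ.IsDeletion := by
    cases δ <;> simp [PUpd.field, PUpd.IsDeletion]
  simp only [clearCm, Cm.Does.ite_iff, Tm.ok_or, Tm.ok_eq, Tm.ok_at2, Tm.ok_var, Tm.ok_lit,
    Tm.holds_or, Tm.holds_eq, Tm.eval_at2, Tm.eval_var, Tm.eval_lit, hq, e0, hdel, true_and,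
    implies_true, Cm.Does.skip_iff]
  refine ⟨fun h => ?_, fun h x i => by simp [h]⟩
  refine Cm.Does.rep n (fun m σ' => ∀ x i, σ' 26 x i 0 = if x < m ∧ i = pl then 0 else σ 26 x i 0)
    (by simp) (by simpa using hn) hN (by simp) ?_ ?_
  · intro m hm σ₁ k₁ h₁
    simp only [Cm.Does.put2_iff, Tm.ok_var, Tm.ok_cell, Tm.ok_lit, Tm.eval_var, Tm.eval_cell,
      Tm.eval_lit, Function.update_self, true_and, k₁ 63 rfl, hpl, Store.write_apply, h₁, and_true]
    intro x i
    by_cases hx : x = m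
    · subst hx; by_cases hi : i = pl <;> simp [hi]
    · have : x < m + 1 ↔ x < m := by omega
      simp [hx, this]
  · intro σ₁ _ h₁ x i
    simp [h₁, h]

theorem pushCm_does {N q pl h : ℕ} {δ : PUpd} {ρ : ℕ → ℕ} {σ : Store}
    {st : ℕ → List (ℕ × PUpd)} (hst : StackIn σ h st) (hq : ρ 0 = q)
    (hrec : ∀ f < 6, σ 32 q f 0 = δ.field f) (hpl : σ 63 0 0 0 = pl) (hplh : pl ≤ h)
    (hN : 6 ≤ N) :
    pushCm.Does N ρ σ fun σ' => StackIn σ' h fun s =>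
      st s ++ if pl = s then [(σ 27 0 0 0 + q + 1, δ)] else [] := by
  set t := (st pl).length with ht
  have e28 : σ 28 pl 0 0 = t := hst.height pl hplh
  simp only [pushCm, Cm.Does.seq_iff, Cm.Does.put2_iff, Tm.ok_cell, Tm.ok_at1, Tm.ok_add,
    Tm.ok_var, Tm.ok_lit, Tm.eval_cell, Tm.eval_at1, Tm.eval_add, Tm.eval_var, Tm.eval_lit, hq,
    hpl, e28, true_and]
  set σ₁ := σ.write 29 pl t 0 (σ 27 0 0 0 + (q + 1)) with hσ₁
  have e₁ : ∀ a, a ≠ 29 → σ₁ a = σ a := fun a h => Store.write_of_ne _ _ _ _ _ h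
  refine Cm.Does.rep 6 (fun m σ' => ∀ s p f, σ' 30 s p f =
      if s = pl ∧ p = t ∧ f < m then δ.field f else σ 30 s p f)
    (by simp) (by simp) hN ?_ ?_ ?_
  · intro s p f; simp [e₁ 30]
  · intro m hm σ₂ k₂ h₂
    simp only [Cm.Does.put_iff, Tm.ok_cell, Tm.ok_at1, Tm.ok_at2, Tm.ok_var, Tm.eval_cell,
      Tm.eval_at1, Tm.eval_at2, Tm.eval_var, Function.update_self, true_and, k₂ 63 rfl,
      k₂ 28 rfl, k₂ 32 rfl, e₁ 63 (by omega), e₁ 28 (by omega), e₁ 32 (by omega), hpl, e28,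
      Store.write_apply, h₂, (show Function.update ρ 1 m 0 = q by simp [hq]), hrec m hm]
    intro s p f
    by_cases hf : f = m
    · subst hf; simp
    · have : f < m + 1 ↔ f < m := by omega
      simp [hf, this]
  · intro σ₂ k₂ h₂
    simp only [Cm.Does.put1_iff, Tm.ok_cell, Tm.ok_at1, Tm.ok_add, Tm.ok_lit, Tm.eval_cell,
      Tm.eval_at1, Tm.eval_add, Tm.eval_lit, true_and, k₂ 63 rfl, k₂ 28 rfl, e₁ 63 (by omega),
      e₁ 28 (by omega), hpl, e28]
    constructor
    · intro s hs
      have := hst.height s hs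
      by_cases hps : s = pl
      · subst hps; simp [Store.write_apply, ht]
      · simp [Store.write_apply, hps, Ne.symm hps, k₂ 28 rfl, e₁ 28, this]
    · intro s hs p n δ' hp
      rw [Store.write_of_ne _ _ _ _ _ (show 29 ≠ 28 by omega),
        Store.write_of_ne _ _ _ _ _ (show 30 ≠ 28 by omega), k₂ 29 rfl]
      by_cases hps : pl = s
      · subst hps
        rw [if_pos rfl] at hp
        by_cases hpt : p < t
        · rw [List.getElem?_append_left hpt] at hp
          obtain ⟨g1, g2⟩ := hst.stack pl hs p n δ' hp
          refine ⟨by simp [hσ₁, Store.write_apply, hpt.ne, g1], fun f hf => ?_⟩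
          simp [h₂, hpt.ne, g2 f hf]
        · rw [List.getElem?_append_right (by omega)] at hp
          have hpt : p = t := by
            by_contra hne
            have : p - (st pl).length = (p - t - 1) + 1 := by omega
            rw [this] at hp
            simp at hp
          subst hpt
          simp only [ht, Nat.sub_self, List.getElem?_cons_zero, Option.some.injEq,
            Prod.mk.injEq] at hp
          obtain ⟨rfl, rfl⟩ := hp
          refine ⟨by simp [hσ₁, Store.write_apply, add_assoc], fun f hf => ?_⟩
          simp [h₂, hf]
      · rw [if_neg hps, List.append_nil] at hp
        obtain ⟨g1, g2⟩ := hst.stack s hs p n δ' hp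
        refine ⟨by simp [hσ₁, Store.write_apply, Ne.symm hps, g1], fun f hf => ?_⟩
        simp [h₂, Ne.symm hps, g2 f hf]

theorem placeCm_does {N q h : ℕ} {δ : PUpd} {ρ : ℕ → ℕ} {σ : Store} {P : Pattern}
    (hP : PatIn σ P) (hδ : δ.Valid P) (hq : ρ 0 = q) (hh : σ 0 0 0 0 = h)
    (hrec : ∀ f < 6, σ 32 q f 0 = δ.field f) :
    placeCm.Does N ρ σ fun σ' => σ' 60 0 0 0 = δ.field 1 ∧ σ' 61 0 0 0 = δ.field 2 ∧
      σ' 63 0 0 0 = δ.place h P := by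
  have e0 := hrec 0 (by omega)
  have e1 := hrec 1 (by omega)
  have e2 := hrec 2 (by omega)
  simp [placeCm, Store.write_apply, hq, e0, e1, e2, hh]
  cases δ with
  | addEdge a b => simp [PUpd.field, PUpd.place, hP.part _ hδ.1, hP.part _ hδ.2.1]
  | delEdge a b =>
    simp [PUpd.field, PUpd.place, hP.part _ (P.mem_of_adj _ _ hδ), hP.part _ (P.mem_of_adj' hδ)]
  | addNode a b => simp [PUpd.field, PUpd.place, hP.part _ hδ.2]
  | delNode a => simp [PUpd.field, PUpd.place, hP.part a hδ]
  | setCap a => simp [PUpd.field, PUpd.place, hP.part a hδ]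

theorem setAdj_does {N x a b : ℕ} {ρ : ℕ → ℕ} {σ : Store} (ha : σ 60 0 0 0 = a)
    (hb : σ 61 0 0 0 = b) :
    (setAdj (.lit x)).Does N ρ σ fun σ' => ∀ u w, σ' 15 u w 0 =
      if (u = a ∧ w = b) ∨ (u = b ∧ w = a) then x else σ 15 u w 0 := by
  simp only [setAdj, Cm.Does.seq_iff, Cm.Does.put2_iff, Tm.ok_cell, Tm.ok_lit, Tm.eval_cell,
    Tm.eval_lit, true_and, Store.write_apply, ha, hb]
  intro u w
  by_cases h1 : u = a ∧ w = b <;> by_cases h2 : u = b ∧ w = a <;> simp [h1, h2]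

theorem PatIn.of_adj {σ σ' : Store} {P : Pattern} {δ : PUpd} (hP : PatIn σ P)
    (hδ : (∃ a b, δ = .addEdge a b) ∨ ∃ a b, δ = .delEdge a b)
    (hσ : ∀ a, 9 ≤ a → a ≤ 14 → σ' a = σ a)
    (h : ∀ u w, u ∈ P.V → w ∈ P.V → σ' 15 u w 0 = bit ((P.apply δ).graph.Adj u w)) :
    PatIn σ' (P.apply δ) := by
  have hV : (P.apply δ).V = P.V := by rcases hδ with ⟨a, b, rfl⟩ | ⟨a, b, rfl⟩ <;> rfl
  have hl : (P.apply δ).label = P.label := by rcases hδ with ⟨a, b, rfl⟩ | ⟨a, b, rfl⟩ <;> rfl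
  have hc : (P.apply δ).cap = P.cap := by rcases hδ with ⟨a, b, rfl⟩ | ⟨a, b, rfl⟩ <;> rfl
  have hp : (P.apply δ).part = P.part := by rcases hδ with ⟨a, b, rfl⟩ | ⟨a, b, rfl⟩ <;> rfl
  refine ⟨?_, ?_, ?_, ?_, ?_, fun u hu w hw => h u w (hV ▸ hu) (hV ▸ hw)⟩
  · rw [hσ 9 (by omega) (by omega), hσ 10 (by omega) (by omega), hV]; exact hP.nodes
  · rw [hσ 11 (by omega) (by omega), hV, hl]; exact hP.label
  · rw [hσ 12 (by omega) (by omega), hV, hc]; exact hP.lo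
  · rw [hσ 13 (by omega) (by omega), hV, hc]; exact hP.hi
  · rw [hσ 14 (by omega) (by omega), hV, hp]; exact hP.part

theorem addPatNode_does {N q u u' c : ℕ} {I : NonemptyInterval ℕ} {ρ : ℕ → ℕ} {σ : Store}
    {P : Pattern} (hP : PatIn σ P) (hδ : (PUpd.addNode u u' c I).Valid P) (hq : ρ 0 = q)
    (hrec : ∀ f < 6, σ 32 q f 0 = (PUpd.addNode u u' c I).field f) (ha : σ 60 0 0 0 = u)
    (hb : σ 61 0 0 0 = u') (hN : P.V.card ≤ N) :
    addPatNode.Does N ρ σ fun σ' => PatIn σ' (P.apply (.addNode u u' c I)) := by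
  have hne : ∀ w ∈ P.V, w ≠ u := fun w hw e => hδ.1 (e ▸ hw)
  refine (Cm.Does.rep (σ 9 0 0 0) (fun m σ' => ∀ x w, σ' 15 x w 0 =
      if (x = u ∧ ∃ i < m, σ 10 i 0 0 = w) ∨ (w = u ∧ ∃ i < m, σ 10 i 0 0 = x) then 0
        else σ 15 x w 0)
    (Q := fun σ' => (∀ a, a ≠ 15 → σ' a = σ a) ∧ ∀ x ∈ P.V, σ' 15 u x 0 = 0 ∧ σ' 15 x u 0 = 0 ∧
      ∀ w ∈ P.V, σ' 15 x w 0 = σ 15 x w 0)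
    (by simp) (by simp) (hP.nodes.card_eq ▸ hN) ?_ ?_ ?_).seq fun σ₁ _ h₁ => ?_
  · intro x w; simp
  · intro m hm σ₁ k₁ h₁
    simp only [Cm.Does.seq_iff, Cm.Does.put2_iff, Tm.ok_cell, Tm.ok_at1, Tm.ok_var, Tm.ok_lit,
      Tm.eval_cell, Tm.eval_at1, Tm.eval_var, Tm.eval_lit, Function.update_self, true_and,
      k₁ 60 rfl, k₁ 10 rfl, ha]
    have hu : u ≠ σ 10 m 0 0 := fun e => hne _ (hP.nodes.mem hm) e.symm
    have hex : ∀ y, (∃ i < m + 1, σ 10 i 0 0 = y) ↔ (∃ i < m, σ 10 i 0 0 = y) ∨ y = σ 10 m 0 0 := by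
      intro y
      constructor
      · rintro ⟨i, hi, e⟩
        rcases Nat.lt_succ_iff_lt_or_eq.1 hi with hi | rfl
        exacts [Or.inl ⟨i, hi, e⟩, Or.inr e.symm]
      · rintro (⟨i, hi, e⟩ | rfl)
        exacts [⟨i, by omega, e⟩, ⟨m, by omega, rfl⟩]
    intro x w
    rw [Store.write_of_ne _ _ _ _ _ (show 10 ≠ 15 by omega),
      Store.write_of_ne _ _ _ _ _ (show 60 ≠ 15 by omega), k₁ 10 rfl, k₁ 60 rfl, ha]
    simp only [Store.write_apply, h₁, hex, true_and, and_true]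
    by_cases c1 : x = σ 10 m 0 0 ∧ w = u
    · rw [if_pos c1, if_pos (Or.inr ⟨c1.2, Or.inr c1.1⟩)]
    · by_cases c2 : x = u ∧ w = σ 10 m 0 0
      · rw [if_neg c1, if_pos c2, if_pos (Or.inl ⟨c2.1, Or.inr c2.2⟩)]
      · rw [if_neg c1, if_neg c2]
        refine if_congr ⟨?_, ?_⟩ rfl rfl
        · rintro (⟨h, h'⟩ | ⟨h, h'⟩)
          exacts [Or.inl ⟨h, Or.inl h'⟩, Or.inr ⟨h, Or.inl h'⟩]
        · rintro (⟨h, h' | h'⟩ | ⟨h, h' | h'⟩)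
          exacts [Or.inl ⟨h, h'⟩, absurd ⟨h, h'⟩ c2, Or.inr ⟨h, h'⟩, absurd ⟨h', h⟩ c1]
  · intro σ₁ k₁ h₁
    refine ⟨fun a h => k₁ a (by simp [Cm.keeps, Cm.put2, h]), fun x hx => ?_⟩
    obtain ⟨i, hi, e⟩ := hP.nodes.mem_iff.1 hx
    refine ⟨?_, ?_, fun w hw => ?_⟩
    · rw [h₁, if_pos (Or.inl ⟨rfl, i, hi, e⟩)]
    · rw [h₁, if_pos (Or.inr ⟨rfl, i, hi, e⟩)]
    · rw [h₁, if_neg]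
      rintro (⟨rfl, -⟩ | ⟨rfl, -⟩)
      exacts [hne _ hx rfl, hne _ hw rfl]
  · obtain ⟨k₁, h₁⟩ := h₁
    simp only [Cm.Does.seq_iff (p := .put2 15 _ _ _), Cm.Does.put2_iff, Tm.ok_cell, Tm.ok_lit,
      Tm.eval_cell, Tm.eval_lit, true_and, k₁ 60 (by omega), ha]
    set σ₂ := σ₁.write 15 u u 0 0 with hσ₂
    have k₂ : ∀ a, a ≠ 15 → σ₂ a = σ a := fun a h => by
      rw [hσ₂, Store.write_of_ne _ _ _ _ _ h, k₁ a h]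
    refine (setAdj_does (x := 1) (a := u) (b := u') (by rw [k₂ 60 (by omega)]; exact ha)
      (by rw [k₂ 61 (by omega)]; exact hb)).seq fun σ₃ k₃' h₃ => ?_
    have k₃ : ∀ a, a ≠ 15 → σ₃ a = σ a := fun a h => by
      rw [k₃' a (by simp [setAdj, Cm.keeps, Cm.put2, h]), k₂ a h]
    have e3 := hrec 3 (by omega)
    have e4 := hrec 4 (by omega)
    have e5 := hrec 5 (by omega)
    have hcell : ∀ a, a ≠ 15 → ∀ i j l, σ₃ a i j l = σ a i j l := fun a h i j l => by rw [k₃ a h]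
    have h15 : ∀ x ∈ insert u P.V, ∀ w ∈ insert u P.V, σ₃ 15 x w 0 =
        bit ((P.apply (.addNode u u' c I)).graph.Adj x w) := by
      intro x hx w hw
      rw [h₃, bit_congr (Pattern.apply_addNode_adj hδ x w)]
      have huA : ∀ y, ¬ P.graph.Adj u y := fun y h => hδ.1 (P.mem_of_adj _ _ h)
      have huA' : ∀ y, ¬ P.graph.Adj y u := fun y h => hδ.1 (P.mem_of_adj' h)
      by_cases hxw : (x = u ∧ w = u') ∨ (x = u' ∧ w = u)
      · rw [if_pos hxw]; simp [bit, hxw]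
      · rw [if_neg hxw, hσ₂, Store.write_apply]
        have hz : ¬ P.graph.Adj x w → 0 = bit (P.graph.Adj x w ∨ x = u ∧ w = u' ∨
            x = u' ∧ w = u) := fun h => by simp only [bit, h, hxw, or_self, if_false]
        by_cases hxu : x = u
        · have hA : ¬ P.graph.Adj x w := by rw [hxu]; exact huA w
          rw [← hz hA]
          by_cases hwu : w = u
          · rw [if_pos ⟨rfl, hxu, hwu, rfl⟩]
          · rw [if_neg (by tauto), hxu, (h₁ w ((Finset.mem_insert.1 hw).resolve_left hwu)).1]
        · have hxV := (Finset.mem_insert.1 hx).resolve_left hxu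
          rw [if_neg (by tauto)]
          by_cases hwu : w = u
          · rw [← hz (by rw [hwu]; exact huA' x), hwu, (h₁ x hxV).2.1]
          · have hwV := (Finset.mem_insert.1 hw).resolve_left hwu
            rw [(h₁ x hxV).2.2 w hwV, hP.adj x hxV w hwV]
            simp only [bit, hxw, or_false]
    simp only [Cm.Does.seq_iff, Cm.Does.put1_iff, Cm.Does.put0_iff, Tm.ok_cell, Tm.ok_at1,
      Tm.ok_at2, Tm.ok_add, Tm.ok_var, Tm.ok_lit, Tm.eval_cell, Tm.eval_at1, Tm.eval_at2,
      Tm.eval_add, Tm.eval_var, Tm.eval_lit, true_and]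
    simp only [Store.write_apply, hcell 60 (by omega), hcell 61 (by omega), hcell 32 (by omega),
      hcell 14 (by omega), hcell 9 (by omega), ha, hb, hq, e3, e4, e5]
    norm_num only [false_and, if_false]
    have hV : (P.apply (.addNode u u' c I)).V = insert u P.V := rfl
    refine ⟨?_, ?_, ?_, ?_, ?_, ?_⟩
    · rw [hV]
      have := hP.nodes.push (z := u) (g := fun j => if j = σ 9 0 0 0 then u else σ 10 j 0 0) hδ.1
        (fun j hj => by simp [hj.ne]) (by simp)
      simpa [Store.write_apply, hcell 10] using this
    · intro w hw
      rw [Pattern.apply_label]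
      rcases Finset.mem_insert.1 hw with rfl | hw
      · simp [Store.write_apply, PUpd.field]
      · simp [Store.write_apply, hne w hw, hcell 11, hP.label w hw]
    · intro w hw
      rw [Pattern.apply_cap]
      rcases Finset.mem_insert.1 hw with rfl | hw
      · simp [Store.write_apply, PUpd.field]
      · simp [Store.write_apply, hne w hw, hcell 12, hP.lo w hw]
    · intro w hw
      rw [Pattern.apply_cap]
      rcases Finset.mem_insert.1 hw with rfl | hw
      · simp [Store.write_apply, PUpd.field]
      · simp [Store.write_apply, hne w hw, hcell 13, hP.hi w hw]
    · intro w hw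
      rw [Pattern.apply_part]
      rcases Finset.mem_insert.1 hw with rfl | hw
      · simp [Store.write_apply, hP.part _ hδ.2]
      · simp [Store.write_apply, hne w hw, hcell 14, hP.part w hw]
    · intro x hx w hw
      simpa [Store.write_apply] using h15 x hx w hw

theorem delPatNode_does {N u : ℕ} {ρ : ℕ → ℕ} {σ : Store}
    {P : Pattern} (hP : PatIn σ P) (hδ : (PUpd.delNode u).Valid P)
    (ha : σ 60 0 0 0 = u) (hN : P.V.card ≤ N) :
    delPatNode.Does N ρ σ fun σ' => PatIn σ' (P.apply (.delNode u)) := by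
  obtain ⟨p, hp, hpu⟩ := hP.nodes.mem_iff.1 hδ
  have hsum : (∑ j ∈ Finset.range (σ 9 0 0 0), if σ 10 j 0 0 = u then j else 0) = p := by
    rw [Finset.sum_eq_single_of_mem p (Finset.mem_range.2 hp)]
    · simp [hpu]
    · intro j hj hjp
      rw [if_neg]
      rintro e
      exact hjp (hP.nodes.inj (Finset.mem_range.1 hj) hp (by rw [e, hpu]))
  have hcard := hP.nodes.card_eq ▸ hN
  simp [delPatNode, Store.write_apply, ha, hsum, hcard]
  have hsub : ∀ w ∈ (P.apply (.delNode u)).V, w ∈ P.V := fun w hw =>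
    ((Pattern.mem_apply _ _).1 hw).2
  have hnode : (P.apply (.delNode u)).V = P.V.erase u := rfl
  refine ⟨?_, ?_, ?_, ?_, ?_, ?_⟩
  · rw [hnode, ← hpu]
    have := hP.nodes.swapRemove hp
      (g := fun j => if j = p then σ 10 (σ 9 0 0 0 - 1) 0 0 else σ 10 j 0 0)
      (by simp) (fun j hj hjp => by simp [hjp])
    simpa [Store.write_apply] using this
  · intro w hw
    rw [Pattern.apply_label]
    simpa [Store.write_apply] using hP.label w (hsub w hw)
  · intro w hw
    rw [Pattern.apply_cap]
    simpa [Store.write_apply] using hP.lo w (hsub w hw)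
  · intro w hw
    rw [Pattern.apply_cap]
    simpa [Store.write_apply] using hP.hi w (hsub w hw)
  · intro w hw
    rw [Pattern.apply_part]
    simpa [Store.write_apply] using hP.part w (hsub w hw)
  · intro x hx w hw
    have hx' := (Pattern.mem_apply _ _).1 hx
    have hw' := (Pattern.mem_apply _ _).1 hw
    have := hP.adj x hx'.2 w hw'.2
    rw [bit_congr (Pattern.apply_delNode_adj x w)]
    simp only [hx'.1, hw'.1, ne_eq, not_false_eq_true, and_true]
    simpa [Store.write_apply] using this

theorem applyPat_does {N q : ℕ} {δ : PUpd} {ρ : ℕ → ℕ} {σ : Store} {P : Pattern}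
    (hP : PatIn σ P) (hδ : δ.Valid P) (hq : ρ 0 = q)
    (hrec : ∀ f < 6, σ 32 q f 0 = δ.field f) (ha : σ 60 0 0 0 = δ.field 1)
    (hb : σ 61 0 0 0 = δ.field 2) (hN : P.V.card ≤ N) :
    applyPat.Does N ρ σ fun σ' => PatIn σ' (P.apply δ) := by
  have e0 := hrec 0 (by omega)
  simp only [applyPat, Cm.Does.ite_iff, Tm.ok_eq, Tm.ok_at2, Tm.ok_var, Tm.ok_lit, Tm.holds_eq,
    Tm.eval_at2, Tm.eval_var, Tm.eval_lit, hq, true_and, e0]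
  cases δ with
  | addEdge a b =>
    refine ⟨fun _ => ?_, fun h => absurd rfl h⟩
    refine (setAdj_does ha hb).mono fun σ' k h => hP.of_adj (Or.inl ⟨a, b, rfl⟩)
      (fun c _ _ => k c (by simp [setAdj, Cm.keeps, Cm.put2]; omega)) fun x w hx hw => ?_
    rw [h, hP.adj x hx w hw, bit_congr (Pattern.apply_addEdge_adj hδ x w)]
    simp only [PUpd.field, bit, List.getD_cons_succ, List.getD_cons_zero]
    split_ifs <;> first | rfl | (exfalso; tauto)
  | delEdge a b =>
    refine ⟨fun h => absurd h (show (1 : ℕ) ≠ 0 by omega), fun _ => ⟨fun _ => ?_,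
      fun h => absurd rfl h⟩⟩
    refine (setAdj_does ha hb).mono fun σ' k h => hP.of_adj (Or.inr ⟨a, b, rfl⟩)
      (fun c _ _ => k c (by simp [setAdj, Cm.keeps, Cm.put2]; omega)) fun x w hx hw => ?_
    rw [h, hP.adj x hx w hw, bit_congr (Pattern.apply_delEdge_adj x w)]
    simp only [PUpd.field, bit, List.getD_cons_succ, List.getD_cons_zero]
    split_ifs <;> first | rfl | (exfalso; tauto)
  | addNode u u' c I =>
    refine ⟨fun h => absurd h (show (2 : ℕ) ≠ 0 by omega), fun _ => ⟨fun h => absurd h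
      (show (2 : ℕ) ≠ 1 by omega), fun _ => ⟨fun _ => ?_, fun h => absurd rfl h⟩⟩⟩
    exact addPatNode_does hP hδ hq hrec ha hb hN
  | delNode u =>
    refine ⟨fun h => absurd h (show (3 : ℕ) ≠ 0 by omega), fun _ => ⟨fun h => absurd h
      (show (3 : ℕ) ≠ 1 by omega), fun _ => ⟨fun h => absurd h (show (3 : ℕ) ≠ 2 by omega),
      fun _ => ⟨fun _ => ?_, fun h => absurd rfl h⟩⟩⟩⟩
    exact delPatNode_does hP hδ ha hN
  | setCap u I =>
    refine ⟨fun h => absurd h (show (4 : ℕ) ≠ 0 by omega), fun _ => ⟨fun h => absurd h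
      (show (4 : ℕ) ≠ 1 by omega), fun _ => ⟨fun h => absurd h (show (4 : ℕ) ≠ 2 by omega),
      fun _ => ⟨fun h => absurd h (show (4 : ℕ) ≠ 3 by omega), fun _ => ?_⟩⟩⟩⟩
    have e2 := hrec 2 (by omega)
    have e3 := hrec 3 (by omega)
    simp [Store.write_apply, ha, hq, e2, e3]
    refine ⟨hP.nodes, hP.label, ?_, ?_, hP.part, hP.adj⟩
    · intro w hw
      have := hP.lo w hw
      rw [Pattern.apply_cap]
      by_cases hwu : w = u <;> simp [Store.write_apply, PUpd.field, hwu]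
      simpa [hwu] using this
    · intro w hw
      have := hP.hi w hw
      rw [Pattern.apply_cap]
      by_cases hwu : w = u <;> simp [Store.write_apply, PUpd.field, hwu]
      simpa [hwu] using this

/-- Process record number `var 0` of the pattern updates. -/
def patStep : Cm := placeCm ;; clearCm ;; pushCm ;; applyPat

theorem patStep_does {N q h n : ℕ} {δ : PUpd} {ρ : ℕ → ℕ} {σ : Store} {P : Pattern}
    {st : ℕ → List (ℕ × PUpd)} (hP : PatIn σ P) (hδ : δ.Valid P) (hf : P.Fragmented h)
    (hst : StackIn σ h st) (hq : ρ 0 = q) (hh : σ 0 0 0 0 = h) (hn : σ 64 0 0 0 = n)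
    (hrec : ∀ f < 6, σ 32 q f 0 = δ.field f) (hnN : n ≤ N) (h6 : 6 ≤ N) (hN : P.V.card ≤ N) :
    patStep.Does N ρ σ fun σ' => PatIn σ' (P.apply δ) ∧
      (StackIn σ' h fun s =>
        st s ++ if δ.place h P = s then [(σ 27 0 0 0 + q + 1, δ)] else []) ∧
      ∀ x i, σ' 26 x i 0 = if x < n ∧ i = δ.place h P ∧ δ.IsDeletion then 0 else σ 26 x i 0 := by
  refine (placeCm_does hP hδ hq hh hrec).seq fun σ₁ k₁ ⟨h60, h61, h63⟩ => ?_
  refine (clearCm_does hq (by rw [k₁ 32 rfl]; exact hrec) h63 (by rw [k₁ 64 rfl]; exact hn)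
    hnN).seq fun σ₂ k₂ h₂ => ?_
  have hst₂ : StackIn σ₂ h st := hst.congr (by rw [k₂ 28 rfl, k₁ 28 rfl])
    (by rw [k₂ 29 rfl, k₁ 29 rfl]) (by rw [k₂ 30 rfl, k₁ 30 rfl])
  refine (pushCm_does hst₂ hq (by rw [k₂ 32 rfl, k₁ 32 rfl]; exact hrec)
    (by rw [k₂ 63 rfl]; exact h63) (hf.place_le hδ) h6).seq fun σ₃ k₃ h₃ => ?_
  have hP₃ : PatIn σ₃ P := hP.congr fun a h9 h15 => by
    rw [k₃ a (by interval_cases a <;> rfl), k₂ a (by interval_cases a <;> rfl),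
      k₁ a (by interval_cases a <;> rfl)]
  refine (applyPat_does hP₃ hδ hq (by rw [k₃ 32 rfl, k₂ 32 rfl, k₁ 32 rfl]; exact hrec)
    (by rw [k₃ 60 rfl, k₂ 60 rfl]; exact h60) (by rw [k₃ 61 rfl, k₂ 61 rfl]; exact h61) hN).mono
    fun σ₄ k₄ h₄ => ⟨h₄, ?_, ?_⟩
  · rw [k₂ 27 rfl, k₁ 27 rfl] at h₃
    exact h₃.congr (k₄ 28 rfl) (k₄ 29 rfl) (k₄ 30 rfl)
  · rw [k₄ 26 rfl, k₃ 26 rfl, ← k₁ 26 rfl]; exact h₂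

/-! ### Type codes as numbers, and the balls selected by the filter -/

theorem codeNum_lt {c : Finset ℕ} {h : ℕ} (hc : c ⊆ Finset.range h) : codeNum c < 2 ^ h :=
  Nat.geomSum_lt le_rfl fun _ hk => Finset.mem_range.1 (hc hk)

theorem codeNum_inj {c d : Finset ℕ} (h : codeNum c = codeNum d) : c = d :=
  Finset.geomSum_injective (le_refl 2) h

theorem exists_codeNum {x h : ℕ} (hx : x < 2 ^ h) : ∃ c ⊆ Finset.range h, codeNum c = x := by
  refine ⟨x.bitIndices.toFinset, fun i hi => ?_, ?_⟩
  · rw [List.mem_toFinset] at hi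
    have h1 := Nat.two_pow_le_of_mem_bitIndices hi
    rw [Finset.mem_range]
    exact (Nat.pow_lt_pow_iff_right (by omega : 1 < 2)).1 (h1.trans_lt hx)
  · exact Finset.sum_toFinset_bitIndices_two_pow x

/-- Process all pattern updates. Cell 64 receives the number of type codes. -/
def patPhase : Cm :=
  .put0 64 (.lit 1) ;; .rep 0 (.cell 0) (.put0 64 (.add (.cell 64) (.cell 64))) ;;
  .rep 0 (.cell 31) patStep ;; .put0 27 (.add (.cell 27) (.cell 31))

theorem patPhase_does {N : ℕ} {ρ : ℕ → ℕ} {σ : Store} {S : State} {DP : List PUpd}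
    {DG : List DUpd} (hS : S.Inv) (hD : S.Admissible DP DG) (hσ : Stores σ S)
    (hI : StoresInput σ DP DG) (hN : 2 ^ S.h ≤ N) (h6 : 6 ≤ N)
    (hPN : S.P.V.card + DP.length ≤ N) :
    patPhase.Does N ρ σ fun σ' => PatIn σ' (S.P.applyAll DP) ∧
      StackIn σ' S.h (fun s => planner S.h s S.base 0 (S.log ++ DP)) ∧
      σ' 27 0 0 0 = (S.log ++ DP).length ∧ σ' 64 0 0 0 = 2 ^ S.h ∧
      ∀ c ⊆ Finset.range S.h, ∀ i < S.h, σ' 26 (codeNum c) i 0 = bit (i ∈ S.bfNew DP c) := by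
  simp only [patPhase, Cm.Does.seq_iff (p := .put0 64 _), Cm.Does.put0_iff, Tm.ok_lit, Tm.eval_lit,
    true_and]
  set σ₀ := σ.write 64 0 0 0 1 with hσ₀
  have e₀ : ∀ a, a ≠ 64 → σ₀ a = σ a := fun a h => Store.write_of_ne _ _ _ _ _ h
  have hhN : S.h ≤ N := (Nat.lt_two_pow_self).le.trans hN
  refine (Cm.Does.rep S.h (fun m σ' => σ' 64 0 0 0 = 2 ^ m) (by simp)
    (by simp [e₀ 0, hσ.data.h]) hhN (by simp [hσ₀, Store.write_apply]) ?_
    (fun σ' _ h => h)).seq fun σ₁ k₁' h₁ => ?_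
  · intro m _ σ' _ h
    simp only [Cm.Does.put0_iff, Tm.ok_add, Tm.ok_cell, Tm.eval_add, Tm.eval_cell, h]
    simp [Store.write_apply, pow_succ]; omega
  have k₁ : ∀ a, a ≠ 64 → σ₁ a = σ a := fun a h => by
    rw [k₁' a (by simp [Cm.keeps, Cm.put0, h]), e₀ a h]
  have hP₁ : PatIn σ₁ S.P := by
    have : PatIn σ S.P := ⟨hσ.pattern.nodes, hσ.pattern.label, hσ.pattern.lo, hσ.pattern.hi,
      hσ.pattern.part, hσ.pattern.adj⟩
    exact this.congr fun a _ _ => k₁ a (by omega)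
  have hst₁ : StackIn σ₁ S.h (fun s => planner S.h s S.base 0 S.log) := by
    have : StackIn σ S.h (fun s => planner S.h s S.base 0 S.log) := ⟨hσ.aux.height, hσ.aux.stack⟩
    exact this.congr (k₁ 28 (by omega)) (k₁ 29 (by omega)) (k₁ 30 (by omega))
  refine (Cm.Does.rep DP.length (fun q σ' => PatIn σ' (S.P.applyAll (DP.take q)) ∧
    StackIn σ' S.h (fun s => planner S.h s S.base 0 (S.log ++ DP.take q)) ∧
    ∀ c ⊆ Finset.range S.h, ∀ i < S.h, σ' 26 (codeNum c) i 0 = bit (i ∈ S.bfNew (DP.take q) c))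
    (by simp) (by simp [k₁ 31, hI.numP]) (by omega) ?_ ?_ (fun σ' _ h => h)).seq
      fun σ₂ k₂ ⟨hP₂, hst₂, hbf₂⟩ => ?_
  · refine ⟨by simpa [Pattern.applyAll] using hP₁, by simpa using hst₁, fun c hc i hi => ?_⟩
    rw [k₁ 26 (by omega), hσ.aux.bf c hc i hi]
    simp [State.bfNew, deletedIn]
  · rintro q hq σ₂ k₂ ⟨hP₂, hst₂, hbf₂⟩
    have ht : DP.take (q + 1) = DP.take q ++ [DP[q]] := by simp
    have hsplit : DP = DP.take q ++ DP[q] :: DP.drop (q + 1) := by simp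
    have hval := hD.validP
    rw [hsplit, validP_append] at hval
    have happ : S.P.applyAll (DP.take (q + 1)) = (S.P.applyAll (DP.take q)).apply DP[q] := by
      rw [ht, Pattern.applyAll_append]; rfl
    have h? : DP[q]? = some DP[q] := by simp
    have hcard := Pattern.card_applyAll (P := S.P) (DP.take q)
    rw [List.length_take] at hcard
    refine (patStep_does hP₂ hval.2.1 (hS.frag.applyAll hval.1) hst₂ (q := q) (by simp)
      (by rw [k₂ 0 rfl, k₁ 0 (by omega)]; exact hσ.data.h)
      (by rw [k₂ 64 rfl]; exact h₁)
      (by rw [k₂ 32 rfl, k₁ 32 (by omega)]; exact hI.recP q _ h?) hN h6 (by omega)).mono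
      fun σ₃ k₃ ⟨hP₃, hst₃, hbf₃⟩ => ⟨by rw [happ]; exact hP₃, ?_, fun c hc i hi => ?_⟩
    · have e : (fun s => planner S.h s S.base 0 (S.log ++ DP.take (q + 1))) = fun s =>
          planner S.h s S.base 0 (S.log ++ DP.take q) ++
            if DP[q].place S.h (S.P.applyAll (DP.take q)) = s
              then [(σ₂ 27 0 0 0 + q + 1, DP[q])] else [] := by
        funext s
        rw [ht, ← List.append_assoc, planner_append, Pattern.applyAll_append, k₂ 27 rfl,
          k₁ 27 (by omega), hσ.aux.log]
        simp only [planner, List.length_append, List.length_take, Nat.zero_add]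
        rw [min_eq_left hq.le]
        rfl
      rw [e]; exact hst₃
    · rw [hbf₃, hbf₂ c hc i hi, ht]
      simp only [codeNum_lt hc, true_and, State.bfNew, deletedIn_append, deletedIn,
        Finset.union_empty, Finset.mem_sdiff, Finset.mem_union, not_or]
      by_cases hdel : i = DP[q].place S.h (S.P.applyAll (DP.take q)) ∧ DP[q].IsDeletion
      · rw [if_pos hdel, if_pos hdel.2]; simp [bit, ← hdel.1]
      · rw [if_neg hdel]
        refine bit_congr ⟨fun h => ⟨h.1, h.2, ?_⟩, fun h => ⟨h.1, h.2.1⟩⟩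
        split_ifs with hd
        · simp only [Finset.mem_singleton]; tauto
        · simp
  · rw [List.take_length] at hP₂ hst₂ hbf₂
    simp only [Cm.Does.put0_iff, Tm.ok_add, Tm.ok_cell, Tm.eval_add, Tm.eval_cell, true_and]
    have k₃ : ∀ a, a ≠ 27 → (σ₂.write 27 0 0 0 (σ₂ 27 0 0 0 + σ₂ 31 0 0 0)) a = σ₂ a :=
      fun a h => Store.write_of_ne _ _ _ _ _ h
    refine ⟨hP₂.congr fun a _ _ => k₃ a (by omega),
      hst₂.congr (k₃ 28 (by omega)) (k₃ 29 (by omega)) (k₃ 30 (by omega)), ?_, ?_, ?_⟩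
    · rw [k₂ 27 rfl, k₂ 31 rfl, k₁ 27 (by omega), k₁ 31 (by omega), hσ.aux.log, hI.numP]
      simp [Store.write_apply]
    · rw [k₃ 64 (by omega), k₂ 64 rfl]; exact h₁
    · rw [k₃ 26 (by omega)]; exact hbf₂

/-- Collect the balls whose type code is selected by its filtering code, and reset these
filtering codes. -/
def filterPhase : Cm :=
  .put0 40 (.lit 0) ;;
  .rep 0 (.cell 64) (.ite
    (.all 1 (.cell 0) (.le (.at2 26 (.var 0) (.var 1)) (.at2 16 (.var 0) (.var 1))))
    (.rep 1 (.at1 17 (.var 0)) (addNew 40 41 (.at2 18 (.var 0) (.var 1)) 2) ;;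
      .rep 1 (.cell 0) (.put2 26 (.var 0) (.var 1) (.lit 1)))
    .skip)

theorem filterPhase_does {N : ℕ} {ρ : ℕ → ℕ} {σ : Store} {S : State} {DP : List PUpd}
    {DG : List DUpd} (hS : S.Inv) (hh : σ 0 0 0 0 = S.h) (hn : σ 64 0 0 0 = 2 ^ S.h)
    (hN : 2 ^ S.h ≤ N)
    (hfs : ∀ c ⊆ Finset.range S.h, ∀ i < S.h, σ 16 (codeNum c) i 0 = bit (i ∈ c))
    (hbf : ∀ c ⊆ Finset.range S.h, ∀ i < S.h, σ 26 (codeNum c) i 0 = bit (i ∈ S.bfNew DP c))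
    (hballs : ∀ c ⊆ Finset.range S.h, Lists (fun p => σ 18 (codeNum c) p 0)
      (σ 17 (codeNum c) 0 0) (S.G.V.filter fun v => S.tc v = c))
    (hAN : (S.G.V.filter fun v => S.bfNew DP (S.tc v) ⊆ S.tc v).card ≤ N) :
    filterPhase.Does N ρ σ fun σ' =>
      Lists (fun j => σ' 41 j 0 0) (σ' 40 0 0 0)
        (S.G.V.filter fun v => S.bfNew DP (S.tc v) ⊆ S.tc v) ∧
      ∀ c ⊆ Finset.range S.h, ∀ i < S.h,
        σ' 26 (codeNum c) i 0 = bit (i ∈ (S.next DP DG).bf c) := by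
  have hhN : S.h ≤ N := (Nat.lt_two_pow_self).le.trans hN
  simp only [filterPhase, Cm.Does.seq_iff (p := .put0 40 _), Cm.Does.put0_iff, Tm.ok_lit,
    Tm.eval_lit, true_and]
  set σ₀ := σ.write 40 0 0 0 0 with hσ₀
  have e₀ : ∀ a, a ≠ 40 → σ₀ a = σ a := fun a h => Store.write_of_ne _ _ _ _ _ h
  set A := fun m => S.G.V.filter fun v => S.bfNew DP (S.tc v) ⊆ S.tc v ∧ codeNum (S.tc v) < m
    with hA
  have hAsub : ∀ m, A m ⊆ S.G.V.filter fun v => S.bfNew DP (S.tc v) ⊆ S.tc v := fun m v hv => by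
    rw [Finset.mem_filter] at hv ⊢; exact ⟨hv.1, hv.2.1⟩
  -- Invariant: the type codes below `m` have been handled.
  refine Cm.Does.rep (2 ^ S.h) (fun m σ' =>
    Lists (fun j => σ' 41 j 0 0) (σ' 40 0 0 0) (A m) ∧
    ∀ c ⊆ Finset.range S.h, ∀ i < S.h, σ' 26 (codeNum c) i 0 =
      bit (i ∈ if codeNum c < m then (S.next DP DG).bf c else S.bfNew DP c))
    (by simp) (by simp [e₀ 64, hn]) hN ?_ ?_ ?_
  · refine ⟨?_, fun c hc i hi => ?_⟩
    · rw [show σ₀ 40 0 0 0 = 0 by simp [hσ₀, Store.write_apply]]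
      exact (Lists.zero _).of_mem_iff fun x => by simp [hA]
    · rw [e₀ 26 (by omega), hbf c hc i hi, if_neg (by omega)]
  · rintro m hm σ₁ k₁ ⟨hL₁, hbf₁⟩
    obtain ⟨c, hc, rfl⟩ := exists_codeNum hm
    have e0 : σ₁ 0 0 0 0 = S.h := by rw [k₁ 0 rfl, e₀ 0 (by omega), hh]
    have hbfc : ∀ i < S.h, σ₁ 26 (codeNum c) i 0 = bit (i ∈ S.bfNew DP c) := fun i hi => by
      rw [hbf₁ c hc i hi, if_neg (lt_irrefl _)]
    have hfs₁ : ∀ i < S.h, σ₁ 16 (codeNum c) i 0 = bit (i ∈ c) := fun i hi => by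
      rw [k₁ 16 rfl, e₀ 16 (by omega), hfs c hc i hi]
    have hcond : (∀ x < S.h, σ₁ 26 (codeNum c) x 0 ≤ σ₁ 16 (codeNum c) x 0) ↔
        S.bfNew DP c ⊆ c := by
      constructor
      · intro h i hi
        have hih := Finset.mem_range.1 (hS.bf c (Finset.mem_sdiff.1 hi).1)
        have := h i hih
        rw [hbfc i hih, hfs₁ i hih] at this
        by_contra hne
        simp [bit, hi, hne] at this
      · intro h i hi
        rw [hbfc i hi, hfs₁ i hi]
        by_cases hb : i ∈ S.bfNew DP c
        · simp [bit, hb, h hb]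
        · simp [bit, hb]
    simp only [Cm.Does.ite_iff, Tm.ok_all, Tm.ok_cell, Tm.ok_le, Tm.ok_at2, Tm.ok_var,
      Tm.holds_all, Tm.holds_le, Tm.eval_cell, Tm.eval_at2, Tm.eval_var, Function.update_self,
      Function.update_of_ne (show (0 : ℕ) ≠ 1 by omega), e0, hcond, hhN, true_and, and_true,
      implies_true, Cm.Does.skip_iff]
    have hlt : ∀ d : Finset ℕ, codeNum d < codeNum c + 1 ↔ codeNum d < codeNum c ∨ d = c := by
      intro d
      rw [Nat.lt_succ_iff_lt_or_eq]
      exact or_congr_right ⟨codeNum_inj, fun h => by rw [h]⟩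
    have hbfnext : ∀ σ' : Store, (∀ i < S.h, σ' 26 (codeNum c) i 0 =
          bit (i ∈ (S.next DP DG).bf c)) →
        (∀ d ⊆ Finset.range S.h, d ≠ c → ∀ i < S.h, σ' 26 (codeNum d) i 0 =
          σ₁ 26 (codeNum d) i 0) →
        ∀ d ⊆ Finset.range S.h, ∀ i < S.h, σ' 26 (codeNum d) i 0 =
          bit (i ∈ if codeNum d < codeNum c + 1 then (S.next DP DG).bf d else S.bfNew DP d) := by
      intro σ' h1 h2 d hd i hi
      by_cases hdc : d = c
      · subst hdc; rw [h1 i hi, if_pos (by omega)]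
      · rw [h2 d hd hdc i hi, hbf₁ d hd i hi]
        simp only [hlt, hdc, or_false]
    refine ⟨fun hsel => ?_, fun hsel => ⟨?_, ?_⟩⟩
    · set B := fun q => A (codeNum c) ∪ (Finset.range q).image fun p => σ 18 (codeNum c) p 0 with hB
      have hBn : ∀ x, x ∈ B (σ 17 (codeNum c) 0 0) ↔ x ∈ A (codeNum c + 1) := by
        intro x
        simp only [hB]
        rw [(hballs c hc).image_eq]
        simp only [hA, Finset.mem_union, Finset.mem_filter, hlt]
        constructor
        · rintro (h | ⟨h1, h2⟩)
          · exact ⟨h.1, h.2.1, Or.inl h.2.2⟩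
          · exact ⟨h1, by rw [h2]; exact hsel, Or.inr h2⟩
        · rintro ⟨h1, h2, h3 | h3⟩
          exacts [Or.inl ⟨h1, h2, h3⟩, Or.inr ⟨h1, h3⟩]
      have hBN : ∀ q ≤ σ 17 (codeNum c) 0 0, (B q).card ≤ N := fun q hq => by
        refine (Finset.card_le_card fun x hx => hAsub (codeNum c + 1) ((hBn x).1 ?_)).trans hAN
        exact Finset.union_subset_union_right (Finset.image_subset_image
          (Finset.range_subset_range.2 hq)) hx
      refine (Cm.Does.rep (σ 17 (codeNum c) 0 0)
        (fun q σ' => Lists (fun j => σ' 41 j 0 0) (σ' 40 0 0 0) (B q)) (by simp)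
        (by simp [k₁ 17 rfl, e₀ 17]) ?_ ?_ ?_ (fun σ' _ h => h)).seq fun σ₂ k₂ h₂ => ?_
      · rw [← (hballs c hc).card_eq]
        refine (Finset.card_le_card fun x hx => ?_).trans hAN
        rw [Finset.mem_filter] at hx ⊢
        exact ⟨hx.1, by rw [hx.2]; exact hsel⟩
      · simpa [hB] using hL₁
      · intro q hq σ₂ k₂ h₂
        have e18 : σ₂ 18 = σ 18 := by rw [k₂ 18 rfl, k₁ 18 rfl, e₀ 18 (by omega)]
        refine (addNew_does (y := σ 18 (codeNum c) q 0) (by omega) h₂ (hBN q hq.le) (by simp)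
          (by simp [e18]) (fun x => by simp [e18])).mono fun σ₃ _ h₃ => ?_
        have : B (q + 1) = insert (σ 18 (codeNum c) q 0) (B q) := by
          simp [hB, Finset.range_add_one, Finset.image_insert]
        rw [this]; exact h₃.1
      · have h₂' := h₂.of_mem_iff hBn
        refine Cm.Does.rep S.h (fun j σ' => ∀ x i, σ' 26 x i 0 =
          if x = codeNum c ∧ i < j then 1 else σ₁ 26 x i 0) (by simp)
          (by simp [k₂ 0 rfl, e0]) hhN (by simp [k₂ 26 rfl]) ?_ ?_
        · intro j hj σ₃ k₃ h₃
          simp only [Cm.Does.put2_iff, Tm.ok_var, Tm.ok_lit, Tm.eval_var, Tm.eval_lit,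
            Function.update_self, Function.update_of_ne (show (0 : ℕ) ≠ 1 by omega), true_and,
            Store.write_apply, h₃, and_true]
          intro x i
          by_cases hi : i = j
          · subst hi; by_cases hx : x = codeNum c <;> simp [hx]
          · have : i < j + 1 ↔ i < j := by omega
            simp [hi, this]
        · intro σ₃ k₃ h₃
          refine ⟨by rw [k₃ 40 rfl, k₃ 41 rfl]; exact h₂', hbfnext σ₃ ?_ ?_⟩
          · intro i hi
            rw [h₃, if_pos ⟨rfl, hi⟩]
            simp [State.next, if_pos hsel, bit, hi]
          · intro d hd hdc i hi
            rw [h₃, if_neg (fun h => hdc (codeNum_inj h.1))]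
    · refine hL₁.of_mem_iff fun x => ?_
      simp only [hA, Finset.mem_filter, hlt]
      refine and_congr_right fun _ => and_congr_right fun h2 => ⟨Or.inl, fun h => h.resolve_right ?_⟩
      intro e
      rw [e] at h2
      exact hsel h2
    · refine hbfnext σ₁ (fun i hi => ?_) fun d _ _ i _ => rfl
      rw [hbfc i hi]
      simp only [State.next, if_neg hsel]
  · rintro σ₁ - ⟨hL₁, hbf₁⟩
    refine ⟨hL₁.of_mem_iff fun x => ?_, fun c hc i hi => ?_⟩
    · simp only [hA, Finset.mem_filter, codeNum_lt (S.tc_subset x), and_true]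
    · rw [hbf₁ c hc i hi, if_pos (codeNum_lt hc)]

/-! ### Graph simulation by refinement -/

/-- A match relation that need not involve all pattern nodes. -/
structure IsSim (Q : Pattern) (B : DataGraph) (M : Finset (ℕ × ℕ)) : Prop where
  subset : M ⊆ Q.V ×ˢ B.V
  label : ∀ u w, (u, w) ∈ M → Q.label u ∈ B.label w
  adj : ∀ u w, (u, w) ∈ M → ∀ u', Q.graph.Adj u u' → ∃ w', B.graph.Adj w w' ∧ (u', w') ∈ M

/-- The greatest simulation of the pattern in the data graph. Unlike `maxMatch` it is nonempty
for some graphs that do not match the pattern. -/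
noncomputable def simRel (Q : Pattern) (B : DataGraph) : Finset (ℕ × ℕ) :=
  (Q.V ×ˢ B.V).filter fun p => ∃ M, IsSim Q B M ∧ p ∈ M

theorem IsSim.le {Q : Pattern} {B : DataGraph} {M : Finset (ℕ × ℕ)} (h : IsSim Q B M) :
    M ⊆ simRel Q B := fun _ hp => Finset.mem_filter.2 ⟨h.subset hp, M, h, hp⟩

theorem simRel_isSim (Q : Pattern) (B : DataGraph) : IsSim Q B (simRel Q B) where
  subset := Finset.filter_subset _ _
  label u w hp := by
    obtain ⟨M, hM, hm⟩ := (Finset.mem_filter.1 hp).2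
    exact hM.label u w hm
  adj u w hp u' hu' := by
    obtain ⟨M, hM, hm⟩ := (Finset.mem_filter.1 hp).2
    obtain ⟨w', hw', hm'⟩ := hM.adj u w hm u' hu'
    exact ⟨w', hw', hM.le hm'⟩

theorem IsMatch.isSim {Q : Pattern} {B : DataGraph} {M : Finset (ℕ × ℕ)} (h : IsMatch Q B M) :
    IsSim Q B M := ⟨h.subset, h.label, h.adj⟩

theorem simRel_isMatch {Q : Pattern} {B : DataGraph}
    (h : ∀ u ∈ Q.V, ∃ w, (u, w) ∈ simRel Q B) : IsMatch Q B (simRel Q B) :=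
  ⟨(simRel_isSim Q B).subset, (simRel_isSim Q B).label, h, (simRel_isSim Q B).adj⟩

theorem matches_iff_simRel {Q : Pattern} {B : DataGraph} :
    Matches Q B ↔ ∀ u ∈ Q.V, ∃ w, (u, w) ∈ simRel Q B := by
  constructor
  · rintro ⟨M, hM⟩ u hu
    obtain ⟨w, hw⟩ := hM.total u hu
    exact ⟨w, hM.isSim.le hw⟩
  · exact fun h => ⟨_, simRel_isMatch h⟩

theorem maxMatch_eq_simRel {Q : Pattern} {B : DataGraph} (h : Matches Q B) :
    maxMatch Q B = simRel Q B := by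
  refine subset_antisymm (maxMatch_isMatch Q B h).isSim.le fun p hp => ?_
  have hM := simRel_isMatch (matches_iff_simRel.1 h)
  exact Finset.mem_filter.2 ⟨hM.subset hp, _, hM, hp⟩

theorem maxMatch_eq_empty {Q : Pattern} {B : DataGraph} (h : ¬ Matches Q B) :
    maxMatch Q B = ∅ :=
  Finset.filter_eq_empty_iff.2 fun _ _ ⟨M, hM, _⟩ => h ⟨M, hM⟩

/-- The memory holds a pattern and a data graph for a computation of the greatest simulation:
node lists in arrays 46, 47 and 42, 43, and labels and adjacency tests. -/
structure SimIn (σ : Store) (Q : Pattern) (B : DataGraph) : Prop where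
  nodes : Lists (fun j => σ 47 j 0 0) (σ 46 0 0 0) Q.V
  ball : Lists (fun j => σ 43 j 0 0) (σ 42 0 0 0) B.V
  label : ∀ u ∈ Q.V, σ 11 u 0 0 = Q.label u
  adj : ∀ u ∈ Q.V, ∀ u' ∈ Q.V, σ 15 u u' 0 = bit (Q.graph.Adj u u')
  labels : ∀ w ∈ B.V, ∀ c, σ 4 w c 0 = bit (c ∈ B.label w)
  edges : ∀ w ∈ B.V, ∀ w' ∈ B.V, σ 7 w w' 0 = bit (B.graph.Adj w w')

theorem SimIn.congr {σ σ' : Store} {Q : Pattern} {B : DataGraph} (h : SimIn σ Q B)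
    (hσ : ∀ a, a ≠ 48 → a ≠ 49 → σ' a = σ a) : SimIn σ' Q B := by
  constructor
  · rw [hσ 46 (by omega) (by omega), hσ 47 (by omega) (by omega)]; exact h.nodes
  · rw [hσ 42 (by omega) (by omega), hσ 43 (by omega) (by omega)]; exact h.ball
  · rw [hσ 11 (by omega) (by omega)]; exact h.label
  · rw [hσ 15 (by omega) (by omega)]; exact h.adj
  · rw [hσ 4 (by omega) (by omega)]; exact h.labels
  · rw [hσ 7 (by omega) (by omega)]; exact h.edges

/-- The relation between pattern nodes and data nodes that array 48 holds. -/
noncomputable def relOf (σ : Store) (Q : Pattern) (B : DataGraph) : Finset (ℕ × ℕ) :=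
  (Q.V ×ˢ B.V).filter fun p => σ 48 p.1 p.2 0 ≠ 0

theorem mem_relOf {σ : Store} {Q : Pattern} {B : DataGraph} {u w : ℕ} :
    (u, w) ∈ relOf σ Q B ↔ (u ∈ Q.V ∧ w ∈ B.V) ∧ σ 48 u w 0 ≠ 0 := by
  simp [relOf]

/-- The pair `(u, w)` is justified by the relation `R`. -/
def Justified (Q : Pattern) (B : DataGraph) (R : Finset (ℕ × ℕ)) (u w : ℕ) : Prop :=
  ∀ u', Q.graph.Adj u u' → ∃ w', B.graph.Adj w w' ∧ (u', w') ∈ R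

/-- Node number `var d` of the pattern. -/
def qN (d : ℕ) : Tm := .at1 47 (.var d)

/-- Node number `var d` of the ball. -/
def bN (d : ℕ) : Tm := .at1 43 (.var d)

/-- Relate nodes according to their labels. -/
def simInit : Cm :=
  .rep 2 (.cell 46) (.rep 3 (.cell 42)
    (.put2 48 (qN 2) (bN 3) (.at2 4 (bN 3) (.at1 11 (qN 2)))))

/-- Remove all pairs that are not justified. -/
def simSweep : Cm :=
  .rep 4 (.cell 46) (.rep 5 (.cell 42)
    (.ite (.all 6 (.cell 46) (.ite (.at2 15 (qN 4) (qN 6))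
        (.ex 7 (.cell 42) (.and (.at2 7 (bN 5) (bN 7)) (.at2 48 (qN 6) (bN 7)))) (.lit 1)))
      .skip (.put2 48 (qN 4) (bN 5) (.lit 0))))

/-- Compute the greatest simulation in array 48, and in cell 49 whether it involves
all pattern nodes. As many sweeps as there are pairs suffice. -/
def sim : Cm :=
  simInit ;; .rep 2 (.cell 46) (.rep 3 (.cell 42) simSweep) ;;
  .put0 49 (.all 2 (.cell 46) (.ex 3 (.cell 42) (.at2 48 (qN 2) (bN 3))))

section simulation

variable {N : ℕ} {ρ : ℕ → ℕ} {σ : Store} {Q : Pattern} {B : DataGraph}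

theorem simInit_does (hσ : SimIn σ Q B) (hQN : Q.V.card ≤ N) (hBN : B.V.card ≤ N) :
    simInit.Does N ρ σ fun σ' => ∀ u ∈ Q.V, ∀ w ∈ B.V,
      (σ' 48 u w 0 ≠ 0 ↔ Q.label u ∈ B.label w) := by
  rw [hσ.nodes.card_eq] at hQN
  rw [hσ.ball.card_eq] at hBN
  have key : ∀ σ' : Store, (∀ a, a ≠ 48 → a ≠ 49 → σ' a = σ a) → ∀ i < σ 46 0 0 0,
      ∀ j < σ 42 0 0 0, σ' 4 (σ' 43 j 0 0) (σ' 11 (σ' 47 i 0 0) 0 0) 0 =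
        bit (Q.label (σ 47 i 0 0) ∈ B.label (σ 43 j 0 0)) := by
    intro σ' k i hi j hj
    have h' := hσ.congr k
    have e47 : σ' 47 = σ 47 := k _ (by omega) (by omega)
    have e43 : σ' 43 = σ 43 := k _ (by omega) (by omega)
    rw [e47, e43, h'.label _ (hσ.nodes.mem hi), h'.labels _ (hσ.ball.mem hj)]
  refine Cm.Does.rep (σ 46 0 0 0) (fun m σ' => ∀ i < m, ∀ w ∈ B.V,
    (σ' 48 (σ 47 i 0 0) w 0 ≠ 0 ↔ Q.label (σ 47 i 0 0) ∈ B.label w)) (by simp) (by simp) hQN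
    (by simp) ?_ ?_
  · intro i hi σ₁ k₁ h₁
    replace k₁ : ∀ a, a ≠ 48 → σ₁ a = σ a := fun a h => k₁ a (by simp [Cm.keeps, Cm.put2, h])
    refine Cm.Does.rep (σ 42 0 0 0) (fun m σ' => (∀ i' < i, ∀ w ∈ B.V,
      (σ' 48 (σ 47 i' 0 0) w 0 ≠ 0 ↔ Q.label (σ 47 i' 0 0) ∈ B.label w)) ∧ ∀ j < m,
      (σ' 48 (σ 47 i 0 0) (σ 43 j 0 0) 0 ≠ 0 ↔
        Q.label (σ 47 i 0 0) ∈ B.label (σ 43 j 0 0))) (by simp) (by simp [k₁ 42]) hBN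
      ⟨h₁, by simp⟩ ?_ ?_
    · rintro j hj σ₂ k₂ ⟨h₂, h₂'⟩
      have k : ∀ a, a ≠ 48 → σ₂ a = σ a := fun a h => by
        rw [k₂ a (by simp [Cm.keeps, Cm.put2, h]), k₁ a h]
      have e := key σ₂ (fun a h _ => k a h) i hi j hj
      rw [k 43 (by omega), k 47 (by omega)] at e
      simp only [Cm.Does.put2_iff, qN, bN, Tm.ok_at1, Tm.ok_at2, Tm.ok_var, Tm.eval_at1,
        Tm.eval_at2, Tm.eval_var, Function.update_self,
        Function.update_of_ne (show (2 : ℕ) ≠ 3 by omega), k 43 (by omega), k 47 (by omega),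
        true_and, Store.write_apply, and_true, e]
      constructor
      · intro i' hi' w hw
        rw [if_neg (fun h => hi'.ne (hσ.nodes.inj (hi'.trans hi) hi h.1))]
        exact h₂ i' hi' w hw
      · intro j' hj'
        by_cases hjj : j' = j
        · subst hjj; simp [bit_ne_zero]
        · rw [if_neg (fun h => hjj (hσ.ball.inj (by omega) hj h))]
          exact h₂' j' (by omega)
    · rintro σ₂ - ⟨h₂, h₂'⟩ i' hi' w hw
      rcases Nat.lt_succ_iff_lt_or_eq.1 hi' with h | rfl
      · exact h₂ i' h w hw
      · obtain ⟨j, hj, rfl⟩ := hσ.ball.mem_iff.1 hw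
        exact h₂' j hj
  · intro σ₁ _ h₁ u hu w hw
    obtain ⟨i, hi, rfl⟩ := hσ.nodes.mem_iff.1 hu
    exact h₁ i hi w hw

theorem simSweep_keeps {a : ℕ} (h : a ≠ 48) : simSweep.keeps a = true := by
  simp [simSweep, Cm.keeps, Cm.put2, h]

/-- A sweep reaches the greatest simulation or makes the relation smaller. -/
theorem simSweep_does (hσ : SimIn σ Q B) (hQN : Q.V.card ≤ N) (hBN : B.V.card ≤ N)
    (hlab : ∀ u w, (u, w) ∈ relOf σ Q B → Q.label u ∈ B.label w)
    (hsub : simRel Q B ⊆ relOf σ Q B) :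
    simSweep.Does N ρ σ fun σ' => simRel Q B ⊆ relOf σ' Q B ∧ relOf σ' Q B ⊆ relOf σ Q B ∧
      (relOf σ' Q B = relOf σ Q B → relOf σ Q B = simRel Q B) := by
  rw [hσ.nodes.card_eq] at hQN
  rw [hσ.ball.card_eq] at hBN
  set R₀ := relOf σ Q B with hR₀
  have step : ∀ i < σ 46 0 0 0, ∀ j < σ 42 0 0 0, ∀ (σ' : Store) (ρ' : ℕ → ℕ),
      ρ' 4 = i → ρ' 5 = j → (∀ a, a ≠ 48 → σ' a = σ a) → simRel Q B ⊆ relOf σ' Q B →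
      relOf σ' Q B ⊆ R₀ →
      (Cm.ite (.all 6 (.cell 46) (.ite (.at2 15 (qN 4) (qN 6))
        (.ex 7 (.cell 42) (.and (.at2 7 (bN 5) (bN 7)) (.at2 48 (qN 6) (bN 7)))) (.lit 1)))
      .skip (.put2 48 (qN 4) (bN 5) (.lit 0))).Does N ρ' σ' fun σ'' =>
        simRel Q B ⊆ relOf σ'' Q B ∧ relOf σ'' Q B ⊆ relOf σ' Q B ∧
        (relOf σ'' Q B = R₀ → (σ 47 i 0 0, σ 43 j 0 0) ∈ R₀ →
          Justified Q B R₀ (σ 47 i 0 0) (σ 43 j 0 0)) := by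
    intro i hi j hj σ' ρ' hρ4 hρ5 k h1 h2
    have h' := hσ.congr fun a h _ => k a h
    have hu := hσ.nodes.mem hi
    have hw := hσ.ball.mem hj
    have hcond : (∀ x < σ 46 0 0 0, if σ' 15 (σ 47 i 0 0) (σ 47 x 0 0) 0 ≠ 0 then
        ∃ y < σ 42 0 0 0, σ' 7 (σ 43 j 0 0) (σ 43 y 0 0) 0 ≠ 0 ∧
          σ' 48 (σ 47 x 0 0) (σ 43 y 0 0) 0 ≠ 0 else (1 : ℕ) ≠ 0) ↔
        Justified Q B (relOf σ' Q B) (σ 47 i 0 0) (σ 43 j 0 0) := by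
      constructor
      · intro h u' hu'
        obtain ⟨x, hx, rfl⟩ := hσ.nodes.mem_iff.1 (Q.mem_of_adj' hu')
        have := h x hx
        rw [h'.adj _ hu _ (hσ.nodes.mem hx), if_pos (by simp [bit_ne_zero, hu'])] at this
        obtain ⟨y, hy, ha, hb⟩ := this
        rw [h'.edges _ hw _ (hσ.ball.mem hy), bit_ne_zero] at ha
        exact ⟨_, ha, mem_relOf.2 ⟨⟨hσ.nodes.mem hx, hσ.ball.mem hy⟩, hb⟩⟩
      · intro h x hx
        split_ifs with hx'
        · rw [h'.adj _ hu _ (hσ.nodes.mem hx), bit_ne_zero] at hx'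
          obtain ⟨w', hw', hr⟩ := h _ hx'
          rw [mem_relOf] at hr
          obtain ⟨y, hy, rfl⟩ := hσ.ball.mem_iff.1 hr.1.2
          refine ⟨y, hy, ?_, hr.2⟩
          rw [h'.edges _ hw _ hr.1.2, bit_ne_zero]; exact hw'
        · omega
    have e46 := k 46 (by omega)
    have e47 := k 47 (by omega)
    have e42 := k 42 (by omega)
    have e43 := k 43 (by omega)
    simp only [Cm.Does.ite_iff, Tm.ok_all, Tm.ok_ite, Tm.ok_ex, Tm.ok_and, Tm.ok_cell, Tm.ok_at2,
      Tm.ok_at1, Tm.ok_var, Tm.ok_lit, qN, bN, Tm.holds_all, Tm.holds_ite, Tm.holds_ex,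
      Tm.holds_and, Tm.holds_at2, Tm.holds_lit, Tm.eval_cell, Tm.eval_at1, Tm.eval_var,
      Tm.eval_lit, Function.update_self, Function.update_of_ne (show (4 : ℕ) ≠ 6 by omega),
      Function.update_of_ne (show (5 : ℕ) ≠ 6 by omega),
      Function.update_of_ne (show (6 : ℕ) ≠ 7 by omega),
      Function.update_of_ne (show (5 : ℕ) ≠ 7 by omega), e46, e47, e42, e43, hρ4, hρ5, hcond,
      Cm.Does.skip_iff, Cm.Does.put2_iff, true_and, and_true, implies_true, hQN, hBN]
    refine ⟨fun hc => ⟨h1, subset_rfl, fun e _ => e ▸ hc⟩, fun hc => ?_⟩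
    have hrel : relOf (σ'.write 48 (σ 47 i 0 0) (σ 43 j 0 0) 0 0) Q B =
        (relOf σ' Q B).erase (σ 47 i 0 0, σ 43 j 0 0) := by
      ext ⟨u, w⟩
      rw [Finset.mem_erase, mem_relOf, mem_relOf, Store.write_apply]
      by_cases h : u = σ 47 i 0 0 ∧ w = σ 43 j 0 0
      · simp [h]
      · simp only [and_true, ne_eq, Prod.mk.injEq, h, not_false_eq_true, if_false, true_and]
    rw [hrel]
    refine ⟨fun p hp => Finset.mem_erase.2 ⟨?_, h1 hp⟩, Finset.erase_subset _ _, fun e hm => ?_⟩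
    · rintro rfl
      refine hc fun u' hu' => ?_
      obtain ⟨w', hw', hm⟩ := (simRel_isSim Q B).adj _ _ hp _ hu'
      exact ⟨w', hw', h1 hm⟩
    · rw [← e] at hm
      exact absurd rfl (Finset.mem_erase.1 hm).1
  refine Cm.Does.rep (σ 46 0 0 0) (fun m σ' => simRel Q B ⊆ relOf σ' Q B ∧ relOf σ' Q B ⊆ R₀ ∧
    (relOf σ' Q B = R₀ → ∀ i < m, ∀ w ∈ B.V, (σ 47 i 0 0, w) ∈ R₀ →
      Justified Q B R₀ (σ 47 i 0 0) w)) (by simp) (by simp) hQN ⟨hsub, subset_rfl, by simp⟩ ?_ ?_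
  · rintro i hi σ₁ k₁ ⟨h₁, h₁', h₁''⟩
    replace k₁ : ∀ a, a ≠ 48 → σ₁ a = σ a := fun a h => k₁ a (by simp [Cm.keeps, Cm.put2, h])
    refine Cm.Does.rep (σ 42 0 0 0) (fun m σ' => simRel Q B ⊆ relOf σ' Q B ∧
      relOf σ' Q B ⊆ relOf σ₁ Q B ∧ (relOf σ' Q B = R₀ → ∀ j < m,
        (σ 47 i 0 0, σ 43 j 0 0) ∈ R₀ → Justified Q B R₀ (σ 47 i 0 0) (σ 43 j 0 0)))
      (by simp) (by simp [k₁ 42]) hBN ⟨h₁, subset_rfl, by simp⟩ ?_ ?_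
    · rintro j hj σ₂ k₂ ⟨h₂, h₂', h₂''⟩
      have k : ∀ a, a ≠ 48 → σ₂ a = σ a := fun a h => by
        rw [k₂ a (by simp [Cm.keeps, Cm.put2, h]), k₁ a h]
      refine (step i hi j hj σ₂ _ (by simp) (by simp) k h₂ (h₂'.trans h₁')).mono ?_
      rintro σ₃ - ⟨h₃, h₃', h₃''⟩
      refine ⟨h₃, h₃'.trans h₂', fun e j' hj' => ?_⟩
      rcases Nat.lt_succ_iff_lt_or_eq.1 hj' with h | rfl
      · exact h₂'' (subset_antisymm (h₂'.trans h₁') (e ▸ h₃')) j' h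
      · exact h₃'' e
    · rintro σ₂ - ⟨h₂, h₂', h₂''⟩
      refine ⟨h₂, h₂'.trans h₁', fun e i' hi' w hw => ?_⟩
      rcases Nat.lt_succ_iff_lt_or_eq.1 hi' with h | rfl
      · exact h₁'' (subset_antisymm h₁' (e ▸ h₂')) i' h w hw
      · obtain ⟨j, hj, rfl⟩ := hσ.ball.mem_iff.1 hw
        exact h₂'' e j hj
  · rintro σ₁ - ⟨h₁, h₁', h₁''⟩
    refine ⟨h₁, h₁', fun e => subset_antisymm ?_ hsub⟩
    refine IsSim.le ⟨Finset.filter_subset _ _, hlab, fun u w hp => ?_⟩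
    obtain ⟨⟨hu, hw⟩, -⟩ := mem_relOf.1 hp
    obtain ⟨i, hi, rfl⟩ := hσ.nodes.mem_iff.1 hu
    exact h₁'' e i hi w hw hp

theorem sim_keeps {a : ℕ} (h : a ≠ 48) (h' : a ≠ 49) : sim.keeps a = true := by
  simp [sim, simInit, simSweep, Cm.keeps, Cm.put2, Cm.put0, h, h']

/-- The relation is only meaningful if all pattern nodes are matched, as the largest match relation
is empty otherwise. -/
theorem sim_does (hσ : SimIn σ Q B) (hQN : Q.V.card ≤ N) (hBN : B.V.card ≤ N) :
    sim.Does N ρ σ fun σ' => σ' 49 0 0 0 = bit (Matches Q B) ∧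
      (Matches Q B → ∀ u ∈ Q.V, ∀ w ∈ B.V, (σ' 48 u w 0 ≠ 0 ↔ (u, w) ∈ maxMatch Q B)) := by
  have hQN' := hQN
  have hBN' := hBN
  rw [hσ.nodes.card_eq] at hQN'
  rw [hσ.ball.card_eq] at hBN'
  refine (simInit_does hσ hQN hBN).seq fun σ₁ k₁ h₁ => ?_
  replace k₁ : ∀ a, a ≠ 48 → a ≠ 49 → σ₁ a = σ a := fun a h _ =>
    k₁ a (by simp [simInit, Cm.keeps, Cm.put2, h])
  -- After `m` sweeps the relation is the greatest simulation, or `m` pairs have been removed.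
  set I : ℕ → Store → Prop := fun m σ' => simRel Q B ⊆ relOf σ' Q B ∧
    relOf σ' Q B ⊆ relOf σ₁ Q B ∧ (relOf σ' Q B = simRel Q B ∨
      (relOf σ' Q B).card + m ≤ σ 46 0 0 0 * σ 42 0 0 0) with hI
  have hlab : ∀ u w, (u, w) ∈ relOf σ₁ Q B → Q.label u ∈ B.label w := fun u w h => by
    rw [mem_relOf] at h
    exact (h₁ u h.1.1 w h.1.2).1 h.2
  have h0 : I 0 σ₁ := by
    refine ⟨fun p hp => ?_, subset_rfl, Or.inr ?_⟩
    · have hs := (simRel_isSim Q B).subset hp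
      rw [Finset.mem_product] at hs
      exact mem_relOf.2 ⟨hs, (h₁ _ hs.1 _ hs.2).2 ((simRel_isSim Q B).label _ _ hp)⟩
    · rw [add_zero, ← hσ.nodes.card_eq, ← hσ.ball.card_eq, ← Finset.card_product]
      exact Finset.card_le_card (Finset.filter_subset _ _)
  refine (Cm.Does.rep (σ 46 0 0 0) (fun m => I (m * σ 42 0 0 0)) (by simp)
    (by simp [k₁ 46]) hQN' (by simpa using h0) ?_ (fun σ' _ h => h)).seq fun σ₂ k₂ h₂ => ?_
  · intro i hi σ₂ k₂ h₂
    replace k₂ : ∀ a, a ≠ 48 → a ≠ 49 → σ₂ a = σ a := fun a h h' =>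
      (k₂ a (simSweep_keeps (a := a) h)).trans (k₁ a h h')
    refine Cm.Does.rep (σ 42 0 0 0) (fun m => I (i * σ 42 0 0 0 + m)) (by simp)
      (by simp [k₂ 42]) hBN' (by simpa using h₂) ?_ (fun σ' _ h => by
        rw [Nat.succ_mul]; exact h)
    rintro j hj σ₃ k₃ ⟨h₃, h₃', h₃''⟩
    have k : ∀ a, a ≠ 48 → a ≠ 49 → σ₃ a = σ a := fun a h h' =>
      (k₃ a (simSweep_keeps (a := a) h)).trans (k₂ a h h')
    refine (simSweep_does (hσ.congr k) hQN hBN (fun u w h => hlab u w (h₃' h)) h₃).mono ?_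
    rintro σ₄ - ⟨h₄, h₄', h₄''⟩
    refine ⟨h₄, h₄'.trans h₃', ?_⟩
    rcases h₃'' with h | h
    · exact Or.inl (subset_antisymm (h ▸ h₄') h₄)
    · by_cases e : relOf σ₄ Q B = relOf σ₃ Q B
      · exact Or.inl (e.trans (h₄'' e))
      · have := Finset.card_lt_card (Finset.ssubset_iff_subset_ne.2 ⟨h₄', e⟩)
        exact Or.inr (by omega)
  · obtain ⟨h₂, -, h₂''⟩ := h₂
    replace k₂ : ∀ a, a ≠ 48 → a ≠ 49 → σ₂ a = σ a := fun a h h' =>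
      (k₂ a (simSweep_keeps (a := a) h)).trans (k₁ a h h')
    have hrel : relOf σ₂ Q B = simRel Q B := by
      rcases h₂'' with h | h
      · exact h
      -- As many removals as there are pairs leave nothing, so the greatest simulation is empty.
      · have h0 : relOf σ₂ Q B = ∅ := Finset.card_eq_zero.1 (by omega)
        rw [h0] at h₂ ⊢
        exact (Finset.subset_empty.1 h₂).symm
    have hm : ∀ u ∈ Q.V, ∀ w ∈ B.V, (σ₂ 48 u w 0 ≠ 0 ↔ (u, w) ∈ simRel Q B) := by
      intro u hu w hw
      rw [← hrel, mem_relOf]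
      simp [hu, hw]
    have e46 := k₂ 46 (by omega) (by omega)
    have e47 := k₂ 47 (by omega) (by omega)
    have e42 := k₂ 42 (by omega) (by omega)
    have e43 := k₂ 43 (by omega) (by omega)
    have hcond : (∀ x < σ 46 0 0 0, ∃ y < σ 42 0 0 0, σ₂ 48 (σ 47 x 0 0) (σ 43 y 0 0) 0 ≠ 0) ↔
        Matches Q B := by
      rw [matches_iff_simRel]
      constructor
      · intro h u hu
        obtain ⟨x, hx, rfl⟩ := hσ.nodes.mem_iff.1 hu
        obtain ⟨y, hy, h⟩ := h x hx
        exact ⟨_, (hm _ (hσ.nodes.mem hx) _ (hσ.ball.mem hy)).1 h⟩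
      · intro h x hx
        obtain ⟨w, hw⟩ := h _ (hσ.nodes.mem hx)
        have hwB := (Finset.mem_product.1 ((simRel_isSim Q B).subset hw)).2
        obtain ⟨y, hy, rfl⟩ := hσ.ball.mem_iff.1 hwB
        exact ⟨y, hy, (hm _ (hσ.nodes.mem hx) _ hwB).2 hw⟩
    simp only [Cm.Does.put0_iff, Tm.ok_all, Tm.ok_ex, Tm.ok_cell, Tm.ok_at2, Tm.ok_at1, Tm.ok_var,
      Tm.eval_all, Tm.holds_ex, Tm.holds_at2, qN, bN, Tm.eval_cell, Tm.eval_at1, Tm.eval_var,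
      Function.update_self, Function.update_of_ne (show (2 : ℕ) ≠ 3 by omega), e46, e47, e42, e43,
      hQN', hBN', hcond, true_and, and_true, implies_true]
    refine ⟨by simp [Store.write_apply, bit], fun hM u hu w hw => ?_⟩
    rw [Store.write_of_ne _ _ _ _ _ (show 48 ≠ 49 by omega), maxMatch_eq_simRel hM]
    exact hm u hu w hw

end simulation

/-! ### Bringing the affected balls up to date -/

namespace Lists

variable {f g : ℕ → ℕ} {n c m : ℕ} {A : Finset ℕ} {p : ℕ → Prop} [DecidablePred p]

/-- Listing the elements with a property: the next element has it. -/
theorem filter_push (hg : Lists g n A) (hm : m < n)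
    (hf : Lists f c (((Finset.range m).image g).filter p)) (hp : p (g m)) {f' : ℕ → ℕ}
    (h : ∀ j < c, f' j = f j) (h' : f' c = g m) :
    Lists f' (c + 1) (((Finset.range (m + 1)).image g).filter p) := by
  refine (hf.push (z := g m) (fun hz => ?_) h h').of_mem_iff fun x => ?_
  · simp only [Finset.mem_filter, Finset.mem_image, Finset.mem_range] at hz
    obtain ⟨⟨j, hj, e⟩, -⟩ := hz
    exact hj.ne (hg.inj (hj.trans hm) hm e)
  · simp only [Finset.range_add_one, Finset.image_insert, Finset.mem_insert, Finset.mem_filter]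
    constructor
    · rintro (rfl | h)
      exacts [⟨Or.inl rfl, hp⟩, ⟨Or.inr h.1, h.2⟩]
    · rintro ⟨rfl | h, h'⟩
      exacts [Or.inl rfl, Or.inr ⟨h, h'⟩]

/-- Listing the elements with a property: the next element does not have it. -/
theorem filter_skip (hf : Lists f c (((Finset.range m).image g).filter p)) (hp : ¬ p (g m)) :
    Lists f c (((Finset.range (m + 1)).image g).filter p) := by
  refine hf.of_mem_iff fun x => ?_
  simp only [Finset.range_add_one, Finset.image_insert, Finset.mem_insert, Finset.mem_filter]
  constructor
  · rintro ⟨h, h'⟩; exact ⟨Or.inr h, h'⟩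
  · rintro ⟨rfl | h, h'⟩
    exacts [absurd h' hp, ⟨h, h'⟩]

theorem filter_zero (f g : ℕ → ℕ) (p : ℕ → Prop) [DecidablePred p] :
    Lists f 0 (((Finset.range 0).image g).filter p) := (Lists.zero f).of_mem_iff (by simp)

end Lists

/-- The index from type codes to balls in memory, for balls with centers in `V` and type
codes `tc`. -/
structure LinksIn (σ : Store) (h : ℕ) (V : Finset ℕ) (tc : ℕ → Finset ℕ) : Prop where
  balls : ∀ c ⊆ Finset.range h, Lists (fun p => σ 18 (codeNum c) p 0) (σ 17 (codeNum c) 0 0)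
    (V.filter fun v => tc v = c)
  code : ∀ v ∈ V, σ 19 v 0 0 = codeNum (tc v)
  pos : ∀ v ∈ V, σ 20 v 0 0 < σ 17 (codeNum (tc v)) 0 0 ∧
    σ 18 (codeNum (tc v)) (σ 20 v 0 0) 0 = v
  range : ∀ v ∈ V, tc v ⊆ Finset.range h

theorem LinksIn.congr {σ σ' : Store} {h : ℕ} {V : Finset ℕ} {tc : ℕ → Finset ℕ}
    (hl : LinksIn σ h V tc) (hσ : ∀ a, 17 ≤ a → a ≤ 20 → σ' a = σ a) : LinksIn σ' h V tc := by
  have h17 := hσ 17 (by omega) (by omega)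
  have h18 := hσ 18 (by omega) (by omega)
  have h19 := hσ 19 (by omega) (by omega)
  have h20 := hσ 20 (by omega) (by omega)
  constructor
  · rw [h17, h18]; exact hl.balls
  · rw [h19]; exact hl.code
  · rw [h17, h18, h20]; exact hl.pos
  · exact hl.range

theorem LinksIn.of_eq {σ : Store} {h : ℕ} {V V' : Finset ℕ} {tc tc' : ℕ → Finset ℕ}
    (hl : LinksIn σ h V tc) (hV : ∀ v, v ∈ V ↔ v ∈ V') (ht : ∀ v ∈ V, tc' v = tc v) :
    LinksIn σ h V' tc' := by
  obtain rfl : V = V' := Finset.ext hV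
  refine ⟨fun c hc => (hl.balls c hc).of_mem_iff fun x => ?_, fun v hv => ?_, fun v hv => ?_,
    fun v hv => ?_⟩
  · simp only [Finset.mem_filter]
    exact and_congr_right fun hx => by rw [ht x hx]
  · rw [ht v hv]; exact hl.code v hv
  · rw [ht v hv]; exact hl.pos v hv
  · rw [ht v hv]; exact hl.range v hv

/-- Remove the ball with the center in cell 66 from the list of its type code. -/
def unlink : Cm :=
  .put0 67 (.at1 19 (.cell 66)) ;;
  .put0 68 (.at2 18 (.cell 67) (.sub (.at1 17 (.cell 67)) (.lit 1))) ;;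
  .put2 18 (.cell 67) (.at1 20 (.cell 66)) (.cell 68) ;;
  .put1 20 (.cell 68) (.at1 20 (.cell 66)) ;;
  .put1 17 (.cell 67) (.sub (.at1 17 (.cell 67)) (.lit 1))

/-- The last entry of the list takes the place of the removed one. -/
theorem unlink_does {N h v : ℕ} {ρ : ℕ → ℕ} {σ : Store} {V : Finset ℕ} {tc : ℕ → Finset ℕ}
    (hσ : LinksIn σ h V tc) (hv : σ 66 0 0 0 = v) (hvV : v ∈ V) :
    unlink.Does N ρ σ fun σ' => LinksIn σ' h (V.erase v) tc := by
  set c := tc v with hc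
  set n := σ 17 (codeNum c) 0 0 with hn
  set p := σ 20 v 0 0 with hp
  have hpn : p < n := (hσ.pos v hvV).1
  have hpv : σ 18 (codeNum c) p 0 = v := (hσ.pos v hvV).2
  have hL := hσ.balls c (hσ.range v hvV)
  set z := σ 18 (codeNum c) (n - 1) 0 with hz
  have hzm : z ∈ V ∧ tc z = c := Finset.mem_filter.1 (hL.mem (j := n - 1) (by omega))
  have e19 := hσ.code v hvV
  simp [unlink, Store.write_apply, hv, e19, ← hc, ← hn, ← hp, ← hz]
  have hpz : ∀ u ∈ V, tc u = c → u ≠ v → u ≠ z → σ 20 u 0 0 ≠ p ∧ σ 20 u 0 0 < n - 1 := by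
    intro u hu hut huv huz
    obtain ⟨h1, h2⟩ := hσ.pos u hu
    rw [hut] at h1 h2
    refine ⟨fun e => huv ?_, ?_⟩
    · rw [← h2, e]; exact hpv
    · by_contra hlt
      exact huz (by rw [← h2, hz]; congr 1; omega)
  refine ⟨fun d hd => ?_, fun u hu => ?_, fun u hu => ?_, fun u hu => ?_⟩
  · by_cases hdc : d = c
    · subst hdc
      have := hL.swapRemove (g := fun q => if q = p then z else σ 18 (codeNum c) q 0) hpn
        (by simp [hz, hn]) (fun j _ hj => by simp [hj])
      refine Lists.of_mem_iff (A := (V.filter fun v => tc v = c).erase (σ 18 (codeNum c) p 0)) ?_ ?_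
      · simpa [Store.write_apply] using this
      · intro x
        rw [hpv]
        simp only [Finset.mem_erase, Finset.mem_filter]; tauto
    · have hne : codeNum d ≠ codeNum c := fun e => hdc (codeNum_inj e)
      refine Lists.of_mem_iff (A := V.filter fun v => tc v = d) ?_ ?_
      · simpa [Store.write_apply, hne] using hσ.balls d hd
      · intro x
        simp only [Finset.mem_erase, Finset.mem_filter]
        refine ⟨fun h => ⟨⟨?_, h.1⟩, h.2⟩, fun h => ⟨h.1.2, h.2⟩⟩
        rintro rfl
        exact hdc (h.2.symm.trans hc.symm)
  · simpa [Store.write_apply] using hσ.code u (Finset.mem_of_mem_erase hu)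
  · have huv := Finset.ne_of_mem_erase hu
    have huV := Finset.mem_of_mem_erase hu
    obtain ⟨h1, h2⟩ := hσ.pos u huV
    by_cases huz : u = z
    · subst huz
      have : p < n - 1 := by
        refine lt_of_le_of_ne (by omega) fun e => huv ?_
        rw [hz, ← e]; exact hpv
      simp [Store.write_apply, hzm.2, this]
    · by_cases hut : tc u = c
      · obtain ⟨h3, h4⟩ := hpz u huV hut huv huz
        rw [hut] at h1 h2
        simp [Store.write_apply, hut, huz, h3, h4, h2]
      · have hne : codeNum (tc u) ≠ codeNum c := fun e => hut (codeNum_inj e)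
        simp [Store.write_apply, huz, hne, h1, h2]
  · exact hσ.range u (Finset.mem_of_mem_erase hu)

/-- Append the ball with the center in cell 66 to the list of the type code in cell 67. -/
def link : Cm :=
  .put1 19 (.cell 66) (.cell 67) ;; .put1 20 (.cell 66) (.at1 17 (.cell 67)) ;;
  .put2 18 (.cell 67) (.at1 17 (.cell 67)) (.cell 66) ;;
  .put1 17 (.cell 67) (.add (.at1 17 (.cell 67)) (.lit 1))

theorem link_does {N h v : ℕ} {ρ : ℕ → ℕ} {σ : Store} {V : Finset ℕ} {tc : ℕ → Finset ℕ}
    (hσ : LinksIn σ h V tc) (hv : σ 66 0 0 0 = v) (hvV : v ∉ V)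
    (hc : σ 67 0 0 0 = codeNum (tc v)) (hch : tc v ⊆ Finset.range h) :
    link.Does N ρ σ fun σ' => LinksIn σ' h (insert v V) tc := by
  set c := tc v with hcc
  set n := σ 17 (codeNum c) 0 0 with hn
  simp [link, Store.write_apply, hv, hc, ← hn]
  refine ⟨fun d hd => ?_, fun u hu => ?_, fun u hu => ?_, fun u hu => ?_⟩
  · by_cases hdc : d = c
    · subst hdc
      have := (hσ.balls c hd).push (z := v) (fun h => hvV (Finset.mem_filter.1 h).1)
        (g := fun q => if q = n then v else σ 18 (codeNum c) q 0) (fun j hj => by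
          simp [(show j ≠ n from hj.ne)]) (by simp [hn])
      refine Lists.of_mem_iff (A := insert v (V.filter fun v => tc v = c)) ?_ ?_
      · simpa [Store.write_apply] using this
      · intro x
        simp only [Finset.mem_insert, Finset.mem_filter]
        constructor
        · rintro (rfl | h)
          exacts [⟨Or.inl rfl, rfl⟩, ⟨Or.inr h.1, h.2⟩]
        · rintro ⟨rfl | h, h'⟩
          exacts [Or.inl rfl, Or.inr ⟨h, h'⟩]
    · have hne : codeNum d ≠ codeNum c := fun e => hdc (codeNum_inj e)
      refine Lists.of_mem_iff (A := V.filter fun v => tc v = d) ?_ ?_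
      · simpa [Store.write_apply, hne] using hσ.balls d hd
      · intro x
        simp only [Finset.mem_insert, Finset.mem_filter]
        refine ⟨fun h => ⟨Or.inr h.1, h.2⟩, ?_⟩
        rintro ⟨rfl | h, h'⟩
        exacts [absurd h'.symm hdc, ⟨h, h'⟩]
  · by_cases huv : u = v
    · subst huv; simp [Store.write_apply, hcc]
    · simpa [Store.write_apply, huv] using hσ.code u ((Finset.mem_insert.1 hu).resolve_left huv)
  · by_cases huv : u = v
    · subst huv; simp [Store.write_apply, ← hcc]
    · obtain ⟨h1, h2⟩ := hσ.pos u ((Finset.mem_insert.1 hu).resolve_left huv)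
      by_cases hut : tc u = c
      · rw [hut] at h1 h2
        have h1' : σ 20 u 0 0 < n := h1
        simp [Store.write_apply, huv, hut, h1'.ne, h2]; omega
      · have hne : codeNum (tc u) ≠ codeNum c := fun e => hut (codeNum_inj e)
        simp [Store.write_apply, huv, hne, h1, h2]
  · by_cases huv : u = v
    · subst huv; exact hch
    · exact hσ.range u ((Finset.mem_insert.1 hu).resolve_left huv)

/-- Put the nodes of fragment `var 1` into the list in arrays 46, 47. -/
def fragNodes : Cm :=
  .put0 46 (.lit 0) ;; .rep 2 (.cell 9)
    (.ite (.eq (.at1 14 (.at1 10 (.var 2))) (.var 1))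
      (.put1 47 (.cell 46) (.at1 10 (.var 2)) ;; .put0 46 (.add (.cell 46) (.lit 1))) .skip)

theorem fragNodes_does {N i : ℕ} {ρ : ℕ → ℕ} {σ : Store} {P : Pattern} (hP : PatIn σ P)
    (hi : ρ 1 = i) (hN : P.V.card ≤ N) :
    fragNodes.Does N ρ σ fun σ' =>
      Lists (fun j => σ' 47 j 0 0) (σ' 46 0 0 0) (P.frag i).V := by
  rw [hP.nodes.card_eq] at hN
  simp only [fragNodes, Cm.Does.seq_iff (p := .put0 46 _), Cm.Does.put0_iff, Tm.ok_lit,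
    Tm.eval_lit, true_and]
  set σ₀ := σ.write 46 0 0 0 0 with hσ₀
  have e₀ : ∀ a, a ≠ 46 → σ₀ a = σ a := fun a h => Store.write_of_ne _ _ _ _ _ h
  refine Cm.Does.rep (σ 9 0 0 0) (fun m σ' => Lists (fun j => σ' 47 j 0 0) (σ' 46 0 0 0)
    (((Finset.range m).image fun j => σ 10 j 0 0).filter fun u => P.part u = i)) (by simp)
    (by simp [e₀ 9]) hN ?_ ?_ ?_
  · rw [show σ₀ 46 0 0 0 = 0 by simp [hσ₀, Store.write_apply]]
    exact Lists.filter_zero _ _ _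
  · intro m hm σ₁ k₁ h₁
    have hu := hP.nodes.mem hm
    have e14 : σ₁ 14 (σ 10 m 0 0) 0 0 = P.part (σ 10 m 0 0) := by
      rw [k₁ 14 rfl, e₀ 14 (by omega)]; exact hP.part _ hu
    have e10 : σ₁ 10 = σ 10 := by rw [k₁ 10 rfl, e₀ 10 (by omega)]
    simp only [Cm.Does.ite_iff, Tm.ok_eq, Tm.ok_at1, Tm.ok_var, Tm.holds_eq, Tm.eval_at1,
      Tm.eval_var, Function.update_self, Function.update_of_ne (show (1 : ℕ) ≠ 2 by omega), e10,
      e14, hi, Cm.Does.seq_iff, Cm.Does.put1_iff, Cm.Does.put0_iff, Tm.ok_cell, Tm.ok_add,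
      Tm.ok_lit, Tm.eval_cell, Tm.eval_add, Tm.eval_lit, Cm.Does.skip_iff, true_and, and_true]
    refine ⟨fun hp => ?_, fun hp => h₁.filter_skip hp⟩
    have := hP.nodes.filter_push hm h₁ hp
      (f' := fun j => if j = σ₁ 46 0 0 0 then σ 10 m 0 0 else σ₁ 47 j 0 0)
      (fun j hj => by simp [hj.ne]) (by simp)
    simpa [Store.write_apply] using this
  · intro σ₁ _ h₁
    rw [hP.nodes.image_eq] at h₁
    exact h₁.of_mem_iff fun x => by simp [Pattern.frag]

theorem mem_matched {M : Finset (ℕ × ℕ)} {u w : ℕ} : w ∈ matched M u ↔ (u, w) ∈ M := by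
  simp [matched]

/-- Store the matches of the pattern node number `var 2` for the ball with the center in
cell 66. -/
def storeNode : Cm :=
  .put2 24 (.cell 66) (qN 2) (.lit 0) ;;
  .ite (.cell 49) (.rep 3 (.cell 42) (.ite (.at2 48 (qN 2) (bN 3))
    (.put 25 (.cell 66) (qN 2) (.at2 24 (.cell 66) (qN 2)) (bN 3) ;;
      .put2 24 (.cell 66) (qN 2) (.add (.at2 24 (.cell 66) (qN 2)) (.lit 1))) .skip)) .skip

theorem storeNode_does {N v u m : ℕ} {ρ : ℕ → ℕ} {σ : Store} {Q : Pattern} {B : DataGraph}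
    (hB : Lists (fun j => σ 43 j 0 0) (σ 42 0 0 0) B.V) (hN : B.V.card ≤ N)
    (hm : ρ 2 = m) (hu : σ 47 m 0 0 = u) (huQ : u ∈ Q.V) (hv : σ 66 0 0 0 = v)
    (h49 : σ 49 0 0 0 = bit (Matches Q B))
    (h48 : Matches Q B → ∀ u ∈ Q.V, ∀ w ∈ B.V, (σ 48 u w 0 ≠ 0 ↔ (u, w) ∈ maxMatch Q B)) :
    storeNode.Does N ρ σ fun σ' =>
      Lists (fun j => σ' 25 v u j) (σ' 24 v u 0) (matched (maxMatch Q B) u) ∧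
      ∀ x y, ¬ (x = v ∧ y = u) → σ' 24 x y = σ 24 x y ∧ σ' 25 x y = σ 25 x y := by
  rw [hB.card_eq] at hN
  simp only [storeNode, Cm.Does.seq_iff (p := .put2 24 _ _ _), Cm.Does.put2_iff, qN, bN,
    Tm.ok_cell, Tm.ok_at1, Tm.ok_var, Tm.ok_lit, Tm.eval_cell, Tm.eval_at1, Tm.eval_var,
    Tm.eval_lit, hm, hu, hv, true_and, Cm.Does.ite_iff, Cm.Does.skip_iff, Tm.holds_cell]
  set σ₀ := σ.write 24 v u 0 0 with hσ₀
  have e₀ : ∀ a, a ≠ 24 → σ₀ a = σ a := fun a h => Store.write_of_ne _ _ _ _ _ h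
  have h24 : σ₀ 24 v u 0 = 0 := by simp [hσ₀, Store.write_apply]
  have hoth : ∀ x y, ¬ (x = v ∧ y = u) → σ₀ 24 x y = σ 24 x y ∧ σ₀ 25 x y = σ 25 x y := by
    intro x y h
    refine ⟨?_, by rw [e₀ 25 (by omega)]⟩
    funext l
    rw [hσ₀, Store.write_apply, if_neg (by tauto)]
  rw [e₀ 49 (by omega), h49, bit_ne_zero]
  refine ⟨fun hM => ?_, fun hM => ⟨?_, hoth⟩⟩
  · refine Cm.Does.rep (σ 42 0 0 0) (fun q σ' => Lists (fun j => σ' 25 v u j) (σ' 24 v u 0)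
      (((Finset.range q).image fun j => σ 43 j 0 0).filter fun w => (u, w) ∈ maxMatch Q B) ∧
      ∀ x y, ¬ (x = v ∧ y = u) → σ' 24 x y = σ 24 x y ∧ σ' 25 x y = σ 25 x y) (by simp)
      (by simp [e₀ 42]) hN ?_ ?_ ?_
    · rw [h24]
      exact ⟨Lists.filter_zero _ _ _, hoth⟩
    · rintro q hq σ₁ k₁ ⟨h₁, h₁'⟩
      have e : ∀ a, a = 42 ∨ a = 43 ∨ a = 47 ∨ a = 48 ∨ a = 66 → σ₁ a = σ a := by
        rintro a (rfl | rfl | rfl | rfl | rfl) <;> rw [k₁ _ rfl, e₀ _ (by omega)]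
      have hc := h48 hM u huQ _ (hB.mem hq)
      simp only [Cm.Does.ite_iff, Tm.ok_at2, Tm.ok_at1, Tm.ok_var, Tm.holds_at2, Tm.eval_at1,
        Tm.eval_at2, Tm.eval_var, Function.update_self, Tm.ok_add, Tm.eval_add,
        Function.update_of_ne (show (2 : ℕ) ≠ 3 by omega), e 43, e 47, e 48, e 66, hm, hu, hv, hc,
        Cm.Does.seq_iff, Cm.Does.put_iff, Cm.Does.put2_iff, Tm.ok_cell, Tm.ok_lit, Tm.eval_cell,
        Tm.eval_lit, Cm.Does.skip_iff, Store.write_of_ne _ _ _ _ _ (show 66 ≠ 25 by omega),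
        Store.write_of_ne _ _ _ _ _ (show 47 ≠ 25 by omega),
        Store.write_of_ne _ _ _ _ _ (show 24 ≠ 25 by omega), true_and, and_true, true_or, or_true]
      refine ⟨fun hp => ⟨?_, fun x y hxy => ⟨?_, ?_⟩⟩, fun hp => ⟨h₁.filter_skip hp, h₁'⟩⟩
      · have := hB.filter_push hq h₁ hp
          (f' := fun j => if j = σ₁ 24 v u 0 then σ 43 q 0 0 else σ₁ 25 v u j)
          (fun j hj => by simp [hj.ne]) (by simp)
        simpa [Store.write_apply] using this
      · rw [← (h₁' x y hxy).1]
        funext l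
        simp only [Store.write_apply]
        rw [if_neg (by tauto), if_neg (by tauto)]
      · rw [← (h₁' x y hxy).2]
        funext l
        simp only [Store.write_apply]
        rw [if_neg (by tauto), if_neg (by tauto)]
    · rintro σ₁ - ⟨h₁, h₁'⟩
      rw [hB.image_eq] at h₁
      refine ⟨h₁.of_mem_iff fun w => ?_, h₁'⟩
      rw [mem_matched, Finset.mem_filter]
      exact ⟨fun h => h.2, fun h =>
        ⟨(Finset.mem_product.1 ((maxMatch_isMatch Q B hM).subset h)).2, h⟩⟩
  · rw [h24, maxMatch_eq_empty hM]
    exact (Lists.zero _).of_mem_iff (by simp [matched])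

/-- Recompute the matches of fragment `var 1` in the ball with the center in cell 66, whose nodes
are listed in arrays 42, 43. Cell 67 accumulates the type code, and cell 68 holds the
current power of 2. -/
def fragStep : Cm :=
  fragNodes ;; sim ;; .rep 2 (.cell 46) storeNode ;;
  .ite (.cell 49) (.put0 67 (.add (.cell 67) (.cell 68))) .skip ;;
  .put0 68 (.add (.cell 68) (.cell 68))

/-- The memory holds the data graph whose nodes are listed in arrays 42, 43. -/
structure BallIn (σ : Store) (B : DataGraph) : Prop where
  nodes : Lists (fun j => σ 43 j 0 0) (σ 42 0 0 0) B.V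
  labels : ∀ w ∈ B.V, ∀ c, σ 4 w c 0 = bit (c ∈ B.label w)
  edges : ∀ w ∈ B.V, ∀ w' ∈ B.V, σ 7 w w' 0 = bit (B.graph.Adj w w')

theorem BallIn.congr {σ σ' : Store} {B : DataGraph} (h : BallIn σ B)
    (hσ : ∀ a, a = 4 ∨ a = 7 ∨ a = 42 ∨ a = 43 → σ' a = σ a) : BallIn σ' B := by
  constructor
  · rw [hσ 42 (by omega), hσ 43 (by omega)]; exact h.nodes
  · rw [hσ 4 (by omega)]; exact h.labels
  · rw [hσ 7 (by omega)]; exact h.edges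

theorem DataIn.ballIn {σ : Store} {H : DataGraph} {v t : ℕ} (h : DataIn σ H)
    (hL : Lists (fun j => σ 43 j 0 0) (σ 42 0 0 0) (H.ball v t).V) : BallIn σ (H.ball v t) where
  nodes := hL
  labels w hw := h.label w (DataGraph.ball_subset hw)
  edges w hw w' hw' := by
    rw [h.adj w w']
    exact bit_congr ⟨fun h => DataGraph.ball_adj.2 ⟨h, hw, hw'⟩, fun h => (DataGraph.ball_adj.1 h).1⟩

theorem PatIn.simIn {σ : Store} {P : Pattern} {B : DataGraph} {i : ℕ} (hP : PatIn σ P)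
    (hB : BallIn σ B) (hL : Lists (fun j => σ 47 j 0 0) (σ 46 0 0 0) (P.frag i).V) :
    SimIn σ (P.frag i) B where
  nodes := hL
  ball := hB.nodes
  label u hu := hP.label u (Pattern.mem_frag.1 hu).1
  adj u hu u' hu' := by
    rw [hP.adj u (Pattern.mem_frag.1 hu).1 u' (Pattern.mem_frag.1 hu').1]
    refine bit_congr ⟨fun h => Pattern.frag_adj.2 ⟨h, ?_, ?_⟩, fun h => (Pattern.frag_adj.1 h).1⟩
    exacts [(Pattern.mem_frag.1 hu).2, (Pattern.mem_frag.1 hu').2]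
  labels := hB.labels
  edges := hB.edges

theorem card_frag_le (P : Pattern) (i : ℕ) : (P.frag i).V.card ≤ P.V.card :=
  Finset.card_le_card (Finset.filter_subset _ _)

/-- The type code of a data graph: the fragments that it matches. -/
noncomputable def typeCode (P : Pattern) (B : DataGraph) (h : ℕ) : Finset ℕ :=
  (Finset.range h).filter fun i => Matches (P.frag i) B

theorem codeNum_typeCode_succ (P : Pattern) (B : DataGraph) (h : ℕ) :
    codeNum (typeCode P B (h + 1)) =
      codeNum (typeCode P B h) + if Matches (P.frag h) B then 2 ^ h else 0 := by
  rw [typeCode, Finset.range_add_one, Finset.filter_insert]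
  split_ifs with hM
  · rw [codeNum, Finset.sum_insert (by simp), add_comm]; rfl
  · rfl

theorem fragStep_does {N v i : ℕ} {ρ : ℕ → ℕ} {σ : Store} {P : Pattern} {B : DataGraph}
    (hP : PatIn σ P) (hB : BallIn σ B) (hPN : P.V.card ≤ N) (hBN : B.V.card ≤ N)
    (hi : ρ 1 = i) (hv : σ 66 0 0 0 = v) (h67 : σ 67 0 0 0 = codeNum (typeCode P B i))
    (h68 : σ 68 0 0 0 = 2 ^ i) :
    fragStep.Does N ρ σ fun σ' =>
      (∀ u ∈ (P.frag i).V, Lists (fun j => σ' 25 v u j) (σ' 24 v u 0)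
        (matched (maxMatch (P.frag i) B) u)) ∧
      (∀ x y, ¬ (x = v ∧ y ∈ (P.frag i).V) → σ' 24 x y = σ 24 x y ∧ σ' 25 x y = σ 25 x y) ∧
      σ' 67 0 0 0 = codeNum (typeCode P B (i + 1)) ∧ σ' 68 0 0 0 = 2 ^ (i + 1) := by
  refine (fragNodes_does hP hi hPN).seq fun σ₁ k₁ h₁ => ?_
  have hP₁ : PatIn σ₁ P := hP.congr fun a h h' => k₁ a (by interval_cases a <;> rfl)
  have hB₁ : BallIn σ₁ B := hB.congr fun a h => k₁ a (by rcases h with rfl | rfl | rfl | rfl <;> rfl)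
  refine (sim_does (hP₁.simIn hB₁ h₁) ((card_frag_le P i).trans hPN) hBN).seq
    fun σ₂ k₂ ⟨h₂, h₂'⟩ => ?_
  replace k₂ : ∀ a, a ≠ 48 → a ≠ 49 → σ₂ a = σ₁ a := fun a h h' => k₂ a (sim_keeps h h')
  have hB₂ : BallIn σ₂ B := hB₁.congr fun a h => k₂ a (by omega) (by omega)
  set Q := P.frag i with hQ
  have h46 : Lists (fun j => σ₂ 47 j 0 0) (σ₂ 46 0 0 0) Q.V := by
    rw [k₂ 46 (by omega) (by omega), k₂ 47 (by omega) (by omega)]; exact h₁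
  have hQN : Q.V.card ≤ N := (card_frag_le P i).trans hPN
  rw [h46.card_eq] at hQN
  have e24 : σ₂ 24 = σ 24 := by rw [k₂ 24 (by omega) (by omega), k₁ 24 rfl]
  have e25 : σ₂ 25 = σ 25 := by rw [k₂ 25 (by omega) (by omega), k₁ 25 rfl]
  have e66 : σ₂ 66 0 0 0 = v := by rw [k₂ 66 (by omega) (by omega), k₁ 66 rfl, hv]
  refine (Cm.Does.rep (σ₂ 46 0 0 0) (fun m σ' =>
    (∀ q < m, Lists (fun j => σ' 25 v (σ₂ 47 q 0 0) j) (σ' 24 v (σ₂ 47 q 0 0) 0)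
      (matched (maxMatch Q B) (σ₂ 47 q 0 0))) ∧
    (∀ x y, ¬ (x = v ∧ y ∈ Q.V) → σ' 24 x y = σ 24 x y ∧ σ' 25 x y = σ 25 x y))
    (by simp) (by simp) hQN ⟨by simp, fun x y _ => by simp [e24, e25]⟩ ?_
    (fun σ' _ h => h)).seq fun σ₃ k₃ ⟨h₃, h₃'⟩ => ?_
  · rintro m hm σ₃ k₃ ⟨h₃, h₃'⟩
    have hB₃ : BallIn σ₃ B := hB₂.congr fun a h => k₃ a (by rcases h with rfl | rfl | rfl | rfl <;> rfl)
    have hmQ := h46.mem hm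
    refine (storeNode_does (Q := Q) (v := v) (m := m) hB₃.nodes hBN (by simp) (by rw [k₃ 47 rfl]) hmQ
      (by rw [k₃ 66 rfl, e66]) (by rw [k₃ 49 rfl]; exact h₂)
      (by rw [k₃ 48 rfl]; exact h₂')).mono ?_
    rintro σ₄ - ⟨h₄, h₄'⟩
    refine ⟨fun q hq => ?_, fun x y hxy => ?_⟩
    · rcases Nat.lt_succ_iff_lt_or_eq.1 hq with h | rfl
      · have := h₄' v (σ₂ 47 q 0 0) fun e => h.ne (h46.inj (h.trans hm) hm e.2)
        rw [this.1, this.2]; exact h₃ q h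
      · exact h₄
    · have := h₄' x y fun e => hxy ⟨e.1, e.2 ▸ hmQ⟩
      rw [this.1, this.2]; exact h₃' x y hxy
  · have e49 : σ₃ 49 0 0 0 = bit (Matches Q B) := by rw [k₃ 49 rfl]; exact h₂
    have e67 : σ₃ 67 0 0 0 = codeNum (typeCode P B i) := by
      rw [k₃ 67 rfl, k₂ 67 (by omega) (by omega), k₁ 67 rfl, h67]
    have e68 : σ₃ 68 0 0 0 = 2 ^ i := by
      rw [k₃ 68 rfl, k₂ 68 (by omega) (by omega), k₁ 68 rfl, h68]
    have h₄ : ∀ u ∈ Q.V, Lists (fun j => σ₃ 25 v u j) (σ₃ 24 v u 0)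
        (matched (maxMatch Q B) u) := fun u hu => by
      obtain ⟨q, hq, rfl⟩ := h46.mem_iff.1 hu
      exact h₃ q hq
    have w67 : ∀ a, a ≠ 67 → ∀ (τ : Store) x, τ.write 67 0 0 0 x a = τ a :=
      fun a h τ x => Store.write_of_ne _ _ _ _ _ h
    have w68 : ∀ a, a ≠ 68 → ∀ (τ : Store) x, τ.write 68 0 0 0 x a = τ a :=
      fun a h τ x => Store.write_of_ne _ _ _ _ _ h
    simp only [Cm.Does.seq_iff, Cm.Does.ite_iff, Tm.ok_cell, Tm.holds_cell, e49, bit_ne_zero,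
      Cm.Does.put0_iff, Tm.ok_add, Tm.eval_add, Tm.eval_cell, e67, e68, Cm.Does.skip_iff,
      Store.write_apply, codeNum_typeCode_succ, true_and, and_true]
    constructor
    · intro hM
      refine ⟨by simpa using h₄, fun x y hxy => ?_, ?_, ?_⟩
      · rw [w68 24 (by omega), w67 24 (by omega), w68 25 (by omega), w67 25 (by omega)]
        exact h₃' x y hxy
      · simp [← hQ, hM]
      · simp [pow_succ]; omega
    · intro hM
      refine ⟨by simpa using h₄, fun x y hxy => ?_, ?_, ?_⟩
      · rw [w68 24 (by omega), w68 25 (by omega)]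
        exact h₃' x y hxy
      · simp [← hQ, hM]
      · simp [pow_succ]; omega

/-- The trivial bound that is stored for a ball: a graph has at most the square of its order as
number of edges. -/
theorem density_le_card {G : DataGraph} {v t : ℕ} {X : Finset ℕ} (hX : X ⊆ (G.ball v t).V) :
    (G.induce X).density ≤ ((G.ball v t).V.card : ℚ) := by
  set H := G.induce X with hH
  have hV : H.V ⊆ X := Finset.inter_subset_right
  have hE : H.graph.edgeSet.ncard ≤ H.V.card * H.V.card := by
    have : H.graph.edgeSet ⊆ (fun p : ℕ × ℕ => s(p.1, p.2)) '' ((H.V ×ˢ H.V : Finset _) : Set _) := by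
      intro e
      induction e using Sym2.ind with
      | _ a b =>
        intro h
        have h' : H.graph.Adj a b := h
        exact ⟨(a, b), by simp [H.mem_of_adj _ _ h', H.mem_of_adj' h'], rfl⟩
    refine (Set.ncard_le_ncard this (Set.toFinite _)).trans ?_
    refine (Set.ncard_image_le (Set.toFinite _)).trans ?_
    rw [Set.ncard_coe_finset, Finset.card_product]
  rw [DataGraph.density]
  refine div_le_of_le_mul₀ (by positivity) (by positivity) ?_
  have h2 : H.V.card ≤ (G.ball v t).V.card := Finset.card_le_card (hV.trans hX)
  exact_mod_cast hE.trans (Nat.mul_le_mul_right _ h2)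

/-- What the memory holds about a single ball. -/
structure EntryIn (σ : Store) (P : Pattern) (G : DataGraph) (h r n v : ℕ) : Prop where
  cflag : σ 21 v 0 0 = n
  den : 0 < σ 23 v 0 0 ∧ ∀ X ⊆ (G.ball v r).V, X.Nonempty →
    (G.induce X).density ≤ (σ 22 v 0 0 : ℚ) / (σ 23 v 0 0 : ℚ)
  fbMatch : ∀ u ∈ P.V, Lists (fun j => σ 25 v u j) (σ 24 v u 0)
    (matched ((Finset.range h).biUnion fun i => maxMatch (P.frag i) (G.ball v r)) u)

theorem EntryIn.congr {σ σ' : Store} {P : Pattern} {G : DataGraph} {h r n v : ℕ}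
    (he : EntryIn σ P G h r n v) (hσ : ∀ a, 21 ≤ a → a ≤ 25 → σ' a v = σ a v) :
    EntryIn σ' P G h r n v := by
  have h21 := hσ 21 (by omega) (by omega)
  have h22 := hσ 22 (by omega) (by omega)
  have h23 := hσ 23 (by omega) (by omega)
  have h24 := hσ 24 (by omega) (by omega)
  have h25 := hσ 25 (by omega) (by omega)
  constructor
  · rw [h21]; exact he.cflag
  · rw [h22, h23]; exact he.den
  · rw [h24, h25]; exact he.fbMatch

/-- Only the fragment of `u` contributes matches of `u` to the stored relations. -/
theorem matched_biUnion_frag {P : Pattern} {B : DataGraph} {h u : ℕ} (hu : P.part u < h) :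
    matched ((Finset.range h).biUnion fun i => maxMatch (P.frag i) B) u =
      matched (maxMatch (P.frag (P.part u)) B) u := by
  ext w
  simp only [mem_matched, Finset.mem_biUnion, Finset.mem_range]
  constructor
  · rintro ⟨i, hi, hm⟩
    have := (Pattern.mem_frag.1 (Finset.mem_product.1 (Finset.mem_filter.1 hm).1).1).2
    rwa [this]
  · exact fun hm => ⟨_, hu, hm⟩

/-- Recompute everything stored for the ball with the center in cell 66; its type code is left
in cell 67. -/
def refresh : Cm :=
  bfs 42 43 (.cell 66) (.cell 1) 1 ;;
  .put1 22 (.cell 66) (.cell 42) ;; .put1 23 (.cell 66) (.lit 1) ;;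
  .put1 21 (.cell 66) (.cell 27) ;; .put0 67 (.lit 0) ;; .put0 68 (.lit 1) ;;
  .rep 1 (.cell 0) fragStep

theorem refresh_does {N v h r : ℕ} {ρ : ℕ → ℕ} {σ : Store} {P : Pattern} {G : DataGraph}
    (hP : PatIn σ P) (hG : DataIn σ G) (hfr : P.Fragmented h) (hv : σ 66 0 0 0 = v) (hvV : v ∈ G.V)
    (hh : σ 0 0 0 0 = h) (hr : σ 1 0 0 0 = r) (hhN : h ≤ N) (hrN : r ≤ N) (hPN : P.V.card ≤ N)
    (hBN : (G.ball v r).V.card ≤ N) :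
    refresh.Does N ρ σ fun σ' => EntryIn σ' P G h r (σ 27 0 0 0) v ∧
      σ' 67 0 0 0 = codeNum (typeCode P (G.ball v r) h) ∧
      ∀ a, 21 ≤ a → a ≤ 25 → ∀ x, x ≠ v → σ' a x = σ a x := by
  refine (bfs_does hG (by omega) (by omega) (by omega) (by simp) (by simpa using hv) hvV
    (fun σ' h => ⟨by simp, by simp [h 1, hr]⟩) hrN hBN).seq fun σ₁ k₁ h₁ => ?_
  replace k₁ : ∀ a, a ≠ 43 → a ≠ 42 → σ₁ a = σ a := fun a h h' => k₁ a (bfs_keeps.2 ⟨h, h'⟩)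
  have e66 : σ₁ 66 0 0 0 = v := by rw [k₁ 66 (by omega) (by omega), hv]
  have e27 : σ₁ 27 0 0 0 = σ 27 0 0 0 := by rw [k₁ 27 (by omega) (by omega)]
  set n := σ 27 0 0 0 with hn
  set b := σ₁ 42 0 0 0 with hb
  have hbc : (G.ball v r).V.card = b := h₁.card_eq
  simp only [Cm.Does.seq_iff, Cm.Does.put1_iff, Cm.Does.put0_iff, Tm.ok_cell, Tm.ok_lit,
    Tm.eval_cell, Tm.eval_lit, e66, ← hb, true_and,
    Store.write_of_ne _ _ _ _ _ (show 66 ≠ 22 by omega),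
    Store.write_of_ne _ _ _ _ _ (show 66 ≠ 23 by omega),
    Store.write_of_ne _ _ _ _ _ (show 27 ≠ 22 by omega),
    Store.write_of_ne _ _ _ _ _ (show 27 ≠ 23 by omega), e27]
  set σ₂ := ((((σ₁.write 22 v 0 0 b).write 23 v 0 0 1).write 21 v 0 0 n).write 67 0 0 0 0).write
    68 0 0 0 1 with hσ₂
  have k₂ : ∀ a, a ≠ 21 → a ≠ 22 → a ≠ 23 → a ≠ 67 → a ≠ 68 → σ₂ a = σ₁ a := by
    intro a h1 h2 h3 h4 h5
    rw [hσ₂, Store.write_of_ne _ _ _ _ _ h5, Store.write_of_ne _ _ _ _ _ h4,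
      Store.write_of_ne _ _ _ _ _ h1, Store.write_of_ne _ _ _ _ _ h3,
      Store.write_of_ne _ _ _ _ _ h2]
  have hP₂ : PatIn σ₂ P := hP.congr fun a h h' => by
    rw [k₂ a (by omega) (by omega) (by omega) (by omega) (by omega), k₁ a (by omega) (by omega)]
  have hB₂ : BallIn σ₂ (G.ball v r) := by
    have hG₁ : DataIn σ₁ G := hG.congr fun a _ _ => k₁ a (by omega) (by omega)
    exact (hG₁.ballIn h₁).congr fun a h => k₂ a (by omega) (by omega) (by omega) (by omega) (by omega)
  have hoth : ∀ a, 21 ≤ a → a ≤ 25 → ∀ x, x ≠ v → σ₂ a x = σ a x := by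
    intro a h h' x hx
    rw [← k₁ a (by omega) (by omega), hσ₂]
    funext j l
    have h67 : a ≠ 67 := by omega
    have h68 : a ≠ 68 := by omega
    simp [Store.write_apply, hx, h67, h68]
  set B := G.ball v r with hB
  refine Cm.Does.rep h (fun i σ' =>
    (∀ u ∈ P.V, P.part u < i → Lists (fun j => σ' 25 v u j) (σ' 24 v u 0)
      (matched (maxMatch (P.frag (P.part u)) B) u)) ∧
    (∀ x y, x ≠ v → σ' 24 x y = σ 24 x y ∧ σ' 25 x y = σ 25 x y) ∧
    σ' 67 0 0 0 = codeNum (typeCode P B i) ∧ σ' 68 0 0 0 = 2 ^ i) (by simp)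
    (by simp [k₂ 0, k₁ 0, hh]) hhN ?_ ?_ ?_
  · refine ⟨by simp, fun x y hx => ?_, ?_, ?_⟩
    · rw [hoth 24 (by omega) (by omega) x hx, hoth 25 (by omega) (by omega) x hx]
      exact ⟨rfl, rfl⟩
    · simp [hσ₂, Store.write_apply, typeCode, codeNum]
    · simp [hσ₂, Store.write_apply]
  · rintro i hi σ₃ k₃ ⟨h₃, h₃', h67, h68⟩
    have hP₃ : PatIn σ₃ P := hP₂.congr fun a h h' => k₃ a (by interval_cases a <;> rfl)
    have hB₃ : BallIn σ₃ B := hB₂.congr fun a h => k₃ a (by rcases h with rfl | rfl | rfl | rfl <;> rfl)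
    refine (fragStep_does (v := v) (i := i) hP₃ hB₃ hPN hBN (by simp) ?_ h67 h68).mono ?_
    · rw [k₃ 66 rfl, k₂ 66 (by omega) (by omega) (by omega) (by omega) (by omega), e66]
    · rintro σ₄ - ⟨h₄, h₄', h67', h68'⟩
      refine ⟨fun u hu hui => ?_, fun x y hx => ?_, h67', h68'⟩
      · rcases Nat.lt_succ_iff_lt_or_eq.1 hui with h | h
        · have := h₄' v u fun e => h.ne (Pattern.mem_frag.1 e.2).2
          rw [this.1, this.2]; exact h₃ u hu h
        · have := h₄ u (Pattern.mem_frag.2 ⟨hu, h⟩)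
          rwa [← h] at this
      · have := h₄' x y fun e => hx e.1
        rw [this.1, this.2]; exact h₃' x y hx
  · rintro σ₃ k₃ ⟨h₃, h₃', h67, -⟩
    have e21 : σ₃ 21 = σ₂ 21 := k₃ 21 rfl
    have e22 : σ₃ 22 = σ₂ 22 := k₃ 22 rfl
    have e23 : σ₃ 23 = σ₂ 23 := k₃ 23 rfl
    refine ⟨⟨?_, ?_, fun u hu => ?_⟩, h67, fun a h1 h2 x hx => ?_⟩
    · simp [e21, hσ₂, Store.write_apply]
    · rw [e22, e23]
      have f22 : σ₂ 22 v 0 0 = b := by simp [hσ₂, Store.write_apply]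
      have f23 : σ₂ 23 v 0 0 = 1 := by simp [hσ₂, Store.write_apply]
      rw [f22, f23]
      refine ⟨by omega, fun X hX _ => ?_⟩
      rw [← hbc]
      simpa using density_le_card hX
    · rw [matched_biUnion_frag (hfr u hu)]
      exact h₃ u hu (hfr u hu)
    · by_cases h3 : a ≤ 23
      · rw [← hoth a h1 h2 x hx]
        have : a = 21 ∨ a = 22 ∨ a = 23 := by omega
        rcases this with rfl | rfl | rfl <;> simp [e21, e22, e23]
      · have : a = 24 ∨ a = 25 := by omega
        rcases this with rfl | rfl
        · funext y; exact (h₃' x y hx).1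
        · funext y; exact (h₃' x y hx).2

/-- Bring the ball number `var 0` in the list of affected balls up to date. Cell 65 separates the
identifiers of nodes of the old data graph from those of nodes inserted in this round. -/
def ballStep : Cm :=
  .put0 66 (.at1 41 (.var 0)) ;; .ite (.lt (.cell 66) (.cell 65)) unlink .skip ;;
  .ite (.at1 3 (.cell 66)) (refresh ;; link) .skip

/-- Bring all affected balls up to date. -/
def ballPhase : Cm := .rep 0 (.cell 40) ballStep

/-- Centers of balls when those with a center in `D` have been brought up to date. -/
noncomputable def mixedV (V V' D : Finset ℕ) : Finset ℕ := (V \ D) ∪ (V' ∩ D)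

/-- Type codes of balls when those with a center in `D` have been brought up to date. -/
noncomputable def mixedTc (tc tc' : ℕ → Finset ℕ) (D : Finset ℕ) (v : ℕ) : Finset ℕ :=
  if v ∈ D then tc' v else tc v

theorem mem_mixedV {V V' D : Finset ℕ} {v : ℕ} (h : v ∈ D) : v ∈ mixedV V V' D ↔ v ∈ V' := by
  simp [mixedV, h]

theorem mem_mixedV' {V V' D : Finset ℕ} {v : ℕ} (h : v ∉ D) : v ∈ mixedV V V' D ↔ v ∈ V := by
  simp [mixedV, h]

/-- Processed entries are those of balls of the new graph for the new pattern; all the others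
remain. Nodes deleted in this round only disappear from the index. -/
theorem ballPhase_does {N h r f : ℕ} {ρ : ℕ → ℕ} {σ : Store} {P : Pattern} {V A : Finset ℕ}
    {G : DataGraph} {tc : ℕ → Finset ℕ} (hP : PatIn σ P) (hG : DataIn σ G) (hfr : P.Fragmented h)
    (hh : σ 0 0 0 0 = h) (hr : σ 1 0 0 0 = r) (hf : σ 65 0 0 0 = f)
    (hA : Lists (fun j => σ 41 j 0 0) (σ 40 0 0 0) A) (hAV : ∀ v ∈ A, v < f ↔ v ∈ V)
    (hl : LinksIn σ h V tc) (hhN : h ≤ N) (hrN : r ≤ N) (hPN : P.V.card ≤ N) (hAN : A.card ≤ N)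
    (hBN : ∀ v ∈ A, (G.ball v r).V.card ≤ N) :
    ballPhase.Does N ρ σ fun σ' =>
      LinksIn σ' h (mixedV V G.V A) (mixedTc tc (fun v => typeCode P (G.ball v r) h) A) ∧
      (∀ v ∈ A, v ∈ G.V → EntryIn σ' P G h r (σ 27 0 0 0) v) ∧
      ∀ a, 21 ≤ a → a ≤ 25 → ∀ x, x ∉ A → σ' a x = σ a x := by
  have hAn := hA.card_eq
  set tc' := fun v => typeCode P (G.ball v r) h with htc'
  set D := fun m => (Finset.range m).image fun j => σ 41 j 0 0 with hD
  have hDs : ∀ m, D (m + 1) = insert (σ 41 m 0 0) (D m) := fun m => by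
    simp [hD, Finset.range_add_one, Finset.image_insert]
  refine Cm.Does.rep (σ 40 0 0 0) (fun m σ' =>
      LinksIn σ' h (mixedV V G.V (D m)) (mixedTc tc tc' (D m)) ∧
      (∀ v ∈ D m, v ∈ G.V → EntryIn σ' P G h r (σ 27 0 0 0) v) ∧
      ∀ a, 21 ≤ a → a ≤ 25 → ∀ x, x ∉ D m → σ' a x = σ a x) (by simp) (by simp)
      (hAn ▸ hAN) ?_ ?_ ?_
  · refine ⟨hl.of_eq (fun v => by simp [mixedV, hD]) (fun v _ => by simp [mixedTc, hD]),
      by simp [hD], fun _ _ _ _ _ => rfl⟩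
  · rintro m hm σ₁ k₁ ⟨hl₁, he₁, ho₁⟩
    set v := σ 41 m 0 0 with hv
    have hvA : v ∈ A := hA.mem hm
    have hvD : v ∉ D m := fun h => by
      obtain ⟨j, hj, e⟩ := Finset.mem_image.1 h
      rw [Finset.mem_range] at hj
      exact hj.ne (hA.inj (hj.trans hm) hm e)
    have e41 : σ₁ 41 = σ 41 := k₁ 41 rfl
    simp only [ballStep, Cm.Does.seq_iff (p := .put0 66 _), Cm.Does.put0_iff, Tm.ok_at1, Tm.ok_var,
      Tm.eval_at1, Tm.eval_var, Function.update_self, e41, ← hv, true_and]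
    set σ₂ := σ₁.write 66 0 0 0 v with hσ₂
    have k₂ : ∀ a, a ≠ 66 → σ₂ a = σ₁ a := fun a h => Store.write_of_ne _ _ _ _ _ h
    have e66 : σ₂ 66 0 0 0 = v := by simp [hσ₂, Store.write_apply]
    have hl₂ : LinksIn σ₂ h (mixedV V G.V (D m)) (mixedTc tc tc' (D m)) :=
      hl₁.congr fun a _ _ => k₂ a (by omega)
    have hvm : v ∈ mixedV V G.V (D m) ↔ v ∈ V := by simp [mixedV, hvD]
    refine Cm.Does.seq (R := fun σ' =>
      LinksIn σ' h ((mixedV V G.V (D m)).erase v) (mixedTc tc tc' (D m))) ?_ ?_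
    · simp only [Cm.Does.ite_iff, Tm.ok_lt, Tm.ok_cell, Tm.holds_lt, Tm.eval_cell, e66, k₂ 65,
        k₁ 65 rfl, hf, hAV v hvA, true_and, Cm.Does.skip_iff, and_true, ne_eq,
        Nat.reduceEqDiff, not_false_eq_true]
      refine ⟨fun h => unlink_does hl₂ e66 (hvm.2 h), fun h => ?_⟩
      rw [Finset.erase_eq_of_notMem (fun h' => h (hvm.1 h'))]
      exact hl₂
    · intro σ₃ k₃ hl₃
      have k : ∀ a, (a ≤ 16 ∨ 21 ≤ a ∧ a ≤ 28) → σ₃ a = σ₁ a := fun a ha => by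
        rw [k₃ a (by rcases ha with h | ⟨h, h'⟩ <;> interval_cases a <;> rfl), k₂ a (by omega)]
      have kk : ∀ a, (a ≤ 16 ∨ 26 ≤ a ∧ a ≤ 28) → σ₃ a = σ a := fun a ha => by
        rw [k a (by omega), k₁ a (by rcases ha with h | ⟨h, h'⟩ <;> interval_cases a <;> rfl)]
      have hG₃ : DataIn σ₃ G := hG.congr fun a _ _ => kk a (by omega)
      have hP₃ : PatIn σ₃ P := hP.congr fun a _ _ => kk a (by omega)
      have e66' : σ₃ 66 0 0 0 = v := by rw [k₃ 66 rfl, e66]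
      simp only [Cm.Does.ite_iff, Tm.ok_at1, Tm.ok_cell, Tm.holds_at1, Tm.eval_cell, e66',
        hG₃.node, bit_ne_zero, true_and, Cm.Does.skip_iff]
      have htc : ∀ x ∈ (mixedV V G.V (D m)).erase v,
          mixedTc tc tc' (D (m + 1)) x = mixedTc tc tc' (D m) x := fun x hx => by
        have := Finset.ne_of_mem_erase hx
        simp [mixedTc, hDs, ← hv, this]
      refine ⟨fun hvG => ?_, fun hvG => ⟨hl₃.of_eq (fun x => ?_) htc, fun x hx hxG => ?_,
        fun a h1 h2 x hx => ?_⟩⟩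
      · refine (refresh_does hP₃ hG₃ hfr e66' hvG (by rw [kk 0 (by omega), hh])
          (by rw [kk 1 (by omega), hr]) hhN hrN hPN (hBN v hvA)).seq ?_
        rintro σ₄ k₄ ⟨he₄, h67, ho₄⟩
        have hl₄ : LinksIn σ₄ h ((mixedV V G.V (D m)).erase v) (mixedTc tc tc' (D (m + 1))) :=
          (hl₃.of_eq (fun _ => Iff.rfl) htc).congr fun a _ _ => k₄ a (by interval_cases a <;> rfl)
        have htv : mixedTc tc tc' (D (m + 1)) v = tc' v := by simp [mixedTc, hDs, ← hv]
        refine (link_does hl₄ (by rw [k₄ 66 rfl, e66']) (by simp) (by rw [htv]; exact h67)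
          (by rw [htv]; exact Finset.filter_subset _ _)).mono fun σ₅ k₅ hl₅ => ?_
        have k45 : ∀ a, 21 ≤ a → a ≤ 25 → σ₅ a = σ₄ a := fun a _ _ =>
          k₅ a (by interval_cases a <;> rfl)
        refine ⟨hl₅.of_eq (fun x => ?_) (fun _ _ => rfl), fun x hx hxG => ?_, fun a h1 h2 x hx => ?_⟩
        · by_cases hxv : x = v
          · subst hxv; simp [mixedV, hDs, ← hv, hvG]
          · simp [mixedV, hDs, ← hv, hxv]
        · by_cases hxv : x = v
          · subst hxv
            rw [← kk 27 (by omega)]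
            exact he₄.congr fun a h1 h2 => by rw [k45 a h1 h2]
          · have hxD : x ∈ D m := by
              rw [hDs] at hx
              exact (Finset.mem_insert.1 hx).resolve_left hxv
            refine (he₁ x hxD hxG).congr fun a h1 h2 => ?_
            rw [k45 a h1 h2, ho₄ a h1 h2 x hxv, k a (by omega)]
        · rw [hDs, Finset.mem_insert, not_or] at hx
          rw [k45 a h1 h2, ho₄ a h1 h2 x hx.1, k a (by omega), ho₁ a h1 h2 x hx.2]
      · by_cases hxv : x = v
        · subst hxv; simp [mixedV, hDs, ← hv, hvG]
        · simp [mixedV, hDs, ← hv, hxv]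
      · have hxv : x ≠ v := fun e => hvG (e ▸ hxG)
        have hxD : x ∈ D m := by
          rw [hDs] at hx
          exact (Finset.mem_insert.1 hx).resolve_left hxv
        exact (he₁ x hxD hxG).congr fun a h1 h2 => by rw [k a (by omega)]
      · rw [hDs, Finset.mem_insert, not_or] at hx
        rw [k a (by omega), ho₁ a h1 h2 x hx.2]
  · rintro σ₁ - ⟨hl₁, he₁, ho₁⟩
    have hDA : D (σ 40 0 0 0) = A := hA.image_eq
    rw [hDA] at hl₁ he₁ ho₁
    exact ⟨hl₁, he₁, ho₁⟩

/-! ### Collecting the perfect subgraphs -/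

theorem Lists.sum {f : ℕ → ℕ} {n : ℕ} {A : Finset ℕ} (h : Lists f n A) (g : ℕ → ℕ) :
    ∑ j ∈ Finset.range n, g (f j) = ∑ a ∈ A, g a := by
  rw [← h.image_eq, Finset.sum_image]
  intro i hi j hj e
  exact h.inj (Finset.mem_range.1 hi) (Finset.mem_range.1 hj) e

/-- Number of ordered pairs of adjacent nodes in `X`, twice the number of edges inside `X`. -/
noncomputable def arcs (G : DataGraph) (X : Finset ℕ) : ℕ :=
  ∑ a ∈ X, ∑ b ∈ X, bit (G.graph.Adj a b)

/-- `X` is the node set of the perfect subgraph that the data graph `B` yields. -/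
def IsTeam (P : Pattern) (B : DataGraph) (X : Finset ℕ) : Prop :=
  Matches P B ∧ (∀ u ∈ P.V, (matched (maxMatch P B) u).card ∈ P.cap u) ∧
    X = (maxMatch P B).image Prod.snd

/-- The memory holds the node sets in `T`: their number in cell 50, their elements and sizes in
arrays 51 and 52, and twice their numbers of edges in array 53. -/
structure TeamsIn (σ : Store) (G : DataGraph) (T : List (Finset ℕ)) : Prop where
  num : σ 50 0 0 0 = T.length
  nodup : T.Nodup
  sets : ∀ p X, T[p]? = some X → Lists (fun j => σ 51 p j 0) (σ 52 p 0 0) X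
  arcs : ∀ p X, T[p]? = some X → σ 53 p 0 0 = arcs G X

theorem TeamsIn.congr {σ σ' : Store} {G : DataGraph} {T : List (Finset ℕ)} (h : TeamsIn σ G T)
    (hσ : ∀ a, 50 ≤ a → a ≤ 53 → σ' a = σ a) : TeamsIn σ' G T := by
  have h50 := hσ 50 (by omega) (by omega)
  have h51 := hσ 51 (by omega) (by omega)
  have h52 := hσ 52 (by omega) (by omega)
  have h53 := hσ 53 (by omega) (by omega)
  constructor
  · rw [h50]; exact h.num
  · exact h.nodup
  · rw [h51, h52]; exact h.sets
  · rw [h53]; exact h.arcs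

/-- List the data nodes that occur in array 48 as a new node set, behind those found so far. -/
def listTeam : Cm :=
  .put1 52 (.cell 50) (.lit 0) ;; .rep 2 (.cell 42)
    (.ite (.ex 3 (.cell 46) (.at2 48 (qN 3) (bN 2)))
      (.put2 51 (.cell 50) (.at1 52 (.cell 50)) (bN 2) ;;
        .put1 52 (.cell 50) (.add (.at1 52 (.cell 50)) (.lit 1))) .skip)

/-- Keep the new node set unless it has been found before. -/
def keepTeam : Cm :=
  .ite (.ex 2 (.cell 50) (.and (.eq (.at1 52 (.var 2)) (.at1 52 (.cell 50)))
      (.all 3 (.at1 52 (.var 2)) (.ex 4 (.at1 52 (.cell 50))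
        (.eq (.at2 51 (.cell 50) (.var 4)) (.at2 51 (.var 2) (.var 3)))))))
    .skip
    (.put1 53 (.cell 50) (.sum 2 (.at1 52 (.cell 50)) (.sum 3 (.at1 52 (.cell 50))
        (.at2 7 (.at2 51 (.cell 50) (.var 2)) (.at2 51 (.cell 50) (.var 3))))) ;;
      .put0 50 (.add (.cell 50) (.lit 1)))

/-- Test the capacities. -/
def capTest : Tm :=
  .all 2 (.cell 46) (.and
    (.le (.at1 12 (qN 2)) (.sum 3 (.cell 42) (.ite (.at2 48 (qN 2) (bN 3)) (.lit 1) (.lit 0))))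
    (.le (.sum 3 (.cell 42) (.ite (.at2 48 (qN 2) (bN 3)) (.lit 1) (.lit 0))) (.at1 13 (qN 2))))

/-- Look for a perfect subgraph in the ball of radius `var 1 + 1` with the center in cell 66. -/
def teamStep : Cm :=
  bfs 42 43 (.cell 66) (.add (.var 1) (.lit 1)) 2 ;; sim ;;
  .ite (.and (.cell 49) capTest) (listTeam ;; keepTeam) .skip

/-- Collect the perfect subgraphs from all affected balls. -/
def teamPhase : Cm :=
  .put0 46 (.cell 9) ;; .rep 0 (.cell 9) (.put1 47 (.var 0) (.at1 10 (.var 0))) ;;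
  .put0 50 (.lit 0) ;;
  .rep 0 (.cell 40) (.put0 66 (.at1 41 (.var 0)) ;;
    .ite (.at1 3 (.cell 66)) (.rep 1 (.cell 1) teamStep) .skip)

section collecting

variable {N : ℕ} {ρ : ℕ → ℕ} {σ : Store} {P : Pattern} {B G : DataGraph} {T : List (Finset ℕ)}

theorem listTeam_does {n : ℕ} (hQ : Lists (fun j => σ 47 j 0 0) (σ 46 0 0 0) P.V)
    (hB : Lists (fun j => σ 43 j 0 0) (σ 42 0 0 0) B.V) (hQN : P.V.card ≤ N) (hBN : B.V.card ≤ N)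
    (h48 : ∀ u ∈ P.V, ∀ w ∈ B.V, (σ 48 u w 0 ≠ 0 ↔ (u, w) ∈ maxMatch P B))
    (hn : σ 50 0 0 0 = n) :
    listTeam.Does N ρ σ fun σ' =>
      Lists (fun j => σ' 51 n j 0) (σ' 52 n 0 0) ((maxMatch P B).image Prod.snd) ∧
      ∀ p, p ≠ n → σ' 51 p = σ 51 p ∧ σ' 52 p = σ 52 p := by
  rw [hB.card_eq] at hBN
  rw [hQ.card_eq] at hQN
  simp only [listTeam, Cm.Does.seq_iff (p := .put1 52 _ _), Cm.Does.put1_iff, Tm.ok_lit,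
    Tm.eval_lit, Tm.ok_cell, Tm.eval_cell, hn, true_and]
  set σ₀ := σ.write 52 n 0 0 0 with hσ₀
  have e₀ : ∀ a, a ≠ 52 → σ₀ a = σ a := fun a h => Store.write_of_ne _ _ _ _ _ h
  refine Cm.Does.rep (σ 42 0 0 0) (fun m σ' => Lists (fun j => σ' 51 n j 0) (σ' 52 n 0 0)
    (((Finset.range m).image fun j => σ 43 j 0 0).filter fun w => ∃ u, (u, w) ∈ maxMatch P B) ∧
    ∀ p, p ≠ n → σ' 51 p = σ 51 p ∧ σ' 52 p = σ 52 p) (by simp) (by simp [e₀ 42]) hBN ?_ ?_ ?_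
  · refine ⟨?_, fun p hp => ⟨by rw [e₀ 51 (by omega)], ?_⟩⟩
    · rw [show σ₀ 52 n 0 0 = 0 by simp [hσ₀, Store.write_apply]]
      exact Lists.filter_zero _ _ _
    · funext j l; simp [hσ₀, Store.write_apply, hp]
  · rintro m hm σ₁ k₁ ⟨h₁, h₁'⟩
    have hw := hB.mem hm
    have e42 : σ₁ 42 = σ 42 := by rw [k₁ 42 rfl, e₀ 42 (by omega)]
    have e43 : σ₁ 43 = σ 43 := by rw [k₁ 43 rfl, e₀ 43 (by omega)]
    have e46 : σ₁ 46 = σ 46 := by rw [k₁ 46 rfl, e₀ 46 (by omega)]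
    have e47 : σ₁ 47 = σ 47 := by rw [k₁ 47 rfl, e₀ 47 (by omega)]
    have e48 : σ₁ 48 = σ 48 := by rw [k₁ 48 rfl, e₀ 48 (by omega)]
    have e50 : σ₁ 50 0 0 0 = n := by rw [k₁ 50 rfl, e₀ 50 (by omega), hn]
    have hcond : (∃ x < σ 46 0 0 0, σ 48 (σ 47 x 0 0) (σ 43 m 0 0) 0 ≠ 0) ↔
        ∃ u, (u, σ 43 m 0 0) ∈ maxMatch P B := by
      constructor
      · rintro ⟨x, hx, h⟩
        exact ⟨_, (h48 _ (hQ.mem hx) _ hw).1 h⟩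
      · rintro ⟨u, h⟩
        have hu := (Finset.mem_product.1 (Finset.mem_filter.1 h).1).1
        obtain ⟨x, hx, rfl⟩ := hQ.mem_iff.1 hu
        exact ⟨x, hx, (h48 _ hu _ hw).2 h⟩
    simp only [Cm.Does.ite_iff, Tm.ok_ex, Tm.ok_cell, Tm.ok_at2, Tm.ok_at1, Tm.ok_var, Tm.ok_add,
      Tm.ok_lit, qN, bN, Tm.holds_ex, Tm.holds_at2, Tm.eval_cell, Tm.eval_at1, Tm.eval_var,
      Tm.eval_add, Tm.eval_lit, Function.update_self,
      Function.update_of_ne (show (2 : ℕ) ≠ 3 by omega), e43, e46, e47, e48, e50,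
      hcond, Cm.Does.seq_iff, Cm.Does.put2_iff, Cm.Does.put1_iff, Cm.Does.skip_iff,
      Store.write_of_ne _ _ _ _ _ (show 50 ≠ 51 by omega),
      Store.write_of_ne _ _ _ _ _ (show 52 ≠ 51 by omega), true_and, and_true, implies_true, hQN]
    refine ⟨fun hp => ⟨?_, fun p hpn => ⟨?_, ?_⟩⟩, fun hp => ⟨h₁.filter_skip hp, h₁'⟩⟩
    · have := hB.filter_push hm h₁ hp
        (f' := fun j => if j = σ₁ 52 n 0 0 then σ 43 m 0 0 else σ₁ 51 n j 0)
        (fun j hj => by simp [hj.ne]) (by simp)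
      simpa [Store.write_apply] using this
    · rw [← (h₁' p hpn).1]; funext j l; simp [Store.write_apply, hpn]
    · rw [← (h₁' p hpn).2]; funext j l; simp [Store.write_apply, hpn]
  · rintro σ₁ - ⟨h₁, h₁'⟩
    rw [hB.image_eq] at h₁
    refine ⟨h₁.of_mem_iff fun w => ?_, h₁'⟩
    simp only [Finset.mem_filter, Finset.mem_image, Prod.exists, exists_eq_right]
    refine ⟨fun h => h.2, fun ⟨u, h⟩ => ⟨?_, u, h⟩⟩
    exact (Finset.mem_product.1 (Finset.mem_filter.1 h).1).2

theorem keepTeam_does {n : ℕ} {X : Finset ℕ} (hT : TeamsIn σ G T) (hG : DataIn σ G)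
    (hn : T.length = n) (hX : Lists (fun j => σ 51 n j 0) (σ 52 n 0 0) X)
    (hnN : n ≤ N) (hXN : X.card ≤ N) :
    keepTeam.Does N ρ σ fun σ' => TeamsIn σ' G (if X ∈ T then T else T ++ [X]) := by
  have e50 : σ 50 0 0 0 = n := hT.num.trans hn
  rw [hX.card_eq] at hXN
  have hcond : (∃ p < n, σ 52 p 0 0 = σ 52 n 0 0 ∧ ∀ x < σ 52 p 0 0, ∃ y < σ 52 n 0 0,
      σ 51 n y 0 = σ 51 p x 0) ↔ X ∈ T := by
    constructor
    · rintro ⟨p, hp, hc, h⟩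
      have hpT : T[p]? = some T[p] := by simp
      have hL := hT.sets p _ hpT
      have hsub : T[p] ⊆ X := fun z hz => by
        obtain ⟨x, hx, rfl⟩ := hL.mem_iff.1 hz
        exact hX.mem_iff.2 (h x hx)
      have : T[p] = X := Finset.eq_of_subset_of_card_le hsub (by
        rw [hL.card_eq, hX.card_eq, hc])
      rw [← this]; exact List.getElem_mem _
    · intro h
      obtain ⟨p, hp, e⟩ := List.getElem_of_mem h
      have hpT : T[p]? = some X := by rw [← e]; simp
      have hL := hT.sets p _ hpT
      refine ⟨p, hn ▸ hp, by rw [← hL.card_eq, hX.card_eq], fun x hx => ?_⟩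
      exact hX.mem_iff.1 (hL.mem hx)
  have harcs : ∑ x ∈ Finset.range (σ 52 n 0 0), ∑ y ∈ Finset.range (σ 52 n 0 0),
      σ 7 (σ 51 n x 0) (σ 51 n y 0) 0 = arcs G X := by
    simp only [hG.adj]
    rw [arcs, ← hX.sum (fun a => ∑ b ∈ X, bit (G.graph.Adj a b))]
    exact Finset.sum_congr rfl fun x _ => hX.sum (fun b => bit (G.graph.Adj (σ 51 n x 0) b))
  simp only [keepTeam, Cm.Does.ite_iff, Tm.ok_ex, Tm.ok_all, Tm.ok_and, Tm.ok_eq, Tm.ok_cell,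
    Tm.ok_at2, Tm.ok_at1, Tm.ok_var, Tm.ok_add, Tm.ok_lit, Tm.ok_sum, Tm.holds_ex, Tm.holds_and,
    Tm.holds_all, Tm.holds_eq, Tm.eval_cell, Tm.eval_at1, Tm.eval_at2, Tm.eval_var, Tm.eval_add,
    Tm.eval_lit, Tm.eval_sum, Function.update_self,
    Function.update_of_ne (show (2 : ℕ) ≠ 3 by omega),
    Function.update_of_ne (show (2 : ℕ) ≠ 4 by omega),
    Function.update_of_ne (show (3 : ℕ) ≠ 4 by omega), e50, hcond, harcs, Cm.Does.seq_iff,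
    Cm.Does.put1_iff, Cm.Does.put0_iff, Cm.Does.skip_iff,
    Store.write_of_ne _ _ _ _ _ (show 50 ≠ 53 by omega), true_and, and_true, implies_true, hnN,
    hXN]
  refine ⟨fun p hp e => e ▸ hXN, fun h => by rw [if_pos h]; exact hT, fun h => ?_⟩
  rw [if_neg h]
  set σ₁ := (σ.write 53 n 0 0 (arcs G X)).write 50 0 0 0 (n + 1) with hσ₁
  have e51 : σ₁ 51 = σ 51 := by
    rw [hσ₁, Store.write_of_ne _ _ _ _ _ (by omega), Store.write_of_ne _ _ _ _ _ (by omega)]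
  have e52 : σ₁ 52 = σ 52 := by
    rw [hσ₁, Store.write_of_ne _ _ _ _ _ (by omega), Store.write_of_ne _ _ _ _ _ (by omega)]
  have hget : ∀ p Y, (T ++ [X])[p]? = some Y → (p ≠ n ∧ T[p]? = some Y) ∨ (p = n ∧ Y = X) := by
    intro p Y hp
    rw [List.getElem?_append] at hp
    split_ifs at hp with hlt
    · exact Or.inl ⟨by omega, hp⟩
    · have : p = n := by
        by_contra hne
        rw [List.getElem?_eq_none (by simp; omega)] at hp
        simp at hp
      subst this
      rw [hn] at hp
      simp at hp
      exact Or.inr ⟨rfl, hp.symm⟩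
  refine ⟨by simp [hσ₁, Store.write_apply, hn], ?_, fun p Y hp => ?_, fun p Y hp => ?_⟩
  · rw [List.nodup_append]
    refine ⟨hT.nodup, List.nodup_singleton _, ?_⟩
    rintro a ha b hb rfl
    rw [List.mem_singleton] at hb
    exact h (hb ▸ ha)
  · rw [e51, e52]
    rcases hget p Y hp with ⟨-, hp⟩ | ⟨rfl, rfl⟩
    · exact hT.sets p Y hp
    · exact hX
  · rcases hget p Y hp with ⟨hne, hp⟩ | ⟨rfl, rfl⟩
    · rw [← hT.arcs p Y hp]
      simp [hσ₁, Store.write_apply, hne]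
    · simp [hσ₁, Store.write_apply]

theorem matched_eq_filter {M : Finset (ℕ × ℕ)} {A C : Finset ℕ} (hM : M ⊆ A ×ˢ C) (u : ℕ) :
    matched M u = C.filter fun w => (u, w) ∈ M := by
  ext w
  rw [mem_matched, Finset.mem_filter]
  exact ⟨fun h => ⟨(Finset.mem_product.1 (hM h)).2, h⟩, fun h => h.2⟩

theorem teamStep_does {v t : ℕ} (hP : PatIn σ P) (hG : DataIn σ G) (hT : TeamsIn σ G T)
    (hQ : Lists (fun j => σ 47 j 0 0) (σ 46 0 0 0) P.V) (hv : σ 66 0 0 0 = v) (hvV : v ∈ G.V)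
    (ht : ρ 1 = t) (htN : t + 1 ≤ N) (hPN : P.V.card ≤ N)
    (hBN : (G.ball v (t + 1)).V.card ≤ N) (hTN : T.length ≤ N) :
    teamStep.Does N ρ σ fun σ' => ∃ T', TeamsIn σ' G T' ∧
      ∀ X, X ∈ T' ↔ X ∈ T ∨ IsTeam P (G.ball v (t + 1)) X := by
  refine (bfs_does hG (by omega) (by omega) (by omega) (by simp) (by simpa using hv) hvV
    (fun σ' _ => ⟨by simp, by simp [ht]⟩) htN hBN).seq fun σ₁ k₁ h₁ => ?_
  replace k₁ : ∀ a, a ≠ 43 → a ≠ 42 → σ₁ a = σ a := fun a h h' => k₁ a (bfs_keeps.2 ⟨h, h'⟩)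
  have hG₁ : DataIn σ₁ G := hG.congr fun a _ _ => k₁ a (by omega) (by omega)
  have hP₁ : PatIn σ₁ P := hP.congr fun a _ _ => k₁ a (by omega) (by omega)
  have hB₁ := hG₁.ballIn h₁
  set B := G.ball v (t + 1) with hB
  have hQ₁ : Lists (fun j => σ₁ 47 j 0 0) (σ₁ 46 0 0 0) P.V := by
    rw [k₁ 46 (by omega) (by omega), k₁ 47 (by omega) (by omega)]; exact hQ
  have hs₁ : SimIn σ₁ P B := ⟨hQ₁, h₁, hP₁.label, hP₁.adj, hB₁.labels, hB₁.edges⟩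
  refine (sim_does hs₁ hPN hBN).seq fun σ₂ k₂ ⟨h49, h48⟩ => ?_
  replace k₂ : ∀ a, a ≠ 48 → a ≠ 49 → σ₂ a = σ₁ a := fun a h h' => k₂ a (sim_keeps h h')
  have hs₂ := hs₁.congr k₂
  have hG₂ : DataIn σ₂ G := hG₁.congr fun a _ _ => k₂ a (by omega) (by omega)
  have hP₂ : PatIn σ₂ P := hP₁.congr fun a _ _ => k₂ a (by omega) (by omega)
  have hT₂ : TeamsIn σ₂ G T := hT.congr fun a _ _ => by
    rw [k₂ a (by omega) (by omega), k₁ a (by omega) (by omega)]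
  have hQN := hPN
  have hBN' := hBN
  rw [hs₂.nodes.card_eq] at hQN
  rw [hs₂.ball.card_eq] at hBN'
  have hcount : Matches P B → ∀ u ∈ P.V, ∑ y ∈ Finset.range (σ₂ 42 0 0 0),
      (if σ₂ 48 u (σ₂ 43 y 0 0) 0 ≠ 0 then 1 else 0) = (matched (maxMatch P B) u).card := by
    intro hM u hu
    rw [hs₂.ball.sum (fun w => if σ₂ 48 u w 0 ≠ 0 then 1 else 0),
      matched_eq_filter (maxMatch_isMatch P B hM).subset, Finset.card_filter]
    exact Finset.sum_congr rfl fun w hw => if_congr (h48 hM u hu w hw) rfl rfl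
  have hcap : Matches P B → ((∀ x < σ₂ 46 0 0 0,
      σ₂ 12 (σ₂ 47 x 0 0) 0 0 ≤ ∑ y ∈ Finset.range (σ₂ 42 0 0 0),
        (if σ₂ 48 (σ₂ 47 x 0 0) (σ₂ 43 y 0 0) 0 ≠ 0 then 1 else 0) ∧
      ∑ y ∈ Finset.range (σ₂ 42 0 0 0),
        (if σ₂ 48 (σ₂ 47 x 0 0) (σ₂ 43 y 0 0) 0 ≠ 0 then 1 else 0) ≤ σ₂ 13 (σ₂ 47 x 0 0) 0 0) ↔
      ∀ u ∈ P.V, (matched (maxMatch P B) u).card ∈ P.cap u) := by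
    intro hM
    have hu : ∀ u ∈ P.V, (σ₂ 12 u 0 0 ≤ ∑ y ∈ Finset.range (σ₂ 42 0 0 0),
        (if σ₂ 48 u (σ₂ 43 y 0 0) 0 ≠ 0 then 1 else 0) ∧
      ∑ y ∈ Finset.range (σ₂ 42 0 0 0),
        (if σ₂ 48 u (σ₂ 43 y 0 0) 0 ≠ 0 then 1 else 0) ≤ σ₂ 13 u 0 0) ↔
        (matched (maxMatch P B) u).card ∈ P.cap u := fun u hu => by
      rw [hcount hM u hu, hP₂.lo u hu, hP₂.hi u hu]; rfl
    constructor
    · intro h u hu'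
      obtain ⟨x, hx, rfl⟩ := hs₂.nodes.mem_iff.1 hu'
      exact (hu _ hu').1 (h x hx)
    · intro h x hx
      exact (hu _ (hs₂.nodes.mem hx)).2 (h _ (hs₂.nodes.mem hx))
  have hcond : (Tm.and (.cell 49) capTest).holds σ₂ ρ ↔ Matches P B ∧
      ∀ u ∈ P.V, (matched (maxMatch P B) u).card ∈ P.cap u := by
    simp only [capTest, Tm.holds_and, Tm.holds_all, Tm.holds_cell, Tm.holds_le, h49, bit_ne_zero,
      qN, bN, Tm.eval_cell, Tm.eval_at1, Tm.eval_var, Tm.eval_sum, Tm.eval_ite, Tm.holds_at2,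
      Tm.eval_lit, Function.update_self, Function.update_of_ne (show (2 : ℕ) ≠ 3 by omega)]
    exact and_congr_right hcap
  rw [Cm.Does.ite_iff, hcond, Cm.Does.skip_iff]
  refine ⟨?_, fun ⟨hM, hc⟩ => ?_, fun hne => ⟨T, hT₂, fun X => ?_⟩⟩
  · simp [capTest, qN, bN, hQN, hBN']
  · refine (listTeam_does hs₂.nodes hs₂.ball hPN hBN (h48 hM) hT₂.num).seq
      fun σ₃ k₃ ⟨h₃, h₃'⟩ => ?_
    have hT₃ : TeamsIn σ₃ G T := by
      have hlt : ∀ p X, T[p]? = some X → p ≠ T.length := fun p X hp => by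
        rintro rfl; simp at hp
      refine ⟨by rw [k₃ 50 rfl]; exact hT₂.num, hT₂.nodup, fun p X hp => ?_, fun p X hp => ?_⟩
      · have := h₃' p (hlt p X hp)
        rw [this.1, this.2]; exact hT₂.sets p X hp
      · rw [k₃ 53 rfl]; exact hT₂.arcs p X hp
    refine (keepTeam_does hT₃ (hG₂.congr fun a _ _ => k₃ a (by interval_cases a <;> rfl)) rfl h₃
      hTN ?_).mono fun σ₄ _ h₄ => ⟨_, h₄, fun X => ?_⟩
    · refine (Finset.card_le_card fun w hw => ?_).trans hBN
      obtain ⟨p, hp, rfl⟩ := Finset.mem_image.1 hw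
      exact (Finset.mem_product.1 (Finset.mem_filter.1 hp).1).2
    · have : IsTeam P B X ↔ X = (maxMatch P B).image Prod.snd :=
        ⟨fun h => h.2.2, fun h => ⟨hM, hc, h⟩⟩
      rw [this]
      split_ifs with hmem
      · exact ⟨Or.inl, fun h => h.elim id fun e => e ▸ hmem⟩
      · simp
  · exact ⟨Or.inl, fun h => h.elim id fun h => absurd ⟨h.1, h.2.1⟩ hne⟩

/-- The list holds exactly the perfect subgraphs that come from balls with centers in `A`. -/
theorem teamPhase_does {r : ℕ} {A : Finset ℕ} (hP : PatIn σ P) (hG : DataIn σ G)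
    (hr : σ 1 0 0 0 = r) (hA : Lists (fun j => σ 41 j 0 0) (σ 40 0 0 0) A) (hAN : A.card ≤ N)
    (hrN : r ≤ N) (hPN : P.V.card ≤ N) (hBN : ∀ v ∈ A, ∀ t ≤ r, (G.ball v t).V.card ≤ N)
    (hTN : A.card * r ≤ N) :
    teamPhase.Does N ρ σ fun σ' => ∃ T, TeamsIn σ' G T ∧ T.length ≤ A.card * r ∧
      (∀ X ∈ T, X.card ≤ N) ∧
      ∀ X, X ∈ T ↔ ∃ v ∈ A, v ∈ G.V ∧ ∃ t, 1 ≤ t ∧ t ≤ r ∧ IsTeam P (G.ball v t) X := by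
  have hPn := hP.nodes.card_eq
  have hAn := hA.card_eq
  simp only [teamPhase, Cm.Does.seq_iff (p := .put0 46 _), Cm.Does.put0_iff, Tm.ok_cell,
    Tm.eval_cell, true_and]
  set σ₀ := σ.write 46 0 0 0 (σ 9 0 0 0) with hσ₀
  have e₀ : ∀ a, a ≠ 46 → σ₀ a = σ a := fun a h => Store.write_of_ne _ _ _ _ _ h
  refine (Cm.Does.rep (σ 9 0 0 0) (fun m σ' => ∀ j < m, σ' 47 j 0 0 = σ 10 j 0 0) (by simp)
    (by simp [e₀ 9]) (hPn ▸ hPN) (by simp) ?_ (fun σ' _ h => h)).seq fun σ₁ k₁ h₁ => ?_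
  · intro m hm σ₁ k₁ h₁
    simp only [Cm.Does.put1_iff, Tm.ok_var, Tm.ok_at1, Tm.eval_var, Tm.eval_at1, k₁ 10 rfl,
      Function.update_self, e₀ 10 (show 10 ≠ 46 by omega), true_and, Store.write_apply, and_true]
    intro j hj
    by_cases hjm : j = m
    · simp [hjm]
    · rw [if_neg hjm]; exact h₁ j (by omega)
  simp only [Cm.Does.seq_iff (p := .put0 50 _), Cm.Does.put0_iff, Tm.ok_lit,
    Tm.eval_lit, true_and]
  set σ₂ := σ₁.write 50 0 0 0 0 with hσ₂
  have e₂ : ∀ a, a ≠ 46 → a ≠ 47 → a ≠ 50 → σ₂ a = σ a := fun a h h' h'' => by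
    rw [hσ₂, Store.write_of_ne _ _ _ _ _ h'', k₁ a (by simp [Cm.keeps, Cm.put1, h']), e₀ a h]
  have hQ₂ : Lists (fun j => σ₂ 47 j 0 0) (σ₂ 46 0 0 0) P.V := by
    rw [hσ₂, Store.write_of_ne _ _ _ _ _ (show 46 ≠ 50 by omega),
      Store.write_of_ne _ _ _ _ _ (show 47 ≠ 50 by omega), k₁ 46 rfl,
      show σ₀ 46 0 0 0 = σ 9 0 0 0 by simp [hσ₀, Store.write_apply]]
    exact hP.nodes.congr h₁
  set D := fun m => (Finset.range m).image fun j => σ 41 j 0 0 with hD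
  have hDs : ∀ m, D (m + 1) = insert (σ 41 m 0 0) (D m) := fun m => by
    simp [hD, Finset.range_add_one, Finset.image_insert]
  have hDA : D (σ 40 0 0 0) = A := hA.image_eq
  have hDsub : ∀ m ≤ σ 40 0 0 0, D m ⊆ A := fun m hm => by
    rw [← hDA]
    exact Finset.image_subset_image (Finset.range_subset_range.2 hm)
  have hlen : ∀ T : List (Finset ℕ), T.Nodup → (∀ X ∈ T, ∃ v ∈ A, ∃ t, 1 ≤ t ∧ t ≤ r ∧
      IsTeam P (G.ball v t) X) → T.length ≤ A.card * r := by
    intro T hT h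
    rw [← List.toFinset_card_of_nodup hT]
    have : T.toFinset ⊆ (A ×ˢ Finset.Icc 1 r).image fun p =>
        (maxMatch P (G.ball p.1 p.2)).image Prod.snd := by
      intro X hX
      obtain ⟨v, hv, t, h1, h2, -, -, rfl⟩ := h X (List.mem_toFinset.1 hX)
      exact Finset.mem_image.2 ⟨(v, t), by simp [hv, h1, h2], rfl⟩
    refine ((Finset.card_le_card this).trans Finset.card_image_le).trans ?_
    rw [Finset.card_product, Nat.card_Icc]; simp
  refine Cm.Does.rep (σ 40 0 0 0) (fun m σ' => ∃ T, TeamsIn σ' G T ∧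
    ∀ X, X ∈ T ↔ ∃ v ∈ D m, v ∈ G.V ∧ ∃ t, 1 ≤ t ∧ t ≤ r ∧ IsTeam P (G.ball v t) X) (by simp)
    (by simp [e₂ 40]) (hAn ▸ hAN) ?_ ?_ ?_
  · refine ⟨[], ⟨by simp [hσ₂, Store.write_apply], by simp, by simp, by simp⟩, by simp [hD]⟩
  · rintro m hm σ₃ k₃ ⟨T, hT₃, hTm⟩
    set v := σ 41 m 0 0 with hv
    have hvA : v ∈ A := hA.mem hm
    have e41 : σ₃ 41 = σ 41 := by rw [k₃ 41 rfl, e₂ 41 (by omega) (by omega) (by omega)]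
    simp only [Cm.Does.seq_iff, Cm.Does.put0_iff, Tm.ok_at1, Tm.ok_var, Tm.eval_at1, Tm.eval_var,
      Function.update_self, e41, ← hv, true_and]
    set σ₄ := σ₃.write 66 0 0 0 v with hσ₄
    have e₄ : ∀ a, a ≠ 66 → σ₄ a = σ₃ a := fun a h => Store.write_of_ne _ _ _ _ _ h
    have e66 : σ₄ 66 0 0 0 = v := by simp [hσ₄, Store.write_apply]
    have kk : ∀ a, a ≤ 15 → σ₄ a = σ a := fun a ha => by
      rw [e₄ a (by omega), k₃ a (by interval_cases a <;> rfl),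
        e₂ a (by omega) (by omega) (by omega)]
    have hG₄ : DataIn σ₄ G := hG.congr fun a _ _ => kk a (by omega)
    have hP₄ : PatIn σ₄ P := hP.congr fun a _ _ => kk a (by omega)
    have hT₄ : TeamsIn σ₄ G T := hT₃.congr fun a _ _ => e₄ a (by omega)
    have hQ₄ : Lists (fun j => σ₄ 47 j 0 0) (σ₄ 46 0 0 0) P.V := by
      rw [e₄ 46 (by omega), e₄ 47 (by omega), k₃ 46 rfl, k₃ 47 rfl]; exact hQ₂
    simp only [Cm.Does.ite_iff, Tm.ok_at1, Tm.ok_cell, Tm.holds_at1, Tm.eval_cell, e66,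
      hG₄.node, bit_ne_zero, true_and, Cm.Does.skip_iff]
    refine ⟨fun hvG => ?_, fun hvG => ⟨T, hT₄, fun X => ?_⟩⟩
    · refine Cm.Does.rep r (fun s σ' => ∃ T, TeamsIn σ' G T ∧ ∀ X, X ∈ T ↔
        (∃ v ∈ D m, v ∈ G.V ∧ ∃ t, 1 ≤ t ∧ t ≤ r ∧ IsTeam P (G.ball v t) X) ∨
        ∃ t, 1 ≤ t ∧ t ≤ s ∧ IsTeam P (G.ball v t) X) (by simp) (by simp [kk 1, hr]) hrN
        ⟨T, hT₄, fun X => ?_⟩ ?_ ?_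
      · rw [hTm]
        exact ⟨Or.inl, fun h => h.elim id fun ⟨t, h1, h2, _⟩ => absurd (h1.trans h2) (by omega)⟩
      · rintro s hs σ₅ k₅ ⟨T₅, hT₅, hm₅⟩
        have k : ∀ a, a ≤ 15 ∨ a = 46 ∨ a = 47 ∨ a = 66 → σ₅ a = σ₄ a := fun a ha => k₅ a (by
          rcases ha with h | rfl | rfl | rfl
          · interval_cases a <;> rfl
          all_goals rfl)
        have hl : T₅.length ≤ N := (hlen T₅ hT₅.nodup fun X hX => by
          rcases (hm₅ X).1 hX with ⟨w, hw, -, t, h⟩ | ⟨t, h1, h2, h3⟩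
          exacts [⟨w, hDsub m hm.le hw, t, h⟩, ⟨v, hvA, t, h1, by omega, h3⟩]).trans hTN
        refine (teamStep_does (v := v) (t := s) (hP₄.congr fun a _ _ => k a (by omega))
          (hG₄.congr fun a _ _ => k a (by omega)) hT₅ (by rw [k 46 (by omega), k 47 (by omega)]; exact hQ₄)
          (by rw [k 66 (by omega), e66]) hvG (by simp) (by omega) hPN (hBN v hvA _ hs) hl).mono ?_
        rintro σ₆ - ⟨T₆, hT₆, hm₆⟩
        refine ⟨T₆, hT₆, fun X => ?_⟩
        rw [hm₆, hm₅, or_assoc]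
        refine or_congr_right ⟨?_, ?_⟩
        · rintro (⟨t, h1, h2, h3⟩ | h)
          exacts [⟨t, h1, by omega, h3⟩, ⟨s + 1, by omega, le_rfl, h⟩]
        · rintro ⟨t, h1, h2, h3⟩
          rcases Nat.lt_succ_iff_lt_or_eq.1 (Nat.lt_succ_of_le h2) with h | rfl
          exacts [Or.inl ⟨t, h1, by omega, h3⟩, Or.inr h3]
      · rintro σ₅ - ⟨T₅, hT₅, hm₅⟩
        refine ⟨T₅, hT₅, fun X => ?_⟩
        rw [hm₅, hDs]
        simp only [Finset.mem_insert, exists_eq_or_imp, ← hv, hvG, true_and]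
        exact or_comm
    · rw [hTm, hDs]
      simp only [Finset.mem_insert, exists_eq_or_imp, ← hv, hvG, false_and, false_or]
  · rintro σ₃ - ⟨T, hT₃, hTm⟩
    rw [hDA] at hTm
    refine ⟨T, hT₃, hlen T hT₃.nodup fun X hX => ?_, fun X hX => ?_, hTm⟩
    · obtain ⟨v, hv, -, h⟩ := (hTm X).1 hX
      exact ⟨v, hv, h⟩
    · obtain ⟨v, hv, -, t, -, h2, -, -, rfl⟩ := (hTm X).1 hX
      refine (Finset.card_le_card fun w hw => ?_).trans (hBN v hv t h2)
      obtain ⟨p, hp, rfl⟩ := Finset.mem_image.1 hw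
      exact (Finset.mem_product.1 (Finset.mem_filter.1 hp).1).2

end collecting

/-! ### The top-k list -/

/-- Each edge is counted once in either direction. -/
theorem arcs_eq_two_mul {G : DataGraph} {X : Finset ℕ} (hX : X ⊆ G.V) :
    arcs G X = 2 * (G.induce X).graph.edgeSet.ncard := by
  set S := (X ×ˢ X).filter fun p => G.graph.Adj p.1 p.2 ∧ p.1 < p.2 with hS
  set S' := (X ×ˢ X).filter fun p => G.graph.Adj p.1 p.2 ∧ p.2 < p.1 with hS'
  have hadj : ∀ a b, (G.induce X).graph.Adj a b ↔ G.graph.Adj a b ∧ a ∈ X ∧ b ∈ X := by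
    intro a b
    simp only [DataGraph.induce, inside, Finset.mem_inter]
    exact ⟨fun h => ⟨h.1, h.2.1.2, h.2.2.2⟩, fun h => ⟨h.1, ⟨hX h.2.1, h.2.1⟩, hX h.2.2, h.2.2⟩⟩
  have h1 : arcs G X = S.card + S'.card := by
    rw [arcs, ← Finset.sum_product', hS, hS', Finset.card_filter, Finset.card_filter,
      ← Finset.sum_add_distrib]
    refine Finset.sum_congr rfl fun p _ => ?_
    by_cases h : G.graph.Adj p.1 p.2
    · rcases lt_or_gt_of_ne h.ne with h' | h'
      · simp [bit, h, h', h'.not_gt]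
      · simp [bit, h, h', h'.not_gt]
    · simp [bit, h]
  have h2 : S'.card = S.card := by
    refine Finset.card_bij (fun p _ => (p.2, p.1)) (fun p hp => ?_) (fun p _ q _ e => ?_)
      fun p hp => ⟨(p.2, p.1), ?_, rfl⟩
    · simp only [hS, hS', Finset.mem_filter, Finset.mem_product] at hp ⊢
      exact ⟨⟨hp.1.2, hp.1.1⟩, hp.2.1.symm, hp.2.2⟩
    · simp only [Prod.mk.injEq] at e
      exact Prod.ext e.2 e.1
    · simp only [hS, hS', Finset.mem_filter, Finset.mem_product] at hp ⊢
      exact ⟨⟨hp.1.2, hp.1.1⟩, hp.2.1.symm, hp.2.2⟩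
  have h3 : (G.induce X).graph.edgeSet = (S.image fun p => s(p.1, p.2) : Finset (Sym2 ℕ)) := by
    ext e
    induction e using Sym2.ind with
    | _ a b =>
      simp only [SimpleGraph.mem_edgeSet, hadj, Finset.coe_image, Set.mem_image, Finset.mem_coe,
        hS, Finset.mem_filter, Finset.mem_product, Prod.exists]
      constructor
      · rintro ⟨h, ha, hb⟩
        rcases lt_or_gt_of_ne h.ne with h' | h'
        · exact ⟨a, b, ⟨⟨ha, hb⟩, h, h'⟩, rfl⟩
        · exact ⟨b, a, ⟨⟨hb, ha⟩, h.symm, h'⟩, Sym2.eq_swap⟩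
      · rintro ⟨x, y, ⟨⟨hx, hy⟩, h, -⟩, e⟩
        rcases Sym2.eq_iff.1 e with ⟨rfl, rfl⟩ | ⟨rfl, rfl⟩
        exacts [⟨h, hx, hy⟩, ⟨h.symm, hy, hx⟩]
  rw [h1, h2, h3, Set.ncard_coe_finset, Finset.card_image_of_injOn, two_mul]
  rintro ⟨a, b⟩ hp ⟨c, d⟩ hq e
  simp only [hS, Finset.coe_filter, Set.mem_ofPred_eq] at hp hq
  rcases Sym2.eq_iff.1 e with ⟨h, h'⟩ | ⟨h, h'⟩
  · exact Prod.ext h h'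
  · simp only at h h'; omega

theorem density_eq {G : DataGraph} {X : Finset ℕ} (hX : X ⊆ G.V) :
    (G.induce X).density = (arcs G X : ℚ) / X.card / 2 := by
  rw [arcs_eq_two_mul hX, DataGraph.density]
  have : (G.induce X).V = X := Finset.inter_eq_right.2 hX
  rw [this]; push_cast; ring

/-- Comparison of densities without division, by cross-multiplication. -/
theorem density_lt_iff {G : DataGraph} {X Y : Finset ℕ} (hX : X ⊆ G.V) (hY : Y ⊆ G.V)
    (hX0 : X.Nonempty) (hY0 : Y.Nonempty) :
    (G.induce Y).density < (G.induce X).density ↔ Y.card * arcs G X > X.card * arcs G Y := by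
  have h1 : (0 : ℚ) < X.card := by exact_mod_cast hX0.card_pos
  have h2 : (0 : ℚ) < Y.card := by exact_mod_cast hY0.card_pos
  rw [density_eq hX, density_eq hY, div_lt_div_iff_of_pos_right (by norm_num),
    div_lt_div_iff₀ h2 h1, gt_iff_lt, ← Nat.cast_lt (α := ℚ)]
  push_cast
  rw [mul_comm, mul_comm (arcs G X : ℚ)]

section rank

variable {n : ℕ} (d : ℕ → ℚ)

/-- Position `p'` comes before position `p` when positions are sorted by descending `d`. -/
def Before (p' p : ℕ) : Prop := d p < d p' ∨ (d p = d p' ∧ p' < p)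

/-- Number of positions below `n` that come before `p`. -/
noncomputable def rank (n p : ℕ) : ℕ := ((Finset.range n).filter fun p' => Before d p' p).card

variable {d}

theorem Before.trans {p q s : ℕ} (h : Before d p q) (h' : Before d q s) : Before d p s := by
  rcases h with h | ⟨h, h1⟩ <;> rcases h' with h' | ⟨h', h2⟩
  · exact Or.inl (h'.trans h)
  · exact Or.inl (h' ▸ h)
  · exact Or.inl (h ▸ h')
  · exact Or.inr ⟨h'.trans h, h1.trans h2⟩

theorem Before.irrefl (p : ℕ) : ¬ Before d p p := by simp [Before]

theorem Before.total {p q : ℕ} (h : p ≠ q) : Before d p q ∨ Before d q p := by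
  rcases lt_trichotomy (d p) (d q) with h1 | h1 | h1
  · exact Or.inr (Or.inl h1)
  · rcases lt_or_gt_of_ne h with h2 | h2
    · exact Or.inl (Or.inr ⟨h1.symm, h2⟩)
    · exact Or.inr (Or.inr ⟨h1, h2⟩)
  · exact Or.inl (Or.inl h1)

theorem rank_lt_rank {p q : ℕ} (hp : p < n) (h : Before d p q) : rank d n p < rank d n q := by
  refine Finset.card_lt_card (Finset.ssubset_iff_of_subset (fun x hx => ?_) |>.2 ⟨p, ?_, ?_⟩)
  · rw [Finset.mem_filter] at hx ⊢; exact ⟨hx.1, hx.2.trans h⟩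
  · simp [hp, h]
  · simp [Before.irrefl]

theorem rank_lt {p : ℕ} (hp : p < n) : rank d n p < n := by
  have : rank d n p < (Finset.range n).card := Finset.card_lt_card
    (Finset.ssubset_iff_of_subset (Finset.filter_subset _ _) |>.2 ⟨p, by simp [hp],
      by simp [Before.irrefl]⟩)
  simpa using this

theorem rank_inj {p q : ℕ} (hp : p < n) (hq : q < n) (h : rank d n p = rank d n q) : p = q := by
  by_contra hne
  rcases Before.total (d := d) hne with h' | h'
  · exact (rank_lt_rank hp h').ne h
  · exact (rank_lt_rank hq h').ne h.symm

theorem exists_rank {q : ℕ} (hq : q < n) : ∃ p < n, rank d n p = q := by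
  have himg : (Finset.range n).image (rank d n) = Finset.range n := by
    refine Finset.eq_of_subset_of_card_le (fun x hx => ?_) ?_
    · obtain ⟨p, hp, rfl⟩ := Finset.mem_image.1 hx
      exact Finset.mem_range.2 (rank_lt (Finset.mem_range.1 hp))
    · rw [Finset.card_image_of_injOn]
      intro p hp q hq h
      exact rank_inj (by simpa using hp) (by simpa using hq) h
  have : q ∈ (Finset.range n).image (rank d n) := by rw [himg]; simpa using hq
  obtain ⟨p, hp, e⟩ := Finset.mem_image.1 this
  exact ⟨p, Finset.mem_range.1 hp, e⟩

theorem le_of_rank_lt {p q : ℕ} (hq : q < n) (h : rank d n p < rank d n q) : d q ≤ d p := by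
  by_contra hlt
  exact (rank_lt_rank hq (Or.inl (not_le.1 hlt))).not_gt h

end rank

/-- Density of the perfect subgraph number `p`. -/
noncomputable def teamDensity (G : DataGraph) (T : List (Finset ℕ)) (p : ℕ) : ℚ :=
  (G.induce (T.getD p ∅)).density

/-- The `k` densest node sets in `T` in non-ascending order of density. -/
theorem exists_isTopK {P : Pattern} {G : DataGraph} {r k : ℕ} {T : List (Finset ℕ)}
    (hT : T.Nodup) (hmem : ∀ X, X ∈ T ↔ X ∈ teams P G r) :
    ∃ L : List (Finset ℕ), IsTopK P G r k L ∧ L.length = min T.length k ∧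
      ∀ q < min T.length k, ∃ p < T.length, rank (teamDensity G T) T.length p = q ∧
        L[q]? = T[p]? := by
  set n := T.length with hn
  set d := teamDensity G T with hd
  choose! s hs hsr using fun q (hq : q < n) => exists_rank (d := d) hq
  have hget : ∀ p < n, T.getD p ∅ ∈ T := fun p hp => by
    rw [List.getD_eq_getElem _ _ hp]; exact List.getElem_mem _
  have hinj : ∀ p < n, ∀ q < n, T.getD p ∅ = T.getD q ∅ → p = q := fun p hp q hq e => by
    rw [List.getD_eq_getElem _ _ hp, List.getD_eq_getElem _ _ hq] at e
    exact (List.Nodup.getElem_inj_iff hT).1 e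
  refine ⟨(List.range (min n k)).map fun q => T.getD (s q) ∅, ⟨?_, ?_, ?_, by simp, ?_⟩, by simp,
    fun q hq => ?_⟩
  · intro X hX
    obtain ⟨q, hq, rfl⟩ := List.mem_map.1 hX
    rw [List.mem_range] at hq
    exact (hmem _).1 (hget _ (hs q (by omega)))
  · refine List.Nodup.map_on (fun q hq q' hq' e => ?_) List.nodup_range
    rw [List.mem_range] at hq hq'
    have := hinj _ (hs q (by omega)) _ (hs q' (by omega)) e
    rw [← hsr q (by omega), ← hsr q' (by omega), this]
  · rw [List.pairwise_map]
    refine List.pairwise_lt_range.imp_of_mem fun {q q'} hq hq' hlt => ?_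
    rw [List.mem_range] at hq hq'
    refine le_of_rank_lt (d := d) (n := n) (hs q' (by omega)) ?_
    rw [hsr q (by omega), hsr q' (by omega)]; exact hlt
  · intro Y hY hYL
    obtain ⟨p, hp, rfl⟩ := List.getElem_of_mem ((hmem Y).2 hY)
    have hge : min n k ≤ rank d n p := by
      by_contra hlt
      refine hYL (List.mem_map.2 ⟨rank d n p, by simpa using hlt, ?_⟩)
      have h1 := rank_lt (d := d) hp
      rw [rank_inj (hs _ h1) hp (hsr _ h1), List.getD_eq_getElem _ _ hp]
    have hlt : rank d n p < n := rank_lt hp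
    refine ⟨by simp only [List.length_map, List.length_range]; omega, fun X hX => ?_⟩
    obtain ⟨q, hq, rfl⟩ := List.mem_map.1 hX
    rw [List.mem_range] at hq
    have := le_of_rank_lt (d := d) (n := n) hp (p := s q) (by rw [hsr q (by omega)]; omega)
    rw [hd, teamDensity, teamDensity, List.getD_eq_getElem _ _ hp] at this
    exact this
  · refine ⟨s q, hs q (by omega), hsr q (by omega), ?_⟩
    have h1 := hs q (by omega)
    simp only [List.getElem?_map, List.getElem?_range hq, Option.map_some]
    rw [List.getD_eq_getElem _ _ h1, List.getElem?_eq_getElem h1]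

/-- Twice the number of edges of node set number `var e`, times the size of the one with
number `var e'`. -/
def crossTm (e e' d : ℕ) : Tm := .sum d (.at1 52 (.var e')) (.at1 53 (.var e))

/-- Write the perfect subgraphs of rank less than `k` to the output. -/
def outPhase : Cm :=
  .put0 36 (.ite (.le (.cell 50) (.cell 2)) (.cell 50) (.cell 2)) ;;
  .rep 0 (.cell 50) (
    .put0 69 (.sum 1 (.cell 50) (.ite (.or (.lt (crossTm 0 1 2) (crossTm 1 0 2))
      (.and (.eq (crossTm 0 1 2) (crossTm 1 0 2)) (.lt (.var 1) (.var 0)))) (.lit 1) (.lit 0))) ;;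
    .ite (.lt (.cell 69) (.cell 36))
      (.put1 37 (.cell 69) (.at1 52 (.var 0)) ;;
        .rep 1 (.at1 52 (.var 0)) (.put2 38 (.cell 69) (.var 1) (.at2 51 (.var 0) (.var 1))))
      .skip)

theorem outPhase_does {N k r : ℕ} {ρ : ℕ → ℕ} {σ : Store} {P : Pattern} {G : DataGraph}
    {T : List (Finset ℕ)} (hT : TeamsIn σ G T) (hk : σ 2 0 0 0 = k) (hTN : T.length ≤ N)
    (hXN : ∀ X ∈ T, X.card ≤ N) (hXV : ∀ X ∈ T, X ⊆ G.V) (hX0 : ∀ X ∈ T, X.Nonempty)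
    (hmem : ∀ X, X ∈ T ↔ X ∈ teams P G r) :
    outPhase.Does N ρ σ fun σ' => ∃ L, IsTopK P G r k L ∧ StoresOutput σ' L := by
  obtain ⟨L, hL, hLl, hLT⟩ := exists_isTopK (k := k) hT.nodup hmem
  set n := T.length with hn
  set d := teamDensity G T with hd
  have hT? : ∀ p (hp : p < n), T[p]? = some T[p] := fun p hp => by simp
  have hlists : ∀ p (hp : p < n), Lists (fun j => σ 51 p j 0) (σ 52 p 0 0) T[p] :=
    fun p hp => hT.sets p _ (hT? p hp)
  have hsz : ∀ p (hp : p < n), T[p].card = σ 52 p 0 0 := fun p hp => (hlists p hp).card_eq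
  have hszN : ∀ p < n, σ 52 p 0 0 ≤ N := fun p hp => by
    rw [← hsz p hp]; exact hXN _ (List.getElem_mem _)
  have harc : ∀ p (hp : p < n), σ 53 p 0 0 = arcs G T[p] := fun p hp => hT.arcs p _ (hT? p hp)
  have hlt : ∀ p (hp : p < n) q (hq : q < n), d p < d q ↔
      σ 52 q 0 0 * σ 53 p 0 0 < σ 52 p 0 0 * σ 53 q 0 0 := by
    intro p hp q hq
    have := density_lt_iff (G := G) (hXV T[q] (List.getElem_mem _)) (hXV T[p] (List.getElem_mem _))
      (hX0 _ (List.getElem_mem _)) (hX0 _ (List.getElem_mem _))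
    rw [hsz p hp, hsz q hq, ← harc p hp, ← harc q hq, gt_iff_lt] at this
    rw [← this, hd, teamDensity, teamDensity, List.getD_eq_getElem _ _ hp,
      List.getD_eq_getElem _ _ hq]
  have hbefore : ∀ p < n, ∀ q < n,
      (σ 52 q 0 0 * σ 53 p 0 0 < σ 52 p 0 0 * σ 53 q 0 0 ∨
        σ 52 q 0 0 * σ 53 p 0 0 = σ 52 p 0 0 * σ 53 q 0 0 ∧ q < p) ↔ Before d q p := by
    intro p hp q hq
    have h1 := hlt p hp q hq
    have h2 := hlt q hq p hp
    rw [Before, h1]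
    refine or_congr_right (and_congr_left fun _ => ?_)
    constructor
    · intro e
      exact le_antisymm (not_lt.1 fun h => by have := h2.1 h; omega)
        (not_lt.1 fun h => by have := h1.1 h; omega)
    · intro e
      refine le_antisymm (not_lt.1 fun h => ?_) (not_lt.1 fun h => ?_)
      · exact (h2.2 h).ne e.symm
      · exact (h1.2 h).ne e
  have hK : (if n ≤ k then n else k) = min n k := by rw [min_def]
  simp only [outPhase, Cm.Does.seq_iff (p := .put0 36 _), Cm.Does.put0_iff, Tm.ok_ite, Tm.ok_le,
    Tm.ok_cell, Tm.eval_ite, Tm.holds_le, Tm.eval_cell, hT.num, hk, ← hn, hK, true_and, and_true,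
    implies_true]
  set σ₀ := σ.write 36 0 0 0 (min n k) with hσ₀
  have e₀ : ∀ a, a ≠ 36 → σ₀ a = σ a := fun a h => Store.write_of_ne _ _ _ _ _ h
  refine Cm.Does.rep n (fun m σ' => ∀ p (hp : p < n), p < m → rank d n p < min n k →
    Lists (fun j => σ' 38 (rank d n p) j 0) (σ' 37 (rank d n p) 0 0) T[p]) (by simp)
    (by simp [e₀ 50, hT.num, hn]) hTN (by simp) ?_ ?_
  · intro m hm σ₁ k₁ h₁
    have e50 : σ₁ 50 0 0 0 = n := by rw [k₁ 50 rfl, e₀ 50 (by omega), hT.num]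
    have e51 : σ₁ 51 = σ 51 := by rw [k₁ 51 rfl, e₀ 51 (by omega)]
    have e52 : σ₁ 52 = σ 52 := by rw [k₁ 52 rfl, e₀ 52 (by omega)]
    have e53 : σ₁ 53 = σ 53 := by rw [k₁ 53 rfl, e₀ 53 (by omega)]
    have e36 : σ₁ 36 0 0 0 = min n k := by rw [k₁ 36 rfl]; simp [hσ₀, Store.write_apply]
    have hsum : ∑ q ∈ Finset.range n, (if σ 52 q 0 0 * σ 53 m 0 0 < σ 52 m 0 0 * σ 53 q 0 0 ∨
        σ 52 q 0 0 * σ 53 m 0 0 = σ 52 m 0 0 * σ 53 q 0 0 ∧ q < m then 1 else 0) =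
        rank d n m := by
      rw [rank, Finset.card_filter]
      exact Finset.sum_congr rfl fun q hq =>
        if_congr (hbefore m hm q (Finset.mem_range.1 hq)) rfl rfl
    set R := rank d n m with hR
    simp only [Cm.Does.seq_iff (p := .put0 69 _), Cm.Does.put0_iff, crossTm, Tm.ok_sum, Tm.ok_ite,
      Tm.ok_or, Tm.ok_and, Tm.ok_lt, Tm.ok_eq, Tm.ok_cell, Tm.ok_at1, Tm.ok_var, Tm.ok_lit,
      Tm.eval_sum, Tm.eval_ite, Tm.holds_or, Tm.holds_and, Tm.holds_lt, Tm.holds_eq, Tm.eval_cell,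
      Tm.eval_at1, Tm.eval_var, Tm.eval_lit, Function.update_self, Finset.sum_const,
      Finset.card_range, smul_eq_mul,
      Function.update_of_ne (show (0 : ℕ) ≠ 1 by omega),
      Function.update_of_ne (show (0 : ℕ) ≠ 2 by omega),
      Function.update_of_ne (show (1 : ℕ) ≠ 2 by omega), e50, e52, e53, hsum, true_and, and_true,
      implies_true]
    refine ⟨⟨hTN, fun q hq => ?_⟩, ?_⟩
    · have := hszN q hq
      have := hszN m hm
      simp [*]
    set σ₂ := σ₁.write 69 0 0 0 R with hσ₂
    have e₂ : ∀ a, a ≠ 69 → σ₂ a = σ₁ a := fun a h => Store.write_of_ne _ _ _ _ _ h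
    have e69 : σ₂ 69 0 0 0 = R := by simp [hσ₂, Store.write_apply]
    simp only [Cm.Does.ite_iff, Tm.ok_lt, Tm.ok_cell, Tm.holds_lt, Tm.eval_cell, e69, e₂ 36,
      e36, Cm.Does.skip_iff, true_and, ne_eq, Nat.reduceEqDiff, not_false_eq_true]
    refine ⟨fun hRk => ?_, fun hRk p hp hpm hpr => ?_⟩
    · simp only [Cm.Does.seq_iff (p := .put1 37 _ _), Cm.Does.put1_iff, Tm.ok_cell, Tm.ok_at1,
        Tm.ok_var, Tm.eval_cell, Tm.eval_at1, Tm.eval_var, Function.update_self, e69, e₂ 52, e52,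
        true_and, ne_eq, Nat.reduceEqDiff, not_false_eq_true]
      set σ₃ := σ₂.write 37 R 0 0 (σ 52 m 0 0) with hσ₃
      have e₃ : ∀ a, a ≠ 37 → σ₃ a = σ₂ a := fun a h => Store.write_of_ne _ _ _ _ _ h
      refine Cm.Does.rep (σ 52 m 0 0) (fun j σ' => (∀ i < j, σ' 38 R i 0 = σ 51 m i 0) ∧
        ∀ q, q ≠ R → σ' 38 q = σ₁ 38 q) (by simp) (by simp [e₃ 52, e₂ 52, e52]) (hszN m hm)
        ⟨by simp, fun q _ => by rw [e₃ 38 (by omega), e₂ 38 (by omega)]⟩ ?_ ?_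
      · rintro j hj σ₄ k₄ ⟨h₄, h₄'⟩
        simp only [Cm.Does.put2_iff, Tm.ok_cell, Tm.ok_at2, Tm.ok_var, Tm.eval_cell, Tm.eval_at2,
          Tm.eval_var, Function.update_self, Function.update_of_ne (show (0 : ℕ) ≠ 1 by omega),
          k₄ 69 rfl, k₄ 51 rfl, e₃ 69 (show 69 ≠ 37 by omega), e₃ 51 (show 51 ≠ 37 by omega),
          e₂ 51 (show 51 ≠ 69 by omega), e69, e51, true_and]
        refine ⟨fun i hi => ?_, fun q hq => ?_⟩
        · rcases Nat.lt_succ_iff_lt_or_eq.1 hi with h | rfl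
          · simp [Store.write_apply, h.ne, h₄ i h]
          · simp [Store.write_apply]
        · rw [← h₄' q hq]; funext i l; simp [Store.write_apply, hq]
      · rintro σ₄ k₄ ⟨h₄, h₄'⟩ p hp hpm hpr
        have e37 : σ₄ 37 = σ₃ 37 := k₄ 37 rfl
        rcases Nat.lt_succ_iff_lt_or_eq.1 hpm with h | rfl
        · have hne : rank d n p ≠ R := fun e => h.ne (rank_inj hp hm e)
          rw [h₄' _ hne, e37, show σ₃ 37 (rank d n p) 0 0 = σ₁ 37 (rank d n p) 0 0 by
            simp [hσ₃, hσ₂, Store.write_apply, hne]]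
          exact h₁ p hp h hpr
        · rw [e37, show σ₃ 37 (rank d n p) 0 0 = σ 52 p 0 0 by
            simp [hσ₃, Store.write_apply, hR]]
          exact (hlists p hp).congr h₄
    · rw [e₂ 37 (by omega), e₂ 38 (by omega)]
      rcases Nat.lt_succ_iff_lt_or_eq.1 hpm with h | rfl
      · exact h₁ p hp h hpr
      · exact absurd hpr hRk
  · intro σ₁ k₁ h₁
    refine ⟨L, hL, ?_, fun q X hq => ?_⟩
    · rw [k₁ 36 rfl, hLl]; simp [hσ₀, Store.write_apply]
    · have hql : q < min n k := by
        rw [← hLl]; exact (List.getElem?_eq_some_iff.1 hq).1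
      obtain ⟨p, hp, hr, e⟩ := hLT q hql
      rw [e, hT? p hp] at hq
      obtain rfl := Option.some.inj hq
      have := h₁ p hp hp (by rw [hr]; exact hql)
      rwa [hr] at this

/-! ### The whole round -/

/-- Nodes touched by the updates are old nodes, or inserted nodes with new identifiers. -/
theorem structural_subset {r : ℕ} {G : DataGraph} {D : List DUpd} (hD : ValidG G D) :
    ∃ E : Finset ℕ, E.card ≤ dsize D ∧ (∀ e ∈ E, G.fresh ≤ e) ∧ structural r G D ⊆ G.V ∪ E := by
  induction D generalizing G with
  | nil => exact ⟨∅, by simp, by simp, by simp [structural]⟩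
  | cons δ D ih =>
    obtain ⟨E, h1, h2, h3⟩ := ih hD.2
    have hfr : G.fresh ≤ (G.apply δ).fresh := by
      rw [DataGraph.apply_fresh]; cases δ <;> simp
    have hstep : ∃ E' : Finset ℕ, E'.card ≤ δ.size ∧ (∀ e ∈ E', G.fresh ≤ e) ∧
        (G.apply δ).V ⊆ G.V ∪ E' := by
      cases δ with
      | addNode w L o =>
        refine ⟨{w}, by simp [DUpd.size], by simpa using hD.1.1, fun x hx => ?_⟩
        have := (DataGraph.mem_apply _ _).1 hx
        simp only [Finset.mem_union, Finset.mem_singleton] at this ⊢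
        tauto
      | addEdge a b => exact ⟨∅, by simp, by simp, by simp [DataGraph.apply, DataGraph.withEdges]⟩
      | delEdge a b => exact ⟨∅, by simp, by simp, by simp [DataGraph.apply, DataGraph.withEdges]⟩
      | delNode w =>
        exact ⟨∅, by simp, by simp, fun x hx => by
          simpa using ((DataGraph.mem_apply _ _).1 hx).1⟩
    obtain ⟨E', g1, g2, g3⟩ := hstep
    refine ⟨E' ∪ E, ?_, fun e he => ?_, ?_⟩
    · have := Finset.card_union_le E' E
      simp only [dsize, List.map_cons, List.sum_cons] at *
      omega
    · rcases Finset.mem_union.1 he with h | h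
      exacts [g2 e h, hfr.trans (h2 e h)]
    · rw [DataGraph.structural_cons]
      refine Finset.union_subset (fun x hx => ?_) (h3.trans fun x hx => ?_)
      · have : x ∈ G.V ∨ x ∈ (G.apply δ).V := by
          cases δ with
          | addEdge a b => exact Or.inr (DataGraph.ball_subset (Finset.mem_inter.1 hx).1)
          | delEdge a b => exact Or.inl (DataGraph.ball_subset (Finset.mem_inter.1 hx).1)
          | addNode w L o => exact Or.inr (DataGraph.ball_subset hx)
          | delNode w => exact Or.inl (DataGraph.ball_subset hx)
        rcases this with h | h
        · exact Finset.mem_union_left _ h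
        · exact Finset.union_subset_union_right Finset.subset_union_left (g3 h)
      · rcases Finset.mem_union.1 hx with h | h
        · exact Finset.union_subset_union_right Finset.subset_union_left (g3 h)
        · exact Finset.mem_union_right _ (Finset.mem_union_right _ h)

theorem structural_take_subset (r : ℕ) (G : DataGraph) (D : List DUpd) (n : ℕ) :
    structural r G (D.take n) ⊆ structural r G D := by
  conv_rhs => rw [← List.take_append_drop n D, DataGraph.structural_append]
  exact Finset.subset_union_left

theorem dsize_take_le (D : List DUpd) (n : ℕ) : dsize (D.take n) ≤ dsize D := by
  conv_rhs => rw [← List.take_append_drop n D, DataGraph.dsize_append]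
  exact Nat.le_add_right _ _

/-- The program processes the pattern updates, selects balls with the filter, processes the data
updates and adds the balls they touch, brings all these balls up to date,
collects the perfect subgraphs in them, and outputs the densest ones. -/
def roundCm : Cm :=
  patPhase ;; filterPhase ;; .put0 65 (.cell 8) ;; dataPhase ;; ballPhase ;; teamPhase ;; outPhase

theorem roundCm_wf : roundCm.wf 0 = true := by rfl

/-- Bound for the number of iterations of every loop in a round: the numbers of type codes and of
record fields, the radius, the sizes of the pattern and the updates, the size of the affected
balls, the number of processed balls, and the number of pairs of such a ball and a radius. -/
def loopBound (h r p np ng ac as : ℕ) : ℕ :=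
  2 ^ h + 6 + r + p + np + ng + as + (ac + ng) + (ac + ng) * r

/-- The list of balls to be processed: the affected balls, and possibly the identifiers of nodes
that are inserted and deleted again in the same round. -/
noncomputable def State.work (S : State) (DP : List PUpd) (DG : List DUpd) : Finset ℕ :=
  (S.G.V.filter fun v => S.bfNew DP (S.tc v) ⊆ S.tc v) ∪ structural S.r S.G DG

section bounds

variable {S : State} {DP : List PUpd} {DG : List DUpd}

theorem State.mem_work {v : ℕ} (h : v ∈ S.G.V ∨ v ∈ (S.G.applyAll DG).V) :
    v ∈ S.work DP DG ↔ v ∈ S.affected DP DG := by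
  rw [State.mem_affected, State.work, Finset.mem_union, Finset.mem_filter]
  exact or_congr_right ⟨fun h' => ⟨h', h⟩, fun h' => h'.1⟩

/-- The processed balls are the affected ones and at most as many as there are new identifiers. -/
theorem State.card_work (hD : ValidG S.G DG) :
    (S.work DP DG).card ≤ S.affCard DP DG + dsize DG := by
  obtain ⟨E, h1, -, h3⟩ := structural_subset (r := S.r) hD
  have : S.work DP DG ⊆ S.affected DP DG ∪ E := by
    intro v hv
    by_cases hvV : v ∈ S.G.V
    · exact Finset.mem_union_left _ ((State.mem_work (Or.inl hvV)).1 hv)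
    · rw [State.work, Finset.mem_union, Finset.mem_filter] at hv
      have := h3 (hv.resolve_left fun h => hvV h.1)
      exact Finset.mem_union_right _ ((Finset.mem_union.1 this).resolve_left hvV)
  refine (Finset.card_le_card this).trans ((Finset.card_union_le _ _).trans ?_)
  exact Nat.add_le_add_left h1 _

/-- The old value of the counter for identifiers tells the old nodes among the processed ones. -/
theorem State.work_lt_fresh (hD : ValidG S.G DG) {v : ℕ} (hv : v ∈ S.work DP DG) :
    v < S.G.fresh ↔ v ∈ S.G.V := by
  obtain ⟨E, -, h2, h3⟩ := structural_subset (r := S.r) hD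
  refine ⟨fun h => ?_, S.G.lt_fresh v⟩
  rw [State.work, Finset.mem_union, Finset.mem_filter] at hv
  rcases hv with hv | hv
  · exact hv.1
  · exact (Finset.mem_union.1 (h3 hv)).resolve_right fun he => absurd (h2 v he) (by omega)

theorem State.card_ball_le_affSize {v : ℕ} (hv : v ∈ S.work DP DG) {t : ℕ} (ht : t ≤ S.r) :
    ((S.G.applyAll DG).ball v t).V.card ≤ S.affSize DP DG := by
  by_cases hvV : v ∈ (S.G.applyAll DG).V
  · have hva := (State.mem_work (Or.inr hvV)).1 hv
    refine (Finset.card_le_card (DataGraph.ball_mono ht)).trans ?_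
    refine le_trans ?_ (Finset.single_le_sum (f := fun v => (S.G.ball v S.r).size +
      ((S.next DP DG).G.ball v S.r).size) (fun _ _ => Nat.zero_le _) hva)
    change _ ≤ (S.G.ball v S.r).size + ((S.G.applyAll DG).ball v S.r).size
    rw [DataGraph.size, DataGraph.size]; omega
  · have : ((S.G.applyAll DG).ball v t).V = ∅ :=
      Finset.eq_empty_of_forall_notMem fun w hw => hvV (DataGraph.center_mem hw)
    simp [this]

/-- The searches in the intermediate graphs are bounded by the affected balls and the updates. -/
theorem State.card_ball_take_le (hr : 1 ≤ S.r) (hD : ValidG S.G DG) {x : ℕ}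
    (hx : x ∈ structural S.r S.G DG) (n : ℕ) :
    ((S.G.applyAll (DG.take n)).ball x S.r).V.card ≤ S.affSize DP DG + dsize DG := by
  have hval : ValidG S.G (DG.take n) := by
    have := hD
    rw [← List.take_append_drop n DG, DataGraph.validG_append] at this
    exact this.1
  refine (DataGraph.card_ball_applyAll hval hr (structural_take_subset _ _ _ n) hx).trans
    (Nat.add_le_add ?_ (dsize_take_le DG n))
  refine (Finset.sum_le_sum_of_subset (fun z hz => ?_)).trans (Finset.sum_le_sum fun z _ => ?_)
    (b := ∑ z ∈ S.affected DP DG, (S.G.ball z S.r).V.card)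
  · rw [Finset.mem_inter] at hz
    exact State.mem_affected.2 (Or.inr ⟨hz.1, Or.inl hz.2⟩)
  · rw [DataGraph.size]; omega

end bounds

theorem teams_eq_isTeam {P : Pattern} {G : DataGraph} {r : ℕ} {X : Finset ℕ} :
    X ∈ teams P G r ↔ ∃ v ∈ G.V, ∃ t, 1 ≤ t ∧ t ≤ r ∧ IsTeam P (G.ball v t) X := Iff.rfl

theorem IsTeam.subset {P : Pattern} {G : DataGraph} {v t : ℕ} {X : Finset ℕ}
    (h : IsTeam P (G.ball v t) X) : X ⊆ G.V := by
  intro w hw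
  rw [h.2.2] at hw
  obtain ⟨p, hp, rfl⟩ := Finset.mem_image.1 hw
  exact DataGraph.ball_subset (Finset.mem_product.1 (Finset.mem_filter.1 hp).1).2

/-- A perfect subgraph has nodes, so that its density is a proper quotient. -/
theorem IsTeam.nonempty {P : Pattern} {B : DataGraph} {X : Finset ℕ} (hP : P.Connected)
    (h : IsTeam P B X) : X.Nonempty := by
  obtain ⟨u, hu⟩ := hP.nonempty
  obtain ⟨w, hw⟩ := (maxMatch_isMatch P B h.1).total u hu
  rw [h.2.2]
  exact ⟨w, Finset.mem_image.2 ⟨_, hw, rfl⟩⟩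

/-- The density of a subgraph of a ball depends on the ball only. -/
theorem density_congr {G G' : DataGraph} {v r : ℕ} (h : (G.ball v r).Same (G'.ball v r))
    {X : Finset ℕ} (hX : X ⊆ (G.ball v r).V) : (G.induce X).density = (G'.induce X).density := by
  have hX' : X ⊆ (G'.ball v r).V := h.1 ▸ hX
  rw [density_eq (hX.trans DataGraph.ball_subset), density_eq (hX'.trans DataGraph.ball_subset)]
  congr 3
  refine Finset.sum_congr rfl fun a ha => Finset.sum_congr rfl fun b hb => bit_congr ?_
  have := h.2 a b
  rw [DataGraph.ball_adj, DataGraph.ball_adj] at this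
  simpa [hX ha, hX hb, hX' ha, hX' hb] using this

theorem Stores.congr {σ τ : Store} {S : State} (hs : Stores σ S) (h : ∀ a < 100, τ a = σ a) :
    Stores τ S := by
  obtain ⟨hd, hp, ha⟩ := hs
  refine ⟨⟨?_, ?_, ?_, ?_, ?_, ?_, ?_, ?_, ?_⟩, ⟨?_, ?_, ?_, ?_, ?_, ?_⟩,
    ⟨?_, ?_, ?_, ?_, ?_, ?_, ?_, ?_, ?_, ?_, ?_⟩⟩
  · rw [h 0 (by omega)]; exact hd.h
  · rw [h 1 (by omega)]; exact hd.r
  · rw [h 2 (by omega)]; exact hd.k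
  · rw [h 3 (by omega)]; exact hd.node
  · rw [h 4 (by omega)]; exact hd.label
  · rw [h 4 (by omega)]; exact hd.label_fresh
  · rw [h 5 (by omega), h 6 (by omega)]; exact hd.nbrs
  · rw [h 7 (by omega)]; exact hd.adj
  · rw [h 8 (by omega)]; exact hd.fresh
  · rw [h 9 (by omega), h 10 (by omega)]; exact hp.nodes
  · rw [h 11 (by omega)]; exact hp.label
  · rw [h 12 (by omega)]; exact hp.lo
  · rw [h 13 (by omega)]; exact hp.hi
  · rw [h 14 (by omega)]; exact hp.part
  · rw [h 15 (by omega)]; exact hp.adj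
  · rw [h 16 (by omega)]; exact ha.fs
  · rw [h 17 (by omega), h 18 (by omega)]; exact ha.balls
  · rw [h 19 (by omega)]; exact ha.tc
  · rw [h 17 (by omega), h 18 (by omega), h 20 (by omega)]; exact ha.pos
  · rw [h 21 (by omega)]; exact ha.cflag
  · rw [h 22 (by omega), h 23 (by omega)]; exact ha.den
  · rw [h 24 (by omega), h 25 (by omega)]; exact ha.fbMatch
  · rw [h 26 (by omega)]; exact ha.bf
  · rw [h 27 (by omega)]; exact ha.log
  · rw [h 28 (by omega)]; exact ha.height
  · rw [h 29 (by omega), h 30 (by omega)]; exact ha.stack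

theorem StoresOutput.congr {σ τ : Store} {L : List (Finset ℕ)} (hs : StoresOutput σ L)
    (h : ∀ a < 100, τ a = σ a) : StoresOutput τ L := by
  constructor
  · rw [h 36 (by omega)]; exact hs.num
  · rw [h 37 (by omega), h 38 (by omega)]; exact hs.sets

/-- Within the loop bound, the program performs the round and outputs the densest perfect subgraphs. -/
theorem roundCm_does {N : ℕ} {ρ : ℕ → ℕ} {σ : Store} {S : State} {DP : List PUpd}
    {DG : List DUpd} (hS : S.Inv) (hD : S.Admissible DP DG) (hσ : Stores σ S)
    (hI : StoresInput σ DP DG)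
    (hN : N = loopBound S.h S.r S.P.size DP.length (dsize DG) (S.affCard DP DG)
      (S.affSize DP DG)) :
    roundCm.Does N ρ σ fun σ' => Stores σ' (S.next DP DG) ∧
      ∃ L, IsTopK (S.P.applyAll DP) (S.G.applyAll DG) S.r S.k L ∧ StoresOutput σ' L := by
  set A := S.work DP DG with hA
  set P' := S.P.applyAll DP with hP'
  set G' := S.G.applyAll DG with hG'
  have hcard : A.card ≤ S.affCard DP DG + dsize DG := State.card_work hD.validG
  have hmul : A.card * S.r ≤ (S.affCard DP DG + dsize DG) * S.r := Nat.mul_le_mul_right S.r hcard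
  have hpow := Nat.one_le_two_pow (n := S.h)
  have hPV : S.P.V.card ≤ S.P.size := Nat.le_add_right _ _
  have hP'V : P'.V.card ≤ S.P.V.card + DP.length := Pattern.card_applyAll DP
  rw [loopBound] at hN
  have hhN : S.h ≤ N := by have := (Nat.lt_two_pow_self (n := S.h)); omega
  have hAN : A.card ≤ N := by omega
  have hfiltN : (S.G.V.filter fun v => S.bfNew DP (S.tc v) ⊆ S.tc v).card ≤ N :=
    (Finset.card_le_card Finset.subset_union_left).trans hAN
  refine (patPhase_does hS hD hσ hI (by omega) (by omega) (by omega)).seq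
    fun σ₁ k₁ ⟨hP₁, hst₁, h27, h64, hbf₁⟩ => ?_
  have e₁ : ∀ a, a ≤ 8 ∨ 16 ≤ a ∧ a ≤ 25 ∨ 31 ≤ a ∧ a ≤ 35 → σ₁ a = σ a := fun a ha =>
    k₁ a (by rcases ha with h | ⟨h, h'⟩ | ⟨h, h'⟩ <;> interval_cases a <;> rfl)
  refine (filterPhase_does (DG := DG) hS (by rw [e₁ 0 (by omega)]; exact hσ.data.h) h64
    (by omega) (by rw [e₁ 16 (by omega)]; exact hσ.aux.fs) hbf₁
    (by rw [e₁ 17 (by omega), e₁ 18 (by omega)]; exact hσ.aux.balls) hfiltN).seq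
    fun σ₂ k₂ ⟨hA₂, hbf₂⟩ => ?_
  have e₂ : ∀ a, a ≤ 25 ∨ 27 ≤ a ∧ a ≤ 35 → σ₂ a = σ₁ a := fun a ha =>
    k₂ a (by rcases ha with h | ⟨h, h'⟩ <;> interval_cases a <;> rfl)
  simp only [Cm.Does.seq_iff (p := .put0 65 _), Cm.Does.put0_iff, Tm.ok_cell, Tm.eval_cell,
    true_and]
  set σ₃ := σ₂.write 65 0 0 0 (σ₂ 8 0 0 0) with hσ₃
  have e₃ : ∀ a, a ≠ 65 → σ₃ a = σ₂ a := fun a h => Store.write_of_ne _ _ _ _ _ h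
  have e03 : ∀ a, a ≤ 8 ∨ 16 ≤ a ∧ a ≤ 25 ∨ 31 ≤ a ∧ a ≤ 35 → σ₃ a = σ a := fun a ha => by
    rw [e₃ a (by omega), e₂ a (by omega), e₁ a ha]
  have hdata : DataIn σ S.G := ⟨hσ.data.node, hσ.data.label, hσ.data.label_fresh, hσ.data.nbrs,
    hσ.data.adj, hσ.data.fresh⟩
  have hI₃ : StoresInput σ₃ DP DG := by
    constructor
    · rw [e03 31 (by omega)]; exact hI.numP
    · rw [e03 32 (by omega)]; exact hI.recP
    · rw [e03 33 (by omega)]; exact hI.numG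
    · rw [e03 34 (by omega)]; exact hI.recG
    · rw [e03 35 (by omega)]; exact hI.labels
  have h65 : σ₃ 65 0 0 0 = S.G.fresh := by
    rw [← hσ.data.fresh, ← e₁ 8 (by omega), ← e₂ 8 (by omega)]
    simp [hσ₃, Store.write_apply]
  refine (dataPhase_does (hdata.congr fun a _ _ => e03 a (by omega)) hD.validG hI₃
    (by rw [e03 1 (by omega)]; exact hσ.data.r) hS.r (by omega) (by omega) (fun x hx n => ?_)
    (by rw [e₃ 40 (by omega), e₃ 41 (by omega)]; exact hA₂) hAN).seq
    fun σ₄ k₄ ⟨hG₄, hA₄⟩ => ?_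
  · have := State.card_ball_take_le (DP := DP) hS.r hD.validG hx n
    omega
  have e₄ : ∀ a, a ≤ 2 ∨ 9 ≤ a ∧ a ≤ 38 ∨ a = 65 → σ₄ a = σ₃ a := fun a ha =>
    k₄ a (by rcases ha with h | ⟨h, h'⟩ | rfl; interval_cases a <;> rfl; interval_cases a <;> rfl; rfl)
  have hP₄ : PatIn σ₄ P' := hP₁.congr fun a _ _ => by
    rw [e₄ a (by omega), e₃ a (by omega), e₂ a (by omega)]
  have hl₄ : LinksIn σ₄ S.h S.G.V S.tc := by
    have : LinksIn σ S.h S.G.V S.tc :=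
      ⟨hσ.aux.balls, hσ.aux.tc, hσ.aux.pos, fun v _ => S.tc_subset v⟩
    exact this.congr fun a _ _ => by rw [e₄ a (by omega), e03 a (by omega)]
  have hball : ∀ v ∈ A, ∀ t ≤ S.r, (G'.ball v t).V.card ≤ N := fun v hv t ht => by
    have : (G'.ball v t).V.card ≤ S.affSize DP DG := State.card_ball_le_affSize hv ht
    omega
  have h4_27 : σ₄ 27 0 0 0 = (S.log ++ DP).length := by
    rw [e₄ 27 (by omega), e₃ 27 (by omega), e₂ 27 (by omega), h27]
  have hfrag : P'.Fragmented S.h := hS.frag.applyAll hD.validP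
  refine (ballPhase_does hP₄ hG₄ hfrag
    (by rw [e₄ 0 (by omega), e03 0 (by omega)]; exact hσ.data.h)
    (by rw [e₄ 1 (by omega), e03 1 (by omega)]; exact hσ.data.r)
    (by rw [e₄ 65 (by omega)]; exact h65) hA₄
    (fun v hv => State.work_lt_fresh hD.validG hv) hl₄ hhN (by omega) (by omega) hAN
    (fun v hv => hball v hv _ le_rfl)).seq fun σ₅ k₅ ⟨hl₅, he₅, ho₅⟩ => ?_
  have e₅ : ∀ a, a ≤ 16 ∨ 26 ≤ a ∧ a ≤ 38 ∨ a = 40 ∨ a = 41 → σ₅ a = σ₄ a := fun a ha =>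
    k₅ a (by
      rcases ha with h | ⟨h, h'⟩ | rfl | rfl
      · interval_cases a <;> rfl
      · interval_cases a <;> rfl
      all_goals rfl)
  refine (teamPhase_does (r := S.r) (hP₄.congr fun a _ _ => e₅ a (by omega))
    (hG₄.congr fun a _ _ => e₅ a (by omega))
    (by rw [e₅ 1 (by omega), e₄ 1 (by omega), e03 1 (by omega)]; exact hσ.data.r)
    (by rw [e₅ 40 (by omega), e₅ 41 (by omega)]; exact hA₄) hAN (by omega) (by omega) hball
    (by omega)).seq fun σ₆ k₆ ⟨T, hT₆, hTl, hTN, hTm⟩ => ?_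
  have e₆ : ∀ a, a ≤ 38 → σ₆ a = σ₅ a := fun a ha => k₆ a (by interval_cases a <;> rfl)
  have hteams : ∀ X, X ∈ T ↔ X ∈ teams P' G' S.r := by
    intro X
    rw [hTm, teams_eq_isTeam]
    constructor
    · rintro ⟨v, -, h⟩; exact ⟨v, h⟩
    · rintro ⟨v, hvV, t, h1, h2, h3⟩
      -- Balls that are not affected contain no perfect subgraph.
      refine ⟨v, ?_, hvV, t, h1, h2, h3⟩
      by_contra hv
      rw [State.mem_work (Or.inr hvV)] at hv
      exact hS.not_matches hD hv hvV h2 h3.1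
  refine (outPhase_does (k := S.k) (r := S.r) (P := P') hT₆
    (by rw [e₆ 2 (by omega), e₅ 2 (by omega), e₄ 2 (by omega), e03 2 (by omega)]
        exact hσ.data.k) (by omega) hTN (fun X hX => ?_) (fun X hX => ?_) hteams).mono
    fun σ₇ k₇ hL => ⟨?_, hL⟩
  · obtain ⟨v, -, -, t, -, -, h⟩ := (hTm X).1 hX
    exact h.subset
  · obtain ⟨v, -, -, t, -, -, h⟩ := (hTm X).1 hX
    exact h.nonempty hD.connected
  have e57 : ∀ a, a ≤ 30 → σ₇ a = σ₅ a := fun a ha => by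
    rw [k₇ a (by interval_cases a <;> rfl), e₆ a (by omega)]
  have e47 : ∀ a, a ≤ 16 ∨ 26 ≤ a ∧ a ≤ 30 → σ₇ a = σ₄ a := fun a ha => by
    rw [e57 a (by omega), e₅ a (by omega)]
  have e07 : ∀ a, a ≤ 2 ∨ a = 16 → σ₇ a = σ a := fun a ha => by
    rw [e47 a (by omega), e₄ a (by omega), e03 a (by omega)]
  have hG₇ : DataIn σ₇ G' := hG₄.congr fun a _ _ => e47 a (by omega)
  have hP₇ : PatIn σ₇ P' := hP₄.congr fun a _ _ => e47 a (by omega)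
  have hst₇ : StackIn σ₇ S.h fun s => planner S.h s S.base 0 (S.log ++ DP) :=
    hst₁.congr (by rw [e47 28 (by omega), e₄ 28 (by omega), e₃ 28 (by omega), e₂ 28 (by omega)])
      (by rw [e47 29 (by omega), e₄ 29 (by omega), e₃ 29 (by omega), e₂ 29 (by omega)])
      (by rw [e47 30 (by omega), e₄ 30 (by omega), e₃ 30 (by omega), e₂ 30 (by omega)])
  -- Balls that are processed are those whose entries change.
  have hin : ∀ v ∈ G'.V, v ∈ A → v ∈ S.affected DP DG := fun v hv h =>
    (State.mem_work (Or.inr hv)).1 h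
  have hun : ∀ v, v ∉ A → v ∈ S.G.V ∨ v ∈ G'.V → State.Unaffected S DP DG v := fun v hv h =>
    hS.unaffected hD (fun h' => hv ((State.mem_work h).2 h')) h
  have hcf : ∀ v ∈ G'.V, v ∈ A → (S.next DP DG).cflag v = (S.log ++ DP).length :=
    fun v hv h => if_pos (hin v hv h)
  have hpa : ∀ v ∈ G'.V, v ∈ A → (S.next DP DG).patAt ((S.next DP DG).cflag v) = P' :=
    fun v hv h => by rw [hcf v hv h, State.patAt_next_length]
  have hl₅' : LinksIn σ₅ S.h (mixedV S.G.V G'.V A)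
      (mixedTc S.tc (fun v => typeCode P' (G'.ball v S.r) S.h) A) := hl₅
  have hl₇ : LinksIn σ₇ S.h G'.V (S.next DP DG).tc := by
    refine (hl₅'.of_eq (fun v => ?_) fun v hv => ?_).congr fun a _ _ => e57 a (by omega)
    · by_cases hvA : v ∈ A
      · exact mem_mixedV hvA
      · exact (mem_mixedV' hvA).trans
          ⟨fun h => (hun v hvA (Or.inl h)).mem', fun h => (hun v hvA (Or.inr h)).mem⟩
    · by_cases hvA : v ∈ A
      · have hvG : v ∈ G'.V := (mem_mixedV hvA).1 hv
        rw [State.tc, hpa v hvG hvA, mixedTc, if_pos hvA]; rfl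
      · have hvG : v ∈ S.G.V := (mem_mixedV' hvA).1 hv
        rw [mixedTc, if_neg hvA, (hun v hvA (Or.inl hvG)).tc]
  have hentry : ∀ v ∈ G'.V, v ∈ A → EntryIn σ₇ P' G' S.h S.r (S.log ++ DP).length v :=
    fun v hv hvA => by
      rw [← h4_27]
      exact (he₅ v hvA hv).congr fun a _ _ => by rw [e57 a (by omega)]
  have hold : ∀ v, v ∉ A → ∀ a, 21 ≤ a → a ≤ 25 → σ₇ a v = σ a v := fun v hv a h1 h2 => by
    rw [e57 a (by omega), ho₅ a h1 h2 v hv, e₄ a (by omega), e03 a (by omega)]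
  refine ⟨⟨?_, ?_, ?_, hG₇.node, hG₇.label, hG₇.label_fresh, hG₇.nbrs, hG₇.adj, hG₇.fresh⟩, ?_,
    ⟨?_, hl₇.balls, hl₇.code, hl₇.pos, fun v hv => ?_, fun v hv => ?_, fun v hv u hu => ?_, ?_, ?_,
      hst₇.height, hst₇.stack⟩⟩
  · rw [e07 0 (by omega)]; exact hσ.data.h
  · rw [e07 1 (by omega)]; exact hσ.data.r
  · rw [e07 2 (by omega)]; exact hσ.data.k
  · have e := State.next_P S DP DG
    constructor
    · rw [e]; exact hP₇.nodes
    · rw [e]; exact hP₇.label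
    · rw [e]; exact hP₇.lo
    · rw [e]; exact hP₇.hi
    · rw [e]; exact hP₇.part
    · rw [e]; exact hP₇.adj
  · rw [e07 16 (by omega)]; exact hσ.aux.fs
  · by_cases hvA : v ∈ A
    · rw [hcf v hv hvA]; exact (hentry v hv hvA).cflag
    · have hu := hun v hvA (Or.inr hv)
      rw [hold v hvA 21 (by omega) (by omega), hu.cflag]
      exact hσ.aux.cflag v hu.mem
  · by_cases hvA : v ∈ A
    · exact (hentry v hv hvA).den
    · have hu := hun v hvA (Or.inr hv)
      rw [hold v hvA 22 (by omega) (by omega), hold v hvA 23 (by omega) (by omega)]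
      obtain ⟨h1, h2⟩ := hσ.aux.den v hu.mem
      refine ⟨h1, fun X hX hne => ?_⟩
      have hX' : X ⊆ (S.G.ball v S.r).V := by rw [hu.same.1]; exact hX
      have := h2 X hX' hne
      rwa [density_congr hu.same hX'] at this
  · by_cases hvA : v ∈ A
    · have hm : (S.next DP DG).fbMatch v = (Finset.range S.h).biUnion fun i =>
          maxMatch (P'.frag i) (G'.ball v S.r) := by
        rw [State.fbMatch, hpa v hv hvA]; rfl
      rw [hpa v hv hvA] at hu
      rw [hm]
      exact (hentry v hv hvA).fbMatch u hu
    · have hun' := hun v hvA (Or.inr hv)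
      rw [hun'.cflag, hun'.patAt] at hu
      rw [hold v hvA 24 (by omega) (by omega), hold v hvA 25 (by omega) (by omega), hun'.fbMatch]
      exact hσ.aux.fbMatch v hun'.mem u hu
  · rw [e47 26 (by omega), e₄ 26 (by omega), e₃ 26 (by omega)]; exact hbf₂
  · rw [e47 27 (by omega)]; exact h4_27

end TF

theorem mainTheorem3 :
    ∃ (dynamic : TF.Prog) (F : ℕ → ℕ → ℕ → ℕ → ℕ → ℕ → ℕ → ℕ → ℕ),
      TF.Processes dynamic fun S DP DG =>
        F S.h S.r S.P.size DP.length (TF.dsize DG)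
          (S.affMatches DP DG) (S.affCard DP DG) (S.affSize DP DG) := by
  refine ⟨TF.roundCm.comp 0, fun h r p np ng _ ac as =>
    TF.roundCm.cost (TF.loopBound h r p np ng ac as), ?_⟩
  intro S DP DG σ hS hD hσ hI
  obtain ⟨hok, hst, L, hL, hout⟩ := TF.roundCm_does (ρ := fun _ => 0) hS.inv hD hσ hI rfl
  obtain ⟨τ, t, hex, ht, hag, -, -⟩ := TF.Cm.comp_spec _ TF.roundCm 0 0 σ σ (fun _ => 0)
    TF.roundCm_wf hok ⟨fun _ _ => rfl, fun n hn => absurd hn n.not_lt_zero⟩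
  exact ⟨τ, t, L, hex, ht, hL, hout.congr hag.1, hst.congr hag.1⟩
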